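/- \textbf{Setting.} Fix $\mu\in(0,1/2)$. For $\epsilon\in(0,1)$ let $f(t)$ solve $\dot f=(1+\epsilon\cos f)^2/(1-\epsilon^2)^{3/2}$, $f(0)=0$, let $\varrho=(1-\epsilon^2)/(1+\epsilon\cos f)$, $q_0=\mu\varrho e^{if}$, $q_1=-(1-\mu)\varrho e^{if}$, and $$V_{\rm pol}(r,\alpha,t;\epsilon)=\frac{1-\mu}{|re^{i\alpha}-q_0(t)|}+\frac{\mu}{|re^{i\alpha}-q_1(t)|}.$$ For $u\in\mathbb R$ let $\tau$ be defined by $u=(\tau+\tau^3/3)/2$, and let $r_{\rm h}(u)=(\tau^2+1)/2$, $e^{i\alpha_{\rm h}(u)}=(\tau-i)/(\tau+i)$ (the parabolic orbit of the two body problem with angular momentum $1$). Put $$V(u,\beta,t;I,\epsilon)=I^3V_{\rm pol}(I^2r_{\rm h}(u),\beta+\alpha_{\rm h}(u),t;\epsilon)-\frac{I}{r_{\rm h}(u)},$$ $$\tilde L(u,\beta,t;I,\epsilon)=\int_{\mathbb R}V(s,\beta,t-I^3u+I^3s;I,\epsilon)\,ds,\qquad \mathcal L_\pm(\varphi,I;\epsilon)=\int_{\mathbb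 R}V(s,\varphi,\tilde\sigma_\pm(\varphi)+I^3s;I,\epsilon)\,ds,$$ with $\tilde\sigma_+(\varphi)=\varphi$, $\tilde\sigma_-(\varphi)=\varphi+\pi$. For $\rho,I_*>0$ and $\epsilon\in(0,I_*^{-3})$ let $\mathbb T_\rho=\{|\mathrm{Im}\,\varphi|\le\rho\}\subset\mathbb C/2\pi\mathbb Z$, $\Lambda_{\rho,I}=\{I\in\mathbb C: |\mathrm{Im}\,I|\le\rho,\ I_*\le\mathrm{Re}\,I\le\epsilon^{-1/3}\}$, $\Lambda_\rho=\mathbb T_\rho\times\Lambda_{\rho,I}$, and let $\Lambda$ be the set of real points of $\Lambda_\rho$. For complex arguments, $\tilde L$ and $\mathcal L_\pm$ denote the analytic extensions from the real arguments (whose existence is part of the claim; the integrals converge for real arguments). The bracket is $\{f,g\}=\partial_\varphi f\,\partial_Ig-\partial_If\,\partial_\varphi g$. A symbol $\mathcal O(a,b)$ means $\mathcal O(a)+\mathcal O(b)$. All implied constants depend only on $\mu$ (and on $\sigma_0$ in part 1). Square roots are principal. \textbf{1. Harmonics of the Melnikov potential.} For every $\sigma_0>0$ there are $\rho_0,I_*>0$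 such that for $\epsilon\in(0,I_*^{-3})$ and $I\in\Lambda_{\rho_0,I}$ the function $\tilde L$ is a (real analytic for real $I$) analytic function of all its arguments, including $\epsilon$, for $\sigma=t-I^3u\in\mathbb T_{\sigma_0}$, $\beta\in\mathbb T_{\rho_0}$, and equals the absolutely convergent series $\sum_{l\ge0}\mathcal L_l(\sigma,\beta;I,\epsilon)$. Here $\mathcal L_0$ is its mean in $\sigma$ and $\mathcal L_l$, $l\ge1$, is the sum of the terms of orders $\pm l$ of its Fourier series in $\sigma$. Moreover: \begin{itemize} \item $\mathcal L_0=\mu(1-\mu)\big(L_{0,0}+L_{0,1}\cos\beta+E_0(\beta;I,\epsilon)\big)$, where $L_{0,0}(I,\epsilon)=\frac{\pi}{2I^3}\big(1+\mathcal O(|I|^{-4},\epsilon^2)\big)$, $L_{0,1}(I,\epsilon)=-(1-2\mu)\frac{15\pi\epsilon}{8I^5}\big(1+\mathcal O(|I|^{-4},\epsilon^2)\big)$ and $E_0=\mathcal O(\epsilon^2|I|^{-7})$; \item $\mathcal L_1=\mu(1-\mu)\big(2L_{1,1}\cos(\sigma-\beta)+2L_{1,2}\cos(\sigma-2\beta)+E_1(\sigma,\beta;I,\epsilon)\big)$,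 where $2L_{1,1}(I,\epsilon)=(1-2\mu)\sqrt{\frac{\pi}{8I}}\big(1+\mathcal O(|I|^{-1},\epsilon^2)\big)e^{-I^3/3}$, $2L_{1,2}(I,\epsilon)=-3\epsilon\sqrt{2\pi I^3}\big(1+\mathcal O(|I|^{-1},\epsilon)\big)e^{-I^3/3}$ and $|E_1|\lesssim\epsilon\big(|I|^{-3/2}+\epsilon|I|^{5/2}\big)|e^{-I^3/3}|$; \item $\big|\sum_{l\ge2}\mathcal L_l\big|\lesssim|I|^{3/2}\exp(-2\,\mathrm{Re}(I^3)/3)$. \end{itemize} \textbf{2. Reduced Melnikov potentials.} There are $\rho_*,I_*>0$ such that for $\epsilon\in(0,I_*^{-3})$ the functions $\mathcal L_\pm$ are real analytic on $\Lambda$ and extend analytically to $\Lambda_{\rho_*}$, and for all $(\varphi,I)\in\Lambda_{\rho_*}$ $$\partial_\varphi\mathcal L_\pm=\mu(1-\mu)(1-2\mu)\frac{15\pi\epsilon}{8I^5}\sin\varphi+\mathcal O(\epsilon|I|^{-7}),\qquad \partial_I\mathcal L_\pm=-\mu(1-\mu)\frac{3\pi}{2I^4}+\mathcal O(|I|^{-7},\epsilon|I|^{-4}),$$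 $$\partial_I(\mathcal L_+-\mathcal L_-)=-\mu(1-\mu)\sqrt{\frac{\pi I^3}{2}}\Big((1-2\mu)+\mathcal O(|I|^{-1})\Big)e^{-I^3/3},$$ $$\partial_\varphi(\mathcal L_+-\mathcal L_-)=\mu(1-\mu)\,\epsilon\Big(6\sqrt{2\pi I^3}\sin\varphi+\mathcal O(|I|^{1/2})\Big)e^{-I^3/3}.$$ Moreover, for all $(\varphi,I)\in\Lambda$, $$\{\mathcal L_+,\mathcal L_-\}=\partial_\varphi(\mathcal L_+-\mathcal L_-)\,\partial_I\mathcal L_++\mathcal O\big(\epsilon|I|^{-7/2}e^{-I^3/3}\big).$$ -/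

import Mathlib

open Set

namespace RPE3BP

/-! ## Keplerian motion of the primaries

The plane is identified with `ℂ`.  The true anomaly is the solution of
`df/dt = (1 + ε cos f)² / (1 - ε²)^(3/2)`, `f(0) = 0`, obtained by separating variables
(see `trueAnomaly_zero` and `hasDerivAt_trueAnomaly`). -/

/-- Time at which the true anomaly takes the value `f`. -/
noncomputable def anomalyTime (ε f : ℝ) : ℝ :=
  ∫ θ in (0 : ℝ)..f, (1 - ε ^ 2) ^ (3 / 2 : ℝ) / (1 + ε * Real.cos θ) ^ 2

/-- The true anomaly `f(t)`. -/
noncomputable def trueAnomaly (ε t : ℝ) : ℝ :=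
  Function.invFun (anomalyTime ε) t

/-- The distance `ϱ(t)` between the primaries. -/
noncomputable def primaryDist (ε t : ℝ) : ℝ :=
  (1 - ε ^ 2) / (1 + ε * Real.cos (trueAnomaly ε t))

/-- Position of the primary of mass `1 - μ`. -/
noncomputable def primaryZero (μ ε t : ℝ) : ℂ :=
  (μ : ℂ) * (primaryDist ε t : ℂ) * Complex.exp ((trueAnomaly ε t : ℂ) * Complex.I)

/-- Position of the primary of mass `μ`. -/
noncomputable def primaryOne (μ ε t : ℝ) : ℂ :=
  -((1 - μ : ℝ) : ℂ) * (primaryDist ε t : ℂ) * Complex.exp ((trueAnomaly ε t : ℂ) * Complex.I)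

/-- The gravitational potential `U(q, t)`. -/
noncomputable def gravPotential (μ ε : ℝ) (q : ℂ) (t : ℝ) : ℝ :=
  (1 - μ) / ‖q - primaryZero μ ε t‖ + μ / ‖q - primaryOne μ ε t‖

/-- The gravitational potential in polar coordinates. -/
noncomputable def polarPotential (μ ε r α t : ℝ) : ℝ :=
  gravPotential μ ε ((r : ℂ) * Complex.exp ((α : ℂ) * Complex.I)) t

/-! ## The parabolic orbit of the two body problem with angular momentum one -/

/-- The time `u` on the parabolic orbit as a function of the parameter `τ`. -/
noncomputable def parabolicTime (τ : ℝ) : ℝ := (τ + τ ^ 3 / 3) / 2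

/-- The parameter `τ(u)`, solution of `u = (τ + τ³/3)/2`. -/
noncomputable def parabolicParam (u : ℝ) : ℝ := Function.invFun parabolicTime u

/-- The radius `r_h(u)`. -/
noncomputable def rHom (u : ℝ) : ℝ := (parabolicParam u ^ 2 + 1) / 2

/-- The angle `α_h(u)`, normalised by `exp (i α_h(u)) → 1` as `u → ±∞`
(see `exp_alphaHom`). -/
noncomputable def alphaHom (u : ℝ) : ℝ := Real.pi + 2 * Real.arctan (parabolicParam u)

/-! ## Perturbative potential and Melnikov potentials -/

/-- The perturbative potential `V(u, β, t; I, ε)`. -/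
noncomputable def pertPotential (μ u β t I ε : ℝ) : ℝ :=
  I ^ 3 * polarPotential μ ε (I ^ 2 * rHom u) (β + alphaHom u) t - I / rHom u

/-- The Melnikov potential `L̃(u, β, t; I, ε)`. -/
noncomputable def melnikovPotential (μ u β t I ε : ℝ) : ℝ :=
  ∫ s : ℝ, pertPotential μ s β (t - I ^ 3 * u + I ^ 3 * s) I ε

/-- The integral `∫ V(s, φ, φ + δ + I³ s; I, ε) ds`, for a phase `δ`. -/
noncomputable def reducedMelnikov (δ μ ε φ I : ℝ) : ℝ :=
  ∫ s : ℝ, pertPotential μ s φ (φ + δ + I ^ 3 * s) I ε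

/-- The reduced Melnikov potential `𝓛₊`. -/
noncomputable def reducedPlus (μ ε φ I : ℝ) : ℝ := reducedMelnikov 0 μ ε φ I

/-- The reduced Melnikov potential `𝓛₋`. -/
noncomputable def reducedMinus (μ ε φ I : ℝ) : ℝ := reducedMelnikov Real.pi μ ε φ I

/-- The canonical Poisson bracket in the variables `(φ, I)`. -/
noncomputable def poissonBracket (f g : ℝ → ℝ → ℝ) (φ I : ℝ) : ℝ :=
  deriv (fun x => f x I) φ * deriv (fun y => g φ y) I
    - deriv (fun y => f φ y) I * deriv (fun x => g x I) φ

/-! ## Domains -/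

/-- The strip of half-width `ρ` around the real line, the covering of the complex torus
`𝕋_ρ`. -/
def strip (ρ : ℝ) : Set ℂ := {z | |z.im| ≤ ρ}

/-- The complex domain of actions. -/
def actionDomain (ρ Istar ε : ℝ) : Set ℂ :=
  {I | |I.im| ≤ ρ ∧ Istar ≤ I.re ∧ I.re ≤ ε ^ (-(1 / 3) : ℝ)}

/-- The interval of real actions. -/
def realActions (Istar ε : ℝ) : Set ℝ := Icc Istar (ε ^ (-(1 / 3) : ℝ))

/-- The interval `(0, Istar⁻³)` of eccentricities. -/
def eccentricities (Istar : ℝ) : Set ℝ := Ioo 0 ((Istar ^ 3)⁻¹)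

/-! ## Fourier harmonics -/

/-- The `l`-th Fourier coefficient of a `2π`-periodic function. -/
noncomputable def angleCoeff (h : ℂ → ℂ) (l : ℤ) : ℂ :=
  (1 / (2 * Real.pi) : ℂ) *
    ∫ x in (0 : ℝ)..(2 * Real.pi), h (x : ℂ) * Complex.exp (-(Complex.I * (l : ℂ) * (x : ℂ)))

/-- The real harmonic of order `l`: the mean for `l = 0`, and the sum of the terms of orders
`l` and `-l` of the Fourier series for `l ≥ 1`. -/
noncomputable def angleHarmonic (h : ℂ → ℂ) (l : ℕ) (σ : ℂ) : ℂ :=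
  if l = 0 then angleCoeff h 0
  else Complex.exp (Complex.I * (l : ℂ) * σ) * angleCoeff h (l : ℤ)
    + Complex.exp (-(Complex.I * (l : ℂ) * σ)) * angleCoeff h (-(l : ℤ))

/-- `F` is the analytic extension, to the complex neighbourhood of width `ρ`, of the function
`f` of a real angle and a real action, and it is periodic in the angle. -/
def IsAngleActionExtension (f : ℝ → ℝ → ℝ) (F : ℂ × ℂ → ℂ) (ρ Istar ε : ℝ) : Prop :=
  AnalyticOnNhd ℂ F (strip ρ ×ˢ actionDomain ρ Istar ε) ∧
  (∀ φ I : ℝ, I ∈ realActions Istar ε → F ((φ : ℂ), (I : ℂ)) = (f φ I : ℂ)) ∧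
  (∀ φ ∈ strip ρ, ∀ I ∈ actionDomain ρ Istar ε, F (φ + 2 * Real.pi, I) = F (φ, I))

/-! ## Basic facts on the orbits -/

lemma one_add_mul_cos_pos {ε : ℝ} (h0 : 0 ≤ ε) (h1 : ε < 1) (θ : ℝ) :
    0 < 1 + ε * Real.cos θ := by
  nlinarith [Real.neg_one_le_cos θ]

lemma hasDerivAt_anomalyTime {ε : ℝ} (h0 : 0 ≤ ε) (h1 : ε < 1) (f : ℝ) :
    HasDerivAt (anomalyTime ε)
      ((1 - ε ^ 2) ^ (3 / 2 : ℝ) / (1 + ε * Real.cos f) ^ 2) f := by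
  have hc : Continuous fun θ : ℝ => (1 - ε ^ 2) ^ (3 / 2 : ℝ) / (1 + ε * Real.cos θ) ^ 2 := by
    refine Continuous.div (by fun_prop) (by fun_prop) fun θ => ?_
    exact (pow_pos (one_add_mul_cos_pos h0 h1 θ) 2).ne'
  exact intervalIntegral.integral_hasDerivAt_right (hc.intervalIntegrable _ _)
    (hc.stronglyMeasurableAtFilter _ _) hc.continuousAt

lemma anomalyTime_strictMono {ε : ℝ} (h0 : 0 ≤ ε) (h1 : ε < 1) :
    StrictMono (anomalyTime ε) := by
  refine strictMono_of_hasDerivAt_pos (hasDerivAt_anomalyTime h0 h1) fun f => ?_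
  have h2 : 0 < 1 - ε ^ 2 := by nlinarith
  exact div_pos (Real.rpow_pos_of_pos h2 _) (pow_pos (one_add_mul_cos_pos h0 h1 f) 2)

lemma anomalyTime_zero (ε : ℝ) : anomalyTime ε 0 = 0 := by
  simp [anomalyTime]

lemma anomalyTime_surjective {ε : ℝ} (h0 : 0 ≤ ε) (h1 : ε < 1) :
    Function.Surjective (anomalyTime ε) := by
  have h2 : 0 < 1 - ε ^ 2 := by nlinarith
  set c : ℝ := (1 - ε ^ 2) ^ (3 / 2 : ℝ) / 4 with hc
  have hcpos : 0 < c := div_pos (Real.rpow_pos_of_pos h2 _) (by norm_num)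
  have hmono : Monotone fun f => anomalyTime ε f - c * f := by
    refine monotone_of_hasDerivAt_nonneg
      (fun f => (hasDerivAt_anomalyTime h0 h1 f).sub ((hasDerivAt_id f).const_mul c)) fun f => ?_
    have hp := one_add_mul_cos_pos h0 h1 f
    have hle : (1 + ε * Real.cos f) ^ 2 ≤ 4 := by
      have hu : 1 + ε * Real.cos f ≤ 2 := by nlinarith [Real.cos_le_one f]
      nlinarith
    have := div_le_div_of_nonneg_left (Real.rpow_pos_of_pos h2 (3 / 2 : ℝ)).le (pow_pos hp 2) hle
    simpa [hc] using this
  have hcont : Continuous (anomalyTime ε) :=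
    continuous_iff_continuousAt.2 fun f => (hasDerivAt_anomalyTime h0 h1 f).continuousAt
  have hz := anomalyTime_zero ε
  refine hcont.surjective ?_ ?_
  · refine Filter.tendsto_atTop_mono' _ ?_ (Filter.tendsto_id.const_mul_atTop hcpos)
    filter_upwards [Filter.eventually_ge_atTop (0 : ℝ)] with f hf
    have := hmono hf
    simp only [hz, mul_zero, sub_zero, id] at this ⊢
    linarith
  · refine Filter.tendsto_atBot_mono' _ ?_ (Filter.tendsto_id.const_mul_atBot hcpos)
    filter_upwards [Filter.eventually_le_atBot (0 : ℝ)] with f hf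
    have := hmono hf
    simp only [hz, mul_zero, sub_zero, id] at this ⊢
    linarith

lemma anomalyTime_trueAnomaly {ε : ℝ} (h0 : 0 ≤ ε) (h1 : ε < 1) (t : ℝ) :
    anomalyTime ε (trueAnomaly ε t) = t :=
  Function.rightInverse_invFun (anomalyTime_surjective h0 h1) t

lemma trueAnomaly_zero {ε : ℝ} (h0 : 0 ≤ ε) (h1 : ε < 1) : trueAnomaly ε 0 = 0 :=
  (anomalyTime_strictMono h0 h1).injective
    ((anomalyTime_trueAnomaly h0 h1 0).trans (anomalyTime_zero ε).symm)

/-- The differential equation of the true anomaly. -/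
lemma hasDerivAt_trueAnomaly {ε : ℝ} (h0 : 0 ≤ ε) (h1 : ε < 1) (t : ℝ) :
    HasDerivAt (trueAnomaly ε)
      ((1 + ε * Real.cos (trueAnomaly ε t)) ^ 2 / (1 - ε ^ 2) ^ (3 / 2 : ℝ)) t := by
  have hs : StrictMono (trueAnomaly ε) := fun a b hab => by
    rw [← (anomalyTime_strictMono h0 h1).lt_iff_lt, anomalyTime_trueAnomaly h0 h1,
      anomalyTime_trueAnomaly h0 h1]
    exact hab
  have hsurj : Function.Surjective (trueAnomaly ε) := fun f =>
    ⟨anomalyTime ε f, Function.leftInverse_invFun (anomalyTime_strictMono h0 h1).injective f⟩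
  have hcont : Continuous (trueAnomaly ε) := hs.monotone.continuous_of_surjective hsurj
  have h2 : 0 < 1 - ε ^ 2 := by nlinarith
  have hne : (1 - ε ^ 2) ^ (3 / 2 : ℝ) / (1 + ε * Real.cos (trueAnomaly ε t)) ^ 2 ≠ 0 :=
    (div_pos (Real.rpow_pos_of_pos h2 _) (pow_pos (one_add_mul_cos_pos h0 h1 _) 2)).ne'
  have := (hasDerivAt_anomalyTime h0 h1 (trueAnomaly ε t)).of_local_left_inverse
    hcont.continuousAt hne (Filter.Eventually.of_forall (anomalyTime_trueAnomaly h0 h1))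
  simpa [inv_div] using this

lemma hasDerivAt_parabolicTime (τ : ℝ) : HasDerivAt parabolicTime ((1 + τ ^ 2) / 2) τ := by
  have := ((hasDerivAt_id' τ).add ((hasDerivAt_pow 3 τ).div_const 3)).div_const 2
  refine HasDerivAt.congr_deriv this ?_
  norm_num

lemma parabolicTime_strictMono : StrictMono parabolicTime :=
  strictMono_of_hasDerivAt_pos hasDerivAt_parabolicTime fun τ => by positivity

lemma parabolicTime_surjective : Function.Surjective parabolicTime := by
  have hcont : Continuous parabolicTime :=
    continuous_iff_continuousAt.2 fun τ => (hasDerivAt_parabolicTime τ).continuousAt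
  refine hcont.surjective ?_ ?_
  · refine Filter.tendsto_atTop_mono' _ ?_
      (Filter.tendsto_id.const_mul_atTop (by norm_num : (0 : ℝ) < 1 / 2))
    filter_upwards [Filter.eventually_ge_atTop (0 : ℝ)] with τ hτ
    have : 0 ≤ τ ^ 3 := by positivity
    simp only [parabolicTime, id]
    linarith
  · refine Filter.tendsto_atBot_mono' _ ?_
      (Filter.tendsto_id.const_mul_atBot (by norm_num : (0 : ℝ) < 1 / 2))
    filter_upwards [Filter.eventually_le_atBot (0 : ℝ)] with τ hτ
    have : τ ^ 3 ≤ 0 := by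
      have := mul_nonneg (sq_nonneg τ) (neg_nonneg.2 hτ)
      nlinarith
    simp only [parabolicTime, id]
    linarith

lemma parabolicTime_parabolicParam (u : ℝ) : parabolicTime (parabolicParam u) = u :=
  Function.rightInverse_invFun parabolicTime_surjective u

lemma hasDerivAt_parabolicParam (u : ℝ) :
    HasDerivAt parabolicParam (1 / rHom u) u := by
  have hs : StrictMono parabolicParam := fun a b hab => by
    rw [← parabolicTime_strictMono.lt_iff_lt, parabolicTime_parabolicParam,
      parabolicTime_parabolicParam]
    exact hab
  have hsurj : Function.Surjective parabolicParam := fun τ =>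
    ⟨parabolicTime τ, Function.leftInverse_invFun parabolicTime_strictMono.injective τ⟩
  have hcont : Continuous parabolicParam := hs.monotone.continuous_of_surjective hsurj
  have hne : (1 + parabolicParam u ^ 2) / 2 ≠ 0 := by positivity
  have := (hasDerivAt_parabolicTime (parabolicParam u)).of_local_left_inverse
    hcont.continuousAt hne (Filter.Eventually.of_forall parabolicTime_parabolicParam)
  simpa [rHom, add_comm] using this

/-- The radial velocity on the parabolic orbit is `y_h = τ / r_h`. -/
lemma hasDerivAt_rHom (u : ℝ) : HasDerivAt rHom (parabolicParam u / rHom u) u := by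
  have := (((hasDerivAt_parabolicParam u).pow 2).add_const 1).div_const 2
  refine HasDerivAt.congr_deriv this ?_
  norm_num
  ring

/-- The angular velocity on the parabolic orbit (angular momentum one). -/
lemma hasDerivAt_alphaHom (u : ℝ) : HasDerivAt alphaHom (1 / rHom u ^ 2) u := by
  have := (((hasDerivAt_parabolicParam u).arctan).const_mul 2).const_add Real.pi
  refine HasDerivAt.congr_deriv this ?_
  have h : rHom u = (parabolicParam u ^ 2 + 1) / 2 := rfl
  have h' : 1 + parabolicParam u ^ 2 ≠ 0 := by positivity
  rw [h]
  field_simp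
  ring

/-- The energy vanishes on the parabolic orbit. -/
lemma parabolic_energy (u : ℝ) :
    (parabolicParam u / rHom u) ^ 2 / 2 + 1 / (2 * rHom u ^ 2) - 1 / rHom u = 0 := by
  have h : rHom u = (parabolicParam u ^ 2 + 1) / 2 := rfl
  have h' : parabolicParam u ^ 2 + 1 ≠ 0 := by positivity
  rw [h]
  field_simp
  ring

lemma exp_alphaHom (u : ℝ) :
    Complex.exp ((alphaHom u : ℂ) * Complex.I)
      = ((parabolicParam u : ℂ) - Complex.I) / ((parabolicParam u : ℂ) + Complex.I) := by
  set τ := parabolicParam u with hτ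
  have hne : (τ : ℂ) + Complex.I ≠ 0 := by
    intro h
    have := congrArg Complex.im h
    simp at this
  have hpos : 0 < 1 + τ ^ 2 := by positivity
  have e1 : Real.cos (alphaHom u) = -(1 - τ ^ 2) / (1 + τ ^ 2) := by
    rw [alphaHom, ← hτ, add_comm, Real.cos_add_pi, Real.cos_two_mul, Real.cos_sq_arctan]
    field_simp
    ring
  have e2 : Real.sin (alphaHom u) = -(2 * τ) / (1 + τ ^ 2) := by
    rw [alphaHom, ← hτ, add_comm, Real.sin_add_pi, Real.sin_two_mul, Real.sin_arctan,
      Real.cos_arctan]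
    have := Real.sq_sqrt hpos.le
    field_simp
    rw [this]
  have hc : ((1 : ℂ) + (τ : ℂ) ^ 2) ≠ 0 := by exact_mod_cast hpos.ne'
  rw [Complex.exp_mul_I, ← Complex.ofReal_cos, ← Complex.ofReal_sin, e1, e2, eq_div_iff hne]
  push_cast
  field_simp
  linear_combination (-2 * (τ : ℂ)) * Complex.I_sq

end RPE3BP

open RPE3BP

namespace RPE3BP

open MeasureTheory Filter Topology

/-! ## Tools from complex analysis -/

/-! The potential is expanded completely, and every term is either computed or bounded. In complex
notation the parabolic orbit is I² e^{iβ}(τ − i)²/2, so the ratio of the relative position w(t) of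
the primaries to it is z = 2w e^{−iβ}/(I²(τ − i)²). As 1/|1 − z| is (1 − z)^{−1/2} times its
conjugate, the potential is a double power series in z and its conjugate (`hasSum_potCoef`,
`pertPotential_parabolicTime`). The constant term is the subtracted Kepler potential, and the linear
terms cancel because the centre of mass is at the origin. Inserting the Fourier series in time of
w^j (conj w)^k gives terms `melnikovTerm` indexed by (j, k, l), where l is the order in σ and −(j −
k) the order in β. Each is a product of a function of σ, one of β, one of I and one of ε.

The factor in ε is a contour integral in ζ = exp(iE), with E the eccentric anomaly. Moving the
circle to radius |ε| or 1/|ε| shows that it is O(ε^{|j−k−l|}) (`norm_keplerCoeff_le`). The factor in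
I is the integral of (τ − i)^{−2j}(τ + i)^{−2k} exp(i l I³(τ + τ³/3)/2). For l = 0 it is rational,
of size I^{1−2(j+k)}, and vanishes when j or k is zero. For l > 0 the contour is moved near the
saddle τ = i, which is also a pole. In ξ = I(τ − i) the phase is exactly −lI³/3 − lIξ²/2 + ilξ³/6,
so the size is exp(−l Re I³/3)(Re I)^{j−2k−1/2} (`norm_saddleIntegral_le`). Negative l follow by
reflection. Writing j = k + l + m, a positive m contributes (εI)^m and a negative one (ε/I)^{|m|},
besides I^{l−k−1/2}. Since εI³ is bounded and I is large, everything is dominated by a geometric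
series.

The leading terms are (1,1,0) and (2,1,0), which are explicit, and (2,1,1) and (2,0,1), for which
the Gaussian integral at the saddle and the first-order expansion of the Kepler coefficient suffice.
Their mirror images (k, j, −l) complete the cosines. All remaining terms are sorted by order and
bounded. Joint analyticity, including in ε, uses the product structure: bounded holomorphic families
are analytic maps to ℓ^∞, where they are multiplied before a weighted sum is taken
(`analyticAt_tsum_prod_four`).

For the reduced potentials, σ = φ + δ and β = φ combine into exp(i(lδ − (j − k − l)φ))
(`melnikovTerm_diag`): the harmonic in φ has the index that governs the order in ε, so the part
independent of φ can be removed and the rest is O(ε). Passing from δ = 0 to δ = π multiplies order l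
by (−1)^l, so the order l = 0 disappears from the difference, which is therefore exponentially
small. Derivatives come from Cauchy's estimate on discs of radius 1/2. For the action derivative of
the difference the factor e^{−I³/3} is divided out first, as it is far from constant on such a disc.
The bracket is then an algebraic identity plus a product of two bounds. -/

/-- Holomorphy of an integral depending on a complex parameter. -/
lemma differentiableOn_integral_of_bound {α : Type*} [MeasurableSpace α] {ν : Measure α}
    {f : ℂ → α → ℂ} {U : Set ℂ} (hU : IsOpen U)
    (hf : ∀ a, DifferentiableOn ℂ (fun z => f z a) U)
    (hm : ∀ z ∈ U, AEStronglyMeasurable (f z) ν) {bound : α → ℝ} (hb : Integrable bound ν)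
    (h : ∀ z ∈ U, ∀ a, ‖f z a‖ ≤ bound a) :
    DifferentiableOn ℂ (fun z => ∫ a, f z a ∂ν) U := by
  intro z₀ hz₀
  obtain ⟨R, hR, hball⟩ := Metric.isOpen_iff.1 hU z₀ hz₀
  have hR2 : 0 < R / 2 := by positivity
  have hsub : ∀ z ∈ Metric.ball z₀ (R / 2), Metric.closedBall z (R / 3) ⊆ U := by
    intro z hz w hw
    refine hball ?_
    rw [Metric.mem_ball] at hz ⊢
    rw [Metric.mem_closedBall] at hw
    linarith [dist_triangle w z z₀]
  have hd : ∀ z ∈ Metric.ball z₀ (R / 2), ∀ a,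
      HasDerivAt (fun z => f z a) (deriv (fun z => f z a) z) z := by
    intro z hz a
    have hzU : z ∈ U := hsub z hz (Metric.mem_closedBall_self (by positivity))
    exact ((hf a).differentiableAt (hU.mem_nhds hzU)).hasDerivAt
  -- Measurability of the derivative is not assumed: it is the pointwise limit of the difference
  -- quotients along a sequence tending to z₀.
  have hmeas : AEStronglyMeasurable (fun a => deriv (fun z => f z a) z₀) ν := by
    let u : ℕ → ℂ := fun n => z₀ + ((R / 2 / (n + 2) : ℝ) : ℂ)
    have hu : ∀ n, u n ∈ U := by
      intro n
      refine hball ?_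
      rw [Metric.mem_ball, dist_eq_norm]
      have hn : (0 : ℝ) < n + 2 := by positivity
      simp only [u, add_sub_cancel_left, Complex.norm_real, Real.norm_eq_abs]
      rw [abs_of_pos (by positivity), div_lt_iff₀ hn]
      nlinarith
    have hlim : Tendsto u atTop (𝓝[≠] z₀) := by
      refine tendsto_nhdsWithin_iff.2 ⟨?_, Eventually.of_forall fun n => ?_⟩
      · have h1 : Tendsto (fun n : ℕ => (R / 2 / ((n : ℝ) + 2) : ℝ)) atTop (𝓝 0) :=
          tendsto_const_nhds.div_atTop
            (tendsto_atTop_add_const_right _ _ tendsto_natCast_atTop_atTop)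
        have h2 := (Complex.continuous_ofReal.tendsto 0).comp h1
        simpa [u] using h2.const_add z₀
      · have hn : (0 : ℝ) < n + 2 := by positivity
        have : (R / 2 / (n + 2) : ℝ) ≠ 0 := by positivity
        intro hc
        simp only [u, mem_singleton_iff, add_eq_left] at hc
        exact this (by exact_mod_cast hc)
    refine aestronglyMeasurable_of_tendsto_ae atTop
      (f := fun n a => slope (fun z => f z a) z₀ (u n)) (fun n => ?_)
      (Eventually.of_forall fun a => ?_)
    · simp only [slope, vsub_eq_sub]
      exact ((hm _ (hu n)).sub (hm _ hz₀)).const_smul ((u n - z₀)⁻¹)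
    · exact (hasDerivAt_iff_tendsto_slope.1
        (hd z₀ (Metric.mem_ball_self hR2) a)).comp hlim
  have := hasDerivAt_integral_of_dominated_loc_of_deriv_le (μ := ν) (F := f)
    (F' := fun z a => deriv (fun z => f z a) z) (bound := fun a => bound a / (R / 3))
    (Metric.ball_mem_nhds z₀ hR2) ?_ ?_ hmeas ?_ (hb.div_const _) ?_
  · exact this.2.differentiableAt.differentiableWithinAt
  · filter_upwards [hU.mem_nhds hz₀] with z hz using hm z hz
  · exact hb.mono' (hm z₀ hz₀) (Eventually.of_forall fun a => h z₀ hz₀ a)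
  -- Cauchy's estimate on a circle of radius R/3 turns the bound of the integrand into a bound of
  -- its derivative.
  · refine Eventually.of_forall fun a z hz => ?_
    refine Complex.norm_deriv_le_of_forall_mem_sphere_norm_le (by positivity) ?_ ?_
    · exact ((hf a).mono (hsub z hz)).diffContOnCl_ball subset_rfl
    · exact fun w hw => h w (hsub z hz (Metric.sphere_subset_closedBall hw)) a
  · exact Eventually.of_forall fun a z hz => hd z hz a

/-- Integrals of a holomorphic function over two horizontal lines coincide when the function
decays quadratically between them. -/
lemma integral_horizontal_eq {f : ℂ → ℂ} {a b C : ℝ}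
    (hd : DifferentiableOn ℂ f {z | z.im ∈ uIcc a b})
    (hb : ∀ z : ℂ, z.im ∈ uIcc a b → ‖f z‖ ≤ C * (1 + z.re ^ 2)⁻¹) :
    ∫ x : ℝ, f (x + a * Complex.I) = ∫ x : ℝ, f (x + b * Complex.I) := by
  have hint : ∀ c ∈ uIcc a b, Integrable fun x : ℝ => f (x + c * Complex.I) := by
    intro c hc
    refine (integrable_inv_one_add_sq.const_mul C).mono' ?_ (Eventually.of_forall fun x => ?_)
    · refine Continuous.aestronglyMeasurable ?_
      refine hd.continuousOn.comp_continuous (by fun_prop) fun x => ?_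
      simpa using hc
    · simpa using hb (x + c * Complex.I) (by simpa using hc)
  have hside : ∀ s : ℝ, s = 1 ∨ s = -1 → Tendsto (fun R : ℝ => ∫ y : ℝ in a..b,
      f (((s * R : ℝ) : ℂ) + y * Complex.I)) atTop (𝓝 0) := by
    intro s hs
    have h0 : Tendsto (fun R : ℝ => C * (1 + R ^ 2)⁻¹ * |b - a|) atTop (𝓝 0) := by
      have : Tendsto (fun R : ℝ => (1 + R ^ 2)⁻¹) atTop (𝓝 0) :=
        tendsto_inv_atTop_zero.comp
          (tendsto_atTop_add_const_left _ _ (tendsto_pow_atTop (by norm_num)))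
      simpa using (this.const_mul C).mul_const |b - a|
    refine squeeze_zero_norm (fun R => ?_) h0
    refine intervalIntegral.norm_integral_le_of_norm_le_const fun y hy => ?_
    have hs2 : s ^ 2 = 1 := by rcases hs with rfl | rfl <;> norm_num
    have := hb (((s * R : ℝ) : ℂ) + y * Complex.I) (by simpa using uIoc_subset_uIcc hy)
    simpa [mul_pow, hs2] using this
  have hrect : ∀ R : ℝ, (∫ x : ℝ in -R..R, f (x + a * Complex.I))
      - (∫ x : ℝ in -R..R, f (x + b * Complex.I))
      + Complex.I • (∫ y : ℝ in a..b, f (((1 * R : ℝ) : ℂ) + y * Complex.I))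
      - Complex.I • (∫ y : ℝ in a..b, f (((-1 * R : ℝ) : ℂ) + y * Complex.I)) = 0 := by
    intro R
    have := Complex.integral_boundary_rect_eq_zero_of_differentiableOn f
      ⟨-R, a⟩ ⟨R, b⟩ (hd.mono fun z hz => (Complex.mem_reProdIm.1 hz).2)
    simpa using this
  have l1 := intervalIntegral_tendsto_integral (hint a left_mem_uIcc) tendsto_neg_atTop_atBot
    tendsto_id
  have l2 := intervalIntegral_tendsto_integral (hint b right_mem_uIcc) tendsto_neg_atTop_atBot
    tendsto_id
  have l3 := ((l1.sub l2).add ((hside 1 (Or.inl rfl)).const_smul Complex.I)).sub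
    ((hside (-1) (Or.inr rfl)).const_smul Complex.I)
  have l4 := l3.congr fun R => hrect R
  have := tendsto_nhds_unique l4 tendsto_const_nhds
  simpa [sub_eq_zero] using this

/-! ### Joint analyticity of sums of products -/

/-- A family of uniformly bounded holomorphic functions is analytic as a map to `ℓ^∞`. -/
lemma exists_analyticAt_lp_infty {N : Type*} {f : N → ℂ → ℂ} {z₀ : ℂ} {R : ℝ} (hR : 0 < R)
    (hd : ∀ n, DifferentiableOn ℂ (f n) (Metric.ball z₀ R))
    (hb : ∀ n, ∀ z ∈ Metric.ball z₀ R, ‖f n z‖ ≤ 1) :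
    ∃ Φ : ℂ → lp (fun _ : N => ℂ) ⊤, AnalyticAt ℂ Φ z₀ ∧
      ∀ᶠ z in 𝓝 z₀, ∀ n, Φ z n = f n z := by
  classical
  -- Truncation outside the ball makes the family bounded for every z, so that the map to ℓ^∞ is
  -- defined everywhere.
  have hmem : ∀ z, Memℓp (fun n => if z ∈ Metric.ball z₀ R then f n z else 0) ⊤ := by
    intro z
    refine memℓp_infty ⟨1, ?_⟩
    rintro _ ⟨n, rfl⟩
    by_cases hz : z ∈ Metric.ball z₀ R
    · simpa [hz] using hb n z hz
    · simp [hz]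
  let Ψ : ℂ → lp (fun _ : N => ℂ) ⊤ := fun z => ⟨_, hmem z⟩
  have hΨ : ∀ z ∈ Metric.ball z₀ R, ∀ n, Ψ z n = f n z := fun z hz n => by simp [Ψ, hz]
  -- Cauchy's estimate bounds all the derivatives by 3/R uniformly in n; this is what makes the
  -- family continuous for the sup norm.
  have hlip : ∀ z ∈ Metric.ball z₀ (R / 2), ∀ w ∈ Metric.ball z₀ (R / 2),
      ‖Ψ w - Ψ z‖ ≤ 3 / R * ‖w - z‖ := by
    intro z hz w hw
    have hRR : R / 2 ≤ R := by linarith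
    refine lp.norm_le_of_forall_le (by positivity) fun n => ?_
    rw [lp.coeFn_sub, Pi.sub_apply, hΨ z (Metric.ball_subset_ball hRR hz),
      hΨ w (Metric.ball_subset_ball hRR hw)]
    refine Convex.norm_image_sub_le_of_norm_deriv_le (𝕜 := ℂ) (s := Metric.ball z₀ (R / 2))
      (fun x hx => ((hd n).differentiableAt (Metric.isOpen_ball.mem_nhds
        (Metric.ball_subset_ball hRR hx)))) (fun x hx => ?_) (convex_ball _ _) hz hw
    have hsub : Metric.closedBall x (R / 3) ⊆ Metric.ball z₀ R := by
      intro y hy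
      rw [Metric.mem_ball] at hx ⊢
      rw [Metric.mem_closedBall] at hy
      linarith [dist_triangle y x z₀]
    have := Complex.norm_deriv_le_of_forall_mem_sphere_norm_le (f := f n) (c := x) (C := 1)
      (R := R / 3) (by positivity) (((hd n).mono hsub).diffContOnCl_ball subset_rfl)
      (fun y hy => hb n y (hsub (Metric.sphere_subset_closedBall hy)))
    refine this.trans (le_of_eq ?_)
    field_simp
  have hcont : ContinuousOn Ψ (Metric.ball z₀ (R / 2)) := by
    refine LipschitzOnWith.continuousOn (K := Real.toNNReal (3 / R)) ?_
    refine LipschitzOnWith.of_dist_le_mul fun w hw z hz => ?_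
    rw [dist_eq_norm, dist_eq_norm, Real.coe_toNNReal _ (by positivity)]
    exact hlip z hz w hw
  let r : NNReal := ⟨R / 4, by positivity⟩
  have hr : (0 : NNReal) < r := by
    change (0 : ℝ) < R / 4
    positivity
  have hrR : (r : ℝ) = R / 4 := rfl
  have hcl : Metric.closedBall z₀ r ⊆ Metric.ball z₀ (R / 2) := by
    refine Metric.closedBall_subset_ball ?_
    rw [hrR]
    linarith
  have hci : CircleIntegrable Ψ z₀ r :=
    (hcont.mono (Metric.sphere_subset_closedBall.trans hcl)).circleIntegrable r.2
  -- The Cauchy integral of a merely continuous map is analytic inside the circle. Evaluation of a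
  -- coordinate commutes with the integral, and the scalar Cauchy formula then identifies that
  -- coordinate with f n.
  refine ⟨_, (hasFPowerSeriesOn_cauchy_integral hci hr).analyticAt, ?_⟩
  filter_upwards [Metric.ball_mem_nhds z₀ (show (0 : ℝ) < r from hr)] with w hw n
  have hev : ∀ x : lp (fun _ : N => ℂ) ⊤, ‖x n‖ ≤ 1 * ‖x‖ := fun x => by
    rw [one_mul]
    exact lp.norm_apply_le_norm (by simp) x n
  let ev : lp (fun _ : N => ℂ) ⊤ →L[ℂ] ℂ :=
    LinearMap.mkContinuous
      { toFun := fun x => x n, map_add' := fun x y => rfl, map_smul' := fun c x => rfl } 1 hev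
  have hint : CircleIntegrable (fun z => (z - w)⁻¹ • Ψ z) z₀ r := by
    refine ContinuousOn.circleIntegrable r.2 ?_
    change ContinuousOn ((fun z => (z - w)⁻¹) • Ψ) _
    refine ContinuousOn.smul ?_ (hcont.mono (Metric.sphere_subset_closedBall.trans hcl))
    refine ContinuousOn.inv₀ (by fun_prop) fun z hz => ?_
    rw [sub_ne_zero]
    rintro rfl
    rw [mem_sphere_iff_norm] at hz
    rw [Metric.mem_ball, dist_eq_norm] at hw
    linarith
  have h1 : ev (∮ z in C(z₀, r), (z - w)⁻¹ • Ψ z) = ∮ z in C(z₀, r), (z - w)⁻¹ • f n z := by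
    refine (ContinuousLinearMap.intervalIntegral_comp_comm ev hint.out).symm.trans ?_
    refine intervalIntegral.integral_congr fun θ _ => ?_
    simp only [map_smul]
    have : circleMap z₀ r θ ∈ Metric.ball z₀ R :=
      Metric.ball_subset_ball (by linarith) (hcl (circleMap_mem_closedBall _ r.2 θ))
    rw [show ev (Ψ (circleMap z₀ r θ)) = Ψ (circleMap z₀ r θ) n from rfl, hΨ _ this]
  have h2 : ev ((2 * Real.pi * Complex.I : ℂ)⁻¹ • ∮ z in C(z₀, r), (z - w)⁻¹ • Ψ z) = f n w := by
    rw [map_smul, h1]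
    have hdc : DiffContOnCl ℂ (f n) (Metric.ball z₀ r) :=
      ((hd n).mono (hcl.trans (Metric.ball_subset_ball (by linarith)))).diffContOnCl_ball subset_rfl
    exact hdc.two_pi_i_inv_smul_circleIntegral_sub_inv_smul hw
  exact h2

/-- A weighted sum of the coordinates of an analytic map to `ℓ^∞` is analytic. -/
lemma analyticAt_tsum_lp_infty {N E : Type*} [NormedAddCommGroup E] [NormedSpace ℂ E]
    {Φ : E → lp (fun _ : N => ℂ) ⊤} {x : E} (hΦ : AnalyticAt ℂ Φ x) {b : N → ℂ}
    (hb : Summable fun n => ‖b n‖) :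
    AnalyticAt ℂ (fun y => ∑' n, b n * Φ y n) x := by
  have hs : ∀ v : lp (fun _ : N => ℂ) ⊤, Summable fun n => ‖b n * v n‖ := fun v => by
    refine Summable.of_nonneg_of_le (fun n => norm_nonneg _) (fun n => ?_) (hb.mul_right ‖v‖)
    rw [norm_mul]
    exact mul_le_mul_of_nonneg_left (lp.norm_apply_le_norm (by simp) v n) (norm_nonneg _)
  let Λ : lp (fun _ : N => ℂ) ⊤ →L[ℂ] ℂ :=
    LinearMap.mkContinuous
      { toFun := fun v => ∑' n, b n * v n
        map_add' := fun v w => by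
          rw [← (hs v).of_norm.tsum_add (hs w).of_norm]
          exact tsum_congr fun n => mul_add _ _ _
        map_smul' := fun c v => by
          simp only [RingHom.id_apply, smul_eq_mul, ← tsum_mul_left]
          exact tsum_congr fun n => mul_left_comm _ _ _ } (∑' n, ‖b n‖) (fun v => by
        refine (norm_tsum_le_tsum_norm (hs v)).trans ?_
        rw [← tsum_mul_right]
        refine (hs v).tsum_le_tsum (fun n => ?_) (hb.mul_right _)
        rw [norm_mul]
        exact mul_le_mul_of_nonneg_left (lp.norm_apply_le_norm (by simp) v n) (norm_nonneg _))
  exact (Λ.analyticAt (Φ x)).comp hΦ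

/-- Joint analyticity of a normally convergent sum of products of functions of one variable. -/
lemma analyticAt_tsum_prod_four {N : Type*} {f₁ f₂ f₃ f₄ : N → ℂ → ℂ} {z₁ z₂ z₃ z₄ : ℂ} {R : ℝ}
    (hR : 0 < R) {B₁ B₂ B₃ B₄ : N → ℝ}
    (hp₁ : ∀ n, 0 < B₁ n) (hp₂ : ∀ n, 0 < B₂ n) (hp₃ : ∀ n, 0 < B₃ n) (hp₄ : ∀ n, 0 < B₄ n)
    (hd₁ : ∀ n, DifferentiableOn ℂ (f₁ n) (Metric.ball z₁ R))
    (hd₂ : ∀ n, DifferentiableOn ℂ (f₂ n) (Metric.ball z₂ R))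
    (hd₃ : ∀ n, DifferentiableOn ℂ (f₃ n) (Metric.ball z₃ R))
    (hd₄ : ∀ n, DifferentiableOn ℂ (f₄ n) (Metric.ball z₄ R))
    (hb₁ : ∀ n, ∀ z ∈ Metric.ball z₁ R, ‖f₁ n z‖ ≤ B₁ n)
    (hb₂ : ∀ n, ∀ z ∈ Metric.ball z₂ R, ‖f₂ n z‖ ≤ B₂ n)
    (hb₃ : ∀ n, ∀ z ∈ Metric.ball z₃ R, ‖f₃ n z‖ ≤ B₃ n)
    (hb₄ : ∀ n, ∀ z ∈ Metric.ball z₄ R, ‖f₄ n z‖ ≤ B₄ n)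
    (hs : Summable fun n => B₁ n * B₂ n * B₃ n * B₄ n) :
    AnalyticAt ℂ (fun p : ℂ × ℂ × ℂ × ℂ =>
      ∑' n, f₁ n p.1 * f₂ n p.2.1 * f₃ n p.2.2.1 * f₄ n p.2.2.2) (z₁, z₂, z₃, z₄) := by
  -- Dividing by its bounds puts each family in the unit ball of ℓ^∞. The four maps are multiplied
  -- there, and the products of the bounds become the summable weights.
  have key : ∀ {f : N → ℂ → ℂ} {z : ℂ} {B : N → ℝ}, (∀ n, 0 < B n) →
      (∀ n, DifferentiableOn ℂ (f n) (Metric.ball z R)) →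
      (∀ n, ∀ w ∈ Metric.ball z R, ‖f n w‖ ≤ B n) →
      ∃ Φ : ℂ → lp (fun _ : N => ℂ) ⊤, AnalyticAt ℂ Φ z ∧
        ∀ᶠ w in 𝓝 z, ∀ n, Φ w n = f n w / B n := by
    intro f z B hp hd hb
    refine exists_analyticAt_lp_infty (f := fun n w => f n w / B n) hR
      (fun n => (hd n).div_const _) fun n w hw => ?_
    rw [norm_div, Complex.norm_real, Real.norm_eq_abs, abs_of_pos (hp n), div_le_one (hp n)]
    exact hb n w hw
  obtain ⟨Φ₁, ha₁, he₁⟩ := key hp₁ hd₁ hb₁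
  obtain ⟨Φ₂, ha₂, he₂⟩ := key hp₂ hd₂ hb₂
  obtain ⟨Φ₃, ha₃, he₃⟩ := key hp₃ hd₃ hb₃
  obtain ⟨Φ₄, ha₄, he₄⟩ := key hp₄ hd₄ hb₄
  set x : ℂ × ℂ × ℂ × ℂ := (z₁, z₂, z₃, z₄) with hx
  have c₁ : AnalyticAt ℂ (fun p : ℂ × ℂ × ℂ × ℂ => p.1) x := analyticAt_fst
  have c₂ : AnalyticAt ℂ (fun p : ℂ × ℂ × ℂ × ℂ => p.2.1) x := analyticAt_fst.comp analyticAt_snd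
  have c₃' : AnalyticAt ℂ (fun p : ℂ × ℂ × ℂ × ℂ => p.2.2) x := analyticAt_snd.comp analyticAt_snd
  have c₃ : AnalyticAt ℂ (fun p : ℂ × ℂ × ℂ × ℂ => p.2.2.1) x := analyticAt_fst.comp c₃'
  have c₄ : AnalyticAt ℂ (fun p : ℂ × ℂ × ℂ × ℂ => p.2.2.2) x := analyticAt_snd.comp c₃'
  have hΦ : AnalyticAt ℂ (fun p : ℂ × ℂ × ℂ × ℂ =>
      Φ₁ p.1 * Φ₂ p.2.1 * Φ₃ p.2.2.1 * Φ₄ p.2.2.2) x :=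
    (((ha₁.comp_of_eq c₁ rfl).mul (ha₂.comp_of_eq c₂ rfl)).mul (ha₃.comp_of_eq c₃ rfl)).mul
      (ha₄.comp_of_eq c₄ rfl)
  have hs' : Summable fun n => ‖((B₁ n * B₂ n * B₃ n * B₄ n : ℝ) : ℂ)‖ := by
    simpa only [Complex.norm_real] using hs.norm
  refine (analyticAt_tsum_lp_infty hΦ hs').congr ?_
  filter_upwards [c₁.continuousAt.eventually he₁, c₂.continuousAt.eventually he₂,
    c₃.continuousAt.eventually he₃, c₄.continuousAt.eventually he₄] with p h₁ h₂ h₃ h₄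
  refine tsum_congr fun n => ?_
  have e₁ : (B₁ n : ℂ) ≠ 0 := by exact_mod_cast (hp₁ n).ne'
  have e₂ : (B₂ n : ℂ) ≠ 0 := by exact_mod_cast (hp₂ n).ne'
  have e₃ : (B₃ n : ℂ) ≠ 0 := by exact_mod_cast (hp₃ n).ne'
  have e₄ : (B₄ n : ℂ) ≠ 0 := by exact_mod_cast (hp₄ n).ne'
  simp only [lp.infty_coeFn_mul, Pi.mul_apply, h₁ n, h₂ n, h₃ n, h₄ n]
  push_cast
  field_simp

/-! ## Integrals through the saddle point -/

/-- The exponential factor near the saddle point. -/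
noncomputable def saddleExp (l : ℕ) (I ξ : ℂ) : ℂ :=
  Complex.exp (-(l * I * ξ ^ 2 / 2) + Complex.I * l * ξ ^ 3 / 6)

/-- The integrand near the saddle point, in the variable `ξ = I (τ - i)`. -/
noncomputable def saddleKernel (j k l : ℕ) (I ξ : ℂ) : ℂ :=
  (ξ ^ (2 * j))⁻¹ * ((ξ + 2 * Complex.I * I) ^ (2 * k))⁻¹ * saddleExp l I ξ

/-- The integral of `saddleKernel` over a horizontal line below the origin. -/
noncomputable def saddleIntegral (j k l : ℕ) (I : ℂ) : ℂ :=
  ∫ y : ℝ, saddleKernel j k l I (y + ((-1 : ℝ) : ℂ) * Complex.I)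

lemma norm_saddleExp (l : ℕ) (I : ℂ) (y η : ℝ) :
    ‖saddleExp l I (y + ((-η : ℝ) : ℂ) * Complex.I)‖
      = Real.exp (-(l / 2 * (I.re * (y ^ 2 - η ^ 2) + 2 * I.im * y * η))
          + l / 6 * (3 * y ^ 2 * η - η ^ 3)) := by
  rw [saddleExp, Complex.norm_exp]
  congr 1
  have h2 : ((y : ℂ) + ((-η : ℝ) : ℂ) * Complex.I) ^ 2
      = ((y ^ 2 - η ^ 2 : ℝ) : ℂ) + ((-(2 * y * η) : ℝ) : ℂ) * Complex.I := by
    push_cast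
    linear_combination (η : ℂ) ^ 2 * Complex.I_sq
  have h3 : ((y : ℂ) + ((-η : ℝ) : ℂ) * Complex.I) ^ 3
      = ((y ^ 3 - 3 * y * η ^ 2 : ℝ) : ℂ) + ((η ^ 3 - 3 * y ^ 2 * η : ℝ) : ℂ) * Complex.I := by
    push_cast
    linear_combination (3 * (y : ℂ) * (η : ℂ) ^ 2 - Complex.I * (η : ℂ) ^ 3) * Complex.I_sq
  rw [h2, h3]
  have e1 : (l : ℂ) * I * (((y ^ 2 - η ^ 2 : ℝ) : ℂ) + ((-(2 * y * η) : ℝ) : ℂ) * Complex.I) / 2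
      = (((l / 2 : ℝ) : ℂ)) *
        (I * (((y ^ 2 - η ^ 2 : ℝ) : ℂ) + ((-(2 * y * η) : ℝ) : ℂ) * Complex.I)) := by
    push_cast; ring
  have e2 : Complex.I * (l : ℂ) * (((y ^ 3 - 3 * y * η ^ 2 : ℝ) : ℂ)
        + ((η ^ 3 - 3 * y ^ 2 * η : ℝ) : ℂ) * Complex.I) / 6
      = (((l / 6 : ℝ) : ℂ)) * (Complex.I * (((y ^ 3 - 3 * y * η ^ 2 : ℝ) : ℂ)
        + ((η ^ 3 - 3 * y ^ 2 * η : ℝ) : ℂ) * Complex.I)) := by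
    push_cast; ring
  rw [e1, e2]
  simp only [Complex.add_re, Complex.neg_re, Complex.mul_re, Complex.mul_im, Complex.add_im, Complex.ofReal_re, Complex.ofReal_im, Complex.I_re,
    Complex.I_im]
  ring

/-- Completing the square absorbs the cross term, thanks to |q| ≤ p/2, and η ≤ p/4 absorbs the cubic
term: each uses an eighth of py², so half of the Gaussian decay survives. The number h is left free
to cover both the full exponent and the pure Gaussian (h = 0). -/
lemma gaussian_exponent_le {l : ℕ} {p q y η : ℝ} (hη : 0 ≤ η) (hηp : η ≤ p / 4) (hq : |q| ≤ p / 2)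
    (h : ℝ) (hh : h ≤ 3 * y ^ 2 * η) :
    -((l : ℝ) / 2 * (p * (y ^ 2 - η ^ 2) + 2 * q * y * η)) + l / 6 * h
      ≤ -(l * p * y ^ 2 / 4) + l * p * η ^ 2 := by
  have hl : (0 : ℝ) ≤ l := Nat.cast_nonneg l
  have hp : 0 ≤ p := by linarith
  obtain ⟨hq1, hq2⟩ := abs_le.1 hq
  have hcross : -(2 * q * y * η) ≤ p / 4 * y ^ 2 + p * η ^ 2 := by
    rcases le_total 0 (y * η) with hs | hs
    · nlinarith [mul_nonneg hp (sq_nonneg (y - 2 * η))]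
    · nlinarith [mul_nonneg hp (sq_nonneg (y + 2 * η))]
  have h3 : y ^ 2 * η ≤ y ^ 2 * (p / 4) := mul_le_mul_of_nonneg_left hηp (sq_nonneg y)
  have : -(1 / 2 * (p * (y ^ 2 - η ^ 2) + 2 * q * y * η)) + 1 / 6 * h
      ≤ -(p * y ^ 2 / 4) + p * η ^ 2 := by nlinarith
  have := mul_le_mul_of_nonneg_left this hl
  nlinarith

lemma norm_saddleExp_le {l : ℕ} {I : ℂ} {y η : ℝ} (hη : 0 ≤ η) (hηp : η ≤ I.re / 4)
    (hq : |I.im| ≤ I.re / 2) :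
    ‖saddleExp l I (y + ((-η : ℝ) : ℂ) * Complex.I)‖
      ≤ Real.exp (l * I.re * η ^ 2) * Real.exp (-(l * I.re / 4) * y ^ 2) := by
  rw [norm_saddleExp, ← Real.exp_add]
  refine Real.exp_le_exp.2 ((gaussian_exponent_le (l := l) hη hηp hq _ ?_).trans (le_of_eq ?_))
  · have : 0 ≤ η ^ 3 := by positivity
    linarith
  · ring

lemma norm_line_ge (y η : ℝ) (hη : 0 ≤ η) : η ≤ ‖(y : ℂ) + ((-η : ℝ) : ℂ) * Complex.I‖ := by
  have := Complex.abs_im_le_norm ((y : ℂ) + ((-η : ℝ) : ℂ) * Complex.I)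
  simpa [abs_of_nonneg hη] using this

/-- The second pole, ξ = −2iI, lies at height −2 Re I, hence at distance at least Re I from a line
at height −η with η ≤ Re I. -/
lemma norm_line_add_ge {I : ℂ} {y η : ℝ} (hη : η ≤ I.re) :
    I.re ≤ ‖(y : ℂ) + ((-η : ℝ) : ℂ) * Complex.I + 2 * Complex.I * I‖ := by
  have := Complex.abs_im_le_norm ((y : ℂ) + ((-η : ℝ) : ℂ) * Complex.I + 2 * Complex.I * I)
  have h2 := le_abs_self ((y : ℂ) + ((-η : ℝ) : ℂ) * Complex.I + 2 * Complex.I * I).im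
  simp only [Complex.add_im, Complex.mul_im, Complex.ofReal_im, Complex.I_re,
    Complex.I_im, Complex.ofReal_re, Complex.mul_re, Complex.re_ofNat, Complex.im_ofNat] at this h2
  linarith

lemma norm_saddleKernel_le {j k l : ℕ} {I : ℂ} {y η : ℝ} (hη : 0 < η) (hηp : η ≤ I.re / 4)
    (hq : |I.im| ≤ I.re / 2) :
    ‖saddleKernel j k l I (y + ((-η : ℝ) : ℂ) * Complex.I)‖
      ≤ (η ^ (2 * j))⁻¹ * (I.re ^ (2 * k))⁻¹ * Real.exp (l * I.re * η ^ 2)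
          * Real.exp (-(l * I.re / 4) * y ^ 2) := by
  have hp : 0 < I.re := by linarith
  rw [saddleKernel, norm_mul, norm_mul, norm_inv, norm_inv, norm_pow, norm_pow,
    mul_assoc _ (Real.exp _) (Real.exp _)]
  have h1 := norm_line_ge y η hη.le
  have h2 := norm_line_add_ge (I := I) (y := y) (η := η) (by linarith)
  gcongr
  exact norm_saddleExp_le hη.le hηp hq

lemma exp_neg_le_inv_one_add {a y : ℝ} (ha : 1 ≤ a) :
    Real.exp (-a * y ^ 2) ≤ (1 + y ^ 2)⁻¹ := by
  rw [show -a * y ^ 2 = -(a * y ^ 2) by ring, Real.exp_neg]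
  have : 1 + y ^ 2 ≤ Real.exp (a * y ^ 2) := by
    have := Real.add_one_le_exp (a * y ^ 2)
    nlinarith [sq_nonneg y]
  exact inv_anti₀ (by positivity) this

lemma differentiableAt_saddleKernel {j k l : ℕ} {I ξ : ℂ} (h1 : ξ ≠ 0)
    (h2 : ξ + 2 * Complex.I * I ≠ 0) :
    DifferentiableAt ℂ (saddleKernel j k l I) ξ := by
  unfold saddleKernel saddleExp
  have := pow_ne_zero (2 * j) h1
  have := pow_ne_zero (2 * k) h2
  fun_prop (disch := assumption)

lemma line_ne_zero {y η : ℝ} (hη : 0 < η) : (y : ℂ) + ((-η : ℝ) : ℂ) * Complex.I ≠ 0 :=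
  norm_pos_iff.1 (hη.trans_le (norm_line_ge y η hη.le))

lemma line_add_ne_zero {I : ℂ} {y η : ℝ} (hη : 0 < η) (hηp : η ≤ I.re) :
    (y : ℂ) + ((-η : ℝ) : ℂ) * Complex.I + 2 * Complex.I * I ≠ 0 :=
  norm_pos_iff.1 ((hη.trans_le hηp).trans_le (norm_line_add_ge hηp))

lemma eq_line (z : ℂ) : z = (z.re : ℂ) + ((-(-z.im) : ℝ) : ℂ) * Complex.I := by
  apply Complex.ext <;> simp

lemma continuous_saddleKernel_line {j k l : ℕ} {I : ℂ} {η : ℝ} (hη : 0 < η) (hηp : η ≤ I.re) :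
    Continuous fun y : ℝ => saddleKernel j k l I (y + ((-η : ℝ) : ℂ) * Complex.I) := by
  refine continuous_iff_continuousAt.2 fun y => ?_
  exact ContinuousAt.comp (f := fun y : ℝ => (y : ℂ) + ((-η : ℝ) : ℂ) * Complex.I)
    (differentiableAt_saddleKernel (line_ne_zero hη) (line_add_ne_zero hη hηp)).continuousAt
    (by fun_prop)

/-- No pole lies between the heights −1 and −η, and the Gaussian decay is uniform there. The height
−1 does not depend on I and serves for holomorphy, while the estimates use the natural scale (Re
I)^{−1/2} of the saddle. -/
lemma saddleIntegral_eq_line {j k l : ℕ} (hl : 1 ≤ l) {I : ℂ} (hI : 4 ≤ I.re)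
    (hq : |I.im| ≤ I.re / 2) {η : ℝ} (hη : 0 < η) (hη1 : η ≤ 1) :
    saddleIntegral j k l I
      = ∫ y : ℝ, saddleKernel j k l I (y + ((-η : ℝ) : ℂ) * Complex.I) := by
  have hl' : (1 : ℝ) ≤ l := by exact_mod_cast hl
  have hrange : ∀ z : ℂ, z.im ∈ uIcc (-1) (-η) → η ≤ -z.im ∧ -z.im ≤ 1 := by
    intro z hz
    rw [uIcc_of_le (by linarith)] at hz
    constructor <;> linarith [hz.1, hz.2]
  refine integral_horizontal_eq
    (C := (η ^ (2 * j))⁻¹ * (I.re ^ (2 * k))⁻¹ * Real.exp (l * I.re)) ?_ ?_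
  · intro z hz
    obtain ⟨h1, h2⟩ := hrange z hz
    rw [eq_line z]
    exact (differentiableAt_saddleKernel (line_ne_zero (by linarith))
      (line_add_ne_zero (by linarith) (by linarith))).differentiableWithinAt
  · intro z hz
    obtain ⟨h1, h2⟩ := hrange z hz
    have h0 : 0 < -z.im := by linarith
    conv_lhs => rw [eq_line z]
    refine (norm_saddleKernel_le h0 (by linarith) hq).trans ?_
    have h5 : (0 : ℝ) ≤ l * I.re := by positivity
    have e1 : Real.exp (l * I.re * (-z.im) ^ 2) ≤ Real.exp (l * I.re) :=
      Real.exp_le_exp.2 (mul_le_of_le_one_right h5 (pow_le_one₀ h0.le h2))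
    have e2 : Real.exp (-(l * I.re / 4) * z.re ^ 2) ≤ (1 + z.re ^ 2)⁻¹ :=
      exp_neg_le_inv_one_add (by nlinarith)
    gcongr

lemma norm_integral_le_of_gaussian {f : ℝ → ℂ} {C a : ℝ} (ha : 0 < a)
    (h : ∀ y, ‖f y‖ ≤ C * Real.exp (-a * y ^ 2)) : ‖∫ y, f y‖ ≤ C * √(Real.pi / a) := by
  rw [← integral_gaussian, ← integral_const_mul]
  exact norm_integral_le_of_norm_le ((integrable_exp_neg_mul_sq ha).const_mul C)
    (Eventually.of_forall h)

lemma sqrt_gaussian {p : ℝ} (hp : 0 < p) : √(Real.pi / (p / 4)) ≤ 4 * (√p)⁻¹ := by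
  rw [Real.sqrt_le_left (by positivity), mul_pow, inv_pow, Real.sq_sqrt hp.le]
  rw [show Real.pi / (p / 4) = 4 * Real.pi * p⁻¹ by field_simp]
  have := Real.pi_le_four
  gcongr
  linarith

lemma sqrt_inv_le_one {p : ℝ} (hp : 1 ≤ p) : (√p)⁻¹ ≤ 1 := by
  rw [inv_le_one₀ (by positivity)]
  exact Real.one_le_sqrt.2 hp

/-- The basic bound of the integrals through the saddle point. -/
lemma norm_saddleIntegral_le {j k l : ℕ} (hl : 1 ≤ l) {I : ℂ} (hI : 4 ≤ I.re)
    (hq : |I.im| ≤ I.re / 2) :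
    ‖saddleIntegral j k l I‖
      ≤ 4 * Real.exp l * I.re ^ j * (I.re ^ (2 * k))⁻¹ * (√I.re)⁻¹ := by
  have hp : 0 < I.re := by linarith
  have hl' : (1 : ℝ) ≤ l := by exact_mod_cast hl
  have hη1 := sqrt_inv_le_one (p := I.re) (by linarith)
  have hη0 : 0 < (√I.re)⁻¹ := by positivity
  -- With η² = 1/Re I the loss exp(l Re I η²) is only e^l, and the pole at the origin costs η^{−2j}
  -- = (Re I)^j.
  rw [saddleIntegral_eq_line hl hI hq hη0 hη1]
  have hsq : (√I.re)⁻¹ ^ 2 = I.re⁻¹ := by rw [inv_pow, Real.sq_sqrt hp.le]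
  have h : ∀ y : ℝ, ‖saddleKernel j k l I (y + ((-(√I.re)⁻¹ : ℝ) : ℂ) * Complex.I)‖
      ≤ Real.exp l * I.re ^ j * (I.re ^ (2 * k))⁻¹ * Real.exp (-(I.re / 4) * y ^ 2) := by
    intro y
    refine (norm_saddleKernel_le hη0 (by linarith) hq).trans ?_
    rw [pow_mul, hsq, inv_pow, inv_inv, mul_assoc (l : ℝ), mul_inv_cancel₀ hp.ne', mul_one]
    rw [show I.re ^ j * (I.re ^ (2 * k))⁻¹ * Real.exp l
      = Real.exp l * I.re ^ j * (I.re ^ (2 * k))⁻¹ by ring]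
    gcongr
    exact le_mul_of_one_le_left hp.le hl'
  refine (norm_integral_le_of_gaussian (by positivity) h).trans ?_
  calc _ ≤ Real.exp l * I.re ^ j * (I.re ^ (2 * k))⁻¹ * (4 * (√I.re)⁻¹) := by
        gcongr
        exact sqrt_gaussian hp
    _ = _ := by ring

/-- The line Im ξ = −1 is the same for all I, so it is enough to dominate the integrand near I; the
upper bound on Re z keeps the factor exp(l Re z) under control. -/
lemma differentiableAt_saddleIntegral {j k l : ℕ} (hl : 1 ≤ l) {I : ℂ} (hI : 4 < I.re)
    (hq : |I.im| < 2) : DifferentiableAt ℂ (saddleIntegral j k l) I := by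
  set U : Set ℂ := {z | 4 < z.re ∧ z.re < I.re + 1 ∧ |z.im| < 2} with hU
  have hUo : IsOpen U := by
    refine (isOpen_lt continuous_const Complex.continuous_re).inter
      ((isOpen_lt Complex.continuous_re continuous_const).inter
        (isOpen_lt Complex.continuous_im.abs continuous_const))
  have hIU : I ∈ U := ⟨hI, by linarith, hq⟩
  have hl' : (1 : ℝ) ≤ l := by exact_mod_cast hl
  refine (differentiableOn_integral_of_bound (ν := (volume : Measure ℝ)) hUo
    (f := fun z (y : ℝ) => saddleKernel j k l z (y + ((-1 : ℝ) : ℂ) * Complex.I)) (fun y z hz => ?_)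
    (fun z hz => ?_) (bound := fun y : ℝ => Real.exp (l * (I.re + 1)) * (1 + y ^ 2)⁻¹)
    (integrable_inv_one_add_sq.const_mul _) (fun z hz y => ?_)).differentiableAt (hUo.mem_nhds hIU)
  · have := pow_ne_zero (2 * k) (line_add_ne_zero (I := z) (y := y) (η := 1) one_pos
      (by linarith [hz.1]))
    unfold saddleKernel saddleExp
    exact DifferentiableAt.differentiableWithinAt (by fun_prop (disch := assumption))
  · exact (continuous_saddleKernel_line one_pos (by linarith [hz.1])).aestronglyMeasurable
  · obtain ⟨h1, h2, h3⟩ := hz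
    refine (norm_saddleKernel_le one_pos (by linarith) (by linarith)).trans ?_
    have hk : (z.re ^ (2 * k))⁻¹ ≤ 1 := inv_le_one_of_one_le₀ (one_le_pow₀ (by linarith))
    rw [one_pow, inv_one, one_mul, one_pow, mul_one]
    have e2 : Real.exp (-(l * z.re / 4) * y ^ 2) ≤ (1 + y ^ 2)⁻¹ :=
      exp_neg_le_inv_one_add (by nlinarith)
    calc _ ≤ 1 * Real.exp (l * (I.re + 1)) * (1 + y ^ 2)⁻¹ := by gcongr
      _ = _ := by ring

/-! ### Leading terms -/

/-- Along the segment from 0 to z the modulus of the exponential is at most 1 + |e^z|. Unlike a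
bound by e^{|z|}, this involves only the real part of z, so multiplying by the Gaussian still leaves
a Gaussian even where ξ³ is large. -/
lemma norm_exp_sub_one_le (z : ℂ) : ‖Complex.exp z - 1‖ ≤ ‖z‖ * (1 + ‖Complex.exp z‖) := by
  have hd : ∀ t ∈ Icc (0 : ℝ) 1, HasDerivWithinAt (fun t : ℝ => Complex.exp (t * z))
      (Complex.exp (t * z) * z) (Icc 0 1) t := by
    intro t _
    have := (((Complex.ofRealCLM.hasDerivAt (x := t)).mul_const z).cexp).hasDerivWithinAt
      (s := Icc (0 : ℝ) 1)
    simpa using this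
  have := norm_image_sub_le_of_norm_deriv_le_segment_01' (C := ‖z‖ * (1 + ‖Complex.exp z‖)) hd
    (fun t ht => ?_)
  · simpa using this
  · rw [norm_mul, mul_comm]
    gcongr
    rw [Complex.norm_exp, Complex.norm_exp, Complex.re_ofReal_mul]
    rcases le_total 0 z.re with h | h
    · have : Real.exp (t * z.re) ≤ Real.exp z.re := Real.exp_le_exp.2 (by nlinarith [ht.2])
      linarith
    · have : Real.exp (t * z.re) ≤ 1 := Real.exp_le_one_iff.2 (by nlinarith [ht.1])
      linarith [Real.exp_pos z.re]

/-- The Gaussian factor alone. -/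
noncomputable def gaussExp (I ξ : ℂ) : ℂ := Complex.exp (-(I * ξ ^ 2 / 2))

lemma norm_gaussExp_le {I : ℂ} {y η : ℝ} (hη : 0 ≤ η) (hηp : η ≤ I.re / 4)
    (hq : |I.im| ≤ I.re / 2) :
    ‖gaussExp I (y + ((-η : ℝ) : ℂ) * Complex.I)‖
      ≤ Real.exp (I.re * η ^ 2) * Real.exp (-(I.re / 4) * y ^ 2) := by
  have h2 : ((y : ℂ) + ((-η : ℝ) : ℂ) * Complex.I) ^ 2
      = ((y ^ 2 - η ^ 2 : ℝ) : ℂ) + ((-(2 * y * η) : ℝ) : ℂ) * Complex.I := by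
    push_cast
    linear_combination (η : ℂ) ^ 2 * Complex.I_sq
  have e1 : -(I * (((y ^ 2 - η ^ 2 : ℝ) : ℂ) + ((-(2 * y * η) : ℝ) : ℂ) * Complex.I) / 2)
      = ((-(1 / 2) : ℝ) : ℂ) *
        (I * (((y ^ 2 - η ^ 2 : ℝ) : ℂ) + ((-(2 * y * η) : ℝ) : ℂ) * Complex.I)) := by
    push_cast; ring
  rw [gaussExp, Complex.norm_exp, h2, e1, ← Real.exp_add, Complex.re_ofReal_mul]
  refine Real.exp_le_exp.2 ?_
  have := gaussian_exponent_le (l := 1) (p := I.re) (q := I.im) (y := y) hη hηp hq 0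
    (by positivity)
  simp only [Complex.mul_re, Complex.add_re, Complex.ofReal_re, Complex.ofReal_im, Complex.I_re,
    Complex.I_im, Complex.add_im, Complex.mul_im]
  simp only [Nat.cast_one] at this
  linarith

lemma integrable_inv_pow_mul_gaussExp {I : ℂ} {η : ℝ} (hη : 0 < η) (hηp : η ≤ I.re / 4)
    (hq : |I.im| ≤ I.re / 2) (n : ℕ) :
    Integrable fun y : ℝ => (((y : ℂ) + ((-η : ℝ) : ℂ) * Complex.I) ^ n)⁻¹
      * gaussExp I (y + ((-η : ℝ) : ℂ) * Complex.I) := by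
  have hp : 0 < I.re := by linarith
  refine ((integrable_exp_neg_mul_sq (b := I.re / 4) (by positivity)).const_mul
    ((η ^ n)⁻¹ * Real.exp (I.re * η ^ 2))).mono' ?_ (Eventually.of_forall fun y => ?_)
  · refine Continuous.aestronglyMeasurable ?_
    unfold gaussExp
    refine Continuous.mul (Continuous.inv₀ (by fun_prop) fun y => ?_) (by fun_prop)
    exact pow_ne_zero _ (line_ne_zero hη)
  · rw [norm_mul, norm_inv, norm_pow, mul_assoc]
    have := norm_line_ge y η hη.le
    gcongr
    exact norm_gaussExp_le hη.le hηp hq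

/-- Integration by parts lowers the order of the pole by two, with the factor −I/(n + 1). Two steps
reach the plain Gaussian integral, with the factor (−I/3)(−I) = I²/3. -/
lemma integral_inv_pow_mul_gaussExp {I : ℂ} {η : ℝ} (hη : 0 < η) (hηp : η ≤ I.re / 4)
    (hq : |I.im| ≤ I.re / 2) :
    ∫ y : ℝ, (((y : ℂ) + ((-η : ℝ) : ℂ) * Complex.I) ^ 4)⁻¹
      * gaussExp I (y + ((-η : ℝ) : ℂ) * Complex.I)
      = I ^ 2 / 3 * (2 * Real.pi / I) ^ (1 / 2 : ℂ) := by
  have hp : 0 < I.re := by linarith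
  have hI0 : I ≠ 0 := by
    rintro rfl
    simp at hp
  have hg := GaussianFourier.integral_cexp_neg_mul_sq_add_real_mul_I (b := I / 2)
    (by simpa using hp) (-η)
  have hint := fun n => integrable_inv_pow_mul_gaussExp hη hηp hq n
  have hξ : ∀ y : ℝ, (y : ℂ) + ((-η : ℝ) : ℂ) * Complex.I ≠ 0 := fun y => line_ne_zero hη
  have hdξ : ∀ y : ℝ, HasDerivAt (fun y : ℝ => (y : ℂ) + ((-η : ℝ) : ℂ) * Complex.I) 1 y :=
    fun y => (Complex.ofRealCLM.hasDerivAt (x := y)).add_const _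
  obtain ⟨ξ, hξe⟩ : ∃ ξ : ℝ → ℂ, ∀ y : ℝ, (y : ℂ) + ((-η : ℝ) : ℂ) * Complex.I = ξ y :=
    ⟨_, fun y => rfl⟩
  simp only [hξe] at hg hint hξ hdξ ⊢
  have hdg : ∀ y, HasDerivAt (fun y => gaussExp I (ξ y)) (gaussExp I (ξ y) * (-(I * ξ y))) y := by
    intro y
    have := ((((hdξ y).pow 2).const_mul I).div_const 2).neg.cexp
    refine this.congr_deriv ?_
    simp only [gaussExp, Pi.pow_apply, Pi.neg_apply]
    push_cast
    ring
  have hrec : ∀ n : ℕ, ∫ y : ℝ, ((ξ y) ^ (n + 2))⁻¹ * gaussExp I (ξ y)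
      = -(I / (n + 1)) * ∫ y : ℝ, ((ξ y) ^ n)⁻¹ * gaussExp I (ξ y) := by
    intro n
    have hd : ∀ y, HasDerivAt (fun y => ((ξ y) ^ (n + 1))⁻¹ * gaussExp I (ξ y))
        (-(n + 1 : ℂ) * (((ξ y) ^ (n + 2))⁻¹ * gaussExp I (ξ y))
          + (-I) * (((ξ y) ^ n)⁻¹ * gaussExp I (ξ y))) y := by
      intro y
      have := (((hdξ y).pow (n + 1)).inv (pow_ne_zero _ (hξ y))).mul (hdg y)
      refine this.congr_deriv ?_
      have := hξ y
      simp only [Pi.pow_apply, Pi.inv_apply]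
      push_cast
      field_simp
      ring_nf
    have h0 := integral_eq_zero_of_hasDerivAt_of_integrable hd
      (((hint (n + 2)).const_mul _).add ((hint n).const_mul _)) (hint (n + 1))
    rw [integral_add ((hint (n + 2)).const_mul _) ((hint n).const_mul _), integral_const_mul,
      integral_const_mul] at h0
    have hn : (n + 1 : ℂ) ≠ 0 := by exact_mod_cast Nat.succ_ne_zero n
    rw [neg_mul, div_mul_eq_mul_div, ← neg_div, eq_div_iff hn]
    linear_combination -h0
  have h2 := hrec 2
  have h0 := hrec 0
  have hg' : ∫ y : ℝ, ((ξ y) ^ 0)⁻¹ * gaussExp I (ξ y) = (2 * Real.pi / I) ^ (1 / 2 : ℂ) := by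
    rw [show (2 * Real.pi / I : ℂ) = Real.pi / (I / 2) by field_simp, ← hg]
    refine integral_congr_ae (Eventually.of_forall fun y => ?_)
    simp only [pow_zero, inv_one, one_mul, gaussExp]
    congr 1
    ring
  rw [zero_add] at h0
  rw [show (4 : ℕ) = 2 + 2 from rfl, h2, h0, hg']
  push_cast
  ring

lemma saddleKernel_two_zero (I ξ : ℂ) : saddleKernel 2 0 1 I ξ
    = (ξ ^ 4)⁻¹ * gaussExp I ξ * Complex.exp (Complex.I * ξ ^ 3 / 6) := by
  simp only [saddleKernel, saddleExp, gaussExp, mul_assoc, ← Complex.exp_add]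
  norm_num

/-- Replacing exp(iξ³/6) by 1 costs |ξ|³/6, which reduces the pole of order four to a simple one. On
the line at height −(Re I)^{−1/2} this is at most a multiple of (Re I)^{1/2}, compensated by the
width of the Gaussian, so the error is bounded. -/
lemma norm_saddleIntegral_two_zero_sub_le {I : ℂ} (hI : 4 ≤ I.re) (hq : |I.im| ≤ I.re / 2) :
    ‖saddleIntegral 2 0 1 I - I ^ 2 / 3 * (2 * Real.pi / I) ^ (1 / 2 : ℂ)‖ ≤ 4 := by
  have hp : 0 < I.re := by linarith
  have hη1 := sqrt_inv_le_one (p := I.re) (by linarith)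
  have hη0 : 0 < (√I.re)⁻¹ := by positivity
  have hsq : (√I.re)⁻¹ ^ 2 = I.re⁻¹ := by rw [inv_pow, Real.sq_sqrt hp.le]
  set η := (√I.re)⁻¹ with hη
  have hηp : η ≤ I.re / 4 := by linarith
  rw [saddleIntegral_eq_line le_rfl hI hq hη0 hη1, ← integral_inv_pow_mul_gaussExp hη0 hηp hq]
  have hint : Integrable fun y : ℝ =>
      saddleKernel 2 0 1 I (y + ((-η : ℝ) : ℂ) * Complex.I) := by
    refine ((integrable_exp_neg_mul_sq (b := ((1 : ℕ) : ℝ) * I.re / 4)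
      (by simp; positivity)).const_mul _).mono'
      (continuous_saddleKernel_line hη0 (by linarith)).aestronglyMeasurable
      (Eventually.of_forall fun y => norm_saddleKernel_le hη0 hηp hq)
  rw [← integral_sub hint (integrable_inv_pow_mul_gaussExp hη0 hηp hq 4)]
  have h : ∀ y : ℝ, ‖saddleKernel 2 0 1 I (y + ((-η : ℝ) : ℂ) * Complex.I)
      - (((y : ℂ) + ((-η : ℝ) : ℂ) * Complex.I) ^ 4)⁻¹
        * gaussExp I (y + ((-η : ℝ) : ℂ) * Complex.I)‖
      ≤ Real.exp 1 * (3 * η)⁻¹ * Real.exp (-(I.re / 4) * y ^ 2) := by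
    intro y
    have hg := norm_gaussExp_le (y := y) hη0.le hηp hq
    have hs := norm_saddleExp_le (l := 1) (y := y) hη0.le hηp hq
    have hse : saddleExp 1 I (y + ((-η : ℝ) : ℂ) * Complex.I)
        = gaussExp I (y + ((-η : ℝ) : ℂ) * Complex.I)
          * Complex.exp (Complex.I * (y + ((-η : ℝ) : ℂ) * Complex.I) ^ 3 / 6) := by
      simp only [saddleExp, gaussExp, ← Complex.exp_add]
      norm_num
    rw [hse, norm_mul] at hs
    simp only [Nat.cast_one, one_mul] at hs
    rw [hsq, mul_inv_cancel₀ hp.ne'] at hg hs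
    set ξ := (y : ℂ) + ((-η : ℝ) : ℂ) * Complex.I with hξ
    have hn : η ≤ ‖ξ‖ := norm_line_ge y η hη0.le
    have hξ0 : 0 < ‖ξ‖ := hη0.trans_le hn
    rw [saddleKernel_two_zero,
      show (ξ ^ 4)⁻¹ * gaussExp I ξ * Complex.exp (Complex.I * ξ ^ 3 / 6)
        - (ξ ^ 4)⁻¹ * gaussExp I ξ
        = (ξ ^ 4)⁻¹ * gaussExp I ξ * (Complex.exp (Complex.I * ξ ^ 3 / 6) - 1) by ring]
    rw [norm_mul, norm_mul, norm_inv, norm_pow]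
    calc (‖ξ‖ ^ 4)⁻¹ * ‖gaussExp I ξ‖ * ‖Complex.exp (Complex.I * ξ ^ 3 / 6) - 1‖
        ≤ (‖ξ‖ ^ 4)⁻¹ * ‖gaussExp I ξ‖ * (‖Complex.I * ξ ^ 3 / 6‖
            * (1 + ‖Complex.exp (Complex.I * ξ ^ 3 / 6)‖)) := by
          gcongr
          exact norm_exp_sub_one_le _
      _ = (6 * ‖ξ‖)⁻¹ * (‖gaussExp I ξ‖
            + ‖gaussExp I ξ‖ * ‖Complex.exp (Complex.I * ξ ^ 3 / 6)‖) := by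
          rw [norm_div, norm_mul, Complex.norm_I, norm_pow]
          simp only [Complex.norm_ofNat]
          field_simp
      _ ≤ (6 * η)⁻¹ * (Real.exp 1 * Real.exp (-(I.re / 4) * y ^ 2)
            + Real.exp 1 * Real.exp (-(I.re / 4) * y ^ 2)) := by gcongr
      _ = _ := by
          field_simp
          ring
  refine (norm_integral_le_of_gaussian (by positivity) h).trans ?_
  calc _ ≤ Real.exp 1 * (3 * η)⁻¹ * (4 * η) := by
        gcongr
        exact sqrt_gaussian hp
    _ = Real.exp 1 * (4 / 3) := by field_simp
    _ ≤ 4 := by linarith [Real.exp_one_lt_d9]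

/-- At the saddle the regular factor (ξ + 2iI)^{−2} equals −1/(4I²), and its variation contains a
factor ξ of relative size 1/I, which also removes one power of the pole. This reduces the integral
to the one with k = 0, whose main term I²/3 becomes −1/12. -/
lemma norm_saddleIntegral_two_one_sub_le {I : ℂ} (hI : 4 ≤ I.re) (hq : |I.im| ≤ I.re / 2) :
    ‖saddleIntegral 2 1 1 I + 1 / 12 * (2 * Real.pi / I) ^ (1 / 2 : ℂ)‖ ≤ 13 * (I.re ^ 2)⁻¹ := by
  have hp : 0 < I.re := by linarith
  have hη1 := sqrt_inv_le_one (p := I.re) (by linarith)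
  have hη0 : 0 < (√I.re)⁻¹ := by positivity
  have hsq : (√I.re)⁻¹ ^ 2 = I.re⁻¹ := by rw [inv_pow, Real.sq_sqrt hp.le]
  have hI0 : I ≠ 0 := by
    rintro rfl
    simp at hp
  have hIn : I.re ≤ ‖I‖ := Complex.re_le_norm I
  have hA := norm_saddleIntegral_two_zero_sub_le hI hq
  set η := (√I.re)⁻¹ with hη
  have hηp : η ≤ I.re / 4 := by linarith
  have hint : ∀ k, Integrable fun y : ℝ =>
      saddleKernel 2 k 1 I (y + ((-η : ℝ) : ℂ) * Complex.I) := by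
    intro k
    refine ((integrable_exp_neg_mul_sq (b := ((1 : ℕ) : ℝ) * I.re / 4)
      (by simp; positivity)).const_mul _).mono'
      (continuous_saddleKernel_line hη0 (by linarith)).aestronglyMeasurable
      (Eventually.of_forall fun y => norm_saddleKernel_le hη0 hηp hq)
  have hB : ‖saddleIntegral 2 1 1 I - (-(4 * I ^ 2)⁻¹) * saddleIntegral 2 0 1 I‖
      ≤ 12 * (I.re ^ 2)⁻¹ := by
    rw [saddleIntegral_eq_line le_rfl hI hq hη0 hη1, saddleIntegral_eq_line le_rfl hI hq hη0 hη1,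
      ← integral_const_mul, ← integral_sub (hint 1) ((hint 0).const_mul _)]
    have h : ∀ y : ℝ, ‖saddleKernel 2 1 1 I (y + ((-η : ℝ) : ℂ) * Complex.I)
        - (-(4 * I ^ 2)⁻¹) * saddleKernel 2 0 1 I (y + ((-η : ℝ) : ℂ) * Complex.I)‖
        ≤ Real.exp 1 * (η ^ 3)⁻¹ * (I.re ^ 3)⁻¹ * Real.exp (-(I.re / 4) * y ^ 2) := by
      intro y
      have hs := norm_saddleExp_le (l := 1) (y := y) hη0.le hηp hq
      simp only [Nat.cast_one, one_mul] at hs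
      rw [hsq, mul_inv_cancel₀ hp.ne'] at hs
      have h2 := norm_line_add_ge (I := I) (y := y) (η := η) (by linarith)
      have hne2 := line_add_ne_zero (I := I) (y := y) (η := η) hη0 (by linarith)
      have hne := line_ne_zero (y := y) hη0
      have hn : η ≤ ‖(y : ℂ) + ((-η : ℝ) : ℂ) * Complex.I‖ := norm_line_ge y η hη0.le
      set ξ := (y : ℂ) + ((-η : ℝ) : ℂ) * Complex.I with hξ
      set ω := ξ + 2 * Complex.I * I with hω
      have key : saddleKernel 2 1 1 I ξ - (-(4 * I ^ 2)⁻¹) * saddleKernel 2 0 1 I ξ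
          = (ξ ^ 3)⁻¹ * saddleExp 1 I ξ * ((4 * I ^ 2 * ω)⁻¹ + Complex.I * (2 * I * ω ^ 2)⁻¹) := by
        simp only [saddleKernel, ← hω]
        have hω2 : ω ^ 2 = ξ ^ 2 + 4 * Complex.I * I * ξ - 4 * I ^ 2 := by
          rw [hω]
          linear_combination 4 * I ^ 2 * Complex.I_sq
        have : ω ^ 2 + 4 * I ^ 2 = ξ * (ω + 2 * Complex.I * I) := by
          rw [hω2, hω]; ring
        have e1 : (ξ ^ (2 * 2))⁻¹ * (ω ^ (2 * 1))⁻¹ * saddleExp 1 I ξ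
            - (-(4 * I ^ 2)⁻¹) * ((ξ ^ (2 * 2))⁻¹ * (ω ^ (2 * 0))⁻¹ * saddleExp 1 I ξ)
            = saddleExp 1 I ξ * (ξ ^ 4)⁻¹ * (ω ^ 2 + 4 * I ^ 2) * (4 * I ^ 2 * ω ^ 2)⁻¹ := by
          clear_value ω ξ
          field_simp
          ring
        rw [e1, this]
        clear_value ω ξ
        field_simp
        ring
      rw [key, norm_mul, norm_mul, norm_inv, norm_pow]
      have hω0 : 0 < ‖ω‖ := hp.trans_le h2
      have hb : ‖(4 * I ^ 2 * ω)⁻¹ + Complex.I * (2 * I * ω ^ 2)⁻¹‖ ≤ (I.re ^ 3)⁻¹ := by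
        refine (norm_add_le _ _).trans ?_
        simp only [norm_mul, norm_inv, norm_pow, Complex.norm_I, Complex.norm_ofNat, one_mul]
        calc (4 * ‖I‖ ^ 2 * ‖ω‖)⁻¹ + (2 * ‖I‖ * ‖ω‖ ^ 2)⁻¹
            ≤ (4 * I.re ^ 2 * I.re)⁻¹ + (2 * I.re * I.re ^ 2)⁻¹ := by gcongr
          _ = (3 / 4) * (I.re ^ 3)⁻¹ := by
              field_simp
              norm_num
          _ ≤ (I.re ^ 3)⁻¹ := by
              have : 0 < (I.re ^ 3)⁻¹ := by positivity
              linarith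
      calc _ ≤ (η ^ 3)⁻¹ * (Real.exp 1 * Real.exp (-(I.re / 4) * y ^ 2)) * (I.re ^ 3)⁻¹ := by
            gcongr
        _ = _ := by ring
    refine (norm_integral_le_of_gaussian (by positivity) h).trans ?_
    calc _ ≤ Real.exp 1 * (η ^ 3)⁻¹ * (I.re ^ 3)⁻¹ * (4 * η) := by
          gcongr
          exact sqrt_gaussian hp
      _ = Real.exp 1 * 4 * (η ^ 2)⁻¹ * (I.re ^ 3)⁻¹ := by field_simp
      _ = Real.exp 1 * 4 * (I.re ^ 2)⁻¹ := by
          rw [hsq]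
          field_simp
      _ ≤ 12 * (I.re ^ 2)⁻¹ := by
          gcongr
          linarith [Real.exp_one_lt_d9]
  have hdecomp : saddleIntegral 2 1 1 I + 1 / 12 * (2 * Real.pi / I) ^ (1 / 2 : ℂ)
      = (saddleIntegral 2 1 1 I - (-(4 * I ^ 2)⁻¹) * saddleIntegral 2 0 1 I)
        + (-(4 * I ^ 2)⁻¹) * (saddleIntegral 2 0 1 I
          - I ^ 2 / 3 * (2 * Real.pi / I) ^ (1 / 2 : ℂ)) := by
    have : (4 * I ^ 2)⁻¹ * (I ^ 2 / 3) = (1 / 12 : ℂ) := by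
      field_simp
      norm_num
    linear_combination (-(2 * Real.pi / I) ^ (1 / 2 : ℂ)) * this
  rw [hdecomp]
  refine (norm_add_le _ _).trans ?_
  have h4 : ‖(-(4 * I ^ 2)⁻¹) * (saddleIntegral 2 0 1 I
      - I ^ 2 / 3 * (2 * Real.pi / I) ^ (1 / 2 : ℂ))‖ ≤ 1 * (I.re ^ 2)⁻¹ := by
    rw [norm_mul, norm_neg, norm_inv, norm_mul, norm_pow, Complex.norm_ofNat]
    calc _ ≤ (4 * I.re ^ 2)⁻¹ * 4 := by gcongr
      _ = _ := by field_simp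
  linarith

/-! ## Fourier coefficients of the Keplerian motion -/

lemma cpow_half_sq (z : ℂ) : (z ^ (1 / 2 : ℂ)) ^ 2 = z := by
  simp

lemma cpow_half_re_pos {z : ℂ} (hz : z ∈ Complex.slitPlane) : 0 < (z ^ (1 / 2 : ℂ)).re := by
  rw [Complex.cpow_def_of_ne_zero (Complex.slitPlane_ne_zero hz), Complex.exp_re]
  refine mul_pos (Real.exp_pos _) (Real.cos_pos_of_mem_Ioo ?_)
  have h1 := Complex.neg_pi_lt_arg z
  have h2 := Complex.arg_le_pi z
  have h3 := Complex.mem_slitPlane_iff_arg.1 hz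
  have : (Complex.log z * (1 / 2)).im = Complex.arg z / 2 := by
    rw [show Complex.log z * (1 / 2) = Complex.log z * ((1 / 2 : ℝ) : ℂ) by push_cast; ring,
      Complex.im_mul_ofReal, Complex.log_im]
    ring
  rw [this]
  have h4 : Complex.arg z < Real.pi := lt_of_le_of_ne h2 h3.1
  constructor <;> linarith

/-- `√(1 - ε²)`. -/
noncomputable def eccRoot (ε : ℂ) : ℂ := (1 - ε ^ 2) ^ (1 / 2 : ℂ)

/-- The Laurent polynomial of the orbit: the position of the reduced primary is `ζ v(1/ζ)`, where
`ζ = exp (i E)` and `E` is the eccentric anomaly. -/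
noncomputable def orbitPoly (ε u : ℂ) : ℂ :=
  (1 + eccRoot ε) / 2 - ε * u + (1 - eccRoot ε) / 2 * u ^ 2

/-- The integrand of the Fourier coefficients, in the variable `ζ = exp (i E)`. -/
noncomputable def keplerKernel (j k : ℕ) (l : ℤ) (ε ζ : ℂ) : ℂ :=
  orbitPoly ε ζ⁻¹ ^ j * orbitPoly ε ζ ^ k * ζ ^ ((j : ℤ) - k - l)
    * Complex.exp (l * ε * (ζ - ζ⁻¹) / 2) * (1 - ε * (ζ + ζ⁻¹) / 2)

/-- The Fourier coefficient of order `l` of `w ^ j * conj w ^ k`, for the Keplerian motion `w`. -/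
noncomputable def keplerCoeff (j k : ℕ) (l : ℤ) (ε : ℂ) : ℂ :=
  Real.circleAverage (keplerKernel j k l ε) 0 1

lemma one_sub_sq_mem_slitPlane {ε : ℂ} (h : ‖ε‖ < 1) : 1 - ε ^ 2 ∈ Complex.slitPlane := by
  left
  have : ‖ε ^ 2‖ < 1 := by
    rw [norm_pow]
    exact pow_lt_one₀ (norm_nonneg _) h two_ne_zero
  have := Complex.re_le_norm (ε ^ 2)
  simp only [Complex.sub_re, Complex.one_re]
  linarith

lemma eccRoot_sq (ε : ℂ) : eccRoot ε ^ 2 = 1 - ε ^ 2 := cpow_half_sq _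

lemma norm_one_add_eccRoot_ge {ε : ℂ} (h : ‖ε‖ < 1) : 1 ≤ ‖1 + eccRoot ε‖ := by
  have h1 := cpow_half_re_pos (one_sub_sq_mem_slitPlane h)
  have h2 := Complex.re_le_norm (1 + eccRoot ε)
  simp only [Complex.add_re, Complex.one_re, eccRoot] at h2 ⊢
  linarith

/-- The product of 1 − √(1 − ε²) and 1 + √(1 − ε²) is ε², and the second factor has modulus at least
1 because the principal root has positive real part. -/
lemma norm_one_sub_eccRoot_le {ε : ℂ} (h : ‖ε‖ < 1) : ‖1 - eccRoot ε‖ ≤ ‖ε‖ ^ 2 := by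
  have h1 := norm_one_add_eccRoot_ge h
  have h2 : (1 - eccRoot ε) * (1 + eccRoot ε) = ε ^ 2 := by
    linear_combination -eccRoot_sq ε
  calc ‖1 - eccRoot ε‖ ≤ ‖1 - eccRoot ε‖ * ‖1 + eccRoot ε‖ :=
        le_mul_of_one_le_right (norm_nonneg _) h1
    _ = ‖ε‖ ^ 2 := by rw [← norm_mul, h2, norm_pow]

lemma differentiableOn_eccRoot : DifferentiableOn ℂ eccRoot (Metric.ball 0 1) := by
  intro ε hε
  have := one_sub_sq_mem_slitPlane (mem_ball_zero_iff.1 hε)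
  have hd : DifferentiableAt ℂ (fun ε : ℂ => 1 - ε ^ 2) ε := by fun_prop
  exact (hd.cpow_const this).differentiableWithinAt

/-- The coefficients of u and u² are of orders ε and ε², so the polynomial stays bounded on the
large disc |u| ≤ 1/|ε|. This allows the contour to be moved as far as the radii |ε| and 1/|ε|. -/
lemma norm_orbitPoly_le {ε u : ℂ} (h : ‖ε‖ < 1) (hu : ‖ε‖ * ‖u‖ ≤ 1) :
    ‖orbitPoly ε u‖ ≤ 4 := by
  have h1 := norm_one_sub_eccRoot_le h
  have h2 : ‖(1 + eccRoot ε) / 2‖ ≤ 3 / 2 := by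
    rw [show (1 + eccRoot ε) / 2 = 1 - (1 - eccRoot ε) / 2 by ring]
    refine (norm_sub_le _ _).trans ?_
    rw [norm_one, norm_div, Complex.norm_ofNat]
    nlinarith [norm_nonneg ε]
  have h3 : ‖(1 - eccRoot ε) / 2 * u ^ 2‖ ≤ 1 / 2 := by
    rw [norm_mul, norm_div, norm_pow, Complex.norm_ofNat]
    have : ‖ε‖ ^ 2 * ‖u‖ ^ 2 ≤ 1 := by
      rw [← mul_pow]
      exact pow_le_one₀ (by positivity) hu
    have := mul_le_mul_of_nonneg_right h1 (sq_nonneg ‖u‖)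
    linarith
  have h4 : ‖ε * u‖ ≤ 1 := by rwa [norm_mul]
  calc ‖orbitPoly ε u‖ ≤ ‖(1 + eccRoot ε) / 2‖ + ‖ε * u‖ + ‖(1 - eccRoot ε) / 2 * u ^ 2‖ :=
        (norm_add_le _ _).trans (by gcongr; exact norm_sub_le _ _)
    _ ≤ 4 := by linarith

/-- On the annulus X ≤ |ζ| ≤ 1/X both εζ and ε/ζ have modulus at most 1, so every factor except the
monomial is bounded independently of X. -/
lemma norm_keplerKernel_le {j k : ℕ} {l : ℤ} {ε ζ : ℂ} {X : ℝ} (hX : 0 < X) (hX1 : X < 1)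
    (hε : ‖ε‖ ≤ X) (h1 : X ≤ ‖ζ‖) (h2 : ‖ζ‖ ≤ X⁻¹) :
    ‖keplerKernel j k l ε ζ‖
      ≤ 2 * 4 ^ (j + k) * Real.exp l.natAbs * ‖ζ‖ ^ ((j : ℤ) - k - l) := by
  have hζ : 0 < ‖ζ‖ := hX.trans_le h1
  have hε1 : ‖ε‖ < 1 := hε.trans_lt hX1
  have a1 : ‖ε‖ * ‖ζ‖ ≤ 1 := by
    calc ‖ε‖ * ‖ζ‖ ≤ X * X⁻¹ := by gcongr
      _ = 1 := mul_inv_cancel₀ hX.ne'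
  have a2 : ‖ε‖ * ‖ζ⁻¹‖ ≤ 1 := by
    rw [norm_inv, ← div_eq_mul_inv, div_le_one hζ]
    exact hε.trans h1
  have b1 : ‖Complex.exp (l * ε * (ζ - ζ⁻¹) / 2)‖ ≤ Real.exp l.natAbs := by
    rw [Complex.norm_exp]
    refine Real.exp_le_exp.2 ((Complex.re_le_norm _).trans ?_)
    rw [norm_div, norm_mul, norm_mul, Complex.norm_ofNat, Complex.norm_intCast, Nat.cast_natAbs,
      Int.cast_abs]
    have : ‖ε‖ * ‖ζ - ζ⁻¹‖ ≤ 2 := by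
      calc ‖ε‖ * ‖ζ - ζ⁻¹‖ ≤ ‖ε‖ * (‖ζ‖ + ‖ζ⁻¹‖) := by gcongr; exact norm_sub_le _ _
        _ ≤ 2 := by linarith
    have := mul_le_mul_of_nonneg_left this (abs_nonneg (l : ℝ))
    linarith
  have b2 : ‖1 - ε * (ζ + ζ⁻¹) / 2‖ ≤ 2 := by
    refine (norm_sub_le _ _).trans ?_
    rw [norm_one, norm_div, norm_mul, Complex.norm_ofNat]
    have : ‖ε‖ * ‖ζ + ζ⁻¹‖ ≤ 2 := by
      calc ‖ε‖ * ‖ζ + ζ⁻¹‖ ≤ ‖ε‖ * (‖ζ‖ + ‖ζ⁻¹‖) := by gcongr; exact norm_add_le _ _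
        _ ≤ 2 := by linarith
    linarith
  rw [keplerKernel, norm_mul, norm_mul, norm_mul, norm_mul, norm_pow, norm_pow, norm_zpow]
  calc _ ≤ 4 ^ j * 4 ^ k * ‖ζ‖ ^ ((j : ℤ) - k - l) * Real.exp l.natAbs * 2 := by
        gcongr
        · exact norm_orbitPoly_le hε1 a2
        · exact norm_orbitPoly_le hε1 a1
    _ = _ := by ring

lemma differentiableAt_keplerKernel {j k : ℕ} {l : ℤ} {ε ζ : ℂ} (hζ : ζ ≠ 0) :
    DifferentiableAt ℂ (keplerKernel j k l ε) ζ := by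
  unfold keplerKernel orbitPoly
  have : DifferentiableAt ℂ (fun ζ : ℂ => ζ ^ ((j : ℤ) - k - l)) ζ :=
    differentiableAt_zpow.2 (Or.inl hζ)
  fun_prop (disch := assumption)

lemma circleAverage_eq_of_differentiableAt {f : ℂ → ℂ} (hf : ∀ z, z ≠ 0 → DifferentiableAt ℂ f z)
    {r R : ℝ} (hr : 0 < r) (hrR : r ≤ R) :
    Real.circleAverage f 0 R = Real.circleAverage f 0 r := by
  rw [Real.circleAverage_eq_circleIntegral (hr.trans_le hrR).ne',
    Real.circleAverage_eq_circleIntegral hr.ne']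
  congr 1
  refine Complex.circleIntegral_sub_center_inv_smul_eq_of_differentiable_on_annulus_off_countable
    hr hrR countable_empty (fun z hz => ?_) (fun z hz => ?_)
  · refine (hf z ?_).continuousAt.continuousWithinAt
    rintro rfl
    exact hz.2 (Metric.mem_ball_self hr)
  · refine hf z ?_
    rintro rfl
    exact hz.1.2 (Metric.mem_closedBall_self hr.le)

lemma keplerCoeff_eq_circleAverage (j k : ℕ) (l : ℤ) (ε : ℂ) {R : ℝ} (hR : 0 < R) :
    keplerCoeff j k l ε = Real.circleAverage (keplerKernel j k l ε) 0 R := by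
  have hf : ∀ z, z ≠ 0 → DifferentiableAt ℂ (keplerKernel j k l ε) z :=
    fun z hz => differentiableAt_keplerKernel hz
  rcases le_total 1 R with h | h
  · exact (circleAverage_eq_of_differentiableAt hf one_pos h).symm
  · exact circleAverage_eq_of_differentiableAt hf hR h

lemma norm_circleAverage_le {f : ℂ → ℂ} {R C : ℝ}
    (h : ∀ z, ‖z‖ = |R| → ‖f z‖ ≤ C) : ‖Real.circleAverage f 0 R‖ ≤ C := by
  rw [Real.circleAverage_def, norm_smul, Real.norm_eq_abs,
    abs_of_pos (by positivity : (0 : ℝ) < (2 * Real.pi)⁻¹)]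
  have : ‖∫ θ in (0 : ℝ)..2 * Real.pi, f (circleMap 0 R θ)‖ ≤ C * |2 * Real.pi - 0| :=
    intervalIntegral.norm_integral_le_of_norm_le_const fun θ _ => h _ (by simp)
  rw [sub_zero, abs_of_pos (by positivity : (0 : ℝ) < 2 * Real.pi)] at this
  rw [inv_mul_le_iff₀ (by positivity)]
  linarith

/-- The basic bound of the Fourier coefficients. -/
lemma norm_keplerCoeff_le {j k : ℕ} {l : ℤ} {ε : ℂ} {X : ℝ} (hX : 0 < X) (hX1 : X < 1)
    (hε : ‖ε‖ ≤ X) :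
    ‖keplerCoeff j k l ε‖
      ≤ 2 * 4 ^ (j + k) * Real.exp l.natAbs * X ^ ((j : ℤ) - k - l).natAbs := by
  have hXX : X ≤ X⁻¹ := hX1.le.trans (one_le_inv₀ hX |>.2 hX1.le)
  -- The sign of the exponent of the monomial decides between the radii X and 1/X; in both cases the
  -- monomial has size X to the power |j − k − l|.
  rcases le_total 0 ((j : ℤ) - k - l) with hm | hm
  · rw [keplerCoeff_eq_circleAverage j k l ε hX]
    refine norm_circleAverage_le fun z hz => ?_
    rw [abs_of_pos hX] at hz
    refine (norm_keplerKernel_le hX hX1 hε hz.ge (hz.le.trans hXX)).trans (le_of_eq ?_)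
    rw [hz, ← zpow_natCast X, Int.natAbs_of_nonneg hm]
  · rw [keplerCoeff_eq_circleAverage j k l ε (inv_pos.2 hX)]
    refine norm_circleAverage_le fun z hz => ?_
    rw [abs_of_pos (inv_pos.2 hX)] at hz
    refine (norm_keplerKernel_le hX hX1 hε (hXX.trans hz.ge) hz.le).trans (le_of_eq ?_)
    rw [hz, ← zpow_natCast X, Int.ofNat_natAbs_of_nonpos hm, inv_zpow']

lemma differentiableOn_keplerCoeff (j k : ℕ) (l : ℤ) :
    DifferentiableOn ℂ (keplerCoeff j k l) (Metric.ball 0 (1 / 2)) := by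
  have h0 : ∀ θ : ℝ, circleMap 0 1 θ ≠ 0 := fun θ => circleMap_ne_center one_ne_zero
  have h1 : ∀ θ : ℝ, ‖circleMap 0 1 θ‖ = 1 := fun θ => by simp
  have : keplerCoeff j k l = fun ε => (2 * Real.pi)⁻¹ •
      ∫ θ, keplerKernel j k l ε (circleMap 0 1 θ) ∂(volume.restrict (Ioc 0 (2 * Real.pi))) := by
    funext ε
    rw [keplerCoeff, Real.circleAverage_def,
      intervalIntegral.integral_of_le (by positivity : (0 : ℝ) ≤ 2 * Real.pi)]
  rw [this]
  have key := differentiableOn_integral_of_bound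
    (ν := volume.restrict (Ioc (0 : ℝ) (2 * Real.pi))) (U := Metric.ball (0 : ℂ) (1 / 2))
    (f := fun ε θ => keplerKernel j k l ε (circleMap 0 1 θ)) Metric.isOpen_ball (fun θ => ?_)
    (fun ε _ => ?_) (bound := fun _ => 2 * 4 ^ (j + k) * Real.exp l.natAbs)
    (integrable_const _) (fun ε hε θ => ?_)
  · exact key.const_smul ((2 * Real.pi)⁻¹ : ℝ)
  · have he : DifferentiableOn ℂ eccRoot (Metric.ball 0 (1 / 2)) :=
      differentiableOn_eccRoot.mono (Metric.ball_subset_ball (by norm_num))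
    unfold keplerKernel orbitPoly
    fun_prop
  · refine Continuous.aestronglyMeasurable (continuous_iff_continuousAt.2 fun θ => ?_)
    exact ContinuousAt.comp (f := fun θ : ℝ => circleMap 0 1 θ)
      (differentiableAt_keplerKernel (h0 θ)).continuousAt (continuous_circleMap 0 1).continuousAt
  · have hε' : ‖ε‖ ≤ 1 / 2 := (mem_ball_zero_iff.1 hε).le
    have := norm_keplerKernel_le (j := j) (k := k) (l := l) (ζ := circleMap 0 1 θ)
      (by norm_num : (0 : ℝ) < 1 / 2) (by norm_num) hε' (by rw [h1]; norm_num)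
      (by rw [h1]; norm_num)
    simpa only [h1, one_zpow, mul_one] using this

/-- The substitution ζ ↦ 1/ζ, that is E ↦ −E, exchanges the two orbit polynomials and preserves the
mean over the circle. -/
lemma keplerCoeff_neg (j k : ℕ) (l : ℤ) (ε : ℂ) :
    keplerCoeff j k (-l) ε = keplerCoeff k j l ε := by
  rw [keplerCoeff, keplerCoeff, ← Real.circleAverage_zero_one_congr_inv]
  refine Real.circleAverage_congr_sphere fun z hz => ?_
  have : z ≠ 0 := by
    rintro rfl
    simp at hz
  simp only [keplerKernel, inv_inv, Int.cast_neg, inv_zpow']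
  rw [show -((j : ℤ) - k - -l) = (k : ℤ) - j - l by ring,
    show -(l : ℂ) * ε * (z⁻¹ - z) / 2 = l * ε * (z - z⁻¹) / 2 by ring, add_comm z⁻¹ z]
  ring

/-! ### Special coefficients -/

lemma circleIntegrable_entire {g : ℂ → ℂ} (hg : Differentiable ℂ g) :
    CircleIntegrable g 0 1 := hg.continuous.continuousOn.circleIntegrable zero_le_one

lemma circleAverage_entire {g : ℂ → ℂ} (hg : Differentiable ℂ g) :
    Real.circleAverage g 0 1 = g 0 := by
  rw [Real.circleAverage_eq_circleIntegral one_ne_zero]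
  have := (hg.diffContOnCl (s := Metric.ball 0 1)).two_pi_i_inv_smul_circleIntegral_sub_inv_smul
    (w := 0) (R := 1) (c := 0) (by simp)
  exact this

/-- The mean over the unit circle of the sum of an entire function of `z` and an entire function
of `z⁻¹`. -/
lemma circleAverage_laurent {f g h : ℂ → ℂ} (hg : Differentiable ℂ g) (hh : Differentiable ℂ h)
    (hf : ∀ z, ‖z‖ = 1 → f z = g z + h z⁻¹) :
    Real.circleAverage f 0 1 = g 0 + h 0 := by
  have hh' : CircleIntegrable (fun z => h z⁻¹) 0 1 := by
    refine ContinuousOn.circleIntegrable zero_le_one ?_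
    refine hh.continuous.comp_continuousOn (continuousOn_id.inv₀ fun z hz => ?_)
    rintro rfl
    simp at hz
  rw [Real.circleAverage_congr_sphere (f₂ := fun z => g z + h z⁻¹)
    (fun z hz => hf z (by simpa using hz)),
    Real.circleAverage_fun_add (circleIntegrable_entire hg) hh', circleAverage_entire hg,
    Real.circleAverage_zero_one_congr_inv (f := h), circleAverage_entire hh]

/-- For real ε on the unit circle this is |w|² = (1 − ε cos E)², in Laurent form. -/
lemma orbitPoly_inv_mul (ε : ℂ) {z : ℂ} (hz : z ≠ 0) :
    orbitPoly ε z⁻¹ * orbitPoly ε z = (1 - ε * (z + z⁻¹) / 2) ^ 2 := by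
  have := eccRoot_sq ε
  simp only [orbitPoly]
  field_simp
  linear_combination (-(z ^ 4) + 2 * z ^ 2 - 1) * this

lemma ne_zero_of_norm_one {z : ℂ} (hz : ‖z‖ = 1) : z ≠ 0 := by
  rintro rfl
  simp at hz

lemma keplerCoeff_one_one_zero (ε : ℂ) : keplerCoeff 1 1 0 ε = 1 + 3 / 2 * ε ^ 2 := by
  rw [keplerCoeff, circleAverage_laurent
    (g := fun z => 1 + 3 / 2 * ε ^ 2 - (3 * ε / 2 + 3 * ε ^ 3 / 8) * z
      + 3 * ε ^ 2 / 4 * z ^ 2 - ε ^ 3 / 8 * z ^ 3)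
    (h := fun z => - (3 * ε / 2 + 3 * ε ^ 3 / 8) * z
      + 3 * ε ^ 2 / 4 * z ^ 2 - ε ^ 3 / 8 * z ^ 3) (by fun_prop) (by fun_prop)]
  · simp
  · intro z hz
    have hz0 := ne_zero_of_norm_one hz
    simp only [keplerKernel, pow_one, orbitPoly_inv_mul ε hz0]
    simp only [Nat.cast_one, sub_self, zpow_zero, Int.cast_zero, zero_mul, zero_div,
      Complex.exp_zero]
    field_simp
    ring

/-- A conjugate pair of factors combines into (1 − ε cos E)², leaving an explicit Laurent
polynomial. The split into its non-negative and its negative powers exhibits the mean as the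
constant term. -/
lemma keplerCoeff_two_one_zero (ε : ℂ) :
    keplerCoeff 2 1 0 ε = -(5 / 2) * ε - 15 / 8 * ε ^ 3 := by
  set a : ℂ := (1 + eccRoot ε) / 2 with ha
  set b : ℂ := (1 - eccRoot ε) / 2 with hb
  have hab : b = 1 - a := by rw [ha, hb]; ring
  rw [keplerCoeff, circleAverage_laurent
    (g := fun z => (-(5 / 2) * ε - 15 / 8 * ε ^ 3)
      + (a * (1 + 3 / 2 * ε ^ 2) + ε * (3 * ε / 2 + 3 * ε ^ 3 / 8) + b * (3 * ε ^ 2 / 4)) * z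
      + (-a * (3 * ε / 2 + 3 * ε ^ 3 / 8) - ε * (3 * ε ^ 2 / 4) - b * (ε ^ 3 / 8)) * z ^ 2
      + (a * (3 * ε ^ 2 / 4) + ε * (ε ^ 3 / 8)) * z ^ 3 - a * (ε ^ 3 / 8) * z ^ 4)
    (h := fun z =>
      (b * (1 + 3 / 2 * ε ^ 2) + ε * (3 * ε / 2 + 3 * ε ^ 3 / 8) + a * (3 * ε ^ 2 / 4)) * z
      + (-b * (3 * ε / 2 + 3 * ε ^ 3 / 8) - ε * (3 * ε ^ 2 / 4) - a * (ε ^ 3 / 8)) * z ^ 2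
      + (b * (3 * ε ^ 2 / 4) + ε * (ε ^ 3 / 8)) * z ^ 3 - b * (ε ^ 3 / 8) * z ^ 4)
    (by fun_prop) (by fun_prop)]
  · simp
  · intro z hz
    have hz0 := ne_zero_of_norm_one hz
    have e1 : orbitPoly ε z⁻¹ ^ 2 * orbitPoly ε z ^ 1
        = orbitPoly ε z⁻¹ * (1 - ε * (z + z⁻¹) / 2) ^ 2 := by
      rw [← orbitPoly_inv_mul ε hz0]; ring
    simp only [keplerKernel, e1]
    rw [show ((2 : ℕ) : ℤ) - ((1 : ℕ) : ℤ) - 0 = 1 by norm_num]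
    simp only [zpow_one, Int.cast_zero, zero_mul, zero_div, Complex.exp_zero, orbitPoly, ← ha, ← hb]
    rw [hab]
    clear_value a
    field_simp
    ring

/-- `f = 1 + ε f₁ + O(ε²)` uniformly on the unit circle. -/
def FirstOrder (f f₁ : ℂ → ℂ → ℂ) : Prop :=
  ∃ C D : ℝ, 0 ≤ C ∧ 0 ≤ D ∧ ∀ ε ζ : ℂ, ‖ε‖ ≤ 1 / 2 → ‖ζ‖ = 1 →
    ‖f ε ζ - (1 + ε * f₁ ε ζ)‖ ≤ C * ‖ε‖ ^ 2 ∧ ‖f₁ ε ζ‖ ≤ D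

lemma FirstOrder.mul {f f₁ g g₁ : ℂ → ℂ → ℂ} (hf : FirstOrder f f₁) (hg : FirstOrder g g₁) :
    FirstOrder (fun ε ζ => f ε ζ * g ε ζ) (fun ε ζ => f₁ ε ζ + g₁ ε ζ) := by
  obtain ⟨C, D, hC, hD, h⟩ := hf
  obtain ⟨C', D', hC', hD', h'⟩ := hg
  refine ⟨C * (1 + D' + C') + (1 + D) * C' + D * D', D + D', by positivity, by positivity,
    fun ε ζ hε hζ => ?_⟩
  obtain ⟨h1, h2⟩ := h ε ζ hε hζ
  obtain ⟨h3, h4⟩ := h' ε ζ hε hζ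
  refine ⟨?_, (norm_add_le _ _).trans (by gcongr)⟩
  have hlin : ∀ {x : ℂ} {B : ℝ}, ‖x‖ ≤ B → ‖1 + ε * x‖ ≤ 1 + B := by
    intro x B hx
    refine (norm_add_le _ _).trans ?_
    rw [norm_one, norm_mul]
    have : ‖ε‖ * ‖x‖ ≤ 1 * B := by
      gcongr
      linarith
    linarith
  have hε2 : ‖ε‖ ^ 2 ≤ 1 := pow_le_one₀ (norm_nonneg _) (by linarith)
  have hg : ‖g ε ζ‖ ≤ 1 + D' + C' := by
    calc ‖g ε ζ‖ = ‖(g ε ζ - (1 + ε * g₁ ε ζ)) + (1 + ε * g₁ ε ζ)‖ := by ring_nf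
      _ ≤ C' * ‖ε‖ ^ 2 + (1 + D') := (norm_add_le _ _).trans (add_le_add h3 (hlin h4))
      _ ≤ C' * 1 + (1 + D') := by gcongr
      _ = _ := by ring
  calc ‖f ε ζ * g ε ζ - (1 + ε * (f₁ ε ζ + g₁ ε ζ))‖
      = ‖(f ε ζ - (1 + ε * f₁ ε ζ)) * g ε ζ
          + (1 + ε * f₁ ε ζ) * (g ε ζ - (1 + ε * g₁ ε ζ)) + ε ^ 2 * (f₁ ε ζ * g₁ ε ζ)‖ := by
        congr 1; ring
    _ ≤ C * ‖ε‖ ^ 2 * (1 + D' + C') + (1 + D) * (C' * ‖ε‖ ^ 2) + ‖ε‖ ^ 2 * (D * D') := by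
        refine norm_add₃_le.trans ?_
        simp only [norm_mul, norm_pow]
        gcongr
        exact hlin h2
    _ = _ := by ring

lemma firstOrder_orbitPoly_inv :
    FirstOrder (fun ε ζ => orbitPoly ε ζ⁻¹) (fun _ ζ => -ζ⁻¹) := by
  refine ⟨1, 1, zero_le_one, zero_le_one, fun ε ζ hε hζ => ⟨?_, by simp [hζ]⟩⟩
  have h := norm_one_sub_eccRoot_le (ε := ε) (by linarith)
  rw [show orbitPoly ε ζ⁻¹ - (1 + ε * -ζ⁻¹) = (1 - eccRoot ε) * ((ζ⁻¹ ^ 2 - 1) / 2) by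
    rw [orbitPoly]; ring, norm_mul, mul_comm 1, mul_one]
  refine (mul_le_of_le_one_right (norm_nonneg _) ?_).trans h
  rw [norm_div, Complex.norm_ofNat, div_le_one two_pos]
  refine (norm_sub_le _ _).trans ?_
  simp only [norm_pow, norm_inv, hζ, norm_one]
  norm_num

lemma firstOrder_orbitPoly :
    FirstOrder (fun ε ζ => orbitPoly ε ζ) (fun _ ζ => -ζ) := by
  obtain ⟨C, D, hC, hD, h⟩ := firstOrder_orbitPoly_inv
  refine ⟨C, D, hC, hD, fun ε ζ hε hζ => ?_⟩
  simpa using h ε ζ⁻¹ hε (by simp [hζ])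

lemma firstOrder_exp :
    FirstOrder (fun ε ζ => Complex.exp (ε * (ζ - ζ⁻¹) / 2)) (fun _ ζ => (ζ - ζ⁻¹) / 2) := by
  have hn : ∀ ζ : ℂ, ‖ζ‖ = 1 → ‖(ζ - ζ⁻¹) / 2‖ ≤ 1 := by
    intro ζ hζ
    rw [norm_div, Complex.norm_ofNat, div_le_one two_pos]
    refine (norm_sub_le _ _).trans ?_
    rw [norm_inv, hζ]
    norm_num
  refine ⟨1, 1, zero_le_one, zero_le_one, fun ε ζ hε hζ => ⟨?_, hn ζ hζ⟩⟩
  have h1 : ‖ε * ((ζ - ζ⁻¹) / 2)‖ ≤ ‖ε‖ := by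
    rw [norm_mul]
    exact mul_le_of_le_one_right (norm_nonneg _) (hn ζ hζ)
  have := Complex.norm_exp_sub_one_sub_id_le (x := ε * ((ζ - ζ⁻¹) / 2)) (by linarith)
  simp only [mul_div_assoc, one_mul, ← sub_sub]
  exact this.trans (by gcongr)

lemma firstOrder_dist :
    FirstOrder (fun ε ζ => 1 - ε * (ζ + ζ⁻¹) / 2) (fun _ ζ => -((ζ + ζ⁻¹) / 2)) := by
  refine ⟨0, 1, le_rfl, zero_le_one, fun ε ζ hε hζ => ⟨?_, ?_⟩⟩
  · rw [show 1 - ε * (ζ + ζ⁻¹) / 2 - (1 + ε * -((ζ + ζ⁻¹) / 2)) = 0 by ring]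
    simp
  · rw [norm_neg, norm_div, Complex.norm_ofNat, div_le_one two_pos]
    refine (norm_add_le _ _).trans ?_
    rw [norm_inv, hζ]
    norm_num

lemma FirstOrder.norm_circleAverage_sub_le {f f₁ : ℂ → ℂ → ℂ} (hf : FirstOrder f f₁) {n : ℤ}
    (hc : ∀ ε, CircleIntegrable (fun ζ => f ε ζ * ζ ^ n) 0 1)
    (hc₁ : ∀ ε, CircleIntegrable (fun ζ => (1 + ε * f₁ ε ζ) * ζ ^ n) 0 1) :
    ∃ C : ℝ, 0 ≤ C ∧ ∀ ε : ℂ, ‖ε‖ ≤ 1 / 2 → ‖Real.circleAverage (fun ζ => f ε ζ * ζ ^ n) 0 1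
      - Real.circleAverage (fun ζ => (1 + ε * f₁ ε ζ) * ζ ^ n) 0 1‖ ≤ C * ‖ε‖ ^ 2 := by
  obtain ⟨C, D, hC, hD, h⟩ := hf
  refine ⟨C, hC, fun ε hε => ?_⟩
  rw [← Real.circleAverage_fun_sub (hc ε) (hc₁ ε)]
  refine norm_circleAverage_le fun ζ hζ => ?_
  rw [abs_one] at hζ
  rw [← sub_mul, norm_mul, norm_zpow, hζ, one_zpow, mul_one]
  exact (h ε ζ hε hζ).1

lemma circleIntegrable_of_continuousAt {f : ℂ → ℂ} (h : ∀ z, z ≠ 0 → ContinuousAt f z) :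
    CircleIntegrable f 0 1 := by
  refine ContinuousOn.circleIntegrable zero_le_one fun z hz => ?_
  refine (h z ?_).continuousWithinAt
  rintro rfl
  simp at hz

/-- Here j − k − l = 0, so the coefficient is 1 at ε = 0. The first-order term of the integrand is
−ζ − 3/ζ, which has mean zero. -/
lemma keplerCoeff_two_one_one :
    ∃ C : ℝ, 0 ≤ C ∧ ∀ ε : ℂ, ‖ε‖ ≤ 1 / 2 → ‖keplerCoeff 2 1 1 ε - 1‖ ≤ C * ‖ε‖ ^ 2 := by
  have h := ((((firstOrder_orbitPoly_inv.mul firstOrder_orbitPoly_inv).mul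
    firstOrder_orbitPoly).mul firstOrder_exp).mul firstOrder_dist).norm_circleAverage_sub_le
    (n := 0) (fun ε => ?_) (fun ε => ?_)
  · obtain ⟨C, hC, h⟩ := h
    refine ⟨C, hC, fun ε hε => ?_⟩
    convert h ε hε using 3
    · refine Real.circleAverage_congr_sphere fun z _ => ?_
      have e : ((2 : ℕ) : ℤ) - ((1 : ℕ) : ℤ) - 1 = 0 := by norm_num
      simp only [keplerKernel, e, zpow_zero, Int.cast_one, one_mul]
      ring
    · symm
      refine (circleAverage_laurent (g := fun z => 1 - ε * z) (h := fun z => -3 * ε * z)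
        (by fun_prop) (by fun_prop) fun z _ => ?_).trans ?_
      · simp only [zpow_zero]
        ring
      · simp
  · refine circleIntegrable_of_continuousAt fun z hz => ?_
    simp only [orbitPoly, zpow_zero]
    fun_prop (disch := assumption)
  · refine circleIntegrable_of_continuousAt fun z hz => ?_
    simp only [zpow_zero]
    fun_prop (disch := assumption)

/-- Here j − k − l = 1. After multiplication by the monomial ζ, the first-order part of the
integrand reduces to the constant −3ε. -/
lemma keplerCoeff_two_zero_one :
    ∃ C : ℝ, 0 ≤ C ∧ ∀ ε : ℂ, ‖ε‖ ≤ 1 / 2 → ‖keplerCoeff 2 0 1 ε + 3 * ε‖ ≤ C * ‖ε‖ ^ 2 := by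
  have h := (((firstOrder_orbitPoly_inv.mul firstOrder_orbitPoly_inv).mul
    firstOrder_exp).mul firstOrder_dist).norm_circleAverage_sub_le
    (n := 1) (fun ε => ?_) (fun ε => ?_)
  · obtain ⟨C, hC, h⟩ := h
    refine ⟨C, hC, fun ε hε => ?_⟩
    have e1 : Real.circleAverage (fun z : ℂ => (1 + ε * (-z⁻¹ + -z⁻¹ + (z - z⁻¹) / 2
        + -((z + z⁻¹) / 2))) * z ^ (1 : ℤ)) 0 1 = -3 * ε := by
      refine (circleAverage_laurent (g := fun z => z - 3 * ε) (h := fun _ => 0)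
        (by fun_prop) (by fun_prop) (fun z hz => ?_)).trans (by simp)
      have := ne_zero_of_norm_one hz
      simp only [zpow_one]
      field_simp
      ring
    have h2 := h ε hε
    rw [e1, neg_mul, sub_neg_eq_add] at h2
    convert h2 using 3
    refine Real.circleAverage_congr_sphere fun z _ => ?_
    have e : ((2 : ℕ) : ℤ) - ((0 : ℕ) : ℤ) - 1 = 1 := by norm_num
    simp only [keplerKernel, e, zpow_one, Int.cast_one, one_mul, pow_zero, mul_one]
    ring
  · refine circleIntegrable_of_continuousAt fun z hz => ?_
    simp only [orbitPoly, zpow_one]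
    fun_prop (disch := assumption)
  · refine circleIntegrable_of_continuousAt fun z hz => ?_
    simp only [zpow_one]
    fun_prop (disch := assumption)

/-! ## The eccentric anomaly -/

/-- The true anomaly as a function of the eccentric anomaly. -/
noncomputable def eccAngle (ε E : ℝ) : ℝ :=
  ∫ x in (0 : ℝ)..E, √(1 - ε ^ 2) / (1 - ε * Real.cos x)

/-- Kepler's equation. -/
noncomputable def eccTime (ε E : ℝ) : ℝ := E - ε * Real.sin E

/-- The relative position of the primaries. -/
noncomputable def relPos (ε t : ℝ) : ℂ :=
  (primaryDist ε t : ℂ) * Complex.exp ((trueAnomaly ε t : ℂ) * Complex.I)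

lemma one_sub_mul_cos_pos {ε : ℝ} (h0 : 0 ≤ ε) (h1 : ε < 1) (θ : ℝ) :
    0 < 1 - ε * Real.cos θ := by
  nlinarith [Real.cos_le_one θ]

lemma hasDerivAt_eccAngle {ε : ℝ} (h0 : 0 ≤ ε) (h1 : ε < 1) (E : ℝ) :
    HasDerivAt (eccAngle ε) (√(1 - ε ^ 2) / (1 - ε * Real.cos E)) E := by
  have hc : Continuous fun x : ℝ => √(1 - ε ^ 2) / (1 - ε * Real.cos x) :=
    Continuous.div (by fun_prop) (by fun_prop) fun x => (one_sub_mul_cos_pos h0 h1 x).ne'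
  exact intervalIntegral.integral_hasDerivAt_right (hc.intervalIntegrable _ _)
    (hc.stronglyMeasurableAtFilter _ _) hc.continuousAt

lemma hasDerivAt_eccTime (ε E : ℝ) :
    HasDerivAt (eccTime ε) (1 - ε * Real.cos E) E :=
  (hasDerivAt_id' E).sub ((Real.hasDerivAt_sin E).const_mul ε)

/-- The normalised left side divided by the exponential has zero derivative and equals 1 at E = 0.
As the angle is defined by an integral, no branch of a half-angle formula has to be chosen. -/
lemma ecc_orbit {ε : ℝ} (h0 : 0 ≤ ε) (h1 : ε < 1) (E : ℝ) :
    ((Real.cos E - ε : ℝ) : ℂ) + ((√(1 - ε ^ 2) * Real.sin E : ℝ) : ℂ) * Complex.I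
      = ((1 - ε * Real.cos E : ℝ) : ℂ) * Complex.exp ((eccAngle ε E : ℂ) * Complex.I) := by
  have hs : √(1 - ε ^ 2) ^ 2 = 1 - ε ^ 2 := Real.sq_sqrt (by nlinarith)
  set s := √(1 - ε ^ 2) with hs_def
  let g : ℝ → ℂ := fun E => (((Real.cos E - ε : ℝ) : ℂ) + ((s * Real.sin E : ℝ) : ℂ) * Complex.I)
    / ((1 - ε * Real.cos E : ℝ) : ℂ) * Complex.exp (-((eccAngle ε E : ℂ) * Complex.I))
  have hne : ∀ x : ℝ, ((1 - ε * Real.cos x : ℝ) : ℂ) ≠ 0 := fun x => by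
    exact_mod_cast (one_sub_mul_cos_pos h0 h1 x).ne'
  have hg : ∀ x, HasDerivAt g 0 x := by
    intro x
    have d1 : HasDerivAt (fun x : ℝ => ((Real.cos x - ε : ℝ) : ℂ)) ((-Real.sin x : ℝ) : ℂ) x :=
      ((Real.hasDerivAt_cos x).sub_const ε).ofReal_comp
    have d2 : HasDerivAt (fun x : ℝ => ((s * Real.sin x : ℝ) : ℂ)) ((s * Real.cos x : ℝ) : ℂ) x :=
      ((Real.hasDerivAt_sin x).const_mul s).ofReal_comp
    have d3 : HasDerivAt (fun x : ℝ => ((1 - ε * Real.cos x : ℝ) : ℂ))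
        ((-(ε * -Real.sin x) : ℝ) : ℂ) x :=
      (((Real.hasDerivAt_cos x).const_mul ε).const_sub 1).ofReal_comp
    have d4 := ((((hasDerivAt_eccAngle h0 h1 x).ofReal_comp).mul_const Complex.I).neg).cexp
    have := ((d1.add (d2.mul_const Complex.I)).div d3 (hne x)).mul d4
    refine this.congr_deriv ?_
    have hcs : (Real.sin x : ℂ) ^ 2 = 1 - (Real.cos x : ℂ) ^ 2 := by
      exact_mod_cast Real.sin_sq x
    have hsc : (s : ℂ) ^ 2 = 1 - (ε : ℂ) ^ 2 := by exact_mod_cast hs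
    have hx := hne x
    simp only [Pi.add_apply, Pi.div_apply, Pi.neg_apply, ← hs_def]
    push_cast at hx ⊢
    rw [← Complex.ofReal_cos, ← Complex.ofReal_sin] at *
    generalize (Real.cos x : ℂ) = C at *
    generalize (Real.sin x : ℂ) = S at *
    generalize (s : ℂ) = s' at *
    generalize Complex.exp (-((eccAngle ε x : ℂ) * Complex.I)) = e
    have e1 : (-S + s' * C * Complex.I) * (1 - ε * C) - (C - ε + s' * S * Complex.I) * (ε * S)
        = (C - ε + s' * S * Complex.I) * s' * Complex.I := by
      linear_combination (-s' * ε * Complex.I) * hcs - S * s' ^ 2 * Complex.I_sq + S * hsc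
    generalize 1 - (ε : ℂ) * C = D at hx e1 ⊢
    field_simp
    linear_combination e * e1
  have hconst : ∀ x, g x = g 0 := fun x =>
    is_const_of_deriv_eq_zero (fun y => (hg y).differentiableAt) (fun y => (hg y).deriv) x 0
  have h0' : g 0 = 1 := by
    have : (1 - ε : ℂ) ≠ 0 := by exact_mod_cast (by linarith : (1 - ε : ℝ) ≠ 0)
    simp [g, eccAngle, this]
  have hE := (hconst E).trans h0'
  have hx := hne E
  simp only [g, Complex.exp_neg] at hE
  have hexp := Complex.exp_ne_zero ((eccAngle ε E : ℂ) * Complex.I)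
  rw [mul_inv_eq_one₀ hexp, div_eq_iff hx] at hE
  rw [hE, mul_comm]

lemma ecc_cos {ε : ℝ} (h0 : 0 ≤ ε) (h1 : ε < 1) (E : ℝ) :
    (1 - ε * Real.cos E) * (1 + ε * Real.cos (eccAngle ε E)) = 1 - ε ^ 2 := by
  have := congrArg Complex.re (ecc_orbit h0 h1 E)
  rw [Complex.exp_mul_I, ← Complex.ofReal_cos, ← Complex.ofReal_sin] at this
  simp only [Complex.add_re, Complex.ofReal_re, Complex.re_ofReal_mul, add_zero,
    Complex.mul_I_re, Complex.ofReal_im, neg_zero] at this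
  linear_combination -ε * this

/-- Both sides vanish at E = 0 and have the same derivative: the relation (1 − ε cos E)(1 + ε cos f)
= 1 − ε² reduces the product of the two rates to 1 − ε cos E. -/
lemma anomalyTime_eccAngle {ε : ℝ} (h0 : 0 ≤ ε) (h1 : ε < 1) (E : ℝ) :
    anomalyTime ε (eccAngle ε E) = eccTime ε E := by
  have h2 : 0 < 1 - ε ^ 2 := by nlinarith
  have hd : ∀ x, HasDerivAt (fun x => anomalyTime ε (eccAngle ε x) - eccTime ε x) 0 x := by
    intro x
    refine (((hasDerivAt_anomalyTime h0 h1 (eccAngle ε x)).comp x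
      (hasDerivAt_eccAngle h0 h1 x)).sub (hasDerivAt_eccTime ε x)).congr_deriv ?_
    have hp := one_sub_mul_cos_pos h0 h1 x
    have hq := one_add_mul_cos_pos h0 h1 (eccAngle ε x)
    have hm := ecc_cos h0 h1 x
    have hpow : (1 - ε ^ 2) ^ (3 / 2 : ℝ) = (1 - ε ^ 2) * √(1 - ε ^ 2) := by
      rw [show (3 / 2 : ℝ) = 1 + 1 / 2 by norm_num, Real.rpow_add h2, Real.rpow_one,
        Real.sqrt_eq_rpow]
    have hs : √(1 - ε ^ 2) ^ 2 = 1 - ε ^ 2 := Real.sq_sqrt h2.le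
    rw [hpow]
    set a := 1 - ε * Real.cos x
    set b := 1 + ε * Real.cos (eccAngle ε x)
    rw [sub_eq_zero, div_mul_div_comm, div_eq_iff (by positivity)]
    rw [show (1 - ε ^ 2) * √(1 - ε ^ 2) * √(1 - ε ^ 2) = (1 - ε ^ 2) * √(1 - ε ^ 2) ^ 2 by ring,
      hs, ← hm]
    ring
  have := is_const_of_deriv_eq_zero (fun y => (hd y).differentiableAt)
    (fun y => (hd y).deriv) E 0
  have hz : eccAngle ε 0 = 0 := by simp [eccAngle]
  simp only [hz, anomalyTime_zero] at this
  have hz' : eccTime ε 0 = 0 := by simp [eccTime]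
  linarith

lemma trueAnomaly_eccTime {ε : ℝ} (h0 : 0 ≤ ε) (h1 : ε < 1) (E : ℝ) :
    trueAnomaly ε (eccTime ε E) = eccAngle ε E := by
  rw [← anomalyTime_eccAngle h0 h1]
  exact Function.leftInverse_invFun (anomalyTime_strictMono h0 h1).injective _

lemma primaryDist_eccTime {ε : ℝ} (h0 : 0 ≤ ε) (h1 : ε < 1) (E : ℝ) :
    primaryDist ε (eccTime ε E) = 1 - ε * Real.cos E := by
  rw [primaryDist, trueAnomaly_eccTime h0 h1, ← ecc_cos h0 h1 E]
  exact mul_div_cancel_right₀ _ (one_add_mul_cos_pos h0 h1 _).ne'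

lemma relPos_eccTime {ε : ℝ} (h0 : 0 ≤ ε) (h1 : ε < 1) (E : ℝ) :
    relPos ε (eccTime ε E)
      = ((Real.cos E - ε : ℝ) : ℂ) + ((√(1 - ε ^ 2) * Real.sin E : ℝ) : ℂ) * Complex.I := by
  rw [relPos, primaryDist_eccTime h0 h1, trueAnomaly_eccTime h0 h1, ecc_orbit h0 h1]

lemma eccTime_surjective {ε : ℝ} : Function.Surjective (eccTime ε) := by
  have hb : ∀ x : ℝ, |ε * Real.sin x| ≤ |ε| := fun x => by
    rw [abs_mul]
    exact mul_le_of_le_one_right (abs_nonneg _) (Real.abs_sin_le_one x)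
  have hc : Continuous (eccTime ε) := by
    unfold eccTime
    fun_prop
  refine hc.surjective ?_ ?_
  · refine tendsto_atTop_mono (f := fun x => x - |ε|) (fun x => ?_)
      (tendsto_atTop_add_const_right _ _ tendsto_id)
    have := (abs_le.1 (hb x)).2
    simp only [eccTime]
    linarith
  · refine tendsto_atBot_mono (f := fun x => x + |ε|) (fun x => ?_)
      (tendsto_atBot_add_const_right _ _ tendsto_id)
    have := (abs_le.1 (hb x)).1
    simp only [eccTime]
    linarith

lemma eccTime_add_two_pi (ε E : ℝ) : eccTime ε (E + 2 * Real.pi) = eccTime ε E + 2 * Real.pi := by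
  simp only [eccTime, Real.sin_add_two_pi]
  ring

lemma relPos_periodic {ε : ℝ} (h0 : 0 ≤ ε) (h1 : ε < 1) :
    Function.Periodic (relPos ε) (2 * Real.pi) := by
  intro t
  obtain ⟨E, rfl⟩ := eccTime_surjective (ε := ε) t
  rw [← eccTime_add_two_pi, relPos_eccTime h0 h1, relPos_eccTime h0 h1, Real.cos_add_two_pi,
    Real.sin_add_two_pi]

lemma continuous_relPos {ε : ℝ} (h0 : 0 ≤ ε) (h1 : ε < 1) : Continuous (relPos ε) := by
  have hf : Continuous (trueAnomaly ε) :=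
    continuous_iff_continuousAt.2 fun t => (hasDerivAt_trueAnomaly h0 h1 t).continuousAt
  have hd : Continuous (primaryDist ε) :=
    Continuous.div (by fun_prop) (by fun_prop) fun t => (one_add_mul_cos_pos h0 h1 _).ne'
  unfold relPos
  fun_prop

lemma norm_relPos_le {ε : ℝ} (h0 : 0 ≤ ε) (h1 : ε < 1) (t : ℝ) : ‖relPos ε t‖ ≤ 2 := by
  obtain ⟨E, rfl⟩ := eccTime_surjective (ε := ε) t
  rw [relPos, norm_mul, Complex.norm_exp_ofReal_mul_I, mul_one, Complex.norm_real,
    primaryDist_eccTime h0 h1, Real.norm_eq_abs, abs_of_pos (one_sub_mul_cos_pos h0 h1 E)]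
  nlinarith [Real.neg_one_le_cos E]

lemma eccRoot_ofReal {ε : ℝ} (h0 : 0 ≤ ε) (h1 : ε < 1) : eccRoot (ε : ℂ) = (√(1 - ε ^ 2) : ℂ) := by
  rw [eccRoot, Real.sqrt_eq_rpow, Complex.ofReal_cpow (by nlinarith)]
  push_cast
  ring_nf

lemma relPos_eq_orbitPoly {ε : ℝ} (h0 : 0 ≤ ε) (h1 : ε < 1) (E : ℝ) :
    relPos ε (eccTime ε E) = Complex.exp (E * Complex.I)
      * orbitPoly ε (Complex.exp (E * Complex.I))⁻¹ := by
  have hne := Complex.exp_ne_zero (E * Complex.I)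
  have e1 : Complex.exp (E * Complex.I) = Real.cos E + Real.sin E * Complex.I := by
    rw [Complex.exp_mul_I, Complex.ofReal_cos, Complex.ofReal_sin]
  have e2 : (Complex.exp (E * Complex.I))⁻¹ = Real.cos E - Real.sin E * Complex.I := by
    rw [← Complex.exp_neg, ← neg_mul, Complex.exp_mul_I, Complex.cos_neg, Complex.sin_neg,
      Complex.ofReal_cos, Complex.ofReal_sin]
    ring
  have e3 : Complex.exp (E * Complex.I) * orbitPoly ε (Complex.exp (E * Complex.I))⁻¹
      = (1 + eccRoot ε) / 2 * Complex.exp (E * Complex.I) - ε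
        + (1 - eccRoot ε) / 2 * (Complex.exp (E * Complex.I))⁻¹ := by
    rw [orbitPoly]
    field_simp
  rw [e3, relPos_eccTime h0 h1, e2, e1, eccRoot_ofReal h0 h1]
  push_cast
  ring

lemma conj_relPos_eq_orbitPoly {ε : ℝ} (h0 : 0 ≤ ε) (h1 : ε < 1) (E : ℝ) :
    (starRingEnd ℂ) (relPos ε (eccTime ε E)) = (Complex.exp (E * Complex.I))⁻¹
      * orbitPoly ε (Complex.exp (E * Complex.I)) := by
  have hexp : (starRingEnd ℂ) (Complex.exp (E * Complex.I)) = (Complex.exp (E * Complex.I))⁻¹ := by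
    rw [← Complex.exp_conj, ← Complex.exp_neg]
    simp
  rw [relPos_eq_orbitPoly h0 h1, map_mul, hexp]
  congr 1
  rw [orbitPoly, orbitPoly, eccRoot_ofReal h0 h1]
  simp only [map_add, map_sub, map_mul, map_div₀, map_pow, map_one, Complex.conj_ofReal,
    map_ofNat, map_inv₀, hexp, inv_inv]

/-- The Fourier coefficients of the Keplerian motion as integrals over the period. -/
lemma keplerCoeff_eq_integral {ε : ℝ} (h0 : 0 ≤ ε) (h1 : ε < 1) (j k : ℕ) (l : ℤ) :
    keplerCoeff j k l ε = (2 * Real.pi)⁻¹ • ∫ t in (0 : ℝ)..2 * Real.pi,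
      relPos ε t ^ j * (starRingEnd ℂ) (relPos ε t) ^ k * Complex.exp (-(l * t * Complex.I)) := by
  set G : ℝ → ℂ := fun t =>
    relPos ε t ^ j * (starRingEnd ℂ) (relPos ε t) ^ k * Complex.exp (-(l * t * Complex.I)) with hG
  have hGc : Continuous G := by
    have h := continuous_relPos h0 h1
    have h' : Continuous fun t => (starRingEnd ℂ) (relPos ε t) := Complex.continuous_conj.comp h
    fun_prop
  -- Kepler's equation is used as the change of variable. Its Jacobian 1 − ε cos E is the last
  -- factor of the kernel, and exp(−ilt) produces the power ζ^{−l} together with the exponential of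
  -- lε(ζ − 1/ζ)/2.
  have hsub := intervalIntegral.integral_deriv_smul_comp (f := eccTime ε)
    (f' := fun E => 1 - ε * Real.cos E) (g := G) (a := 0) (b := 2 * Real.pi)
    (fun x _ => hasDerivAt_eccTime ε x) (by fun_prop) hGc
  have ha : eccTime ε 0 = 0 := by simp [eccTime]
  have hb : eccTime ε (2 * Real.pi) = 2 * Real.pi := by simp [eccTime]
  rw [ha, hb] at hsub
  rw [← hsub, keplerCoeff, Real.circleAverage_def]
  congr 1
  refine intervalIntegral.integral_congr fun E _ => ?_
  have hc : circleMap 0 1 E = Complex.exp (E * Complex.I) := by simp [circleMap]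
  have hne := Complex.exp_ne_zero (E * Complex.I)
  simp only [Function.comp, hG, hc, conj_relPos_eq_orbitPoly h0 h1, keplerKernel]
  rw [relPos_eq_orbitPoly h0 h1]
  have hcos : Complex.exp (E * Complex.I) + (Complex.exp (E * Complex.I))⁻¹
      = 2 * (Real.cos E : ℂ) := by
    rw [← Complex.exp_neg, Complex.ofReal_cos, Complex.cos]
    ring_nf
  have hsin : Complex.exp (E * Complex.I) - (Complex.exp (E * Complex.I))⁻¹
      = 2 * (Real.sin E : ℂ) * Complex.I := by
    rw [← Complex.exp_neg, Complex.ofReal_sin, Complex.sin, neg_mul]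
    linear_combination (Complex.exp (E * Complex.I) - Complex.exp (-(E * Complex.I)))
      * Complex.I_sq
  have hexp : Complex.exp (-(l * (eccTime ε E : ℝ) * Complex.I))
      = Complex.exp (E * Complex.I) ^ (-l) * Complex.exp (l * ε * (2 * (Real.sin E : ℂ)
        * Complex.I) / 2) := by
    rw [← Complex.exp_int_mul, ← Complex.exp_add]
    congr 1
    simp only [eccTime]
    push_cast
    ring
  rw [hexp, hsin, hcos, sub_eq_add_neg ((j : ℤ) - k) l, zpow_add₀ hne, zpow_sub₀ hne,
    zpow_natCast, zpow_natCast, mul_pow, mul_pow, Complex.real_smul]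
  generalize Complex.exp (E * Complex.I) = ζ at *
  generalize orbitPoly ε ζ⁻¹ = A
  simp only [inv_pow]
  push_cast
  field_simp

/-! ### Fourier series -/

lemma summable_pow_natAbs {r : ℝ} (h0 : 0 ≤ r) (h1 : r < 1) :
    Summable fun m : ℤ => r ^ m.natAbs := by
  refine Summable.of_nat_of_neg ?_ ?_
  · simpa using summable_geometric_of_lt_one h0 h1
  · simpa using summable_geometric_of_lt_one h0 h1

/-- Since |l| ≤ |q| + |q − l|, the growth e^{|l|} is absorbed, for fixed q, by replacing X with eX.
-/
lemma exp_natAbs_mul_pow_le {X : ℝ} (hX : 0 ≤ X) (q l : ℤ) :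
    Real.exp l.natAbs * X ^ (q - l).natAbs
      ≤ Real.exp q.natAbs * (Real.exp 1 * X) ^ (q - l).natAbs := by
  rw [mul_pow, ← mul_assoc, ← Real.exp_nat_mul, mul_one, ← Real.exp_add]
  gcongr
  have : l.natAbs ≤ q.natAbs + (q - l).natAbs := by omega
  exact_mod_cast this

lemma summable_norm_keplerCoeff {ε : ℂ} (hε0 : ε ≠ 0) (hε : ‖ε‖ < 1 / 4) (j k : ℕ) :
    Summable fun l : ℤ => ‖keplerCoeff j k l ε‖ := by
  have hX : 0 < ‖ε‖ := norm_pos_iff.2 hε0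
  have hr : Real.exp 1 * ‖ε‖ < 1 := by
    have := Real.exp_one_lt_d9
    nlinarith
  have hs := ((Equiv.subLeft ((j : ℤ) - k)).summable_iff (f := fun m : ℤ =>
    (Real.exp 1 * ‖ε‖) ^ m.natAbs)).2 (summable_pow_natAbs (by positivity) hr)
  refine Summable.of_nonneg_of_le (fun l => norm_nonneg _) (fun l => ?_)
    (hs.mul_left (2 * 4 ^ (j + k) * Real.exp ((j : ℤ) - k).natAbs))
  refine (norm_keplerCoeff_le hX (by linarith) le_rfl).trans ?_
  have := exp_natAbs_mul_pow_le hX.le ((j : ℤ) - k) l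
  simp only [Function.comp, Equiv.subLeft_apply]
  rw [mul_assoc, mul_assoc _ (Real.exp (((j : ℤ) - k).natAbs : ℝ))]
  gcongr

/-- The coefficients are summable, so the Fourier series of the continuous periodic function
converges to it at every point. The bound ε < 1/4 is what makes eε smaller than 1. -/
lemma hasSum_keplerCoeff {ε : ℝ} (h0 : 0 < ε) (h1 : ε < 1 / 4) (j k : ℕ) (t : ℝ) :
    HasSum (fun l : ℤ => keplerCoeff j k l ε * Complex.exp (l * t * Complex.I))
      (relPos ε t ^ j * (starRingEnd ℂ) (relPos ε t) ^ k) := by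
  have hlt : ε < 1 := by linarith
  have : Fact (0 < 2 * Real.pi) := ⟨by positivity⟩
  set h : ℝ → ℂ := fun t => relPos ε t ^ j * (starRingEnd ℂ) (relPos ε t) ^ k with hh
  have hper : Function.Periodic h (2 * Real.pi) := fun t => by
    simp only [hh, relPos_periodic h0.le hlt t]
  have hcont : Continuous h := by
    have h := continuous_relPos h0.le hlt
    have h' : Continuous fun t => (starRingEnd ℂ) (relPos ε t) := Complex.continuous_conj.comp h
    fun_prop
  let f : C(AddCircle (2 * Real.pi), ℂ) := ⟨hper.lift, continuous_coinduced_dom.mpr hcont⟩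
  have hcoeff : ∀ l : ℤ, fourierCoeff f l = keplerCoeff j k l ε := by
    intro l
    rw [fourierCoeff_eq_intervalIntegral _ _ 0, keplerCoeff_eq_integral h0.le hlt, zero_add,
      one_div]
    congr 1
    refine intervalIntegral.integral_congr fun x _ => ?_
    simp only [fourier_coe_apply, f, ContinuousMap.coe_mk, Function.Periodic.lift_coe, hh,
      smul_eq_mul]
    rw [mul_comm]
    congr 2
    have : (Real.pi : ℂ) ≠ 0 := by exact_mod_cast Real.pi_ne_zero
    push_cast
    field_simp
  have hsum : Summable (fourierCoeff f) := by
    have : fourierCoeff f = fun l => keplerCoeff j k l ε := funext hcoeff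
    rw [this]
    refine (summable_norm_keplerCoeff (by exact_mod_cast h0.ne') ?_ j k).of_norm
    simpa [abs_of_pos h0] using h1
  have := has_pointwise_sum_fourier_series_of_summable hsum (t : AddCircle (2 * Real.pi))
  simp only [hcoeff, fourier_coe_apply, smul_eq_mul] at this
  have hf : f (t : AddCircle (2 * Real.pi)) = h t := rfl
  rw [hf] at this
  convert this using 4 with l
  have : (Real.pi : ℂ) ≠ 0 := by exact_mod_cast Real.pi_ne_zero
  push_cast
  field_simp

/-! ## Expansion of the perturbative potential -/

/-- The coefficients of the power series of `(1 - z)^(-1/2)`. -/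
noncomputable def legCoef (j : ℕ) : ℝ := (-1) ^ j * Ring.choose (-(1 / 2) : ℝ) j

lemma legCoef_succ (n : ℕ) : (n + 1) * legCoef (n + 1) = (n + 1 / 2) * legCoef n := by
  have := Ring.choose_smul_choose (-(1 / 2) : ℝ) (Nat.le_succ n)
  rw [Nat.succ_sub (le_refl n), Nat.sub_self, Nat.choose_succ_self_right, Ring.choose_one_right,
    nsmul_eq_mul] at this
  simp only [legCoef, pow_succ]
  push_cast at this ⊢
  linear_combination (-((-1) ^ n)) * this

lemma legCoef_zero : legCoef 0 = 1 := by simp [legCoef]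

lemma legCoef_one : legCoef 1 = 1 / 2 := by
  have := legCoef_succ 0
  rw [legCoef_zero] at this
  norm_num at this
  linarith

lemma legCoef_two : legCoef 2 = 3 / 8 := by
  have := legCoef_succ 1
  rw [legCoef_one] at this
  norm_num at this
  linarith

lemma legCoef_mem (n : ℕ) : 0 ≤ legCoef n ∧ legCoef n ≤ 1 := by
  induction n with
  | zero => simp [legCoef_zero]
  | succ n ih =>
    have h := legCoef_succ n
    have hn : (0 : ℝ) < n + 1 := by positivity
    have e : legCoef (n + 1) = (n + 1 / 2) * legCoef n / (n + 1) := by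
      rw [eq_div_iff hn.ne', ← h, mul_comm]
    rw [e]
    constructor
    · have := ih.1
      positivity
    · rw [div_le_one hn]
      nlinarith [ih.1, ih.2]

lemma hasSum_of_eq {ι : Type*} {f g : ι → ℂ} {a : ℂ} (h : HasSum g a) (e : ∀ i, f i = g i) :
    HasSum f a := by
  rwa [show f = g from funext e]

lemma hasSum_legCoef {z : ℂ} (hz : ‖z‖ < 1) :
    HasSum (fun j : ℕ => (legCoef j : ℂ) * z ^ j) ((1 - z) ^ (-(1 / 2) : ℂ)) := by
  have h := Complex.one_add_cpow_hasFPowerSeriesOnBall_zero (a := (-(1 / 2) : ℂ))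
  have hy : -z ∈ Metric.eball (0 : ℂ) 1 := by
    rw [Metric.mem_eball, edist_zero_right, enorm_neg, ← ofReal_norm, ENNReal.ofReal_lt_one]
    exact hz
  have h2 := h.hasSum hy
  simp only [binomialSeries_apply, zero_add, List.ofFn_const, List.prod_replicate, smul_eq_mul] at h2
  rw [← sub_eq_add_neg] at h2
  refine hasSum_of_eq h2 fun j => ?_
  rw [neg_pow z, legCoef]
  push_cast
  ring

lemma norm_legCoef_mul_pow_le (z : ℂ) (j : ℕ) : ‖(legCoef j : ℂ) * z ^ j‖ ≤ ‖z‖ ^ j := by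
  obtain ⟨h0, h1⟩ := legCoef_mem j
  rw [norm_mul, Complex.norm_real, Real.norm_eq_abs, abs_of_nonneg h0, norm_pow]
  exact mul_le_of_le_one_left (by positivity) h1

lemma conj_one_sub_cpow {z : ℂ} (hz : ‖z‖ < 1) :
    (1 - (starRingEnd ℂ) z) ^ (-(1 / 2) : ℂ) = (starRingEnd ℂ) ((1 - z) ^ (-(1 / 2) : ℂ)) := by
  have hre : 0 < (1 - z).re := by
    have := Complex.re_le_norm z
    simp only [Complex.sub_re, Complex.one_re]
    linarith
  have h1 : (1 - z).arg ≠ Real.pi := (Complex.mem_slitPlane_iff_arg.1 (Or.inl hre)).1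
  have h2 := Complex.conj_cpow (1 - z) (-(1 / 2) : ℂ) h1
  have h3 : (starRingEnd ℂ) (-(1 / 2) : ℂ) = -(1 / 2) := by
    rw [map_neg, map_div₀, map_one, map_ofNat]
  rwa [map_sub, map_one, h3] at h2

lemma norm_one_sub_cpow_sq {z : ℂ} (hz : ‖z‖ < 1) :
    ‖(1 - z) ^ (-(1 / 2) : ℂ)‖ ^ 2 = 1 / ‖1 - z‖ := by
  have hne : 1 - z ≠ 0 := by
    intro h
    rw [sub_eq_zero] at h
    rw [← h, norm_one] at hz
    exact lt_irrefl _ hz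
  rw [← norm_pow, sq, ← Complex.cpow_add _ _ hne,
    show (-(1 / 2) + -(1 / 2) : ℂ) = -1 by ring, Complex.cpow_neg_one, norm_inv, one_div]

lemma summable_norm_legCoef {z : ℂ} (hz : ‖z‖ < 1) :
    Summable fun j : ℕ => ‖(legCoef j : ℂ) * z ^ j‖ :=
  Summable.of_nonneg_of_le (fun _ => norm_nonneg _) (norm_legCoef_mul_pow_le z)
    (summable_geometric_of_lt_one (norm_nonneg _) hz)

/-- The modulus is removed by writing 1/|1 − z| as (1 − z)^{−1/2} times its conjugate, which is a
Cauchy product of two binomial series. -/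
lemma hasSum_inv_norm {z : ℂ} (hz : ‖z‖ < 1) :
    HasSum (fun x : ℕ × ℕ => (legCoef x.1 : ℂ) * legCoef x.2 * z ^ x.1 * (starRingEnd ℂ) z ^ x.2)
      ((1 / ‖1 - z‖ : ℝ) : ℂ) := by
  have hz' : ‖(starRingEnd ℂ) z‖ < 1 := by
    rw [Complex.norm_conj]
    exact hz
  have hs : Summable fun x : ℕ × ℕ =>
      ((legCoef x.1 : ℂ) * z ^ x.1) * ((legCoef x.2 : ℂ) * (starRingEnd ℂ) z ^ x.2) :=
    summable_mul_of_summable_norm (f := fun j : ℕ => (legCoef j : ℂ) * z ^ j)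
      (g := fun j : ℕ => (legCoef j : ℂ) * (starRingEnd ℂ) z ^ j)
      (summable_norm_legCoef hz) (summable_norm_legCoef hz')
  have h := HasSum.mul (hasSum_legCoef hz) (hasSum_legCoef hz') hs
  rw [conj_one_sub_cpow hz, Complex.mul_conj, Complex.normSq_eq_norm_sq,
    norm_one_sub_cpow_sq hz] at h
  exact hasSum_of_eq h fun x => by ring

/-- The coefficients of the expansion of the perturbative potential. -/
noncomputable def potCoef (μ : ℝ) (j k : ℕ) : ℝ :=
  if j + k ≤ 1 then 0 else
    legCoef j * legCoef k * ((1 - μ) * μ ^ (j + k) + μ * (-(1 - μ)) ^ (j + k))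

lemma abs_potCoef_le {μ : ℝ} (h0 : 0 ≤ μ) (h1 : μ ≤ 1) (j k : ℕ) : |potCoef μ j k| ≤ 1 := by
  unfold potCoef
  split_ifs
  · simp
  · rw [abs_mul, abs_mul, abs_of_nonneg (legCoef_mem j).1, abs_of_nonneg (legCoef_mem k).1]
    have e : |(1 - μ) * μ ^ (j + k) + μ * (-(1 - μ)) ^ (j + k)| ≤ 1 := by
      refine (abs_add_le _ _).trans ?_
      rw [abs_mul, abs_mul, abs_pow, abs_pow, abs_neg, abs_of_nonneg h0,
        abs_of_nonneg (sub_nonneg.2 h1)]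
      have a1 : μ ^ (j + k) ≤ 1 := pow_le_one₀ h0 h1
      have a2 : (1 - μ) ^ (j + k) ≤ 1 := pow_le_one₀ (sub_nonneg.2 h1) (by linarith)
      nlinarith
    exact mul_le_one₀ (mul_le_one₀ (legCoef_mem j).2 (legCoef_mem k).1 (legCoef_mem k).2)
      (abs_nonneg _) e

lemma potCoef_eq_zero {μ : ℝ} {j k : ℕ} (h : j + k ≤ 1) : potCoef μ j k = 0 := if_pos h

/-- The two linear coefficients (1 − μ)μ and −μ(1 − μ) cancel, which expresses that the centre of
mass is at the origin. The constant term is removed by the −1, which comes from the subtracted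
Kepler potential. -/
lemma hasSum_potCoef {μ : ℝ} (h0 : 0 ≤ μ) (h1 : μ ≤ 1) {z : ℂ} (hz : ‖z‖ < 1) :
    HasSum (fun x : ℕ × ℕ => (potCoef μ x.1 x.2 : ℂ) * z ^ x.1 * (starRingEnd ℂ) z ^ x.2)
      (((1 - μ) / ‖1 - μ * z‖ + μ / ‖1 + (1 - μ) * z‖ - 1 : ℝ) : ℂ) := by
  have hμ : ‖(μ : ℂ) * z‖ < 1 := by
    rw [norm_mul, Complex.norm_real, Real.norm_eq_abs, abs_of_nonneg h0]
    nlinarith [norm_nonneg z]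
  have hμ' : ‖(((-(1 - μ) : ℝ)) : ℂ) * z‖ < 1 := by
    rw [norm_mul, Complex.norm_real, Real.norm_eq_abs, abs_neg, abs_of_nonneg (sub_nonneg.2 h1)]
    nlinarith [norm_nonneg z]
  have hA := (hasSum_inv_norm hμ).mul_left ((1 - μ : ℝ) : ℂ)
  have hB := (hasSum_inv_norm hμ').mul_left (μ : ℂ)
  have h := (hA.add hB).sub (hasSum_ite_eq ((0, 0) : ℕ × ℕ) (1 : ℂ))
  have hval : (((1 - μ) / ‖1 - μ * z‖ + μ / ‖1 + (1 - μ) * z‖ - 1 : ℝ) : ℂ)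
      = ((1 - μ : ℝ) : ℂ) * ((1 / ‖1 - μ * z‖ : ℝ) : ℂ)
        + (μ : ℂ) * ((1 / ‖1 - ((-(1 - μ) : ℝ) : ℂ) * z‖ : ℝ) : ℂ) - 1 := by
    have e : (1 : ℂ) - ((-(1 - μ) : ℝ) : ℂ) * z = 1 + (1 - μ) * z := by
      push_cast
      ring
    rw [e]
    push_cast
    ring
  rw [hval]
  refine hasSum_of_eq h fun x => ?_
  obtain ⟨j, k⟩ := x
  simp only [map_mul, Complex.conj_ofReal, mul_pow, Prod.mk.injEq]
  unfold potCoef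
  split_ifs with hjk h00 h00
  · obtain ⟨rfl, rfl⟩ := h00
    simp [legCoef_zero]
  · have : j + k = 1 := by omega
    rcases Nat.add_eq_one_iff.1 this with ⟨rfl, rfl⟩ | ⟨rfl, rfl⟩ <;>
      · push_cast
        ring
  · omega
  · push_cast
    ring

/-! ### The potential along the parabolic orbit, in the parameter τ. -/

lemma parabolicParam_parabolicTime (τ : ℝ) : parabolicParam (parabolicTime τ) = τ :=
  Function.leftInverse_invFun parabolicTime_strictMono.injective τ

lemma ofReal_sub_I_ne_zero (τ : ℝ) : (τ : ℂ) - Complex.I ≠ 0 := fun h => by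
  simpa using congrArg Complex.im h

lemma ofReal_add_I_ne_zero (τ : ℝ) : (τ : ℂ) + Complex.I ≠ 0 := fun h => by
  simpa using congrArg Complex.im h

lemma norm_sq_ofReal_sub_I (τ : ℝ) : ‖(τ : ℂ) - Complex.I‖ ^ 2 = 1 + τ ^ 2 := by
  rw [← Complex.normSq_eq_norm_sq, Complex.normSq_apply]
  simp
  ring

lemma norm_sq_ofReal_add_I (τ : ℝ) : ‖(τ : ℂ) + Complex.I‖ ^ 2 = 1 + τ ^ 2 := by
  rw [← Complex.normSq_eq_norm_sq, Complex.normSq_apply]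
  simp
  ring

/-- The ratio of the distances, as a complex number. -/
noncomputable def distRatio (ε I β t τ : ℝ) : ℂ :=
  2 * relPos ε t * Complex.exp (-(β * Complex.I)) / (I ^ 2 * (τ - Complex.I) ^ 2)

lemma norm_distRatio_lt {ε I β t τ : ℝ} (h0 : 0 ≤ ε) (h1 : ε < 1) (hI : 4 ≤ I) :
    ‖distRatio ε I β t τ‖ < 1 := by
  have h2 := norm_relPos_le h0 h1 t
  have hexp : ‖Complex.exp (-(β * Complex.I))‖ = 1 := by
    rw [← neg_mul, ← Complex.ofReal_neg, Complex.norm_exp_ofReal_mul_I]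
  rw [distRatio, norm_div, norm_mul, norm_mul, norm_mul, norm_pow, norm_pow, hexp,
    norm_sq_ofReal_sub_I, Complex.norm_real, Complex.norm_ofNat, Real.norm_eq_abs, sq_abs,
    div_lt_one (by positivity)]
  nlinarith [sq_nonneg τ, mul_nonneg (sq_nonneg I) (sq_nonneg τ)]

/-- From r = (τ − i)(τ + i)/2 and e^{iα} = (τ − i)/(τ + i), the position is I² e^{iβ}(τ − i)²/2, a
pure square. The factor on the left is both the Jacobian of the time and the radius, so it cancels
against the Kepler potential. -/
lemma pertPotential_parabolicTime {μ ε I : ℝ} (hI : 0 < I) (β t τ : ℝ) :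
    pertPotential μ (parabolicTime τ) β t I ε * ((1 + τ ^ 2) / 2)
      = I * ((1 - μ) / ‖1 - μ * distRatio ε I β t τ‖
        + μ / ‖1 + (1 - μ) * distRatio ε I β t τ‖ - 1) := by
  have hr : rHom (parabolicTime τ) = (1 + τ ^ 2) / 2 := by
    rw [rHom, parabolicParam_parabolicTime, add_comm]
  have hα := exp_alphaHom (parabolicTime τ)
  rw [parabolicParam_parabolicTime] at hα
  have hm := ofReal_sub_I_ne_zero τ
  have hp := ofReal_add_I_ne_zero τ
  have hIc : (I : ℂ) ≠ 0 := by exact_mod_cast hI.ne'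
  have hβ := Complex.exp_ne_zero (β * Complex.I)
  set q : ℂ := ((I ^ 2 * rHom (parabolicTime τ) : ℝ) : ℂ)
    * Complex.exp (((β + alphaHom (parabolicTime τ) : ℝ) : ℂ) * Complex.I) with hq
  have hprod : ((τ : ℂ) - Complex.I) * (τ + Complex.I) = 1 + (τ : ℂ) ^ 2 := by
    linear_combination -Complex.I_sq
  have hq' : q = I ^ 2 * Complex.exp (β * Complex.I) * (τ - Complex.I) ^ 2 / 2 := by
    rw [hq, hr, Complex.ofReal_add, add_mul, Complex.exp_add, hα]
    push_cast
    rw [← hprod]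
    field_simp
  have hz : q * distRatio ε I β t τ = relPos ε t := by
    rw [hq', distRatio, Complex.exp_neg]
    field_simp
  have hnq : ‖q‖ = I ^ 2 * ((1 + τ ^ 2) / 2) := by
    rw [hq, norm_mul, Complex.norm_exp_ofReal_mul_I, mul_one, hr, Complex.norm_real,
      Real.norm_eq_abs, abs_of_pos (by positivity)]
  have e0 : ‖q - primaryZero μ ε t‖
      = I ^ 2 * ((1 + τ ^ 2) / 2) * ‖1 - μ * distRatio ε I β t τ‖ := by
    rw [← hnq, ← norm_mul, primaryZero, mul_assoc, ← relPos, ← hz]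
    congr 1
    ring
  have e1 : ‖q - primaryOne μ ε t‖
      = I ^ 2 * ((1 + τ ^ 2) / 2) * ‖1 + (1 - μ) * distRatio ε I β t τ‖ := by
    rw [← hnq, ← norm_mul, primaryOne, mul_assoc, ← relPos, ← hz]
    congr 1
    push_cast
    ring
  have hI2 : (0 : ℝ) < 1 + τ ^ 2 := by positivity
  rw [pertPotential, polarPotential, gravPotential, ← hq, e0, e1, hr]
  simp only [div_eq_mul_inv, mul_inv, inv_inv]
  field_simp

/-! ## Termwise integration along the parabolic orbit -/

/-- The bound serves twice: uniformly in x it makes the sum continuous, hence measurable, and after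
integration it justifies the exchange of sum and integral. -/
lemma integrable_hasSum_of_bound {ι : Type*} [Countable ι] {F : ι → ℝ → ℂ} {b : ι → ℝ} {f : ℝ → ℂ}
    (hF : ∀ n, Continuous (F n)) (hb : Summable b) (h : ∀ n x, ‖F n x‖ ≤ b n * (1 + x ^ 2)⁻¹)
    (hf : ∀ x, HasSum (fun n => F n x) (f x)) :
    Integrable f ∧ HasSum (fun n => ∫ x, F n x) (∫ x, f x) := by
  have hle : ∀ x : ℝ, (1 + x ^ 2)⁻¹ ≤ 1 := fun x => inv_le_one_of_one_le₀ (by nlinarith [sq_nonneg x])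
  have hb0 : ∀ n, 0 ≤ b n := fun n => by simpa using (norm_nonneg _).trans (h n 0)
  have hF1 : ∀ n x, ‖F n x‖ ≤ b n := fun n x =>
    (h n x).trans (mul_le_of_le_one_right (hb0 n) (hle x))
  have hft : f = fun x => ∑' n, F n x := funext fun x => (hf x).tsum_eq.symm
  have hcont : Continuous f := by
    rw [hft]
    exact continuous_tsum hF hb hF1
  have hint : ∀ n, Integrable (F n) := fun n =>
    (integrable_inv_one_add_sq.const_mul (b n)).mono' (hF n).aestronglyMeasurable
      (Eventually.of_forall (h n))
  constructor
  · refine (integrable_inv_one_add_sq.const_mul (∑' n, b n)).mono' hcont.aestronglyMeasurable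
      (Eventually.of_forall fun x => ?_)
    rw [← (hf x).tsum_eq, ← tsum_mul_right]
    exact tsum_of_norm_bounded (hb.mul_right _).hasSum (fun n => h n x)
  · rw [hft]
    refine hasSum_integral_of_summable_integral_norm hint ?_
    refine Summable.of_nonneg_of_le (fun n => integral_nonneg fun x => norm_nonneg _) (fun n => ?_)
      (hb.mul_right (∫ x : ℝ, (1 + x ^ 2)⁻¹))
    rw [← integral_const_mul]
    exact integral_mono (hint n).norm (integrable_inv_one_add_sq.const_mul (b n)) (h n)

lemma integral_comp_parabolicTime {g : ℝ → ℝ}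
    (h : Integrable fun τ => g (parabolicTime τ) * ((1 + τ ^ 2) / 2)) :
    Integrable g ∧ ∫ s, g s = ∫ τ, g (parabolicTime τ) * ((1 + τ ^ 2) / 2) := by
  have hd : ∀ x ∈ (univ : Set ℝ), HasDerivWithinAt parabolicTime ((1 + x ^ 2) / 2) univ x :=
    fun x _ => (hasDerivAt_parabolicTime x).hasDerivWithinAt
  have hinj : InjOn parabolicTime univ := parabolicTime_strictMono.injective.injOn
  have himg : parabolicTime '' univ = univ := by
    rw [image_univ, parabolicTime_surjective.range_eq]
  have he : (fun x => |(1 + x ^ 2) / 2| • g (parabolicTime x))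
      = fun τ => g (parabolicTime τ) * ((1 + τ ^ 2) / 2) := by
    funext x
    rw [abs_of_pos (by positivity), smul_eq_mul, mul_comm]
  have h1 := integrableOn_image_iff_integrableOn_abs_deriv_smul MeasurableSet.univ hd hinj g
  have h2 := integral_image_eq_integral_abs_deriv_smul MeasurableSet.univ hd hinj g
  rw [himg, he, integrableOn_univ, integrableOn_univ] at h1
  rw [himg, setIntegral_univ, setIntegral_univ] at h2
  exact ⟨h1.2 h, by rw [h2, ← he]⟩

/-! ## The integrals of the harmonics on the parabolic orbit -/

/-- The integrand of the integrals of the harmonics on the parabolic orbit. -/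
noncomputable def parabolicKernel (j k : ℕ) (l : ℤ) (I τ : ℝ) : ℂ :=
  (((τ : ℂ) - Complex.I) ^ (2 * j))⁻¹ * (((τ : ℂ) + Complex.I) ^ (2 * k))⁻¹
    * Complex.exp ((l * I ^ 3 * parabolicTime τ : ℝ) * Complex.I)

lemma continuous_parabolicTime : Continuous parabolicTime :=
  continuous_iff_continuousAt.2 fun τ => (hasDerivAt_parabolicTime τ).continuousAt

lemma continuous_parabolicKernel (j k : ℕ) (l : ℤ) (I : ℝ) :
    Continuous (parabolicKernel j k l I) := by
  unfold parabolicKernel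
  have h1 : ∀ τ : ℝ, ((τ : ℂ) - Complex.I) ^ (2 * j) ≠ 0 :=
    fun τ => pow_ne_zero _ (ofReal_sub_I_ne_zero τ)
  have h2 : ∀ τ : ℝ, ((τ : ℂ) + Complex.I) ^ (2 * k) ≠ 0 :=
    fun τ => pow_ne_zero _ (ofReal_add_I_ne_zero τ)
  have h3 := continuous_parabolicTime
  have h4 : Continuous fun τ : ℝ => (((τ : ℂ) - Complex.I) ^ (2 * j))⁻¹ :=
    Continuous.inv₀ (by fun_prop) h1
  have h5 : Continuous fun τ : ℝ => (((τ : ℂ) + Complex.I) ^ (2 * k))⁻¹ :=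
    Continuous.inv₀ (by fun_prop) h2
  fun_prop

lemma inv_pow_le_inv {q : ℝ} (hq : 1 ≤ q) {n : ℕ} (hn : 1 ≤ n) : (q ^ n)⁻¹ ≤ q⁻¹ :=
  inv_anti₀ (by linarith) (le_self_pow₀ hq (by omega))

lemma norm_parabolicKernel_le {j k : ℕ} (h : 1 ≤ j + k) (l : ℤ) (I τ : ℝ) :
    ‖parabolicKernel j k l I τ‖ ≤ (1 + τ ^ 2)⁻¹ := by
  rw [parabolicKernel, norm_mul, Complex.norm_exp_ofReal_mul_I, mul_one, norm_mul, norm_inv,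
    norm_inv, pow_mul, pow_mul, norm_pow, norm_pow, norm_pow, norm_pow, norm_sq_ofReal_sub_I,
    norm_sq_ofReal_add_I, ← mul_inv, ← pow_add]
  exact inv_pow_le_inv (by nlinarith [sq_nonneg τ]) h

/-- The time is odd in τ and the reflection exchanges the points i and −i. This reduces negative
orders l to positive ones, for which the same saddle can be used. -/
lemma parabolicKernel_neg (j k : ℕ) (l : ℤ) (I τ : ℝ) :
    parabolicKernel j k (-l) I (-τ) = parabolicKernel k j l I τ := by
  have e1 : ((-τ : ℝ) : ℂ) - Complex.I = -((τ : ℂ) + Complex.I) := by push_cast; ring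
  have e2 : ((-τ : ℝ) : ℂ) + Complex.I = -((τ : ℂ) - Complex.I) := by push_cast; ring
  have e3 : ((-l : ℤ) : ℝ) * I ^ 3 * parabolicTime (-τ) = l * I ^ 3 * parabolicTime τ := by
    simp only [parabolicTime]
    push_cast
    ring
  rw [parabolicKernel, parabolicKernel, e1, e2, e3, (even_two_mul j).neg_pow,
    (even_two_mul k).neg_pow, mul_comm (_⁻¹) (_⁻¹)]

lemma integral_parabolicKernel_neg (j k : ℕ) (l : ℤ) (I : ℝ) :
    ∫ τ, parabolicKernel j k (-l) I τ = ∫ τ, parabolicKernel k j l I τ := by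
  rw [← integral_neg_eq_self]
  simp only [parabolicKernel_neg]

/-- The integral of the zeroth harmonic. -/
noncomputable def rationalIntegral (j k : ℕ) : ℂ := ∫ τ, parabolicKernel j k 0 0 τ

lemma parabolicKernel_zero (j k : ℕ) (I τ : ℝ) :
    parabolicKernel j k 0 I τ = parabolicKernel j k 0 0 τ := by
  simp [parabolicKernel]

lemma rationalIntegral_comm (j k : ℕ) : rationalIntegral j k = rationalIntegral k j := by
  have := integral_parabolicKernel_neg j k 0 0
  rwa [neg_zero] at this

lemma integrable_parabolicKernel {j k : ℕ} (h : 1 ≤ j + k) (l : ℤ) (I : ℝ) :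
    Integrable (parabolicKernel j k l I) :=
  integrable_inv_one_add_sq.mono' (continuous_parabolicKernel j k l I).aestronglyMeasurable
    (Eventually.of_forall (norm_parabolicKernel_le h l I))

lemma norm_rationalIntegral_le {j k : ℕ} (h : 1 ≤ j + k) : ‖rationalIntegral j k‖ ≤ Real.pi := by
  rw [← integral_univ_inv_one_add_sq]
  exact norm_integral_le_of_norm_le integrable_inv_one_add_sq
    (Eventually.of_forall (norm_parabolicKernel_le h 0 0))

lemma hasDerivAt_inv_sub_I (τ : ℝ) :
    HasDerivAt (fun τ : ℝ => ((τ : ℂ) - Complex.I)⁻¹) (-((τ : ℂ) - Complex.I)⁻¹ ^ 2) τ := by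
  have := ((Complex.ofRealCLM.hasDerivAt (x := τ)).sub_const Complex.I).fun_inv
    (ofReal_sub_I_ne_zero τ)
  refine this.congr_deriv ?_
  simp [div_eq_mul_inv]

lemma hasDerivAt_inv_add_I (τ : ℝ) :
    HasDerivAt (fun τ : ℝ => ((τ : ℂ) + Complex.I)⁻¹) (-((τ : ℂ) + Complex.I)⁻¹ ^ 2) τ := by
  have := ((Complex.ofRealCLM.hasDerivAt (x := τ)).add_const Complex.I).fun_inv
    (ofReal_add_I_ne_zero τ)
  refine this.congr_deriv ?_
  simp [div_eq_mul_inv]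

lemma tendsto_inv_ofReal_add (c : ℂ) {F : Filter ℝ} (hF : Tendsto (fun x : ℝ => |x|) F atTop) :
    Tendsto (fun τ : ℝ => ((τ : ℂ) + c)⁻¹) F (𝓝 0) := by
  refine tendsto_inv₀_cobounded.comp ?_
  rw [← tendsto_norm_atTop_iff_cobounded]
  refine tendsto_atTop_mono (fun τ => ?_) (tendsto_atTop_add_const_right _ (-‖c‖) hF)
  have := norm_sub_norm_le (τ : ℂ) (-c)
  rw [norm_neg, sub_neg_eq_add, Complex.norm_real, Real.norm_eq_abs] at this
  linarith

lemma tendsto_inv_sub_I {F : Filter ℝ} (hF : Tendsto (fun x : ℝ => |x|) F atTop) :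
    Tendsto (fun τ : ℝ => ((τ : ℂ) - Complex.I)⁻¹) F (𝓝 0) := by
  simpa [sub_eq_add_neg] using tendsto_inv_ofReal_add (-Complex.I) hF

lemma inv_sub_I_mul_inv_add_I (τ : ℝ) :
    ((τ : ℂ) - Complex.I)⁻¹ * ((τ : ℂ) + Complex.I)⁻¹
      = -Complex.I / 2 * (((τ : ℂ) - Complex.I)⁻¹ - ((τ : ℂ) + Complex.I)⁻¹) := by
  have h1 := ofReal_sub_I_ne_zero τ
  have h2 := ofReal_add_I_ne_zero τ
  field_simp
  linear_combination 2 * Complex.I_sq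

lemma hasDerivAt_ofReal_arctan (τ : ℝ) :
    HasDerivAt (fun τ : ℝ => ((Real.arctan τ : ℝ) : ℂ))
      (((τ : ℂ) - Complex.I)⁻¹ * ((τ : ℂ) + Complex.I)⁻¹) τ := by
  refine (Real.hasDerivAt_arctan τ).ofReal_comp.congr_deriv ?_
  have h1 := ofReal_sub_I_ne_zero τ
  have h2 := ofReal_add_I_ne_zero τ
  have h3 : (1 : ℂ) + (τ : ℂ) ^ 2 ≠ 0 := by
    have : (1 : ℝ) + τ ^ 2 ≠ 0 := by positivity
    exact_mod_cast this
  push_cast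
  field_simp
  linear_combination -Complex.I_sq

/-- With a single pole, of order at least two, the integrand has a primitive vanishing at both ends.
In this way all the terms with j = 0 or k = 0 disappear from the mean in σ. -/
lemma rationalIntegral_zero_right {j : ℕ} (hj : 1 ≤ j) : rationalIntegral j 0 = 0 := by
  have hd : ∀ τ : ℝ, HasDerivAt
      (fun τ : ℝ => -(1 / (2 * j - 1 : ℂ)) * ((τ : ℂ) - Complex.I)⁻¹ ^ (2 * j - 1))
      (parabolicKernel j 0 0 0 τ) τ := by
    intro τ
    refine (((hasDerivAt_inv_sub_I τ).pow (2 * j - 1)).const_mul _).congr_deriv ?_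
    obtain ⟨n, rfl⟩ := Nat.exists_eq_add_of_le' hj
    have hn : (2 * (n + 1 : ℂ) - 1) ≠ 0 := by
      have : (2 * (n + 1 : ℂ) - 1) = ((2 * n + 1 : ℕ) : ℂ) := by push_cast; ring
      rw [this]
      exact Nat.cast_ne_zero.2 (by omega)
    rw [show 2 * (n + 1) - 1 = 2 * n + 1 by omega]
    simp only [parabolicKernel]
    push_cast
    simp only [zero_mul, pow_zero, Complex.exp_zero, inv_one, mul_one]
    rw [← inv_pow, show 2 * (n + 1) = 2 * n + 2 by ring, pow_add]
    field_simp
    ring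
  have hlim : ∀ F : Filter ℝ, Tendsto (fun x : ℝ => |x|) F atTop → Tendsto
      (fun τ : ℝ => -(1 / (2 * j - 1 : ℂ)) * ((τ : ℂ) - Complex.I)⁻¹ ^ (2 * j - 1)) F (𝓝 0) := by
    intro F hF
    have := ((tendsto_inv_sub_I hF).pow (2 * j - 1)).const_mul (-(1 / (2 * j - 1 : ℂ)))
    rwa [zero_pow (by omega), mul_zero] at this
  have := integral_of_hasDerivAt_of_tendsto hd (integrable_parabolicKernel (by omega) 0 0)
    (hlim _ tendsto_abs_atBot_atTop) (hlim _ tendsto_abs_atTop_atTop)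
  rw [rationalIntegral, this, sub_zero]

lemma tendsto_ofReal_arctan_atTop :
    Tendsto (fun τ : ℝ => ((Real.arctan τ : ℝ) : ℂ)) atTop (𝓝 ((Real.pi / 2 : ℝ) : ℂ)) :=
  (Complex.continuous_ofReal.tendsto _).comp
    (tendsto_nhds_of_tendsto_nhdsWithin Real.tendsto_arctan_atTop)

lemma tendsto_ofReal_arctan_atBot :
    Tendsto (fun τ : ℝ => ((Real.arctan τ : ℝ) : ℂ)) atBot (𝓝 ((-(Real.pi / 2) : ℝ) : ℂ)) :=
  (Complex.continuous_ofReal.tendsto _).comp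
    (tendsto_nhds_of_tendsto_nhdsWithin Real.tendsto_arctan_atBot)

/-- The rational part of the primitive vanishes at infinity, so only the arctangent contributes. -/
lemma integral_of_arctan_primitive {f R : ℝ → ℂ} {c : ℂ} (hf : Integrable f)
    (hd : ∀ τ, HasDerivAt (fun τ : ℝ => R τ + c * ((Real.arctan τ : ℝ) : ℂ)) (f τ) τ)
    (hR : ∀ F : Filter ℝ, Tendsto (fun x : ℝ => |x|) F atTop → Tendsto R F (𝓝 0)) :
    ∫ τ, f τ = c * Real.pi := by
  have := integral_of_hasDerivAt_of_tendsto hd hf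
    ((hR _ tendsto_abs_atBot_atTop).add (tendsto_ofReal_arctan_atBot.const_mul c))
    ((hR _ tendsto_abs_atTop_atTop).add (tendsto_ofReal_arctan_atTop.const_mul c))
  rw [this]
  push_cast
  ring

lemma rationalIntegral_one_one : rationalIntegral 1 1 = Real.pi / 2 := by
  have := integral_of_arctan_primitive (c := 1 / 2)
    (R := fun τ : ℝ => (((τ : ℂ) - Complex.I)⁻¹ + ((τ : ℂ) + Complex.I)⁻¹) / 4)
    (integrable_parabolicKernel (j := 1) (k := 1) (by omega) 0 0) (fun τ => ?_) fun F hF => ?_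
  · rw [rationalIntegral, this]
    ring
  · refine ((((hasDerivAt_inv_sub_I τ).add (hasDerivAt_inv_add_I τ)).div_const 4).add
      ((hasDerivAt_ofReal_arctan τ).const_mul (1 / 2))).congr_deriv ?_
    have h := inv_sub_I_mul_inv_add_I τ
    simp only [parabolicKernel]
    simp only [← inv_pow]
    set a := ((τ : ℂ) - Complex.I)⁻¹
    set b := ((τ : ℂ) + Complex.I)⁻¹
    simp
    linear_combination (-(a * b) + Complex.I / 2 * (a - b)) * h
      - (a - b) ^ 2 / 4 * Complex.I_sq
  · have := ((tendsto_inv_sub_I hF).add (tendsto_inv_ofReal_add Complex.I hF)).div_const 4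
    simpa using this

lemma rationalIntegral_two_one : rationalIntegral 2 1 = -(Real.pi / 4) := by
  have := integral_of_arctan_primitive (c := -(1 / 4))
    (R := fun τ : ℝ => ((τ : ℂ) - Complex.I)⁻¹ ^ 3 / 12
      + Complex.I / 8 * ((τ : ℂ) - Complex.I)⁻¹ ^ 2 - 3 / 16 * ((τ : ℂ) - Complex.I)⁻¹
      - 1 / 16 * ((τ : ℂ) + Complex.I)⁻¹)
    (integrable_parabolicKernel (j := 2) (k := 1) (by omega) 0 0) (fun τ => ?_) fun F hF => ?_
  · rw [rationalIntegral, this]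
    ring
  · have ha := hasDerivAt_inv_sub_I τ
    have hb := hasDerivAt_inv_add_I τ
    refine ((((((ha.pow 3).div_const 12).add ((ha.pow 2).const_mul (Complex.I / 8))).sub
      (ha.const_mul (3 / 16))).sub (hb.const_mul (1 / 16))).add
      ((hasDerivAt_ofReal_arctan τ).const_mul (-(1 / 4)))).congr_deriv ?_
    have h := inv_sub_I_mul_inv_add_I τ
    simp only [parabolicKernel]
    simp only [← inv_pow]
    set a := ((τ : ℂ) - Complex.I)⁻¹
    set b := ((τ : ℂ) + Complex.I)⁻¹
    -- This is the partial fraction expansion of a⁴b²: each product ab is lowered by the relation ab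
    -- = −i(a − b)/2.
    have h2 : (a * b) ^ 2 = -(a - b) ^ 2 / 4 := by
      rw [h]
      linear_combination (a - b) ^ 2 / 4 * Complex.I_sq
    have h3 : a ^ 2 * b = -Complex.I / 2 * (a ^ 2 - a * b) := by linear_combination a * h
    have h4 : a ^ 3 * b = -Complex.I / 2 * (a ^ 3 - a ^ 2 * b) := by linear_combination a ^ 2 * h
    have h5 : a ^ 4 * b ^ 2 = -a ^ 4 / 4 - Complex.I * a ^ 3 / 4 + 3 / 16 * a ^ 2 + b ^ 2 / 16
        - a * b / 4 := by
      rw [h3] at h4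
      linear_combination a ^ 2 * h2 + 1 / 2 * h4 - 1 / 4 * h2
        + (-(a ^ 2) / 8 + a * b / 8) * Complex.I_sq
    simp
    linear_combination -h5
  · have h1 := tendsto_inv_sub_I hF
    have := ((((h1.pow 3).div_const 12).add ((h1.pow 2).const_mul (Complex.I / 8))).sub
      (h1.const_mul (3 / 16))).sub ((tendsto_inv_ofReal_add Complex.I hF).const_mul (1 / 16))
    simpa using this

/-! ## The Melnikov integrals -/

/-- The integral of a harmonic of order `l` on the parabolic orbit, as an analytic function of the
action. -/
noncomputable def melnikovIntegral (j k : ℕ) (l : ℤ) (I : ℂ) : ℂ :=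
  if l = 0 then I * (I ^ (2 * (j + k)))⁻¹ * rationalIntegral j k
  else if 0 < l then Complex.exp (-(l.natAbs * (I ^ 3 / 3))) * saddleIntegral j k l.natAbs I
  else Complex.exp (-(l.natAbs * (I ^ 3 / 3))) * saddleIntegral k j l.natAbs I

lemma melnikovIntegral_zero (j k : ℕ) (I : ℂ) :
    melnikovIntegral j k 0 I = I * (I ^ (2 * (j + k)))⁻¹ * rationalIntegral j k := if_pos rfl

lemma melnikovIntegral_natCast (j k : ℕ) {l : ℕ} (hl : 1 ≤ l) (I : ℂ) :
    melnikovIntegral j k l I = Complex.exp (-(l * (I ^ 3 / 3))) * saddleIntegral j k l I := by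
  rw [melnikovIntegral, if_neg (by omega), if_pos (by omega), Int.natAbs_natCast]

lemma melnikovIntegral_neg (j k : ℕ) (l : ℤ) (I : ℂ) :
    melnikovIntegral j k (-l) I = melnikovIntegral k j l I := by
  unfold melnikovIntegral
  rw [Int.natAbs_neg, add_comm k j, rationalIntegral_comm k j]
  rcases lt_trichotomy l 0 with h | h | h
  · simp [h.ne, h, h.not_gt]
  · simp [h]
  · simp [h.ne', h, h.not_gt]

lemma one_add_sq_le_norm_sq_line {y η : ℝ} (hη : 1 ≤ |η|) :
    1 + y ^ 2 ≤ ‖(y : ℂ) + (η : ℂ) * Complex.I‖ ^ 2 := by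
  rw [← Complex.normSq_eq_norm_sq, Complex.normSq_apply]
  simp
  nlinarith [sq_abs η]

/-- For real I the real τ-axis is the line Im ξ = −I. There the exponential has constant modulus and
the Gaussian decay is lost, so the quadratic decay needed to move the contour must come from the
poles; this requires 1 ≤ j + k. -/
lemma saddleIntegral_ofReal (j k : ℕ) (h : 1 ≤ j + k) (l : ℕ) {I : ℝ} (hI : 1 ≤ I) :
    saddleIntegral j k l I
      = ∫ y : ℝ, saddleKernel j k l I (y + ((-I : ℝ) : ℂ) * Complex.I) := by
  have hrange : ∀ z : ℂ, z.im ∈ uIcc (-1) (-I) → 1 ≤ -z.im ∧ -z.im ≤ I := by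
    intro z hz
    rw [uIcc_of_ge (by linarith)] at hz
    constructor <;> linarith [hz.1, hz.2]
  refine integral_horizontal_eq (C := Real.exp (l * I ^ 3)) (fun z hz => ?_) (fun z hz => ?_)
  · obtain ⟨h1, h2⟩ := hrange z hz
    refine (differentiableAt_saddleKernel ?_ ?_).differentiableWithinAt
    · rw [eq_line z]
      exact line_ne_zero (by linarith)
    · rw [eq_line z]
      exact line_add_ne_zero (by linarith) (by simpa using h2)
  · obtain ⟨h1, h2⟩ := hrange z hz
    have e := eq_line z
    set y := z.re with hy
    set η := -z.im with hη
    rw [e]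
    have n1 : 1 + y ^ 2 ≤ ‖(y : ℂ) + ((-η : ℝ) : ℂ) * Complex.I‖ ^ 2 :=
      one_add_sq_le_norm_sq_line (by rw [abs_neg, abs_of_pos] <;> linarith)
    have n2 : 1 + y ^ 2 ≤ ‖(y : ℂ) + ((-η : ℝ) : ℂ) * Complex.I + 2 * Complex.I * I‖ ^ 2 := by
      have : (y : ℂ) + ((-η : ℝ) : ℂ) * Complex.I + 2 * Complex.I * I
          = (y : ℂ) + ((2 * I - η : ℝ) : ℂ) * Complex.I := by
        push_cast
        ring
      rw [this]
      exact one_add_sq_le_norm_sq_line (by rw [abs_of_pos] <;> linarith)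
    have hy1 : 1 ≤ 1 + y ^ 2 := by nlinarith [sq_nonneg y]
    have n3 : ‖saddleExp l I (y + ((-η : ℝ) : ℂ) * Complex.I)‖ ≤ Real.exp (l * I ^ 3) := by
      rw [norm_saddleExp]
      refine Real.exp_le_exp.2 ?_
      have hl : (0 : ℝ) ≤ l := Nat.cast_nonneg l
      simp only [Complex.ofReal_re, Complex.ofReal_im]
      have : -(I * (y ^ 2 - η ^ 2) / 2) + (3 * y ^ 2 * η - η ^ 3) / 6 ≤ I ^ 3 := by
        have a1 : 0 ≤ y ^ 2 * (I - η) := mul_nonneg (sq_nonneg y) (by linarith)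
        have a2 : I * η ^ 2 ≤ I * I ^ 2 := by gcongr
        have a3 : 0 ≤ η ^ 3 := by positivity
        have a4 : 0 ≤ I ^ 3 := by positivity
        nlinarith
      nlinarith [mul_le_mul_of_nonneg_left this hl]
    rw [saddleKernel, norm_mul, norm_mul, norm_inv, norm_inv, pow_mul, pow_mul, norm_pow _ j,
      norm_pow _ k, norm_pow _ 2, norm_pow _ 2, ← mul_inv, mul_comm]
    gcongr
    calc 1 + y ^ 2 ≤ (1 + y ^ 2) ^ (j + k) := le_self_pow₀ hy1 (by omega)
      _ = (1 + y ^ 2) ^ j * (1 + y ^ 2) ^ k := pow_add _ _ _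
      _ ≤ _ := by gcongr

/-- The Taylor expansion of the cubic phase at τ = i is exact: iI³(τ + τ³/3)/2 = −I³/3 − Iξ²/2 +
iξ³/6 with ξ = I(τ − i). -/
lemma saddleKernel_eq_parabolicKernel (j k l : ℕ) (I τ : ℝ) :
    saddleKernel j k l I (((I * τ : ℝ) : ℂ) + ((-I : ℝ) : ℂ) * Complex.I)
      = Complex.exp (l * ((I : ℂ) ^ 3 / 3)) * ((I : ℂ) ^ (2 * (j + k)))⁻¹
        * parabolicKernel j k l I τ := by
  have e1 : ((I * τ : ℝ) : ℂ) + ((-I : ℝ) : ℂ) * Complex.I = I * (τ - Complex.I) := by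
    push_cast
    ring
  have e2 : (I : ℂ) * (τ - Complex.I) + 2 * Complex.I * I = I * (τ + Complex.I) := by ring
  have e3 : saddleExp l I (I * (τ - Complex.I)) = Complex.exp (l * ((I : ℂ) ^ 3 / 3))
      * Complex.exp ((((l : ℤ) : ℝ) * I ^ 3 * parabolicTime τ : ℝ) * Complex.I) := by
    rw [saddleExp, ← Complex.exp_add]
    congr 1
    simp only [parabolicTime]
    push_cast
    have h3 : Complex.I ^ 3 = -Complex.I := by rw [pow_succ, Complex.I_sq]; ring
    have h4 : Complex.I ^ 4 = 1 := Complex.I_pow_four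
    ring_nf
    rw [h3, h4, Complex.I_sq]
    ring
  rw [e1, saddleKernel, e2, e3, parabolicKernel, mul_pow, mul_pow, mul_add, pow_add, mul_inv,
    mul_inv, mul_inv]
  ring

lemma melnikovIntegral_ofReal_natCast {j k : ℕ} (h : 1 ≤ j + k) {l : ℕ} (hl : 1 ≤ l) {I : ℝ}
    (hI : 1 ≤ I) :
    melnikovIntegral j k l I
      = I * ((I : ℂ) ^ (2 * (j + k)))⁻¹ * ∫ τ, parabolicKernel j k l I τ := by
  have hI0 : 0 < I := by linarith
  have hIc : (I : ℂ) ≠ 0 := by exact_mod_cast hI0.ne'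
  have hcv := Measure.integral_comp_mul_left
    (fun y : ℝ => saddleKernel j k l I ((y : ℂ) + ((-I : ℝ) : ℂ) * Complex.I)) I
  simp only [saddleKernel_eq_parabolicKernel j k l] at hcv
  rw [integral_const_mul, ← saddleIntegral_ofReal j k h l hI, abs_of_pos (inv_pos.2 hI0),
    Complex.real_smul] at hcv
  rw [melnikovIntegral_natCast j k hl]
  have : saddleIntegral j k l I = I * (Complex.exp (l * ((I : ℂ) ^ 3 / 3))
      * ((I : ℂ) ^ (2 * (j + k)))⁻¹ * ∫ τ, parabolicKernel j k l I τ) := by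
    rw [hcv]
    push_cast
    field_simp
  rw [this, Complex.exp_neg]
  have := Complex.exp_ne_zero (l * ((I : ℂ) ^ 3 / 3))
  field_simp

lemma melnikovIntegral_ofReal {j k : ℕ} (h : 1 ≤ j + k) (l : ℤ) {I : ℝ} (hI : 1 ≤ I) :
    melnikovIntegral j k l I
      = I * ((I : ℂ) ^ (2 * (j + k)))⁻¹ * ∫ τ, parabolicKernel j k l I τ := by
  rcases lt_trichotomy l 0 with hl | rfl | hl
  · obtain ⟨n, hn⟩ := Int.eq_ofNat_of_zero_le (show 0 ≤ -l by omega)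
    obtain rfl : l = -(n : ℤ) := by omega
    rw [melnikovIntegral_neg, integral_parabolicKernel_neg, add_comm j k]
    exact melnikovIntegral_ofReal_natCast (by omega) (by omega) hI
  · rw [melnikovIntegral_zero, rationalIntegral]
    simp only [parabolicKernel_zero j k I]
  · obtain ⟨n, rfl⟩ := Int.eq_ofNat_of_zero_le hl.le
    exact melnikovIntegral_ofReal_natCast h (by omega) hI

/-! ## The series of the Melnikov potential -/

/-- The terms of the expansion of the Melnikov potential. -/
noncomputable def melnikovTerm (μ : ℝ) (x : (ℕ × ℕ) × ℤ) (σ β I ε : ℂ) : ℂ :=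
  potCoef μ x.1.1 x.1.2 * 2 ^ (x.1.1 + x.1.2) * keplerCoeff x.1.1 x.1.2 x.2 ε
    * Complex.exp (Complex.I * (x.2 * σ - ((x.1.1 : ℂ) - x.1.2) * β))
    * melnikovIntegral x.1.1 x.1.2 x.2 I

/-- The analytic extension of the Melnikov potential, in the variables `σ`, `β`, `I`, `ε`. -/
noncomputable def melnikovSeries (μ : ℝ) (p : ℂ × ℂ × ℂ × ℂ) : ℂ :=
  ∑' x, melnikovTerm μ x p.1 p.2.1 p.2.2.1 p.2.2.2

/-- The harmonics of the perturbative potential on the parabolic orbit. -/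
noncomputable def potentialTerm (μ σ β I ε : ℝ) (x : (ℕ × ℕ) × ℤ) (τ : ℝ) : ℂ :=
  potCoef μ x.1.1 x.1.2 * 2 ^ (x.1.1 + x.1.2) * keplerCoeff x.1.1 x.1.2 x.2 ε
    * Complex.exp (Complex.I * (x.2 * σ - ((x.1.1 : ℂ) - x.1.2) * β))
    * (I * ((I : ℂ) ^ (2 * (x.1.1 + x.1.2)))⁻¹) * parabolicKernel x.1.1 x.1.2 x.2 I τ

lemma integral_potentialTerm (μ σ β : ℝ) {I : ℝ} (ε : ℝ) (hI : 1 ≤ I) (x : (ℕ × ℕ) × ℤ) :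
    ∫ τ, potentialTerm μ σ β I ε x τ = melnikovTerm μ x σ β I ε := by
  unfold potentialTerm melnikovTerm
  rw [integral_const_mul]
  rcases Nat.lt_or_ge (x.1.1 + x.1.2) 1 with h | h
  · rw [potCoef_eq_zero (by omega)]
    simp
  · rw [melnikovIntegral_ofReal h x.2 hI]
    ring

/-- The equivalence that introduces the difference of the orders. -/
def diffEquiv : (ℕ × ℕ) × ℤ ≃ (ℕ × ℕ) × ℤ :=
  Equiv.prodShear (Equiv.refl _) fun x => Equiv.subLeft ((x.1 : ℤ) - x.2)

lemma summable_pow_add {r : ℝ} (h0 : 0 ≤ r) (h1 : r < 1) :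
    Summable fun x : ℕ × ℕ => r ^ (x.1 + x.2) := by
  have h := summable_geometric_of_lt_one h0 h1
  simp only [pow_add]
  exact h.mul_of_nonneg h (fun _ => by positivity) (fun _ => by positivity)

lemma summable_geometric_triple {r t : ℝ} (hr0 : 0 ≤ r) (hr1 : r < 1) (ht0 : 0 ≤ t) (ht1 : t < 1) :
    Summable fun x : (ℕ × ℕ) × ℤ =>
      r ^ (x.1.1 + x.1.2) * t ^ ((x.1.1 : ℤ) - x.1.2 - x.2).natAbs := by
  have h := (summable_pow_add hr0 hr1).mul_of_nonneg (summable_pow_natAbs ht0 ht1)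
    (fun _ => by positivity) (fun _ => by positivity)
  exact (diffEquiv.summable_iff
    (f := fun x : (ℕ × ℕ) × ℤ => r ^ (x.1.1 + x.1.2) * t ^ x.2.natAbs)).2 h

/-- The base 12 is the product of the bound 4 of the orbit polynomials and of 3 > e, which pays for
replacing e^{|l|} by a power of e depending on j − k only. -/
lemma norm_keplerCoeff_le_geometric {j k : ℕ} {l : ℤ} {ε : ℂ} {X : ℝ} (hX : 0 < X) (hX1 : X < 1)
    (hε : ‖ε‖ ≤ X) :
    ‖keplerCoeff j k l ε‖
      ≤ 2 * (12 ^ (j + k) * (Real.exp 1 * X) ^ ((j : ℤ) - k - l).natAbs) := by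
  refine (norm_keplerCoeff_le hX hX1 hε).trans ?_
  have h1 := exp_natAbs_mul_pow_le hX.le ((j : ℤ) - k) l
  have h2 : Real.exp (((j : ℤ) - k).natAbs : ℝ) ≤ 3 ^ (j + k) := by
    calc Real.exp (((j : ℤ) - k).natAbs : ℝ) ≤ Real.exp ((j + k : ℕ) : ℝ) := by
          gcongr
          omega
      _ = Real.exp 1 ^ (j + k) := by rw [← Real.exp_nat_mul, mul_one]
      _ ≤ 3 ^ (j + k) := by
          gcongr
          exact Real.exp_one_lt_three.le
  calc 2 * 4 ^ (j + k) * Real.exp l.natAbs * X ^ ((j : ℤ) - k - l).natAbs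
      = 2 * 4 ^ (j + k) * (Real.exp l.natAbs * X ^ ((j : ℤ) - k - l).natAbs) := by ring
    _ ≤ 2 * 4 ^ (j + k) * (3 ^ (j + k) * (Real.exp 1 * X) ^ ((j : ℤ) - k - l).natAbs) := by
        refine mul_le_mul_of_nonneg_left (h1.trans ?_) (by positivity)
        gcongr
    _ = 2 * (12 ^ (j + k) * (Real.exp 1 * X) ^ ((j : ℤ) - k - l).natAbs) := by
        have : (12 : ℝ) ^ (j + k) = 4 ^ (j + k) * 3 ^ (j + k) := by
          rw [← mul_pow]
          norm_num
        rw [this]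
        ring

lemma norm_potentialTerm_le {μ : ℝ} (h0 : 0 ≤ μ) (h1 : μ ≤ 1) (σ β : ℝ) {I ε : ℝ} (hI : 1 ≤ I)
    (hε0 : 0 < ε) (hε1 : ε < 1) (x : (ℕ × ℕ) × ℤ) (τ : ℝ) :
    ‖potentialTerm μ σ β I ε x τ‖ ≤ 2 * I * ((24 / I ^ 2) ^ (x.1.1 + x.1.2)
      * (Real.exp 1 * ε) ^ ((x.1.1 : ℤ) - x.1.2 - x.2).natAbs) * (1 + τ ^ 2)⁻¹ := by
  have hI0 : 0 < I := by linarith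
  rcases Nat.lt_or_ge (x.1.1 + x.1.2) 1 with h | h
  · rw [potentialTerm, potCoef_eq_zero (by omega)]
    simp
    positivity
  · have hexp : ‖Complex.exp (Complex.I * (x.2 * σ - ((x.1.1 : ℂ) - x.1.2) * β))‖ = 1 := by
      rw [show Complex.I * (x.2 * σ - ((x.1.1 : ℂ) - x.1.2) * β)
        = ((x.2 * σ - ((x.1.1 : ℝ) - x.1.2) * β : ℝ) : ℂ) * Complex.I by push_cast; ring,
        Complex.norm_exp_ofReal_mul_I]
    have hk := norm_keplerCoeff_le_geometric (j := x.1.1) (k := x.1.2) (l := x.2) (ε := (ε : ℂ))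
      hε0 hε1 (by simp [abs_of_pos hε0])
    have hp := abs_potCoef_le h0 h1 x.1.1 x.1.2
    have hker := norm_parabolicKernel_le h x.2 I τ
    rw [potentialTerm, norm_mul, norm_mul, norm_mul, norm_mul, norm_mul, norm_mul, hexp,
      Complex.norm_real, norm_pow, norm_inv, norm_pow, Complex.norm_real, Complex.norm_ofNat,
      Real.norm_eq_abs, Real.norm_eq_abs, abs_of_pos hI0, mul_one]
    generalize ((x.1.1 : ℤ) - x.1.2 - x.2).natAbs = m at *
    calc |potCoef μ x.1.1 x.1.2| * 2 ^ (x.1.1 + x.1.2) * ‖keplerCoeff x.1.1 x.1.2 x.2 ε‖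
          * (I * (I ^ (2 * (x.1.1 + x.1.2)))⁻¹) * ‖parabolicKernel x.1.1 x.1.2 x.2 I τ‖
        ≤ 1 * 2 ^ (x.1.1 + x.1.2) * (2 * (12 ^ (x.1.1 + x.1.2) * (Real.exp 1 * ε) ^ m))
          * (I * (I ^ (2 * (x.1.1 + x.1.2)))⁻¹) * (1 + τ ^ 2)⁻¹ := by gcongr
      _ = 2 * I * ((24 / I ^ 2) ^ (x.1.1 + x.1.2) * (Real.exp 1 * ε) ^ m) * (1 + τ ^ 2)⁻¹ := by
        have : (24 : ℝ) ^ (x.1.1 + x.1.2) = 2 ^ (x.1.1 + x.1.2) * 12 ^ (x.1.1 + x.1.2) := by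
          rw [← mul_pow]
          norm_num
        rw [div_pow, this, pow_mul]
        field_simp

/-- Summing over l at fixed (j, k) restores w^j (conj w)^k, and summing over (j, k) restores the
potential. Summability over all the indices makes this iterated sum the total sum. -/
lemma hasSum_potentialTerm {μ : ℝ} (h0 : 0 ≤ μ) (h1 : μ ≤ 1) (σ β : ℝ) {I ε : ℝ} (hI : 5 ≤ I)
    (hε0 : 0 < ε) (hε1 : ε < 1 / 4) (τ : ℝ)
    (hs : Summable fun x => potentialTerm μ σ β I ε x τ) :
    HasSum (fun x => potentialTerm μ σ β I ε x τ)
      ((pertPotential μ (parabolicTime τ) β (σ + I ^ 3 * parabolicTime τ) I ε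
        * ((1 + τ ^ 2) / 2) : ℝ) : ℂ) := by
  have hε : ε < 1 := by linarith
  set t := σ + I ^ 3 * parabolicTime τ with ht
  have hI0 : 0 < I := by linarith
  have hIc : (I : ℂ) ≠ 0 := by exact_mod_cast hI0.ne'
  have hfib : ∀ y : ℕ × ℕ, HasSum (fun l : ℤ => potentialTerm μ σ β I ε (y, l) τ)
      (I * (potCoef μ y.1 y.2 * distRatio ε I β t τ ^ y.1
        * (starRingEnd ℂ) (distRatio ε I β t τ) ^ y.2)) := by
    intro y
    have hk := (hasSum_keplerCoeff hε0 hε1 y.1 y.2 t).mul_left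
      (potCoef μ y.1 y.2 * 2 ^ (y.1 + y.2) * Complex.exp (-(Complex.I * (((y.1 : ℂ) - y.2) * β)))
        * (I * ((I : ℂ) ^ (2 * (y.1 + y.2)))⁻¹)
        * ((((τ : ℂ) - Complex.I) ^ (2 * y.1))⁻¹ * (((τ : ℂ) + Complex.I) ^ (2 * y.2))⁻¹))
    have hval : I * (potCoef μ y.1 y.2 * distRatio ε I β t τ ^ y.1
        * (starRingEnd ℂ) (distRatio ε I β t τ) ^ y.2)
        = potCoef μ y.1 y.2 * 2 ^ (y.1 + y.2) * Complex.exp (-(Complex.I * (((y.1 : ℂ) - y.2) * β)))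
        * (I * ((I : ℂ) ^ (2 * (y.1 + y.2)))⁻¹)
        * ((((τ : ℂ) - Complex.I) ^ (2 * y.1))⁻¹ * (((τ : ℂ) + Complex.I) ^ (2 * y.2))⁻¹)
        * (relPos ε t ^ y.1 * (starRingEnd ℂ) (relPos ε t) ^ y.2) := by
      have hc : (starRingEnd ℂ) (distRatio ε I β t τ)
          = 2 * (starRingEnd ℂ) (relPos ε t) * Complex.exp (β * Complex.I)
            / (I ^ 2 * (τ + Complex.I) ^ 2) := by
        simp only [distRatio, map_div₀, map_mul, map_pow, map_sub, Complex.conj_ofReal,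
          Complex.conj_I, map_ofNat, ← Complex.exp_conj, map_neg]
        congr 2
        · congr 1
          ring_nf
        · ring
      have he : Complex.exp (-(Complex.I * (((y.1 : ℂ) - y.2) * β)))
          = Complex.exp (-(β * Complex.I)) ^ y.1 * Complex.exp (β * Complex.I) ^ y.2 := by
        rw [← Complex.exp_nat_mul, ← Complex.exp_nat_mul, ← Complex.exp_add]
        congr 1
        ring
      rw [hc, distRatio, he, div_pow, div_pow, mul_pow, mul_pow, mul_pow, mul_pow, mul_pow,
        mul_pow, mul_add, pow_add, pow_add, ← pow_mul, ← pow_mul, ← pow_mul, ← pow_mul]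
      simp only [div_eq_mul_inv, mul_inv]
      ring
    rw [hval]
    refine hasSum_of_eq hk fun l => ?_
    have he : Complex.exp (Complex.I * (l * σ - ((y.1 : ℂ) - y.2) * β))
        * Complex.exp ((l * I ^ 3 * parabolicTime τ : ℝ) * Complex.I)
        = Complex.exp (-(Complex.I * (((y.1 : ℂ) - y.2) * β)))
          * Complex.exp (l * t * Complex.I) := by
      rw [← Complex.exp_add, ← Complex.exp_add]
      congr 1
      rw [ht]
      push_cast
      ring
    simp only [potentialTerm, parabolicKernel]
    linear_combination (potCoef μ y.1 y.2 * 2 ^ (y.1 + y.2) * keplerCoeff y.1 y.2 l ε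
      * (I * ((I : ℂ) ^ (2 * (y.1 + y.2)))⁻¹)
      * ((((τ : ℂ) - Complex.I) ^ (2 * y.1))⁻¹ * (((τ : ℂ) + Complex.I) ^ (2 * y.2))⁻¹)) * he
  have hz := norm_distRatio_lt (β := β) (t := t) (τ := τ) hε0.le hε (by linarith : (4 : ℝ) ≤ I)
  have htot := (hasSum_potCoef h0 h1 hz).mul_left (I : ℂ)
  have hun := (HasSum.prod_fiberwise hs.hasSum hfib).unique htot
  rw [pertPotential_parabolicTime hI0 β t τ, Complex.ofReal_mul, ← hun]
  exact hs.hasSum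

/-- The expansion of the Melnikov potential for real arguments. -/
lemma integrable_hasSum_melnikovTerm {μ : ℝ} (h0 : 0 ≤ μ) (h1 : μ ≤ 1) (σ β : ℝ) {I ε : ℝ}
    (hI : 5 ≤ I) (hε0 : 0 < ε) (hε1 : ε < 1 / 4) :
    Integrable (fun s => pertPotential μ s β (σ + I ^ 3 * s) I ε) ∧
      HasSum (fun x => melnikovTerm μ x σ β I ε)
        ((∫ s, pertPotential μ s β (σ + I ^ 3 * s) I ε : ℝ) : ℂ) := by
  -- The two ratios of the dominating geometric series explain the thresholds: 24 = 2 · 12 requires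
  -- I ≥ 5, and eε < 1 follows from ε < 1/4.
  have hr : 24 / I ^ 2 < 1 := by
    rw [div_lt_one (by positivity)]
    nlinarith
  have ht : Real.exp 1 * ε < 1 := by
    have := Real.exp_one_lt_three
    nlinarith
  have hb := (summable_geometric_triple (r := 24 / I ^ 2) (by positivity) hr
    (t := Real.exp 1 * ε) (by positivity) ht).mul_left (2 * I)
  have hle := norm_potentialTerm_le h0 h1 σ β (by linarith : 1 ≤ I) hε0
    (by linarith : ε < 1)
  have hsum : ∀ τ, HasSum (fun x => potentialTerm μ σ β I ε x τ)
      ((pertPotential μ (parabolicTime τ) β (σ + I ^ 3 * parabolicTime τ) I ε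
        * ((1 + τ ^ 2) / 2) : ℝ) : ℂ) := fun τ =>
    hasSum_potentialTerm h0 h1 σ β hI hε0 hε1 τ
      (Summable.of_norm_bounded (hb.mul_right ((1 + τ ^ 2)⁻¹)) fun x => hle x τ)
  obtain ⟨hint, hS⟩ := integrable_hasSum_of_bound (fun x =>
    (continuous_parabolicKernel _ _ _ _).const_mul _) hb hle hsum
  have hintR := hint.re
  simp only [RCLike.re_to_complex, Complex.ofReal_re] at hintR
  obtain ⟨a, b⟩ := integral_comp_parabolicTime
    (g := fun s => pertPotential μ s β (σ + I ^ 3 * s) I ε) hintR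
  refine ⟨a, ?_⟩
  rw [b, ← integral_complex_ofReal]
  exact hasSum_of_eq hS fun x => (integral_potentialTerm μ σ β ε (by linarith) x).symm

/-! ## Bounds of the terms -/

/-- The bound of the dependence on the eccentricity of the terms of difference order `m`. -/
noncomputable def modeBound (y z : ℝ) (m : ℤ) : ℝ := if 0 ≤ m then y ^ m.natAbs else z ^ m.natAbs

/-- With j = k + L + m one has P^{j−2k} = P^L P^{−k} P^m. A positive m therefore gives powers of XP
and a negative one powers of X/P, which leaves three independent small ratios. -/
lemma pow_mul_pow_le_modeBound {c P X : ℝ} (hc : 1 ≤ c) (hP : 1 ≤ P) (hX : 0 ≤ X) (j k L : ℕ) :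
    c ^ (j + k) * (P ^ j * (P ^ (2 * k))⁻¹) * X ^ ((j : ℤ) - k - L).natAbs
      ≤ (c * P) ^ L * (c ^ 2 / P) ^ k * modeBound (c * X * P) (c * X / P) ((j : ℤ) - k - L) := by
  have hP0 : 0 < P := by linarith
  rw [modeBound]
  split_ifs with hm
  · obtain ⟨d, hd⟩ := Int.eq_ofNat_of_zero_le hm
    obtain rfl : j = k + L + d := by omega
    rw [hd, Int.natAbs_natCast]
    refine le_of_eq ?_
    rw [div_pow]
    field_simp
    ring
  · obtain ⟨d, hd⟩ := Int.eq_ofNat_of_zero_le (show 0 ≤ -((j : ℤ) - k - L) by omega)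
    have hda : ((j : ℤ) - k - L).natAbs = d := by omega
    rw [hda]
    have hj : j + d = k + L := by omega
    have e1 : P ^ j * P ^ d = P ^ k * P ^ L := by rw [← pow_add, hj, pow_add]
    have e2 : c ^ (j + k) ≤ c ^ (2 * k + L + d) := pow_le_pow_right₀ hc (by omega)
    calc c ^ (j + k) * (P ^ j * (P ^ (2 * k))⁻¹) * X ^ d
        ≤ c ^ (2 * k + L + d) * (P ^ j * (P ^ (2 * k))⁻¹) * X ^ d := by gcongr
      _ = c ^ (2 * k + L + d) * X ^ d * ((P ^ j * P ^ d) * (P ^ (2 * k))⁻¹ * (P ^ d)⁻¹) := by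
          field_simp
      _ = (c * P) ^ L * (c ^ 2 / P) ^ k * (c * X / P) ^ d := by
          rw [e1, div_pow, div_pow]
          field_simp
          ring

/-- The bound of the dependence on the action. -/
noncomputable def actionBound (P E : ℝ) (j k : ℕ) (l : ℤ) : ℝ :=
  if l = 0 then Real.pi * (P * (P ^ (2 * (j + k)))⁻¹)
  else if 0 < l then
    4 * (√P)⁻¹ * (Real.exp 1 * E) ^ l.natAbs * ((2 * P) ^ j * (P ^ (2 * k))⁻¹)
  else 4 * (√P)⁻¹ * (Real.exp 1 * E) ^ l.natAbs * ((2 * P) ^ k * (P ^ (2 * j))⁻¹)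

lemma actionBound_zero (P E : ℝ) (j k : ℕ) :
    actionBound P E j k 0 = Real.pi * (P * (P ^ (2 * (j + k)))⁻¹) := if_pos rfl

lemma actionBound_natCast (P E : ℝ) (j k : ℕ) {L : ℕ} (hL : 1 ≤ L) :
    actionBound P E j k L
      = 4 * (√P)⁻¹ * (Real.exp 1 * E) ^ L * ((2 * P) ^ j * (P ^ (2 * k))⁻¹) := by
  rw [actionBound, if_neg (by omega), if_pos (by omega), Int.natAbs_natCast]

lemma actionBound_neg (P E : ℝ) (j k : ℕ) (l : ℤ) :
    actionBound P E j k (-l) = actionBound P E k j l := by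
  unfold actionBound
  rw [Int.natAbs_neg, add_comm k j]
  rcases lt_trichotomy l 0 with h | h | h
  · simp [h.ne, h, h.not_gt]
  · simp [h]
  · simp [h.ne', h, h.not_gt]

lemma actionBound_pos {P E : ℝ} (hP : 0 < P) (hE : 0 < E) (j k : ℕ) (l : ℤ) :
    0 < actionBound P E j k l := by
  unfold actionBound
  have := Real.pi_pos
  split_ifs <;> positivity

/-- The bound has to hold uniformly near a given action, so Re I is only known to lie between P and
2P: positive powers are paid with 2P, negative ones with P. -/
lemma norm_melnikovIntegral_natCast_le {j k L : ℕ} (hL : 1 ≤ L) {I : ℂ} {P E : ℝ} (hP : 4 ≤ P)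
    (h1 : P ≤ I.re) (h2 : I.re ≤ 2 * P) (hq : |I.im| ≤ 1)
    (hE : Real.exp (-((I ^ 3).re / 3)) ≤ E) :
    ‖melnikovIntegral j k L I‖ ≤ actionBound P E j k L := by
  have hP0 : 0 < P := by linarith
  have hI0 : 0 < I.re := by linarith
  have hE0 : 0 ≤ E := (Real.exp_pos _).le.trans hE
  have h3 := norm_saddleIntegral_le (j := j) (k := k) hL (I := I) (by linarith) (by linarith)
  have h4 : ‖Complex.exp (-(L * (I ^ 3 / 3)))‖ = Real.exp (-((I ^ 3).re / 3)) ^ L := by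
    rw [Complex.norm_exp, ← Real.exp_nat_mul]
    congr 1
    rw [show -((L : ℂ) * (I ^ 3 / 3)) = ((-(L / 3) : ℝ) : ℂ) * I ^ 3 by push_cast; ring,
      Complex.re_ofReal_mul]
    ring
  rw [melnikovIntegral_natCast j k hL, actionBound_natCast P E j k hL, norm_mul, h4]
  calc Real.exp (-((I ^ 3).re / 3)) ^ L * ‖saddleIntegral j k L I‖
      ≤ E ^ L * (4 * Real.exp L * I.re ^ j * (I.re ^ (2 * k))⁻¹ * (√I.re)⁻¹) := by
        gcongr
    _ ≤ E ^ L * (4 * Real.exp L * (2 * P) ^ j * (P ^ (2 * k))⁻¹ * (√P)⁻¹) := by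
        gcongr
    _ = _ := by
        rw [mul_pow (Real.exp 1), ← Real.exp_nat_mul, mul_one]
        ring

lemma norm_melnikovIntegral_zero_le {j k : ℕ} (h : 1 ≤ j + k) {I : ℂ} {P E : ℝ} (hP : 4 ≤ P)
    (h1 : P ≤ I.re) : ‖melnikovIntegral j k 0 I‖ ≤ actionBound P E j k 0 := by
  have hP0 : 0 < P := by linarith
  have hI : P ≤ ‖I‖ := h1.trans (Complex.re_le_norm I)
  have hI0 : 0 < ‖I‖ := by linarith
  rw [melnikovIntegral_zero, actionBound_zero, norm_mul, norm_mul, norm_inv, norm_pow, mul_comm]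
  obtain ⟨n, hn⟩ := Nat.exists_eq_add_of_le h
  have e : ∀ x : ℝ, 0 < x → x * (x ^ (2 * (j + k)))⁻¹ = (x ^ (2 * n + 1))⁻¹ := fun x hx => by
    rw [hn, show 2 * (1 + n) = (2 * n + 1) + 1 by ring, pow_succ]
    field_simp
  rw [e _ hP0, e _ hI0]
  have := norm_rationalIntegral_le h
  gcongr

lemma norm_melnikovIntegral_le {j k : ℕ} (h : 1 ≤ j + k) (l : ℤ) {I : ℂ} {P E : ℝ} (hP : 4 ≤ P)
    (h1 : P ≤ I.re) (h2 : I.re ≤ 2 * P) (hq : |I.im| ≤ 1)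
    (hE : Real.exp (-((I ^ 3).re / 3)) ≤ E) :
    ‖melnikovIntegral j k l I‖ ≤ actionBound P E j k l := by
  rcases lt_trichotomy l 0 with hl | rfl | hl
  · obtain ⟨n, hn⟩ := Int.eq_ofNat_of_zero_le (show 0 ≤ -l by omega)
    obtain rfl : l = -(n : ℤ) := by omega
    rw [melnikovIntegral_neg, actionBound_neg]
    exact norm_melnikovIntegral_natCast_le (by omega) hP h1 h2 hq hE
  · exact norm_melnikovIntegral_zero_le h hP h1
  · obtain ⟨n, rfl⟩ := Int.eq_ofNat_of_zero_le hl.le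
    exact norm_melnikovIntegral_natCast_le (by omega) hP h1 h2 hq hE

/-- The order in the eccentricity. -/
def eccOrder (x : (ℕ × ℕ) × ℤ) : ℤ := (x.1.1 : ℤ) - x.1.2 - x.2

/-- The bound of the terms of the series. -/
noncomputable def termBound (s P E X : ℝ) (x : (ℕ × ℕ) × ℤ) : ℝ :=
  Real.exp (s * x.2.natAbs) * 3 ^ (x.1.1 + x.1.2)
    * (2 ^ (x.1.1 + x.1.2) * actionBound P E x.1.1 x.1.2 x.2)
    * (2 * (12 ^ (x.1.1 + x.1.2) * (3 * X) ^ (eccOrder x).natAbs))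

/-- The exchange of the two indices. -/
def swapIndex (x : (ℕ × ℕ) × ℤ) : (ℕ × ℕ) × ℤ := ((x.1.2, x.1.1), -x.2)

lemma termBound_swapIndex (s P E X : ℝ) (x : (ℕ × ℕ) × ℤ) :
    termBound s P E X (swapIndex x) = termBound s P E X x := by
  have : (eccOrder (swapIndex x)).natAbs = (eccOrder x).natAbs := by
    simp only [eccOrder, swapIndex]
    omega
  simp only [termBound, this]
  simp only [swapIndex, actionBound_neg, Int.natAbs_neg, add_comm x.1.2 x.1.1]

/-- Exchanging j with k and reversing l only reverses both angles, as each coefficient has this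
symmetry. It is used throughout to deduce negative orders from positive ones. -/
lemma melnikovTerm_swapIndex (μ : ℝ) (x : (ℕ × ℕ) × ℤ) (σ β I ε : ℂ) :
    melnikovTerm μ (swapIndex x) σ β I ε = melnikovTerm μ x (-σ) (-β) I ε := by
  have h : potCoef μ x.1.2 x.1.1 = potCoef μ x.1.1 x.1.2 := by
    simp only [potCoef, add_comm x.1.2 x.1.1, mul_comm (legCoef x.1.2)]
  simp only [melnikovTerm, swapIndex, keplerCoeff_neg, melnikovIntegral_neg, h,
    add_comm x.1.2 x.1.1]
  congr 3
  push_cast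
  ring

lemma norm_exp_sigma_le {s : ℝ} {σ : ℂ} (hσ : |σ.im| ≤ s) (l : ℤ) :
    ‖Complex.exp (Complex.I * (l * σ))‖ ≤ Real.exp (s * l.natAbs) := by
  rw [Complex.norm_exp]
  refine Real.exp_le_exp.2 ?_
  have e : (Complex.I * (l * σ)).re = -(l * σ.im) := by
    simp
  rw [e, Nat.cast_natAbs, Int.cast_abs]
  calc -(l * σ.im) ≤ |(l : ℝ) * σ.im| := neg_le_abs _
    _ = |σ.im| * |(l : ℝ)| := by rw [abs_mul, mul_comm]
    _ ≤ s * |(l : ℝ)| := by gcongr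

lemma norm_exp_beta_le {β : ℂ} (hβ : |β.im| ≤ 1) (j k : ℕ) :
    ‖Complex.exp (-(Complex.I * (((j : ℂ) - k) * β)))‖ ≤ 3 ^ (j + k) := by
  rw [Complex.norm_exp]
  have e : (-(Complex.I * (((j : ℂ) - k) * β))).re = ((j : ℝ) - k) * β.im := by
    simp
  have h : ((j : ℝ) - k) * β.im ≤ (j + k : ℕ) * 1 := by
    refine (le_abs_self _).trans ?_
    rw [abs_mul]
    have : |(j : ℝ) - k| ≤ (j + k : ℕ) := by
      push_cast
      refine (abs_sub _ _).trans (le_of_eq ?_)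
      rw [abs_of_nonneg (Nat.cast_nonneg j), abs_of_nonneg (Nat.cast_nonneg k)]
    gcongr
  rw [e]
  calc Real.exp (((j : ℝ) - k) * β.im) ≤ Real.exp ((j + k : ℕ) * 1) := Real.exp_le_exp.2 h
    _ = Real.exp 1 ^ (j + k) := Real.exp_nat_mul _ _
    _ ≤ 3 ^ (j + k) := by
        gcongr
        exact Real.exp_one_lt_three.le

lemma norm_keplerCoeff_le_three {j k : ℕ} {l : ℤ} {ε : ℂ} {X : ℝ} (hX : 0 < X) (hX1 : X < 1)
    (hε : ‖ε‖ ≤ X) :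
    ‖keplerCoeff j k l ε‖ ≤ 2 * (12 ^ (j + k) * (3 * X) ^ (eccOrder ((j, k), l)).natAbs) := by
  refine (norm_keplerCoeff_le_geometric hX hX1 hε).trans ?_
  have := Real.exp_one_lt_three.le
  simp only [eccOrder]
  gcongr

lemma norm_actionFactor_le {μ : ℝ} (h0 : 0 ≤ μ) (h1 : μ ≤ 1) (j k : ℕ) (l : ℤ) {I : ℂ} {P E : ℝ}
    (hP : 4 ≤ P) (hI1 : P ≤ I.re) (hI2 : I.re ≤ 2 * P) (hq : |I.im| ≤ 1)
    (hE : Real.exp (-((I ^ 3).re / 3)) ≤ E) :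
    ‖(potCoef μ j k : ℂ) * 2 ^ (j + k) * melnikovIntegral j k l I‖
      ≤ 2 ^ (j + k) * actionBound P E j k l := by
  have hpos := actionBound_pos (by linarith : 0 < P) ((Real.exp_pos _).trans_le hE) j k l
  rcases Nat.lt_or_ge (j + k) 1 with h | h
  · rw [potCoef_eq_zero (by omega)]
    simp
    positivity
  · rw [norm_mul, norm_mul, norm_pow, Complex.norm_ofNat, Complex.norm_real, Real.norm_eq_abs]
    have := norm_melnikovIntegral_le h l hP hI1 hI2 hq hE
    have := abs_potCoef_le h0 h1 j k
    calc |potCoef μ j k| * 2 ^ (j + k) * ‖melnikovIntegral j k l I‖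
        ≤ 1 * 2 ^ (j + k) * actionBound P E j k l := by gcongr
      _ = _ := by ring

lemma melnikovTerm_eq (μ : ℝ) (x : (ℕ × ℕ) × ℤ) (σ β I ε : ℂ) :
    melnikovTerm μ x σ β I ε = Complex.exp (Complex.I * (x.2 * σ))
      * Complex.exp (-(Complex.I * (((x.1.1 : ℂ) - x.1.2) * β)))
      * ((potCoef μ x.1.1 x.1.2 : ℂ) * 2 ^ (x.1.1 + x.1.2) * melnikovIntegral x.1.1 x.1.2 x.2 I)
      * keplerCoeff x.1.1 x.1.2 x.2 ε := by
  rw [melnikovTerm, mul_sub, sub_eq_add_neg, Complex.exp_add]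
  ring

lemma norm_melnikovTerm_le {μ : ℝ} (h0 : 0 ≤ μ) (h1 : μ ≤ 1) (x : (ℕ × ℕ) × ℤ) {σ β I ε : ℂ}
    {s P E X : ℝ} (hσ : |σ.im| ≤ s) (hβ : |β.im| ≤ 1) (hP : 4 ≤ P) (hI1 : P ≤ I.re)
    (hI2 : I.re ≤ 2 * P) (hq : |I.im| ≤ 1) (hE : Real.exp (-((I ^ 3).re / 3)) ≤ E)
    (hX : 0 < X) (hX1 : X < 1) (hε : ‖ε‖ ≤ X) :
    ‖melnikovTerm μ x σ β I ε‖ ≤ termBound s P E X x := by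
  have a1 := norm_exp_sigma_le hσ x.2
  have a2 := norm_exp_beta_le hβ x.1.1 x.1.2
  have a3 := norm_actionFactor_le h0 h1 x.1.1 x.1.2 x.2 hP hI1 hI2 hq hE
  have a4 := norm_keplerCoeff_le_three (j := x.1.1) (k := x.1.2) (l := x.2) hX hX1 hε
  have := actionBound_pos (by linarith : 0 < P) ((Real.exp_pos _).trans_le hE) x.1.1 x.1.2 x.2
  rw [melnikovTerm_eq, norm_mul, norm_mul, norm_mul, termBound]
  gcongr

/-- The weight of the series that dominates the expansion. -/
noncomputable def indexWeight (x : (ℕ × ℕ) × ℤ) : ℝ := (1 / 2) ^ (x.1.1 + x.1.2) * (1 / 2) ^ x.2.natAbs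

lemma indexWeight_pos (x : (ℕ × ℕ) × ℤ) : 0 < indexWeight x := by
  unfold indexWeight
  positivity

lemma indexWeight_swapIndex (x : (ℕ × ℕ) × ℤ) : indexWeight (swapIndex x) = indexWeight x := by
  simp only [indexWeight, swapIndex, Int.natAbs_neg, add_comm x.1.2 x.1.1]

lemma summable_indexWeight : Summable indexWeight := by
  have h1 := summable_pow_add (r := 1 / 2) (by norm_num) (by norm_num)
  have h2 := summable_pow_natAbs (r := 1 / 2) (by norm_num) (by norm_num)
  have h3 := h1.mul_of_nonneg h2 (fun _ => by positivity) (fun _ => by positivity)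
  exact h3

/-- The conditions on the parameters under which the expansion converges. -/
structure SmallParams (s P E X : ℝ) : Prop where
  width_nonneg : 0 ≤ s
  le_action : 100000 ≤ P
  exp_pos : 0 < E
  ecc_pos : 0 < X
  exp_le : 144 * Real.exp (s + 1) * P * E ≤ 1 / 4
  ecc_le : 432 * X * P ≤ 1 / 4

/-- Of the n small factors, N are kept as a gain and the others are given up for summability. -/
lemma pow_le_of_le_quarter {a : ℝ} (h0 : 0 ≤ a) (h1 : a ≤ 1 / 4) {N n : ℕ} (h : N ≤ n) :
    a ^ n ≤ (4 * a) ^ N * (1 / 4) ^ n := by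
  obtain ⟨d, rfl⟩ := Nat.exists_eq_add_of_le h
  have : (4 * a) ^ N * (1 / 4 : ℝ) ^ (N + d) = a ^ N * (1 / 4) ^ d := by
    rw [pow_add, ← mul_assoc, ← mul_pow]
    congr 2
    ring
  rw [this, pow_add]
  gcongr

/-- The index j is not free: j ≤ k + L + |m|, so j + k + L is at most twice the exponent on the
left. This is why the base is the square of 1/2. -/
lemma quarter_pow_le_indexWeight (j k L : ℕ) :
    (1 / 4 : ℝ) ^ L * (1 / 4) ^ k * (1 / 4) ^ (eccOrder ((j, k), (L : ℤ))).natAbs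
      ≤ indexWeight ((j, k), (L : ℤ)) := by
  have h4 : (1 / 4 : ℝ) = (1 / 2) ^ 2 := by norm_num
  rw [indexWeight, h4, ← pow_mul, ← pow_mul, ← pow_mul, ← pow_add, ← pow_add, ← pow_add]
  refine pow_le_pow_of_le_one (by norm_num) (by norm_num) ?_
  simp only [eccOrder, Int.natAbs_natCast]
  omega

/-- The constant 144 = 3 · 2 · 2 · 12 collects the complex strip in β, the power of 2 of the
expansion, the interval [P, 2P] of actions and the Kepler coefficients; 432 = 144 · 3 is attached to
the eccentricity. -/
lemma termBound_natCast_le {s P E X : ℝ} (h : SmallParams s P E X) (j k : ℕ) {L : ℕ} (hL : 1 ≤ L) :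
    termBound s P E X ((j, k), (L : ℤ))
      ≤ 8 * (√P)⁻¹ * (144 * Real.exp (s + 1) * P * E) ^ L * (144 ^ 2 / P) ^ k
        * modeBound (432 * X * P) (432 * X / P) (eccOrder ((j, k), (L : ℤ))) := by
  have hP := h.le_action
  have hP0 : 0 < P := by linarith
  have hX := h.ecc_pos
  have hE := h.exp_pos
  have hm := pow_mul_pow_le_modeBound (c := 144) (P := P) (X := 3 * X) (by norm_num) (by linarith)
    (by positivity) j k L
  rw [show 144 * (3 * X) = 432 * X by ring] at hm
  have h2 : (2 : ℝ) ^ j ≤ 2 ^ (j + k) := pow_le_pow_right₀ (by norm_num) (by omega)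
  have e144 : (144 : ℝ) ^ (j + k) = 3 ^ (j + k) * 2 ^ (j + k) * 2 ^ (j + k) * 12 ^ (j + k) := by
    rw [← mul_pow, ← mul_pow, ← mul_pow]
    norm_num
  have ea : Real.exp (s * L) * Real.exp 1 ^ L = Real.exp (s + 1) ^ L := by
    rw [← Real.exp_nat_mul, ← Real.exp_nat_mul, ← Real.exp_add]
    congr 1
    ring
  simp only [termBound, actionBound_natCast P E j k hL, Int.natAbs_natCast]
  simp only [eccOrder] at *
  calc Real.exp (s * L) * 3 ^ (j + k) * (2 ^ (j + k) * (4 * (√P)⁻¹ * (Real.exp 1 * E) ^ L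
          * ((2 * P) ^ j * (P ^ (2 * k))⁻¹)))
        * (2 * (12 ^ (j + k) * (3 * X) ^ ((j : ℤ) - k - L).natAbs))
      = 8 * (√P)⁻¹ * (Real.exp (s * L) * Real.exp 1 ^ L) * E ^ L
        * ((3 ^ (j + k) * 2 ^ (j + k) * 2 ^ j * 12 ^ (j + k)) * (P ^ j * (P ^ (2 * k))⁻¹)
          * (3 * X) ^ ((j : ℤ) - k - L).natAbs) := by
        rw [mul_pow, mul_pow 2 P]
        ring
    _ ≤ 8 * (√P)⁻¹ * (Real.exp (s * L) * Real.exp 1 ^ L) * E ^ L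
        * (144 ^ (j + k) * (P ^ j * (P ^ (2 * k))⁻¹)
          * (3 * X) ^ ((j : ℤ) - k - L).natAbs) := by
        rw [e144]
        gcongr
    _ ≤ 8 * (√P)⁻¹ * (Real.exp (s * L) * Real.exp 1 ^ L) * E ^ L
        * ((144 * P) ^ L * (144 ^ 2 / P) ^ k
          * modeBound (432 * X * P) (432 * X / P) ((j : ℤ) - k - L)) := by
        gcongr
    _ = _ := by
        rw [ea, show 144 * Real.exp (s + 1) * P * E = Real.exp (s + 1) * E * (144 * P) by ring,
          mul_pow (Real.exp (s + 1) * E), mul_pow (Real.exp (s + 1)) E]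
        ring

/-- The first inequality needs P ≥ 4 · 144² = 82944, which explains the number 100000. -/
lemma SmallParams.le_quarter {s P E X : ℝ} (h : SmallParams s P E X) :
    144 ^ 2 / P ≤ 1 / 4 ∧ 432 * X / P ≤ 432 * X * P := by
  have hP := h.le_action
  have hP0 : 0 < P := by linarith
  have hX := h.ecc_pos
  constructor
  · rw [div_le_iff₀ hP0]
    linarith
  · rw [div_le_iff₀ hP0]
    have h1 : 0 < 432 * X := by positivity
    have h2 : 1 ≤ P * P := by nlinarith
    nlinarith

lemma modeBound_le {y z : ℝ} (hy0 : 0 ≤ y) (hz0 : 0 ≤ z) (hy : y ≤ 1 / 4) (hz : z ≤ y) {d : ℕ}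
    {m : ℤ} (hd : d ≤ m.natAbs) : modeBound y z m ≤ (4 * y) ^ d * (1 / 4) ^ m.natAbs := by
  have h1 := pow_le_of_le_quarter hy0 hy hd
  rw [modeBound]
  split_ifs
  · exact h1
  · exact (pow_le_pow_left₀ hz0 hz _).trans h1

/-- The bound of the terms of positive order in `σ`. -/
lemma termBound_natCast_le_weight {s P E X : ℝ} (h : SmallParams s P E X) {j k L L₀ k₀ d : ℕ}
    (hL : 1 ≤ L) (hL₀ : L₀ ≤ L) (hk : k₀ ≤ k) (hd : d ≤ (eccOrder ((j, k), (L : ℤ))).natAbs) :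
    termBound s P E X ((j, k), (L : ℤ))
      ≤ 8 * (√P)⁻¹ * (4 * (144 * Real.exp (s + 1) * P * E)) ^ L₀ * (4 * (144 ^ 2 / P)) ^ k₀
        * (4 * (432 * X * P)) ^ d * indexWeight ((j, k), (L : ℤ)) := by
  have hP := h.le_action
  have hP0 : 0 < P := by linarith
  have hX := h.ecc_pos
  have hE := h.exp_pos
  obtain ⟨hk4, hz⟩ := h.le_quarter
  have b1 := pow_le_of_le_quarter (by positivity) h.exp_le hL₀
  have b2 := pow_le_of_le_quarter (by positivity) hk4 hk
  have b3 := modeBound_le (by positivity) (by positivity) h.ecc_le hz hd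
  refine (termBound_natCast_le h j k hL).trans ?_
  calc _ ≤ 8 * (√P)⁻¹ * ((4 * (144 * Real.exp (s + 1) * P * E)) ^ L₀ * (1 / 4) ^ L)
        * ((4 * (144 ^ 2 / P)) ^ k₀ * (1 / 4) ^ k)
        * ((4 * (432 * X * P)) ^ d * (1 / 4) ^ (eccOrder ((j, k), (L : ℤ))).natAbs) := by
        have : 0 ≤ modeBound (432 * X * P) (432 * X / P) (eccOrder ((j, k), (L : ℤ))) := by
          unfold modeBound
          split_ifs <;> positivity
        gcongr
    _ = 8 * (√P)⁻¹ * (4 * (144 * Real.exp (s + 1) * P * E)) ^ L₀ * (4 * (144 ^ 2 / P)) ^ k₀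
        * (4 * (432 * X * P)) ^ d
        * ((1 / 4 : ℝ) ^ L * (1 / 4) ^ k * (1 / 4) ^ (eccOrder ((j, k), (L : ℤ))).natAbs) := by ring
    _ ≤ _ := by
        gcongr
        exact quarter_pow_le_indexWeight j k L

/-- The bound of the terms of positive order in `σ` and negative order in the eccentricity. -/
lemma termBound_natCast_le_weight_of_neg {s P E X : ℝ} (h : SmallParams s P E X) {j k L k₀ : ℕ}
    (hL : 1 ≤ L) (hk : k₀ ≤ k) (hm : eccOrder ((j, k), (L : ℤ)) < 0) :
    termBound s P E X ((j, k), (L : ℤ))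
      ≤ 8 * (√P)⁻¹ * (4 * (144 * Real.exp (s + 1) * P * E)) * (4 * (144 ^ 2 / P)) ^ k₀
        * (4 * (432 * X / P)) * indexWeight ((j, k), (L : ℤ)) := by
  have hP := h.le_action
  have hP0 : 0 < P := by linarith
  have hX := h.ecc_pos
  have hE := h.exp_pos
  obtain ⟨hk4, hz⟩ := h.le_quarter
  have b1 := pow_le_of_le_quarter (by positivity) h.exp_le hL
  have b2 := pow_le_of_le_quarter (by positivity) hk4 hk
  have b3 := pow_le_of_le_quarter (a := 432 * X / P) (by positivity) (hz.trans h.ecc_le)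
    (show 1 ≤ (eccOrder ((j, k), (L : ℤ))).natAbs by omega)
  rw [pow_one] at b1 b3
  refine (termBound_natCast_le h j k hL).trans ?_
  rw [modeBound, if_neg (by omega)]
  calc _ ≤ 8 * (√P)⁻¹ * ((4 * (144 * Real.exp (s + 1) * P * E)) * (1 / 4) ^ L)
        * ((4 * (144 ^ 2 / P)) ^ k₀ * (1 / 4) ^ k)
        * ((4 * (432 * X / P)) * (1 / 4) ^ (eccOrder ((j, k), (L : ℤ))).natAbs) := by
        gcongr
    _ = 8 * (√P)⁻¹ * (4 * (144 * Real.exp (s + 1) * P * E)) * (4 * (144 ^ 2 / P)) ^ k₀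
        * (4 * (432 * X / P))
        * ((1 / 4 : ℝ) ^ L * (1 / 4) ^ k * (1 / 4) ^ (eccOrder ((j, k), (L : ℤ))).natAbs) := by ring
    _ ≤ _ := by
        gcongr
        exact quarter_pow_le_indexWeight j k L

/-- The bound of the terms of order zero in `σ`. -/
lemma termBound_zero_le_weight {s P E X : ℝ} (h : SmallParams s P E X) {j k N d : ℕ}
    (hN : N ≤ j + k) (hd : d ≤ (eccOrder ((j, k), 0)).natAbs) :
    termBound s P E X ((j, k), 0)
      ≤ 2 * Real.pi * P * (144 / P ^ 2) ^ N * (3 * X) ^ d * indexWeight ((j, k), 0) := by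
  have hP := h.le_action
  have hP0 : 0 < P := by linarith
  have hX := h.ecc_pos
  have hX1 : 3 * X ≤ 1 := by
    have := h.ecc_le
    nlinarith
  have e : (3 : ℝ) ^ (j + k) * 2 ^ (j + k) * 12 ^ (j + k) = 72 ^ (j + k) := by
    rw [← mul_pow, ← mul_pow]
    norm_num
  have h72 : (144 / P ^ 2) / 2 ≤ 1 / 2 := by
    have : 144 / P ^ 2 ≤ 1 := by
      rw [div_le_one (by positivity)]
      nlinarith
    linarith
  -- The constant 72 is 3 · 2 · 12. Doubling it to 144 sets aside a factor 1/2 for each unit of j +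
  -- k, that is, the weight.
  have b1 : (72 / P ^ 2) ^ (j + k) ≤ (144 / P ^ 2) ^ N * (1 / 2) ^ (j + k) := by
    rw [show 72 / P ^ 2 = (144 / P ^ 2) * (1 / 2) by ring, mul_pow]
    have := pow_le_pow_of_le_one (by positivity) (by linarith : 144 / P ^ 2 ≤ 1) hN
    gcongr
  have b2 : (3 * X) ^ (eccOrder ((j, k), 0)).natAbs ≤ (3 * X) ^ d :=
    pow_le_pow_of_le_one (by positivity) hX1 hd
  simp only [termBound, actionBound_zero, indexWeight]
  simp only [Int.natAbs_zero, Nat.cast_zero, mul_zero, Real.exp_zero, one_mul, pow_zero, mul_one]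
  calc (3 : ℝ) ^ (j + k) * (2 ^ (j + k) * (Real.pi * (P * (P ^ (2 * (j + k)))⁻¹)))
        * (2 * (12 ^ (j + k) * (3 * X) ^ (eccOrder ((j, k), 0)).natAbs))
      = 2 * Real.pi * P * ((3 ^ (j + k) * 2 ^ (j + k) * 12 ^ (j + k)) / (P ^ 2) ^ (j + k))
        * (3 * X) ^ (eccOrder ((j, k), 0)).natAbs := by
        rw [pow_mul]
        ring
    _ = 2 * Real.pi * P * (72 / P ^ 2) ^ (j + k) * (3 * X) ^ (eccOrder ((j, k), 0)).natAbs := by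
        rw [e, div_pow]
    _ ≤ 2 * Real.pi * P * ((144 / P ^ 2) ^ N * (1 / 2) ^ (j + k)) * (3 * X) ^ d := by
        have := Real.pi_pos
        gcongr
    _ = _ := by ring

lemma termBound_le_indexWeight {s P E X : ℝ} (h : SmallParams s P E X) (x : (ℕ × ℕ) × ℤ) :
    termBound s P E X x ≤ 8 * P * indexWeight x := by
  have hP := h.le_action
  have hw := indexWeight_pos x
  have hpos : ∀ (j k L : ℕ), 1 ≤ L →
      termBound s P E X ((j, k), (L : ℤ)) ≤ 8 * P * indexWeight ((j, k), (L : ℤ)) := by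
    intro j k L hL
    refine (termBound_natCast_le_weight h hL (Nat.zero_le _) (Nat.zero_le _) (Nat.zero_le _)).trans ?_
    simp only [pow_zero, mul_one]
    have := indexWeight_pos ((j, k), (L : ℤ))
    have h1 := sqrt_inv_le_one (p := P) (by linarith)
    gcongr
    linarith
  obtain ⟨⟨j, k⟩, l⟩ := x
  rcases lt_trichotomy l 0 with hl | rfl | hl
  · obtain ⟨n, hn⟩ := Int.eq_ofNat_of_zero_le (show 0 ≤ -l by omega)
    obtain rfl : l = -(n : ℤ) := by omega
    have := hpos k j n (by omega)
    rw [← termBound_swapIndex, ← indexWeight_swapIndex] at this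
    exact this
  · refine (termBound_zero_le_weight h (Nat.zero_le _) (Nat.zero_le _)).trans ?_
    simp only [pow_zero, mul_one]
    have := Real.pi_le_four
    gcongr
    linarith
  · obtain ⟨n, rfl⟩ := Int.eq_ofNat_of_zero_le hl.le
    exact hpos j k n (by omega)

lemma summable_termBound {s P E X : ℝ} (h : SmallParams s P E X) :
    Summable (termBound s P E X) := by
  have hP : 0 < P := by linarith [h.le_action]
  refine Summable.of_nonneg_of_le (fun x => ?_) (termBound_le_indexWeight h)
    (summable_indexWeight.mul_left _)
  have := (actionBound_pos hP h.exp_pos x.1.1 x.1.2 x.2).le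
  have := h.ecc_pos.le
  unfold termBound
  positivity

/-! ## Analyticity of the series -/

/-- The lower bound of the actions. -/
noncomputable def actionThreshold (s : ℝ) : ℝ := 100000 * Real.exp (s + 1)

lemma le_actionThreshold {s : ℝ} (hs : 0 ≤ s) : 100000 ≤ actionThreshold s := by
  have := Real.add_one_le_exp (s + 1)
  rw [actionThreshold]
  linarith

/-- As E ≤ 4/P³ and X ≤ 16/P³, both smallness conditions reduce to a constant over P². The factor
exp(s + 1), the cost of the strip in σ, is compensated by its presence in the threshold. -/
lemma smallParams_of_le {s P E X : ℝ} (hs : 0 ≤ s) (hP : actionThreshold s ≤ P) (hE0 : 0 < E)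
    (hE : E ≤ Real.exp (-(P ^ 3 / 4))) (hX0 : 0 < X) (hX : X * P ^ 3 ≤ 16) :
    SmallParams s P E X := by
  have h1 := le_actionThreshold hs
  have hP1 : 100000 ≤ P := h1.trans hP
  have hP0 : 0 < P := by linarith
  have hα : 1 ≤ Real.exp (s + 1) := Real.one_le_exp (by linarith)
  rw [actionThreshold] at hP
  set α := Real.exp (s + 1)
  have hE4 : E ≤ 4 / P ^ 3 := by
    refine hE.trans ?_
    rw [Real.exp_neg, show 4 / P ^ 3 = (P ^ 3 / 4)⁻¹ by rw [inv_div]]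
    have := Real.add_one_le_exp (P ^ 3 / 4)
    exact inv_anti₀ (by positivity) (by linarith)
  have hX4 : X ≤ 16 / P ^ 3 := by rwa [le_div_iff₀ (by positivity)]
  refine ⟨hs, hP1, hE0, hX0, ?_, ?_⟩
  · calc 144 * α * P * E ≤ 144 * α * P * (4 / P ^ 3) := by gcongr
      _ = 576 * α / P ^ 2 := by
        field_simp
        norm_num
      _ ≤ 1 / 4 := by
        rw [div_le_iff₀ (by positivity)]
        nlinarith
  · calc 432 * X * P ≤ 432 * (16 / P ^ 3) * P := by gcongr
      _ = 6912 / P ^ 2 := by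
        field_simp
        norm_num
      _ ≤ 1 / 4 := by
        rw [div_le_iff₀ (by positivity)]
        nlinarith

/-- Here Re I³ = p³ − 3pq² with |q| ≤ 1, and the loss is at most a quarter of p³ once p² ≥ 12. The
constant 1/3 in the exponential thereby becomes 1/4 in terms of Re I. -/
lemma re_cube_ge {I : ℂ} (hq : |I.im| ≤ 1) (hI : 10 ≤ I.re) : 3 / 4 * I.re ^ 3 ≤ (I ^ 3).re := by
  have e : (I ^ 3).re = I.re ^ 3 - 3 * I.re * I.im ^ 2 := by
    simp [pow_succ]
    ring
  have h2 : I.im ^ 2 ≤ 1 := by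
    rw [← sq_abs]
    exact pow_le_one₀ (abs_nonneg _) hq
  rw [e]
  nlinarith [mul_le_mul_of_nonneg_left h2 (by linarith : 0 ≤ I.re),
    mul_nonneg (by linarith : 0 ≤ I.re) (by nlinarith : 0 ≤ I.re ^ 2 - 12)]

/-- The modulus of the exponentially small factor. -/
noncomputable def expFactor (I : ℂ) : ℝ := Real.exp (-((I ^ 3).re / 3))

lemma expFactor_le {I : ℂ} (hq : |I.im| ≤ 1) {P : ℝ} (h0 : 10 ≤ P) (hI : P ≤ I.re) :
    expFactor I ≤ Real.exp (-(P ^ 3 / 4)) := by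
  refine Real.exp_le_exp.2 ?_
  have := re_cube_ge hq (h0.trans hI)
  have : P ^ 3 ≤ I.re ^ 3 := by gcongr
  linarith

lemma differentiableAt_melnikovIntegral (j k : ℕ) (l : ℤ) {I : ℂ} (hI : 4 < I.re)
    (hq : |I.im| < 2) : DifferentiableAt ℂ (melnikovIntegral j k l) I := by
  have hI0 : I ≠ 0 := by
    rintro rfl
    simp at hI
    linarith
  have hpos : ∀ (j k n : ℕ), 1 ≤ n → DifferentiableAt ℂ (melnikovIntegral j k (n : ℤ)) I := by
    intro j k n hn
    have h1 := differentiableAt_saddleIntegral (j := j) (k := k) hn hI hq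
    rw [show melnikovIntegral j k (n : ℤ) = fun I => Complex.exp (-(n * (I ^ 3 / 3)))
      * saddleIntegral j k n I from funext (melnikovIntegral_natCast j k hn)]
    fun_prop
  rcases lt_trichotomy l 0 with hl | rfl | hl
  · obtain ⟨n, hn⟩ := Int.eq_ofNat_of_zero_le (show 0 ≤ -l by omega)
    obtain rfl : l = -(n : ℤ) := by omega
    rw [show melnikovIntegral j k (-(n : ℤ)) = melnikovIntegral k j (n : ℤ) from
      funext (melnikovIntegral_neg j k n)]
    exact hpos k j n (by omega)
  · rw [show melnikovIntegral j k 0 = fun I => I * (I ^ (2 * (j + k)))⁻¹ * rationalIntegral j k from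
      funext (melnikovIntegral_zero j k)]
    have := pow_ne_zero (2 * (j + k)) hI0
    fun_prop (disch := assumption)
  · obtain ⟨n, rfl⟩ := Int.eq_ofNat_of_zero_le hl.le
    exact hpos j k n (by omega)

/-- The domain of convergence of the series. -/
def coreDomain (s : ℝ) : Set (ℂ × ℂ × ℂ × ℂ) :=
  {p | |p.1.im| < s ∧ |p.2.1.im| < 1 ∧ |p.2.2.1.im| < 1 ∧ actionThreshold s < p.2.2.1.re ∧
    ‖p.2.2.2‖ * p.2.2.1.re ^ 3 < 8}

/-- Each term is a product of four functions of one variable. On a small ball around p the product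
of their bounds is a summable `termBound`, so the criterion for sums of products applies. -/
lemma analyticAt_melnikovSeries {μ : ℝ} (h0 : 0 ≤ μ) (h1 : μ ≤ 1) {s : ℝ}
    {p : ℂ × ℂ × ℂ × ℂ} (hp : p ∈ coreDomain s) : AnalyticAt ℂ (melnikovSeries μ) p := by
  obtain ⟨σ, β, I, ε⟩ := p
  obtain ⟨hσ, hβ, hq, hI, hε⟩ := hp
  simp only at hσ hβ hq hI hε
  have hs : 0 ≤ s := (abs_nonneg _).trans hσ.le
  have hth := le_actionThreshold hs
  have hre : 100000 < I.re := by linarith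
  have hre0 : 0 < I.re := by linarith
  -- The radius keeps every variable inside its domain. The last condition gives |ε'| (Re I)³ ≤ 8 +
  -- 1 on the ball, within the bound 16 allowed by the estimates.
  obtain ⟨R, hR0, hRσ, hRβ, hRq, hRI, hRε⟩ : ∃ R : ℝ, 0 < R ∧ R ≤ s - |σ.im| ∧ R ≤ 1 - |β.im| ∧
      R ≤ 1 - |I.im| ∧ R ≤ I.re - actionThreshold s ∧ R ≤ (I.re ^ 3)⁻¹ := by
    refine ⟨min (s - |σ.im|) (min (1 - |β.im|) (min (1 - |I.im|)
      (min (I.re - actionThreshold s) (I.re ^ 3)⁻¹))), ?_, ?_, ?_, ?_, ?_, ?_⟩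
    · simp only [lt_min_iff]
      exact ⟨by linarith, by linarith, by linarith, by linarith, by positivity⟩
    all_goals simp
  have hR1 : R ≤ 1 := by linarith [abs_nonneg β.im]
  have him : ∀ {z₀ z : ℂ} {c : ℝ}, R ≤ c - |z₀.im| → z ∈ Metric.ball z₀ R → |z.im| ≤ c := by
    intro z₀ z c hc hz
    have h2 := Complex.abs_im_le_norm (z - z₀)
    rw [mem_ball_iff_norm] at hz
    rw [Complex.sub_im] at h2
    have h3 := abs_sub_abs_le_abs_sub z.im z₀.im
    linarith
  set P := I.re - R with hP
  have hPre : ∀ z ∈ Metric.ball I R, P ≤ z.re ∧ z.re ≤ 2 * P := by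
    intro z hz
    have h2 := Complex.abs_re_le_norm (z - I)
    rw [mem_ball_iff_norm] at hz
    rw [Complex.sub_re] at h2
    obtain ⟨h3, h4⟩ := abs_le.1 (h2.trans hz.le)
    constructor <;> linarith
  have hP1 : actionThreshold s ≤ P := by linarith
  set E := Real.exp (-(P ^ 3 / 4)) with hE
  set X := ‖ε‖ + R with hX
  have hX0 : 0 < X := by positivity
  have hXP : X * P ^ 3 ≤ 16 := by
    have e1 : P ^ 3 ≤ I.re ^ 3 := by
      have : 0 ≤ P := by linarith
      gcongr
      linarith
    have e2 : R * I.re ^ 3 ≤ 1 := by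
      calc R * I.re ^ 3 ≤ (I.re ^ 3)⁻¹ * I.re ^ 3 := by gcongr
        _ = 1 := inv_mul_cancel₀ (by positivity)
    calc X * P ^ 3 ≤ X * I.re ^ 3 := by gcongr
      _ ≤ 16 := by
        rw [hX]
        linarith
  have hsm := smallParams_of_le hs hP1 (Real.exp_pos _) le_rfl hX0 hXP
  have hX1 : X < 1 / 2 := by
    have := hsm.ecc_le
    have := hsm.le_action
    nlinarith
  have hεX : ∀ z ∈ Metric.ball ε R, ‖z‖ ≤ X := by
    intro z hz
    rw [mem_ball_iff_norm] at hz
    have := norm_le_norm_add_norm_sub' z ε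
    rw [hX]
    linarith
  have hPpos : 0 < P := by linarith
  have main := analyticAt_tsum_prod_four (N := (ℕ × ℕ) × ℤ)
    (f₁ := fun x σ => Complex.exp (Complex.I * (x.2 * σ)))
    (f₂ := fun x β => Complex.exp (-(Complex.I * (((x.1.1 : ℂ) - x.1.2) * β))))
    (f₃ := fun x I =>
      (potCoef μ x.1.1 x.1.2 : ℂ) * 2 ^ (x.1.1 + x.1.2) * melnikovIntegral x.1.1 x.1.2 x.2 I)
    (f₄ := fun x ε => keplerCoeff x.1.1 x.1.2 x.2 ε)
    (z₁ := σ) (z₂ := β) (z₃ := I) (z₄ := ε) hR0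
    (B₁ := fun x => Real.exp (s * x.2.natAbs)) (B₂ := fun x => 3 ^ (x.1.1 + x.1.2))
    (B₃ := fun x => 2 ^ (x.1.1 + x.1.2) * actionBound P E x.1.1 x.1.2 x.2)
    (B₄ := fun x => 2 * (12 ^ (x.1.1 + x.1.2) * (3 * X) ^ (eccOrder x).natAbs))
    (fun x => Real.exp_pos _) (fun x => by positivity)
    (fun x => mul_pos (by positivity) (actionBound_pos hPpos hsm.exp_pos _ _ _))
    (fun x => by positivity)
    (fun x => by fun_prop) (fun x => by fun_prop)
    (fun x z hz => ((differentiableAt_melnikovIntegral _ _ _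
      (by linarith [(hPre z hz).1]) ((him hRq hz).trans_lt (by norm_num))).const_mul
        _).differentiableWithinAt)
    (fun x => (differentiableOn_keplerCoeff _ _ _).mono fun z hz =>
      mem_ball_zero_iff.2 ((hεX z hz).trans_lt hX1))
    (fun x z hz => norm_exp_sigma_le (him hRσ hz) x.2)
    (fun x z hz => norm_exp_beta_le (him hRβ hz) x.1.1 x.1.2)
    (fun x z hz => norm_actionFactor_le h0 h1 x.1.1 x.1.2 x.2 (by linarith) (hPre z hz).1
      (hPre z hz).2 (him hRq hz) (expFactor_le (him hRq hz) (by linarith) (hPre z hz).1))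
    (fun x z hz => norm_keplerCoeff_le_three hX0 (by linarith) (hεX z hz))
    (summable_termBound hsm)
  have he : melnikovSeries μ = _ := funext fun p => by
    simp only [melnikovSeries, melnikovTerm_eq]
    rfl
  rw [he]
  exact main

/-- The admissible values of the arguments, for the estimates. -/
structure Admissible (s : ℝ) (σ β I : ℂ) (ε : ℝ) : Prop where
  width_nonneg : 0 ≤ s
  sigma_im : |σ.im| ≤ s
  beta_im : |β.im| ≤ 1
  action_im : |I.im| ≤ 1
  le_action : actionThreshold s ≤ I.re
  ecc_pos : 0 < ε
  ecc_le : ε * I.re ^ 3 ≤ 16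

lemma Admissible.smallParams {s : ℝ} {σ β I : ℂ} {ε : ℝ} (h : Admissible s σ β I ε) :
    SmallParams s I.re (expFactor I) ε :=
  smallParams_of_le h.width_nonneg h.le_action (Real.exp_pos _)
    (expFactor_le h.action_im (by linarith [le_actionThreshold h.width_nonneg, h.le_action]) le_rfl)
    h.ecc_pos h.ecc_le

lemma Admissible.norm_melnikovTerm_le {s : ℝ} {σ β I : ℂ} {ε : ℝ} (h : Admissible s σ β I ε)
    {μ : ℝ} (h0 : 0 ≤ μ) (h1 : μ ≤ 1) (x : (ℕ × ℕ) × ℤ) :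
    ‖melnikovTerm μ x σ β I ε‖ ≤ termBound s I.re (expFactor I) ε x := by
  have hs := h.smallParams
  have := hs.le_action
  have := hs.ecc_le
  have := hs.ecc_pos
  exact RPE3BP.norm_melnikovTerm_le h0 h1 x h.sigma_im h.beta_im (by linarith) le_rfl (by linarith)
    h.action_im le_rfl hs.ecc_pos (by nlinarith) (by simp [abs_of_pos hs.ecc_pos])

lemma Admissible.summable_melnikovTerm {s : ℝ} {σ β I : ℂ} {ε : ℝ} (h : Admissible s σ β I ε)
    {μ : ℝ} (h0 : 0 ≤ μ) (h1 : μ ≤ 1) :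
    Summable fun x => ‖melnikovTerm μ x σ β I ε‖ :=
  Summable.of_nonneg_of_le (fun _ => norm_nonneg _) (h.norm_melnikovTerm_le h0 h1)
    (summable_termBound h.smallParams)

lemma melnikovSeries_ofReal {μ : ℝ} (h0 : 0 ≤ μ) (h1 : μ ≤ 1) (σ β : ℝ) {I ε : ℝ}
    (hI : 5 ≤ I) (hε0 : 0 < ε) (hε1 : ε < 1 / 4) :
    melnikovSeries μ (σ, β, I, ε)
      = ((∫ s, pertPotential μ s β (σ + I ^ 3 * s) I ε : ℝ) : ℂ) :=
  (integrable_hasSum_melnikovTerm h0 h1 σ β hI hε0 hε1).2.tsum_eq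

/-! ## Bounds of the groups of terms -/

/-- The constant of the bounds of the terms. -/
noncomputable def termConst (s : ℝ) : ℝ :=
  8 * (4 * (144 * Real.exp (s + 1))) ^ 2 * (4 * 144 ^ 2) ^ 2 * (4 * 432) ^ 2

lemma termConst_ge {s : ℝ} (hs : 0 ≤ s) : 10 ^ 20 ≤ termConst s := by
  have hα : 1 ≤ Real.exp (s + 1) := Real.one_le_exp (by linarith)
  calc (10 : ℝ) ^ 20 ≤ 8 * (4 * (144 * 1)) ^ 2 * (4 * 144 ^ 2) ^ 2 * (4 * 432) ^ 2 := by norm_num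
    _ ≤ termConst s := by
      rw [termConst]
      gcongr

lemma mul_pow_le_of_one_le {A y : ℝ} (hA : 1 ≤ A) (hy : 0 ≤ y) {a : ℕ} (ha : a ≤ 2) :
    (A * y) ^ a ≤ A ^ 2 * y ^ a := by
  rw [mul_pow]
  have := pow_le_pow_right₀ hA ha
  gcongr

/-- The exponents a, b, d choose how much of the gains PE, 1/P and XP is retained. Limiting them to
2 lets a single constant serve all the cases. -/
lemma termBound_natCast_le_shape {s P E X : ℝ} (h : SmallParams s P E X) {j k L a b d : ℕ}
    (hL : 1 ≤ L) (ha : a ≤ L) (hb : b ≤ k) (hd : d ≤ (eccOrder ((j, k), (L : ℤ))).natAbs)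
    (ha2 : a ≤ 2) (hb2 : b ≤ 2) (hd2 : d ≤ 2) :
    termBound s P E X ((j, k), (L : ℤ))
      ≤ termConst s * ((√P)⁻¹ * (P * E) ^ a * (P⁻¹) ^ b * (X * P) ^ d)
        * indexWeight ((j, k), (L : ℤ)) := by
  have hP0 : 0 < P := by linarith [h.le_action]
  have hX := h.ecc_pos
  have hE := h.exp_pos
  have hα : 1 ≤ Real.exp (s + 1) := Real.one_le_exp (by linarith [h.width_nonneg])
  refine (termBound_natCast_le_weight h hL ha hb hd).trans ?_
  have c1 := mul_pow_le_of_one_le (A := 4 * (144 * Real.exp (s + 1))) (y := P * E) (by linarith)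
    (by positivity) ha2
  have c2 := mul_pow_le_of_one_le (A := 4 * 144 ^ 2) (y := P⁻¹) (by norm_num) (by positivity) hb2
  have c3 := mul_pow_le_of_one_le (A := 4 * 432) (y := X * P) (by norm_num) (by positivity) hd2
  have hw := indexWeight_pos ((j, k), (L : ℤ))
  calc _ = 8 * (√P)⁻¹ * (4 * (144 * Real.exp (s + 1)) * (P * E)) ^ a * (4 * 144 ^ 2 * P⁻¹) ^ b
        * (4 * 432 * (X * P)) ^ d * indexWeight ((j, k), (L : ℤ)) := by
        rw [show 4 * (144 * Real.exp (s + 1) * P * E) = 4 * (144 * Real.exp (s + 1)) * (P * E) by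
          ring, show 4 * (144 ^ 2 / P) = 4 * 144 ^ 2 * P⁻¹ by ring,
          show 4 * (432 * X * P) = 4 * 432 * (X * P) by ring]
    _ ≤ 8 * (√P)⁻¹ * ((4 * (144 * Real.exp (s + 1))) ^ 2 * (P * E) ^ a)
        * ((4 * 144 ^ 2) ^ 2 * (P⁻¹) ^ b)
        * ((4 * 432) ^ 2 * (X * P) ^ d) * indexWeight ((j, k), (L : ℤ)) := by gcongr
    _ = _ := by
        rw [termConst]
        ring

/-! ### Sizes of the terms, according to their orders in σ and in the eccentricity. -/

section Shapes

variable {s P E X : ℝ}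

lemma SmallParams.sqrt_pos (h : SmallParams s P E X) : 0 < √P :=
  Real.sqrt_pos.2 (by linarith [h.le_action])

lemma SmallParams.eq_sqrt_mul (h : SmallParams s P E X) : P = √P * √P :=
  (Real.mul_self_sqrt (by linarith [h.le_action])).symm

lemma termBound_one_le (h : SmallParams s P E X) (j k : ℕ) {L : ℕ} (hL : 1 ≤ L) :
    termBound s P E X ((j, k), (L : ℤ))
      ≤ termConst s * (√P * E) * indexWeight ((j, k), (L : ℤ)) := by
  refine (termBound_natCast_le_shape (a := 1) (b := 0) (d := 0) h hL hL (by omega) (by omega)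
    (by omega) (by omega) (by omega)).trans (le_of_eq ?_)
  have hS := h.sqrt_pos
  have e := h.eq_sqrt_mul
  generalize √P = S at *
  subst e
  field_simp

lemma termBound_one_le_of_two_le (h : SmallParams s P E X) {j k L : ℕ} (hL : 1 ≤ L) (hk : 2 ≤ k) :
    termBound s P E X ((j, k), (L : ℤ))
      ≤ termConst s * ((√P)⁻¹ * P⁻¹ * E) * indexWeight ((j, k), (L : ℤ)) := by
  refine (termBound_natCast_le_shape (a := 1) (b := 2) (d := 0) h hL hL hk (by omega)
    (by omega) (by omega) (by omega)).trans (le_of_eq ?_)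
  have hP : P ≠ 0 := by linarith [h.le_action]
  field_simp

lemma termBound_one_le_of_ecc (h : SmallParams s P E X) {j k L : ℕ} (hL : 1 ≤ L)
    (hm : eccOrder ((j, k), (L : ℤ)) ≠ 0) :
    termBound s P E X ((j, k), (L : ℤ))
      ≤ termConst s * (X * P * √P * E) * indexWeight ((j, k), (L : ℤ)) := by
  refine (termBound_natCast_le_shape (a := 1) (b := 0) (d := 1) h hL hL (by omega) (by omega)
    (by omega) (by omega) (by omega)).trans (le_of_eq ?_)
  have hS := h.sqrt_pos
  have e := h.eq_sqrt_mul
  generalize √P = S at *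
  subst e
  field_simp

lemma termBound_one_le_of_one_le (h : SmallParams s P E X) {j k L : ℕ} (hL : 1 ≤ L) (hk : 1 ≤ k)
    (hm : eccOrder ((j, k), (L : ℤ)) ≠ 0) :
    termBound s P E X ((j, k), (L : ℤ))
      ≤ termConst s * (X * √P * E) * indexWeight ((j, k), (L : ℤ)) := by
  refine (termBound_natCast_le_shape (a := 1) (b := 1) (d := 1) h hL hL hk (by omega)
    (by omega) (by omega) (by omega)).trans (le_of_eq ?_)
  have hS := h.sqrt_pos
  have e := h.eq_sqrt_mul
  generalize √P = S at *
  subst e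
  field_simp

lemma termBound_one_le_sq (h : SmallParams s P E X) {j k L : ℕ} (hL : 1 ≤ L)
    (hm : 2 ≤ (eccOrder ((j, k), (L : ℤ))).natAbs) :
    termBound s P E X ((j, k), (L : ℤ))
      ≤ termConst s * (X ^ 2 * (P ^ 2 * √P) * E) * indexWeight ((j, k), (L : ℤ)) := by
  refine (termBound_natCast_le_shape (a := 1) (b := 0) (d := 2) h hL hL (by omega) hm
    (by omega) (by omega) (by omega)).trans (le_of_eq ?_)
  have hS := h.sqrt_pos
  have e := h.eq_sqrt_mul
  generalize √P = S at *
  subst e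
  field_simp

/-- For a negative order m the eccentricity enters through X/P instead of XP. Together with one
factor 1/P from k ≥ 1 this produces the power −3/2 of the first remainder. -/
lemma termBound_one_le_of_neg (h : SmallParams s P E X) {j k L : ℕ} (hL : 1 ≤ L) (hk : 1 ≤ k)
    (hm : eccOrder ((j, k), (L : ℤ)) < 0) :
    termBound s P E X ((j, k), (L : ℤ))
      ≤ termConst s * (X * ((√P)⁻¹ * P⁻¹) * E) * indexWeight ((j, k), (L : ℤ)) := by
  have hP0 : 0 < P := by linarith [h.le_action]
  have hX := h.ecc_pos
  have hE := h.exp_pos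
  have hα : 1 ≤ Real.exp (s + 1) := Real.one_le_exp (by linarith [h.width_nonneg])
  refine (termBound_natCast_le_weight_of_neg h hL hk hm).trans ?_
  have hw := indexWeight_pos ((j, k), (L : ℤ))
  refine mul_le_mul_of_nonneg_right ?_ hw.le
  have e : 8 * (√P)⁻¹ * (4 * (144 * Real.exp (s + 1) * P * E)) * (4 * (144 ^ 2 / P)) ^ 1
        * (4 * (432 * X / P)) = (8 * (4 * (144 * Real.exp (s + 1))) * (4 * 144 ^ 2) * (4 * 432))
        * (X * ((√P)⁻¹ * P⁻¹) * E) := by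
    field_simp
  rw [e]
  refine mul_le_mul_of_nonneg_right ?_ (by positivity)
  rw [termConst]
  have hA : 4 * (144 * Real.exp (s + 1)) ≤ (4 * (144 * Real.exp (s + 1))) ^ 2 := by nlinarith
  gcongr <;> norm_num

lemma termBound_two_le (h : SmallParams s P E X) (j k : ℕ) {L : ℕ} (hL : 2 ≤ L) :
    termBound s P E X ((j, k), (L : ℤ))
      ≤ termConst s * (P * √P * E ^ 2) * indexWeight ((j, k), (L : ℤ)) := by
  refine (termBound_natCast_le_shape (a := 2) (b := 0) (d := 0) h (by omega) hL (by omega)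
    (by omega) (by omega) (by omega) (by omega)).trans (le_of_eq ?_)
  have hS := h.sqrt_pos
  have e := h.eq_sqrt_mul
  generalize √P = S at *
  subst e
  field_simp

lemma termBound_two_le_of_ecc (h : SmallParams s P E X) {j k L : ℕ} (hL : 2 ≤ L)
    (hm : eccOrder ((j, k), (L : ℤ)) ≠ 0) :
    termBound s P E X ((j, k), (L : ℤ))
      ≤ termConst s * (X * (P ^ 2 * √P) * E ^ 2) * indexWeight ((j, k), (L : ℤ)) := by
  refine (termBound_natCast_le_shape (a := 2) (b := 0) (d := 1) h (by omega) hL (by omega)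
    (by omega) (by omega) (by omega) (by omega)).trans (le_of_eq ?_)
  have hS := h.sqrt_pos
  have e := h.eq_sqrt_mul
  generalize √P = S at *
  subst e
  field_simp

lemma termBound_zero_le (h : SmallParams s P E X) {j k N d : ℕ} (hN : N ≤ j + k) (hN5 : N ≤ 5)
    (hd2 : d ≤ 2) (hd : d ≤ (eccOrder ((j, k), 0)).natAbs) :
    termBound s P E X ((j, k), 0)
      ≤ termConst s * (P * ((P ^ 2) ^ N)⁻¹ * X ^ d) * indexWeight ((j, k), 0) := by
  have hP0 : 0 < P := by linarith [h.le_action]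
  have hX := h.ecc_pos
  have hw := indexWeight_pos ((j, k), 0)
  refine (termBound_zero_le_weight h hN hd).trans (mul_le_mul_of_nonneg_right ?_ hw.le)
  have h1 : (144 : ℝ) ^ N ≤ 144 ^ 5 := pow_le_pow_right₀ (by norm_num) hN5
  have h2 : (3 : ℝ) ^ d ≤ 3 ^ 2 := pow_le_pow_right₀ (by norm_num) hd2
  have hpi := Real.pi_le_four
  calc 2 * Real.pi * P * (144 / P ^ 2) ^ N * (3 * X) ^ d
      = 2 * Real.pi * 144 ^ N * 3 ^ d * (P * ((P ^ 2) ^ N)⁻¹ * X ^ d) := by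
        rw [div_pow, mul_pow]
        ring
    _ ≤ 2 * 4 * 144 ^ 5 * 3 ^ 2 * (P * ((P ^ 2) ^ N)⁻¹ * X ^ d) := by gcongr
    _ ≤ _ := by
        refine mul_le_mul_of_nonneg_right ?_ (by positivity)
        have := termConst_ge h.width_nonneg
        norm_num at this ⊢
        linarith

end Shapes

/-! ## Fourier series in the angle -/

lemma intervalIntegral_exp_int_mul (n : ℤ) :
    ∫ x in (0 : ℝ)..(2 * Real.pi), Complex.exp (Complex.I * n * x)
      = if n = 0 then (2 * Real.pi : ℂ) else 0 := by
  split_ifs with h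
  · simp [h]
  · have hc : Complex.I * (n : ℂ) ≠ 0 := mul_ne_zero Complex.I_ne_zero (by exact_mod_cast h)
    rw [integral_exp_mul_complex hc]
    have : Complex.exp (Complex.I * n * ((2 * Real.pi : ℝ) : ℂ)) = 1 := by
      rw [Complex.exp_eq_one_iff]
      exact ⟨n, by push_cast; ring⟩
    rw [this]
    simp

/-- Normal convergence allows integration term by term against exp(−ilx), and only the term n = l
survives. -/
lemma angleCoeff_of_hasSum {a : ℤ → ℂ} {h : ℂ → ℂ} (ha : Summable fun l => ‖a l‖)
    (hh : ∀ x : ℝ, HasSum (fun l : ℤ => a l * Complex.exp (Complex.I * l * x)) (h x)) (l : ℤ) :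
    angleCoeff h l = a l := by
  have key := intervalIntegral.hasSum_integral_of_dominated_convergence (a := 0)
    (b := 2 * Real.pi) (μ := volume)
    (F := fun (n : ℤ) (x : ℝ) => a n * Complex.exp (Complex.I * ((n - l : ℤ) : ℂ) * x))
    (f := fun x : ℝ => h x * Complex.exp (-(Complex.I * l * x)))
    (fun n _ => ‖a n‖) (fun n => Continuous.aestronglyMeasurable (by fun_prop))
    (fun n => Eventually.of_forall fun x _ => ?_) (Eventually.of_forall fun x _ => ha)
    (by simp) (Eventually.of_forall fun x _ => ?_)
  · simp only [intervalIntegral.integral_const_mul, intervalIntegral_exp_int_mul] at key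
    have h2 := hasSum_ite_eq l (a l * (2 * Real.pi))
    have e := (hasSum_of_eq key fun n => ?_ : HasSum (fun n => if n = l then a l * (2 * Real.pi)
      else 0) _).unique h2
    · have hpi : (Real.pi : ℂ) ≠ 0 := by exact_mod_cast Real.pi_ne_zero
      rw [angleCoeff, e]
      field_simp
    · by_cases hn : n = l
      · simp [hn]
      · simp [hn, sub_eq_zero]
  · rw [norm_mul]
    have : ‖Complex.exp (Complex.I * ((n - l : ℤ) : ℂ) * x)‖ = 1 := by
      rw [show Complex.I * ((n - l : ℤ) : ℂ) * x = (((n - l : ℤ) * x : ℝ) : ℂ) * Complex.I by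
        push_cast; ring, Complex.norm_exp_ofReal_mul_I]
    rw [this, mul_one]
  · refine hasSum_of_eq ((hh x).mul_right _) fun n => ?_
    rw [mul_assoc (a n), ← Complex.exp_add]
    congr 2
    push_cast
    ring

lemma angleHarmonic_zero (h : ℂ → ℂ) (σ : ℂ) : angleHarmonic h 0 σ = angleCoeff h 0 := if_pos rfl

lemma hasSum_angleHarmonic {a : ℤ → ℂ} {h : ℂ → ℂ} (ha : ∀ l, angleCoeff h l = a l) {σ S : ℂ}
    (hn : Summable fun l : ℤ => ‖a l * Complex.exp (Complex.I * l * σ)‖)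
    (hs : HasSum (fun l : ℤ => a l * Complex.exp (Complex.I * l * σ)) S) :
    Summable (fun l : ℕ => ‖angleHarmonic h l σ‖) ∧
      HasSum (fun l : ℕ => angleHarmonic h l σ) S := by
  -- The sum of the terms of orders l and −l counts the mean twice when l = 0; the last summand
  -- corrects this.
  have hval : ∀ l : ℕ, angleHarmonic h l σ
      = a l * Complex.exp (Complex.I * (l : ℤ) * σ)
        + a (-l) * Complex.exp (Complex.I * ((-l : ℤ) : ℂ) * σ)
        - if l = 0 then a 0 else 0 := by
    intro l
    rw [angleHarmonic]
    split_ifs with hl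
    · simp [hl, ha]
    · rw [ha, ha]
      push_cast
      rw [show Complex.I * -(l : ℂ) * σ = -(Complex.I * l * σ) by ring]
      ring
  constructor
  · have h1 : Summable fun l : ℕ => ‖a l * Complex.exp (Complex.I * (l : ℤ) * σ)‖ :=
      hn.comp_injective Nat.cast_injective
    have h2 : Summable fun l : ℕ => ‖a (-l) * Complex.exp (Complex.I * ((-l : ℤ) : ℂ) * σ)‖ :=
      hn.comp_injective (i := fun l : ℕ => (-l : ℤ)) fun x y hxy => by simpa using hxy
    have h3 : Summable fun l : ℕ => ‖if l = 0 then a 0 else 0‖ := by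
      refine summable_of_ne_finset_zero (s := {0}) fun l hl => ?_
      rw [if_neg (by simpa using hl), norm_zero]
    refine Summable.of_nonneg_of_le (fun _ => norm_nonneg _) (fun l => ?_) ((h1.add h2).add h3)
    rw [hval]
    exact (norm_sub_le _ _).trans (add_le_add_left (norm_add_le _ _) _)
  · have h1 := HasSum.nat_add_neg hs
    have h2 := h1.sub (hasSum_ite_eq (0 : ℕ) (a 0))
    have e : S + a 0 * Complex.exp (Complex.I * ((0 : ℤ) : ℂ) * σ) - a 0 = S := by simp
    rw [e] at h2
    exact hasSum_of_eq h2 hval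

/-! ## The harmonics of the series -/

/-- The coefficient of order `l` in `σ`. -/
noncomputable def melnikovCoeff (μ : ℝ) (l : ℤ) (β I ε : ℂ) : ℂ :=
  ∑' y : ℕ × ℕ, melnikovTerm μ (y, l) 0 β I ε

lemma melnikovTerm_sigma (μ : ℝ) (x : (ℕ × ℕ) × ℤ) (σ β I ε : ℂ) :
    melnikovTerm μ x σ β I ε
      = melnikovTerm μ x 0 β I ε * Complex.exp (Complex.I * x.2 * σ) := by
  rw [melnikovTerm_eq, melnikovTerm_eq, mul_zero, mul_zero, Complex.exp_zero, mul_assoc Complex.I]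
  ring

lemma melnikovTerm_angles (μ : ℝ) (x : (ℕ × ℕ) × ℤ) (σ β I ε : ℂ) :
    melnikovTerm μ x σ β I ε = melnikovTerm μ x 0 0 I ε
      * Complex.exp (Complex.I * (x.2 * σ - ((x.1.1 : ℂ) - x.1.2) * β)) := by
  simp only [melnikovTerm, mul_zero, sub_zero, Complex.exp_zero]
  ring

lemma Admissible.zero_sigma {s : ℝ} {σ β I : ℂ} {ε : ℝ} (h : Admissible s σ β I ε) :
    Admissible s 0 β I ε :=
  ⟨h.1, by simpa using h.1, h.3, h.4, h.5, h.6, h.7⟩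

lemma Admissible.neg {s : ℝ} {σ β I : ℂ} {ε : ℝ} (h : Admissible s σ β I ε) :
    Admissible s (-σ) (-β) I ε :=
  ⟨h.1, by simpa using h.2, by simpa using h.3, h.4, h.5, h.6, h.7⟩

section Harmonics

variable {s : ℝ} {σ β I : ℂ} {ε : ℝ} {μ : ℝ}

lemma Admissible.hasSum_melnikovSeries (h : Admissible s σ β I ε) (h0 : 0 ≤ μ) (h1 : μ ≤ 1) :
    HasSum (fun x => melnikovTerm μ x σ β I ε) (melnikovSeries μ (σ, β, I, ε)) :=
  (h.summable_melnikovTerm h0 h1).of_norm.hasSum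

lemma Admissible.summable_fiber (h : Admissible s σ β I ε) (h0 : 0 ≤ μ) (h1 : μ ≤ 1) (l : ℤ) :
    Summable fun y : ℕ × ℕ => melnikovTerm μ (y, l) σ β I ε :=
  (h.summable_melnikovTerm h0 h1).of_norm.comp_injective (i := fun y : ℕ × ℕ => (y, l))
    fun _ _ hxy => (Prod.mk.inj hxy).1

lemma Admissible.hasSum_melnikovCoeff (h : Admissible s σ β I ε) (h0 : 0 ≤ μ) (h1 : μ ≤ 1) :
    Summable (fun l : ℤ => ‖melnikovCoeff μ l β I ε * Complex.exp (Complex.I * l * σ)‖) ∧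
    HasSum (fun l : ℤ => melnikovCoeff μ l β I ε * Complex.exp (Complex.I * l * σ))
      (melnikovSeries μ (σ, β, I, ε)) := by
  have hN := (h.summable_melnikovTerm h0 h1).prod_symm
  have hS := (Equiv.prodComm ℤ (ℕ × ℕ)).hasSum_iff.2 (h.hasSum_melnikovSeries h0 h1)
  have hfib : ∀ l : ℤ, HasSum (fun y : ℕ × ℕ => melnikovTerm μ (y, l) σ β I ε)
      (melnikovCoeff μ l β I ε * Complex.exp (Complex.I * l * σ)) := fun l =>
    hasSum_of_eq ((h.zero_sigma.summable_fiber h0 h1 l).hasSum.mul_right _)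
      fun y => melnikovTerm_sigma μ (y, l) σ β I ε
  constructor
  · refine Summable.of_nonneg_of_le (fun _ => norm_nonneg _) (fun l => ?_) hN.prod
    rw [← (hfib l).tsum_eq]
    exact norm_tsum_le_tsum_norm (hN.prod_factor l)
  · exact HasSum.prod_fiberwise hS hfib

lemma melnikovCoeff_neg (l : ℤ) :
    melnikovCoeff μ (-l) β I ε = melnikovCoeff μ l (-β) I ε := by
  rw [melnikovCoeff, melnikovCoeff, ← (Equiv.prodComm ℕ ℕ).tsum_eq]
  refine tsum_congr fun y => ?_
  have := melnikovTerm_swapIndex μ (y, l) 0 β I ε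
  rw [neg_zero] at this
  exact this

lemma Admissible.angleCoeff_melnikovSeries (h : Admissible s σ β I ε) (h0 : 0 ≤ μ) (h1 : μ ≤ 1)
    (l : ℤ) :
    angleCoeff (fun x => melnikovSeries μ (x, β, I, ε)) l = melnikovCoeff μ l β I ε := by
  refine angleCoeff_of_hasSum (a := fun l => melnikovCoeff μ l β I ε) ?_ (fun x => ?_) l
  · simpa using (h.zero_sigma.hasSum_melnikovCoeff h0 h1).1
  · have hx : Admissible s x β I ε := ⟨h.1, by simpa using h.1, h.3, h.4, h.5, h.6, h.7⟩
    exact (hx.hasSum_melnikovCoeff h0 h1).2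

end Harmonics

/-! ## The main terms -/

/-- The square root `(2π/I)^(1/2)`. -/
noncomputable def actionRoot (I : ℂ) : ℂ := (2 * Real.pi / I) ^ (1 / 2 : ℂ)

/-! ### Principal square roots of the action and comparison of its modulus with its real part. -/

lemma cpow_half_eq {z w : ℂ} (hz : z ∈ Complex.slitPlane) (hw : w ^ 2 = z) (h : 0 < w.re) :
    z ^ (1 / 2 : ℂ) = w := by
  have h1 := cpow_half_re_pos hz
  have h2 := cpow_half_sq z
  have h3 : (z ^ (1 / 2 : ℂ) - w) * (z ^ (1 / 2 : ℂ) + w) = 0 := by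
    linear_combination h2 - hw
  rcases mul_eq_zero.1 h3 with h4 | h4
  · exact sub_eq_zero.1 h4
  · have := congrArg Complex.re h4
    rw [Complex.add_re, Complex.zero_re] at this
    linarith

lemma inv_re_pos {I : ℂ} (hI : 0 < I.re) : 0 < (I⁻¹).re := by
  rw [Complex.inv_re]
  refine div_pos hI (Complex.normSq_pos.2 ?_)
  rintro rfl
  simp at hI

lemma actionRoot_mem_slitPlane {I : ℂ} (hI : 0 < I.re) :
    0 < (2 * Real.pi / I).re := by
  have h1 : (2 * Real.pi / I : ℂ) = ((2 * Real.pi : ℝ) : ℂ) * I⁻¹ := by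
    push_cast
    rw [div_eq_mul_inv]
  rw [h1, Complex.re_ofReal_mul]
  have := inv_re_pos hI
  have := Real.pi_pos
  positivity

lemma actionRoot_re_pos {I : ℂ} (hI : 0 < I.re) : 0 < (actionRoot I).re :=
  cpow_half_re_pos (Or.inl (actionRoot_mem_slitPlane hI))

lemma actionRoot_sq (I : ℂ) : actionRoot I ^ 2 = 2 * Real.pi / I := cpow_half_sq _

lemma norm_actionRoot_sq (I : ℂ) : ‖actionRoot I‖ ^ 2 = 2 * Real.pi / ‖I‖ := by
  rw [← norm_pow, actionRoot_sq, norm_div, norm_mul, Complex.norm_ofNat, Complex.norm_real,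
    Real.norm_eq_abs, abs_of_pos Real.pi_pos]

lemma cpow_half_pi_div {I : ℂ} (hI : 0 < I.re) :
    (Real.pi / (8 * I)) ^ (1 / 2 : ℂ) = actionRoot I / 4 := by
  have hz := actionRoot_mem_slitPlane hI
  have hr := actionRoot_re_pos hI
  have h1 : (Real.pi / (8 * I) : ℂ) = ((1 / 16 : ℝ) : ℂ) * (2 * Real.pi / I) := by
    push_cast
    by_cases hI0 : I = 0
    · simp [hI0]
    · field_simp
      norm_num
  refine cpow_half_eq (Or.inl ?_) ?_ ?_
  · rw [h1, Complex.re_ofReal_mul]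
    positivity
  · rw [div_pow, actionRoot_sq, h1]
    push_cast
    ring
  · rw [show actionRoot I / 4 = ((1 / 4 : ℝ) : ℂ) * actionRoot I by push_cast; ring,
      Complex.re_ofReal_mul]
    positivity

/-- The action is nearly real while (2π/I)^{1/2} has argument at most π/4 in modulus, so the product
stays in the right half plane. This identifies it with the principal root of 2πI³. -/
lemma sq_mul_actionRoot_re_pos {I : ℂ} (hI : 10 ≤ I.re) (hq : |I.im| ≤ 1) :
    0 < (I ^ 2 * actionRoot I).re := by
  have hr := actionRoot_re_pos (show 0 < I.re by linarith)
  have hz := actionRoot_mem_slitPlane (show 0 < I.re by linarith)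
  rw [← actionRoot_sq] at hz
  set q := actionRoot I
  have e1 : (q ^ 2).re = q.re ^ 2 - q.im ^ 2 := by
    simp [sq]
  have e2 : (I ^ 2 * q).re = (I.re ^ 2 - I.im ^ 2) * q.re - 2 * I.re * I.im * q.im := by
    simp only [sq, Complex.mul_re, Complex.mul_im]
    ring
  rw [e1] at hz
  have hb : |q.im| < q.re := abs_lt_of_sq_lt_sq (by linarith) hr.le
  have hy : I.im ^ 2 ≤ 1 := by
    rw [← sq_abs]
    exact pow_le_one₀ (abs_nonneg _) hq
  have h3 : |I.im * q.im| ≤ q.re := by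
    rw [abs_mul]
    nlinarith [abs_nonneg I.im, abs_nonneg q.im]
  have h4 := (abs_le.1 h3).2
  rw [e2]
  nlinarith [mul_pos hr (show 0 < I.re by linarith), mul_le_mul_of_nonneg_left hy hr.le,
    mul_le_mul_of_nonneg_left h4 (show 0 ≤ I.re by linarith),
    mul_nonneg hr.le (show 0 ≤ I.re * (I.re - 10) by nlinarith)]

lemma cpow_half_two_pi_mul {I : ℂ} (hI : 10 ≤ I.re) (hq : |I.im| ≤ 1) :
    (2 * Real.pi * I ^ 3) ^ (1 / 2 : ℂ) = I ^ 2 * actionRoot I := by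
  have h3 := re_cube_ge hq hI
  have hI0 : I ≠ 0 := by
    rintro rfl
    simp at hI
    linarith
  refine cpow_half_eq (Or.inl ?_) ?_ (sq_mul_actionRoot_re_pos hI hq)
  · rw [show (2 * Real.pi * I ^ 3 : ℂ) = ((2 * Real.pi : ℝ) : ℂ) * I ^ 3 by push_cast; ring,
      Complex.re_ofReal_mul]
    have : 0 < I.re ^ 3 := by positivity
    have := Real.pi_pos
    exact mul_pos (by positivity) (by linarith)
  · rw [mul_pow, actionRoot_sq]
    field_simp

lemma cpow_half_pi_mul_div {I : ℂ} (hI : 10 ≤ I.re) (hq : |I.im| ≤ 1) :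
    (Real.pi * I ^ 3 / 2) ^ (1 / 2 : ℂ) = I ^ 2 * actionRoot I / 2 := by
  have h3 := re_cube_ge hq hI
  have hr := sq_mul_actionRoot_re_pos hI hq
  have hI0 : I ≠ 0 := by
    rintro rfl
    simp at hI
    linarith
  refine cpow_half_eq (Or.inl ?_) ?_ ?_
  · rw [show (Real.pi * I ^ 3 / 2 : ℂ) = ((Real.pi / 2 : ℝ) : ℂ) * I ^ 3 by push_cast; ring,
      Complex.re_ofReal_mul]
    have : 0 < I.re ^ 3 := by positivity
    have := Real.pi_pos
    exact mul_pos (by positivity) (by linarith)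
  · rw [div_pow, mul_pow, actionRoot_sq]
    field_simp
  · rw [show I ^ 2 * actionRoot I / 2 = ((1 / 2 : ℝ) : ℂ) * (I ^ 2 * actionRoot I) by
      push_cast; ring, Complex.re_ofReal_mul]
    positivity

lemma expFactor_eq_norm (I : ℂ) : ‖Complex.exp (-(I ^ 3 / 3))‖ = expFactor I := by
  rw [Complex.norm_exp, expFactor]
  congr 1
  rw [show -(I ^ 3 / 3) = ((-(1 / 3) : ℝ) : ℂ) * I ^ 3 by push_cast; ring, Complex.re_ofReal_mul]
  ring

lemma re_le_norm_action {I : ℂ} (hI : 10 ≤ I.re) : I.re ≤ ‖I‖ ∧ 0 < ‖I‖ := by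
  have := Complex.re_le_norm I
  exact ⟨this, by linarith⟩

lemma norm_action_le {I : ℂ} (hI : 10 ≤ I.re) (hq : |I.im| ≤ 1) : ‖I‖ ≤ 2 * I.re := by
  have := Complex.norm_le_abs_re_add_abs_im I
  rw [abs_of_pos (by linarith : 0 < I.re)] at this
  linarith

lemma inv_sqrt_le_norm_actionRoot {I : ℂ} (hI : 10 ≤ I.re) (hq : |I.im| ≤ 1) : (√I.re)⁻¹ ≤ ‖actionRoot I‖ := by
  have h1 := norm_action_le hI hq
  have h2 := (re_le_norm_action hI).2
  have hp : 0 < I.re := by linarith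
  refine le_of_sq_le_sq ?_ (norm_nonneg _)
  rw [norm_actionRoot_sq, inv_pow, Real.sq_sqrt hp.le, inv_eq_one_div, div_le_div_iff₀ hp h2]
  have := Real.pi_gt_three
  nlinarith

lemma norm_actionRoot_le {I : ℂ} (hI : 10 ≤ I.re) : ‖actionRoot I‖ ≤ 3 * (√I.re)⁻¹ := by
  obtain ⟨h1, h2⟩ := re_le_norm_action hI
  have hp : 0 < I.re := by linarith
  refine le_of_sq_le_sq ?_ (by positivity)
  rw [norm_actionRoot_sq, mul_pow, inv_pow, Real.sq_sqrt hp.le, ← div_eq_mul_inv,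
    div_le_div_iff₀ h2 hp]
  have := Real.pi_le_four
  nlinarith

lemma inv_re_le_one_sqrt {I : ℂ} (hI : 10 ≤ I.re) : (I.re)⁻¹ ≤ (√I.re)⁻¹ ∧ (√I.re)⁻¹ ≤ 1 := by
  have hp : 0 < I.re := by linarith
  have h1 := sqrt_inv_le_one (p := I.re) (by linarith)
  refine ⟨?_, h1⟩
  have e : (I.re)⁻¹ = (√I.re)⁻¹ * (√I.re)⁻¹ := by
    rw [← mul_inv, Real.mul_self_sqrt hp.le]
  rw [e]
  exact mul_le_of_le_one_left (by positivity) h1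

lemma inv_re_le_norm_inv {I : ℂ} (hI : 10 ≤ I.re) (hq : |I.im| ≤ 1) : (I.re)⁻¹ ≤ 2 * ‖I‖⁻¹ := by
  have h1 := norm_action_le hI hq
  have h2 := (re_le_norm_action hI).2
  have hp : 0 < I.re := by linarith
  rw [inv_eq_one_div, ← div_eq_mul_inv, div_le_div_iff₀ hp h2]
  linarith

lemma potCoef_one_one (μ : ℝ) : potCoef μ 1 1 = μ * (1 - μ) / 4 := by
  rw [potCoef, if_neg (by norm_num), legCoef_one]
  ring

lemma potCoef_two_one (μ : ℝ) : potCoef μ 2 1 = -(3 / 16 * (μ * (1 - μ) * (1 - 2 * μ))) := by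
  rw [potCoef, if_neg (by norm_num), legCoef_one, legCoef_two]
  ring

lemma potCoef_two_zero (μ : ℝ) : potCoef μ 2 0 = 3 / 8 * (μ * (1 - μ)) := by
  rw [potCoef, if_neg (by norm_num), legCoef_zero, legCoef_two]
  ring

lemma melnikovTerm_one_one_zero (μ : ℝ) {I : ℂ} (hI : I ≠ 0) (ε : ℂ) :
    melnikovTerm μ ((1, 1), 0) 0 0 I ε
      = μ * (1 - μ) * (Real.pi / (2 * I ^ 3)) * (1 + 3 / 2 * ε ^ 2) := by
  simp only [melnikovTerm, melnikovIntegral_zero, rationalIntegral_one_one, potCoef_one_one,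
    keplerCoeff_one_one_zero, mul_zero, sub_zero, Complex.exp_zero]
  push_cast
  field_simp
  ring

lemma melnikovTerm_two_one_zero (μ : ℝ) {I : ℂ} (hI : I ≠ 0) (ε : ℂ) :
    melnikovTerm μ ((2, 1), 0) 0 0 I ε
      = -(μ * (1 - μ) * (1 - 2 * μ) * (15 * Real.pi / (16 * I ^ 5)) * (ε + 3 / 4 * ε ^ 3)) := by
  simp only [melnikovTerm, melnikovIntegral_zero, rationalIntegral_two_one, potCoef_two_one,
    keplerCoeff_two_one_zero, mul_zero, sub_zero, Complex.exp_zero]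
  push_cast
  field_simp
  ring

lemma Admissible.ten_le {s : ℝ} {σ β I : ℂ} {ε : ℝ} (h : Admissible s σ β I ε) : 10 ≤ I.re := by
  linarith [le_actionThreshold h.width_nonneg, h.le_action]

lemma Admissible.ecc_le_half {s : ℝ} {σ β I : ℂ} {ε : ℝ} (h : Admissible s σ β I ε) :
    ε ≤ 1 / 2 := by
  have h1 := h.ecc_le
  have h2 := h.ten_le
  have h3 := h.ecc_pos
  have : (10 : ℝ) ^ 3 ≤ I.re ^ 3 := by gcongr
  nlinarith

/-- The main constant is (−3/16) · 2³ · (−1/12) = 1/8. The relative errors are O(ε²) from the Kepler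
coefficient and O(1/I) from the saddle, whose error O(I^{−2}) is measured against a root of size
I^{−1/2}. -/
lemma norm_melnikovTerm_two_one_one_sub_le {μ : ℝ} (hμ0 : 0 ≤ μ) (hμ1 : μ ≤ 1 / 2) :
    ∃ C : ℝ, 0 < C ∧ ∀ {s : ℝ} {σ β I : ℂ} {ε : ℝ}, Admissible s σ β I ε →
      ‖melnikovTerm μ ((2, 1), 1) 0 0 I ε
        - μ * (1 - μ) * ((1 - 2 * μ) * (actionRoot I / 8) * Complex.exp (-(I ^ 3 / 3)))‖
        ≤ C * ((‖I‖⁻¹ + ε ^ 2) * ‖actionRoot I‖ * expFactor I) := by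
  obtain ⟨C, hC, hc⟩ := keplerCoeff_two_one_one
  refine ⟨3 / 2 * (C + 26 * (1 + C)), by positivity, fun {s σ β I ε} h => ?_⟩
  have hI := h.ten_le
  have hε := h.ecc_le_half
  have hε0 := h.ecc_pos
  have hnε : ‖(ε : ℂ)‖ = ε := by simp [abs_of_pos hε0]
  have hc1 := hc ε (by rw [hnε]; exact hε)
  rw [hnε] at hc1
  have hs := norm_saddleIntegral_two_one_sub_le (I := I) (by linarith)
    (by linarith [h.action_im])
  rw [← actionRoot] at hs
  have hval : melnikovTerm μ ((2, 1), 1) 0 0 I ε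
        - μ * (1 - μ) * ((1 - 2 * μ) * (actionRoot I / 8) * Complex.exp (-(I ^ 3 / 3)))
      = ((-(3 / 2 * (μ * (1 - μ) * (1 - 2 * μ))) : ℝ) : ℂ) * Complex.exp (-(I ^ 3 / 3))
        * (keplerCoeff 2 1 1 ε * (saddleIntegral 2 1 1 I + 1 / 12 * actionRoot I)
          - (keplerCoeff 2 1 1 ε - 1) * (actionRoot I / 12)) := by
    have := melnikovIntegral_natCast 2 1 (l := 1) le_rfl I
    simp only [Nat.cast_one, one_mul] at this
    simp only [melnikovTerm, this, potCoef_two_one, mul_zero, sub_zero, Complex.exp_zero]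
    push_cast
    ring
  have hk : ‖keplerCoeff 2 1 1 ε‖ ≤ 1 + C := by
    have h1 := norm_le_norm_add_norm_sub' (keplerCoeff 2 1 1 ε) 1
    rw [norm_one] at h1
    have h2 : C * ε ^ 2 ≤ C := mul_le_of_le_one_right hC (by nlinarith)
    linarith
  have hμ : |-(3 / 2 * (μ * (1 - μ) * (1 - 2 * μ)))| ≤ 3 / 2 := by
    rw [abs_neg, abs_of_nonneg (by
      have : 0 ≤ 1 - μ := by linarith
      have : 0 ≤ 1 - 2 * μ := by linarith
      positivity)]
    have : μ * (1 - μ) ≤ 1 := by nlinarith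
    have : 0 ≤ μ * (1 - μ) := by nlinarith
    nlinarith
  have hP : (I.re ^ 2)⁻¹ ≤ 2 * ‖I‖⁻¹ * ‖actionRoot I‖ := by
    have a1 := inv_re_le_norm_inv hI h.action_im
    have a2 := (inv_re_le_one_sqrt hI).1.trans (inv_sqrt_le_norm_actionRoot hI h.action_im)
    rw [sq, mul_inv]
    have : 0 < I.re := by linarith
    gcongr
  rw [hval, norm_mul, norm_mul, expFactor_eq_norm, Complex.norm_real, Real.norm_eq_abs]
  have hE : 0 < expFactor I := Real.exp_pos _
  have hI0 := (re_le_norm_action hI).2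
  have h12 : ‖actionRoot I / 12‖ ≤ ‖actionRoot I‖ := by
    rw [norm_div, Complex.norm_ofNat]
    linarith [norm_nonneg (actionRoot I)]
  calc |-(3 / 2 * (μ * (1 - μ) * (1 - 2 * μ)))| * expFactor I
        * ‖keplerCoeff 2 1 1 ε * (saddleIntegral 2 1 1 I + 1 / 12 * actionRoot I)
          - (keplerCoeff 2 1 1 ε - 1) * (actionRoot I / 12)‖
      ≤ 3 / 2 * expFactor I * ((1 + C) * (13 * (2 * ‖I‖⁻¹ * ‖actionRoot I‖))
          + C * ε ^ 2 * ‖actionRoot I‖) := by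
        gcongr
        refine (norm_sub_le _ _).trans ?_
        rw [norm_mul, norm_mul]
        gcongr
        exact hs.trans (by gcongr)
    _ ≤ _ := by
        have e1 : 0 ≤ expFactor I * ‖actionRoot I‖ * ‖I‖⁻¹ * C := by positivity
        have e2 : 0 ≤ expFactor I * ‖actionRoot I‖ * ε ^ 2 * (1 + C) := by positivity
        nlinarith

/-- The main constant is (3/8) · 2² · (−3ε) · I²/3 = −(3/2)εI². The Kepler coefficient is known only
up to O(ε²), hence a relative error O(ε) here. -/
lemma norm_melnikovTerm_two_zero_one_add_le {μ : ℝ} (hμ0 : 0 ≤ μ) (hμ1 : μ ≤ 1 / 2) :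
    ∃ C : ℝ, 0 < C ∧ ∀ {s : ℝ} {σ β I : ℂ} {ε : ℝ}, Admissible s σ β I ε →
      ‖melnikovTerm μ ((2, 0), 1) 0 0 I ε
        + μ * (1 - μ) * (3 / 2 * ε * (I ^ 2 * actionRoot I) * Complex.exp (-(I ^ 3 / 3)))‖
        ≤ C * (ε * (‖I‖⁻¹ + ε) * (‖I‖ ^ 2 * ‖actionRoot I‖) * expFactor I) := by
  obtain ⟨C, hC, hc⟩ := keplerCoeff_two_zero_one
  refine ⟨3 / 2 * (C + 4 * (3 + C)), by positivity, fun {s σ β I ε} h => ?_⟩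
  have hI := h.ten_le
  have hε := h.ecc_le_half
  have hε0 := h.ecc_pos
  have hnε : ‖(ε : ℂ)‖ = ε := by simp [abs_of_pos hε0]
  have hc1 := hc ε (by rw [hnε]; exact hε)
  rw [hnε] at hc1
  have hs := norm_saddleIntegral_two_zero_sub_le (I := I) (by linarith)
    (by linarith [h.action_im])
  rw [← actionRoot] at hs
  have hval : melnikovTerm μ ((2, 0), 1) 0 0 I ε
        + μ * (1 - μ) * (3 / 2 * ε * (I ^ 2 * actionRoot I) * Complex.exp (-(I ^ 3 / 3)))
      = ((3 / 2 * (μ * (1 - μ)) : ℝ) : ℂ) * Complex.exp (-(I ^ 3 / 3))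
        * (keplerCoeff 2 0 1 ε * (saddleIntegral 2 0 1 I - I ^ 2 / 3 * actionRoot I)
          + (keplerCoeff 2 0 1 ε + 3 * ε) * (I ^ 2 / 3 * actionRoot I)) := by
    have := melnikovIntegral_natCast 2 0 (l := 1) le_rfl I
    simp only [Nat.cast_one, one_mul] at this
    simp only [melnikovTerm, this, potCoef_two_zero, mul_zero, sub_zero, Complex.exp_zero]
    push_cast
    ring
  have hk : ‖keplerCoeff 2 0 1 ε‖ ≤ (3 + C) * ε := by
    have h1 := norm_sub_le (keplerCoeff 2 0 1 ε + 3 * ε) (3 * ε)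
    rw [add_sub_cancel_right, norm_mul, hnε, Complex.norm_ofNat] at h1
    have h2 : C * ε ^ 2 ≤ C * ε := mul_le_mul_of_nonneg_left (by nlinarith) hC
    linarith
  have hμ : |3 / 2 * (μ * (1 - μ))| ≤ 3 / 2 := by
    rw [abs_of_nonneg (by
      have : 0 ≤ 1 - μ := by linarith
      positivity)]
    have : μ * (1 - μ) ≤ 1 := by nlinarith
    nlinarith
  have hI0 := (re_le_norm_action hI).2
  have hP : 1 ≤ ‖I‖⁻¹ * (‖I‖ ^ 2 * ‖actionRoot I‖) := by
    have a2 := inv_sqrt_le_norm_actionRoot hI h.action_im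
    have a3 := (inv_re_le_one_sqrt hI).1
    have a4 := (re_le_norm_action hI).1
    have hp : 0 < I.re := by linarith
    calc 1 = I.re * I.re⁻¹ := (mul_inv_cancel₀ hp.ne').symm
      _ ≤ ‖I‖ * ‖actionRoot I‖ := by
        gcongr
        exact a3.trans a2
      _ = _ := by
        field_simp
  rw [hval, norm_mul, norm_mul, expFactor_eq_norm, Complex.norm_real, Real.norm_eq_abs]
  have hE : 0 < expFactor I := Real.exp_pos _
  have h12 : ‖I ^ 2 / 3 * actionRoot I‖ ≤ ‖I‖ ^ 2 * ‖actionRoot I‖ := by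
    rw [norm_mul, norm_div, Complex.norm_ofNat, norm_pow]
    gcongr
    linarith [sq_nonneg ‖I‖]
  set N := ‖I‖ ^ 2 * ‖actionRoot I‖ with hN
  have hN0 : 0 ≤ N := by positivity
  calc |3 / 2 * (μ * (1 - μ))| * expFactor I
        * ‖keplerCoeff 2 0 1 ε * (saddleIntegral 2 0 1 I - I ^ 2 / 3 * actionRoot I)
          + (keplerCoeff 2 0 1 ε + 3 * ε) * (I ^ 2 / 3 * actionRoot I)‖
      ≤ 3 / 2 * expFactor I * ((3 + C) * ε * (4 * (‖I‖⁻¹ * N)) + C * ε ^ 2 * N) := by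
        gcongr
        refine (norm_add_le _ _).trans ?_
        rw [norm_mul, norm_mul]
        gcongr
        linarith
    _ ≤ _ := by
        have e1 : 0 ≤ expFactor I * N * ‖I‖⁻¹ * C * ε := by positivity
        have e2 : 0 ≤ expFactor I * N * ε ^ 2 * (3 + C) := by positivity
        nlinarith

/-! ## Decomposition of the harmonics -/

lemma norm_tsum_sub_sum_le {ι : Type*} {f : ι → ℂ} {w : ι → ℝ} {Q : ℝ} (S : Finset ι)
    (hf : Summable f) (hw : Summable w) (hw0 : ∀ i, 0 ≤ w i) (hQ : 0 ≤ Q)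
    (h : ∀ i ∉ S, ‖f i‖ ≤ Q * w i) : ‖∑' i, f i - ∑ i ∈ S, f i‖ ≤ Q * ∑' i, w i := by
  classical
  have h1 : HasSum (fun i => if i ∈ S then f i else 0) (∑ i ∈ S, f i) := by
    have : HasSum (fun i => if i ∈ S then f i else 0) (∑ i ∈ S, if i ∈ S then f i else 0) :=
      hasSum_sum_of_ne_finset_zero fun i hi => if_neg hi
    rwa [Finset.sum_congr rfl fun i hi => if_pos hi] at this
  have h2 := hf.hasSum.sub h1
  rw [← h2.tsum_eq]
  refine tsum_of_norm_bounded (hw.hasSum.mul_left Q) fun i => ?_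
  by_cases hi : i ∈ S
  · simp only [if_pos hi, sub_self, norm_zero]
    exact mul_nonneg hQ (hw0 i)
  · simp only [if_neg hi, sub_zero]
    exact h i hi

/-- The weight of the pairs of indices. -/
noncomputable def pairWeight (y : ℕ × ℕ) : ℝ := (1 / 2) ^ (y.1 + y.2)

/-- The sum of the weights of the pairs of indices. -/
noncomputable def pairTotal : ℝ := ∑' y, pairWeight y

lemma pairWeight_pos (y : ℕ × ℕ) : 0 < pairWeight y := by
  unfold pairWeight
  positivity

lemma summable_pairWeight : Summable pairWeight :=
  summable_pow_add (r := 1 / 2) (by norm_num) (by norm_num)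

lemma pairTotal_pos : 0 < pairTotal :=
  summable_pairWeight.tsum_pos (fun y => (pairWeight_pos y).le) (0, 0) (pairWeight_pos _)

lemma indexWeight_le_pairWeight (y : ℕ × ℕ) (l : ℤ) : indexWeight (y, l) ≤ pairWeight y :=
  mul_le_of_le_one_right (pairWeight_pos y).le (pow_le_one₀ (by norm_num) (by norm_num))

/-- The sum of the terms of order `l` in `σ` and `-d` in `β`. -/
noncomputable def diffSum (μ : ℝ) (l d : ℤ) (β I ε : ℂ) : ℂ :=
  ∑' y : ℕ × ℕ, if (y.1 : ℤ) - y.2 = d then melnikovTerm μ (y, l) 0 β I ε else 0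

/-- The sum of the terms of order `l` in `σ` whose order in `-β` is not in `D`. -/
noncomputable def diffRem (μ : ℝ) (l : ℤ) (D : Finset ℤ) (β I ε : ℂ) : ℂ :=
  ∑' y : ℕ × ℕ, if (y.1 : ℤ) - y.2 ∈ D then 0 else melnikovTerm μ (y, l) 0 β I ε

lemma summable_ite {f : ℕ × ℕ → ℂ} (hf : Summable fun y => ‖f y‖) (p : ℕ × ℕ → Prop)
    [DecidablePred p] : Summable fun y => if p y then f y else 0 := by
  refine Summable.of_norm_bounded hf fun y => ?_
  split_ifs <;> simp

section Groups

variable {s : ℝ} {σ β I : ℂ} {ε : ℝ} {μ : ℝ}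

lemma Admissible.summable_norm_fiber (h : Admissible s σ β I ε) (h0 : 0 ≤ μ) (h1 : μ ≤ 1) (l : ℤ) :
    Summable fun y : ℕ × ℕ => ‖melnikovTerm μ (y, l) σ β I ε‖ :=
  (h.summable_melnikovTerm h0 h1).comp_injective (i := fun y : ℕ × ℕ => (y, l))
    fun _ _ hxy => (Prod.mk.inj hxy).1

lemma Admissible.melnikovCoeff_eq (h : Admissible s 0 β I ε) (h0 : 0 ≤ μ) (h1 : μ ≤ 1) (l : ℤ)
    (D : Finset ℤ) :
    melnikovCoeff μ l β I ε = ∑ d ∈ D, diffSum μ l d β I ε + diffRem μ l D β I ε := by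
  have hn := h.summable_norm_fiber h0 h1 l
  have hs : ∀ d ∈ D, Summable fun y : ℕ × ℕ =>
      if (y.1 : ℤ) - y.2 = d then melnikovTerm μ (y, l) 0 β I ε else 0 :=
    fun d _ => summable_ite hn _
  have hr : Summable fun y : ℕ × ℕ =>
      if (y.1 : ℤ) - y.2 ∈ D then 0 else melnikovTerm μ (y, l) 0 β I ε := by
    refine Summable.of_norm_bounded hn fun y => ?_
    split_ifs <;> simp
  simp only [diffSum, diffRem, melnikovCoeff]
  rw [← Summable.tsum_finsetSum hs, ← Summable.tsum_add (summable_sum hs) hr]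
  refine tsum_congr fun y => ?_
  rw [Finset.sum_ite_eq]
  split_ifs <;> simp

lemma diffSum_beta (l d : ℤ) :
    diffSum μ l d β I ε = Complex.exp (-(Complex.I * (d * β))) * diffSum μ l d 0 I ε := by
  rw [diffSum, diffSum, ← tsum_mul_left]
  refine tsum_congr fun y => ?_
  split_ifs with hy
  · rw [melnikovTerm_angles]
    simp only [← hy]
    push_cast
    rw [mul_comm]
    congr 2
    ring
  · simp

/-- At order zero in σ the exchange of j and k is a symmetry, so the orders ±d in β have equal
coefficients and combine into a cosine. -/
lemma diffSum_zero_neg (d : ℤ) : diffSum μ 0 (-d) 0 I ε = diffSum μ 0 d 0 I ε := by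
  rw [diffSum, diffSum, ← (Equiv.prodComm ℕ ℕ).tsum_eq]
  refine tsum_congr fun y => ?_
  have := melnikovTerm_swapIndex μ (y, 0) 0 0 I ε
  rw [neg_zero] at this
  simp only [swapIndex, neg_zero] at this
  simp only [Equiv.prodComm_apply, Prod.swap, this]
  congr 1
  exact propext (by omega)

lemma melnikovTerm_eq_zero {j k : ℕ} (hjk : j + k ≤ 1) (l : ℤ) :
    melnikovTerm μ ((j, k), l) σ β I ε = 0 := by
  simp [melnikovTerm, potCoef_eq_zero hjk]

lemma melnikovTerm_eq_zero_of_right {j : ℕ} : melnikovTerm μ ((j, 0), 0) σ β I ε = 0 := by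
  rcases Nat.eq_zero_or_pos j with rfl | hj
  · exact melnikovTerm_eq_zero (by norm_num) 0
  · simp [melnikovTerm, melnikovIntegral_zero, rationalIntegral_zero_right hj]

lemma melnikovTerm_eq_zero_of_left {k : ℕ} : melnikovTerm μ ((0, k), 0) σ β I ε = 0 := by
  rcases Nat.eq_zero_or_pos k with rfl | hk
  · exact melnikovTerm_eq_zero (by norm_num) 0
  · simp [melnikovTerm, melnikovIntegral_zero, rationalIntegral_comm 0 k,
      rationalIntegral_zero_right hk]

/-! ### The terms of order zero in `σ` -/

/-- Besides (0, 0), which vanishes, and the excluded (1, 1), the condition j = k forces j + k ≥ 4: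
the size is I^{1−8}, a factor I^{−4} below the main term. -/
lemma Admissible.norm_term_zero_diag_le (h : Admissible s σ β I ε) (h0 : 0 ≤ μ) (h1 : μ ≤ 1)
    {y : ℕ × ℕ} (hy : (y.1 : ℤ) - y.2 = 0) (hy1 : y ≠ (1, 1)) :
    ‖melnikovTerm μ (y, 0) σ β I ε‖
      ≤ termConst s * (I.re * ((I.re ^ 2) ^ 4)⁻¹) * indexWeight (y, 0) := by
  obtain ⟨j, k⟩ := y
  simp only [ne_eq, Prod.mk.injEq] at hy hy1
  rcases Nat.lt_or_ge (j + k) 4 with hjk | hjk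
  · obtain ⟨rfl, rfl⟩ : j = 0 ∧ k = 0 := by omega
    rw [melnikovTerm_eq_zero (by norm_num), norm_zero]
    have := termConst_ge h.width_nonneg
    have := h.ten_le
    have := indexWeight_pos ((0, 0), 0)
    positivity
  · have := termBound_zero_le (N := 4) (d := 0) h.smallParams hjk (by omega) (by omega)
      (Nat.zero_le _)
    rw [pow_zero, mul_one] at this
    exact (h.norm_melnikovTerm_le h0 h1 _).trans this

/-- The sum j + k is odd. Sum 1 vanishes and sum 3 is excluded, so j + k ≥ 5 and the size is
εI^{1−10}. -/
lemma Admissible.norm_term_zero_one_le (h : Admissible s σ β I ε) (h0 : 0 ≤ μ) (h1 : μ ≤ 1)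
    {y : ℕ × ℕ} (hy : ((y.1 : ℤ) - y.2).natAbs = 1) (hy1 : y ≠ (2, 1)) (hy2 : y ≠ (1, 2)) :
    ‖melnikovTerm μ (y, 0) σ β I ε‖
      ≤ termConst s * (I.re * ((I.re ^ 2) ^ 5)⁻¹ * ε) * indexWeight (y, 0) := by
  obtain ⟨j, k⟩ := y
  simp only [ne_eq, Prod.mk.injEq] at hy hy1 hy2
  rcases Nat.lt_or_ge (j + k) 5 with hjk | hjk
  · have hjk1 : j + k ≤ 1 := by omega
    rw [melnikovTerm_eq_zero hjk1, norm_zero]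
    have := termConst_ge h.width_nonneg
    have := h.ten_le
    have := h.ecc_pos
    have := indexWeight_pos ((j, k), 0)
    positivity
  · have := termBound_zero_le (j := j) (k := k) (N := 5) (d := 1) h.smallParams hjk le_rfl
      (by omega) (by simp only [eccOrder, sub_zero]; omega)
    rw [pow_one] at this
    exact (h.norm_melnikovTerm_le h0 h1 _).trans this

/-- The terms with j = 0 or k = 0 integrate to zero. Otherwise |j − k| ≥ 2 forces j + k ≥ 4, and
there are at least two powers of ε. -/
lemma Admissible.norm_term_zero_two_le (h : Admissible s σ β I ε) (h0 : 0 ≤ μ) (h1 : μ ≤ 1)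
    {y : ℕ × ℕ} (hy : 2 ≤ ((y.1 : ℤ) - y.2).natAbs) :
    ‖melnikovTerm μ (y, 0) σ β I ε‖
      ≤ termConst s * (I.re * ((I.re ^ 2) ^ 4)⁻¹ * ε ^ 2) * indexWeight (y, 0) := by
  obtain ⟨j, k⟩ := y
  simp only at hy
  have hpos : 0 ≤ termConst s * (I.re * ((I.re ^ 2) ^ 4)⁻¹ * ε ^ 2) * indexWeight ((j, k), 0) := by
    have := termConst_ge h.width_nonneg
    have := h.ten_le
    have := indexWeight_pos ((j, k), 0)
    positivity
  rcases Nat.eq_zero_or_pos j with rfl | hj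
  · rwa [melnikovTerm_eq_zero_of_left, norm_zero]
  rcases Nat.eq_zero_or_pos k with rfl | hk
  · rwa [melnikovTerm_eq_zero_of_right, norm_zero]
  exact (h.norm_melnikovTerm_le h0 h1 _).trans
    (termBound_zero_le (N := 4) (d := 2) h.smallParams (by omega) (by omega) le_rfl
      (by simp only [eccOrder, sub_zero]; omega))

/-! ### The terms of order one in `σ` -/

/-- Here the order in the eccentricity is zero. The pair (1, 0) has no potential coefficient and (2,
1) is excluded, so k ≥ 2; each unit of k costs 1/I. -/
lemma Admissible.norm_term_one_diag_le (h : Admissible s σ β I ε) (h0 : 0 ≤ μ) (h1 : μ ≤ 1)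
    {y : ℕ × ℕ} (hy : (y.1 : ℤ) - y.2 = 1) (hy1 : y ≠ (2, 1)) :
    ‖melnikovTerm μ (y, 1) σ β I ε‖
      ≤ termConst s * ((√I.re)⁻¹ * I.re⁻¹ * expFactor I) * indexWeight (y, 1) := by
  obtain ⟨j, k⟩ := y
  simp only [ne_eq, Prod.mk.injEq] at hy hy1
  rcases Nat.lt_or_ge k 2 with hk | hk
  · have hjk1 : j + k ≤ 1 := by omega
    rw [melnikovTerm_eq_zero hjk1, norm_zero]
    have := termConst_ge h.width_nonneg
    have := h.ten_le
    have := indexWeight_pos ((j, k), 1)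
    have : 0 < expFactor I := Real.exp_pos _
    positivity
  · exact (h.norm_melnikovTerm_le h0 h1 _).trans
      (termBound_one_le_of_two_le (L := 1) h.smallParams le_rfl hk)

lemma Admissible.norm_term_one_ecc_le (h : Admissible s σ β I ε) (h0 : 0 ≤ μ) (h1 : μ ≤ 1)
    {y : ℕ × ℕ} (hy : (y.1 : ℤ) - y.2 = 2) (hy1 : y ≠ (2, 0)) :
    ‖melnikovTerm μ (y, 1) σ β I ε‖
      ≤ termConst s * (ε * √I.re * expFactor I) * indexWeight (y, 1) := by
  obtain ⟨j, k⟩ := y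
  simp only [ne_eq, Prod.mk.injEq] at hy hy1
  exact (h.norm_melnikovTerm_le h0 h1 _).trans
    (termBound_one_le_of_one_le (L := 1) h.smallParams le_rfl (by omega)
      (by simp only [eccOrder]; omega))

/-- If j − k ≤ 0 the eccentricity order is negative, and k = 0 would force j = 0, a term that
vanishes. If j − k ≥ 3 the eccentricity order is at least two. The two cases give the two summands.
-/
lemma Admissible.norm_term_one_rem_le (h : Admissible s σ β I ε) (h0 : 0 ≤ μ) (h1 : μ ≤ 1)
    {y : ℕ × ℕ} (hy1 : (y.1 : ℤ) - y.2 ≠ 1) (hy2 : (y.1 : ℤ) - y.2 ≠ 2) :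
    ‖melnikovTerm μ (y, 1) σ β I ε‖
      ≤ termConst s * (ε * ((√I.re)⁻¹ * I.re⁻¹ + ε * (I.re ^ 2 * √I.re)) * expFactor I)
        * indexWeight (y, 1) := by
  obtain ⟨j, k⟩ := y
  simp only at hy1 hy2
  have hK := termConst_ge h.width_nonneg
  have hp := h.ten_le
  have hε := h.ecc_pos
  have hw := indexWeight_pos ((j, k), 1)
  have hE : 0 < expFactor I := Real.exp_pos _
  have hp0 : 0 < I.re := by linarith
  rcases lt_or_ge (eccOrder ((j, k), 1)) 0 with hm | hm
  · rcases Nat.eq_zero_or_pos k with rfl | hk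
    · have hjk1 : j + 0 ≤ 1 := by
        simp only [eccOrder] at hm
        omega
      rw [melnikovTerm_eq_zero hjk1, norm_zero]
      positivity
    · refine (h.norm_melnikovTerm_le h0 h1 _).trans
        ((termBound_one_le_of_neg (L := 1) h.smallParams le_rfl hk hm).trans ?_)
      simp only [Nat.cast_one]
      gcongr
      exact le_add_of_nonneg_right (by positivity)
  · have hm2 : 2 ≤ (eccOrder ((j, k), 1)).natAbs := by
      simp only [eccOrder] at hm ⊢
      omega
    refine (h.norm_melnikovTerm_le h0 h1 _).trans
      ((termBound_one_le_sq (L := 1) h.smallParams le_rfl hm2).trans ?_)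
    simp only [Nat.cast_one]
    refine mul_le_mul_of_nonneg_right (mul_le_mul_of_nonneg_left ?_ (by linarith)) hw.le
    refine mul_le_mul_of_nonneg_right ?_ hE.le
    have : 0 ≤ ε * ((√I.re)⁻¹ * I.re⁻¹) := by positivity
    linarith

/-! ### The groups of terms -/

lemma Admissible.norm_diffSum_zero_zero_sub_le (h : Admissible s 0 0 I ε) (h0 : 0 ≤ μ)
    (h1 : μ ≤ 1) :
    ‖diffSum μ 0 0 0 I ε - melnikovTerm μ ((1, 1), 0) 0 0 I ε‖
      ≤ termConst s * (I.re * ((I.re ^ 2) ^ 4)⁻¹) * pairTotal := by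
  have hp := h.ten_le
  have hK := termConst_ge h.width_nonneg
  have hQ : 0 ≤ termConst s * (I.re * ((I.re ^ 2) ^ 4)⁻¹) := by positivity
  have := norm_tsum_sub_sum_le {((1, 1) : ℕ × ℕ)}
    (summable_ite (h.summable_norm_fiber h0 h1 0) fun y => (y.1 : ℤ) - y.2 = 0)
    summable_pairWeight (fun y => (pairWeight_pos y).le) hQ fun y hy => ?_
  · simpa [diffSum, pairTotal] using this
  · split_ifs with hd
    · exact (h.norm_term_zero_diag_le h0 h1 hd (by simpa using hy)).trans
        (mul_le_mul_of_nonneg_left (indexWeight_le_pairWeight y 0) hQ)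
    · rw [norm_zero]
      exact mul_nonneg hQ (pairWeight_pos y).le

lemma Admissible.norm_diffSum_zero_one_sub_le (h : Admissible s 0 0 I ε) (h0 : 0 ≤ μ)
    (h1 : μ ≤ 1) :
    ‖diffSum μ 0 1 0 I ε - melnikovTerm μ ((2, 1), 0) 0 0 I ε‖
      ≤ termConst s * (I.re * ((I.re ^ 2) ^ 5)⁻¹ * ε) * pairTotal := by
  have hp := h.ten_le
  have hε := h.ecc_pos
  have hK := termConst_ge h.width_nonneg
  have hQ : 0 ≤ termConst s * (I.re * ((I.re ^ 2) ^ 5)⁻¹ * ε) := by positivity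
  have := norm_tsum_sub_sum_le {((2, 1) : ℕ × ℕ)}
    (summable_ite (h.summable_norm_fiber h0 h1 0) fun y => (y.1 : ℤ) - y.2 = 1)
    summable_pairWeight (fun y => (pairWeight_pos y).le) hQ fun y hy => ?_
  · simpa [diffSum, pairTotal] using this
  · split_ifs with hd
    · refine (h.norm_term_zero_one_le h0 h1 (by omega) (by simpa using hy) ?_).trans
        (mul_le_mul_of_nonneg_left (indexWeight_le_pairWeight y 0) hQ)
      rintro rfl
      norm_num at hd
    · rw [norm_zero]
      exact mul_nonneg hQ (pairWeight_pos y).le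

lemma Admissible.norm_diffRem_zero_le (h : Admissible s 0 β I ε) (h0 : 0 ≤ μ) (h1 : μ ≤ 1) :
    ‖diffRem μ 0 {0, 1, -1} β I ε‖
      ≤ termConst s * (I.re * ((I.re ^ 2) ^ 4)⁻¹ * ε ^ 2) * pairTotal := by
  have hp := h.ten_le
  have hK := termConst_ge h.width_nonneg
  have hQ : 0 ≤ termConst s * (I.re * ((I.re ^ 2) ^ 4)⁻¹ * ε ^ 2) := by positivity
  refine tsum_of_norm_bounded (summable_pairWeight.hasSum.mul_left _) fun y => ?_
  split_ifs with hd
  · rw [norm_zero]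
    exact mul_nonneg hQ (pairWeight_pos y).le
  · refine (h.norm_term_zero_two_le h0 h1 ?_).trans
        (mul_le_mul_of_nonneg_left (indexWeight_le_pairWeight y 0) hQ)
    simp only [Finset.mem_insert, Finset.mem_singleton] at hd
    omega

lemma Admissible.norm_diffSum_one_one_sub_le (h : Admissible s 0 0 I ε) (h0 : 0 ≤ μ)
    (h1 : μ ≤ 1) :
    ‖diffSum μ 1 1 0 I ε - melnikovTerm μ ((2, 1), 1) 0 0 I ε‖
      ≤ termConst s * ((√I.re)⁻¹ * I.re⁻¹ * expFactor I) * pairTotal := by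
  have hp := h.ten_le
  have hK := termConst_ge h.width_nonneg
  have hE : 0 < expFactor I := Real.exp_pos _
  have hQ : 0 ≤ termConst s * ((√I.re)⁻¹ * I.re⁻¹ * expFactor I) := by positivity
  have := norm_tsum_sub_sum_le {((2, 1) : ℕ × ℕ)}
    (summable_ite (h.summable_norm_fiber h0 h1 1) fun y => (y.1 : ℤ) - y.2 = 1)
    summable_pairWeight (fun y => (pairWeight_pos y).le) hQ fun y hy => ?_
  · simpa [diffSum, pairTotal] using this
  · split_ifs with hd
    · exact (h.norm_term_one_diag_le h0 h1 hd (by simpa using hy)).trans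
        (mul_le_mul_of_nonneg_left (indexWeight_le_pairWeight y 1) hQ)
    · rw [norm_zero]
      exact mul_nonneg hQ (pairWeight_pos y).le

lemma Admissible.norm_diffSum_one_two_sub_le (h : Admissible s 0 0 I ε) (h0 : 0 ≤ μ)
    (h1 : μ ≤ 1) :
    ‖diffSum μ 1 2 0 I ε - melnikovTerm μ ((2, 0), 1) 0 0 I ε‖
      ≤ termConst s * (ε * √I.re * expFactor I) * pairTotal := by
  have hε := h.ecc_pos
  have hK := termConst_ge h.width_nonneg
  have hE : 0 < expFactor I := Real.exp_pos _
  have hQ : 0 ≤ termConst s * (ε * √I.re * expFactor I) := by positivity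
  have := norm_tsum_sub_sum_le {((2, 0) : ℕ × ℕ)}
    (summable_ite (h.summable_norm_fiber h0 h1 1) fun y => (y.1 : ℤ) - y.2 = 2)
    summable_pairWeight (fun y => (pairWeight_pos y).le) hQ fun y hy => ?_
  · simpa [diffSum, pairTotal] using this
  · split_ifs with hd
    · exact (h.norm_term_one_ecc_le h0 h1 hd (by simpa using hy)).trans
        (mul_le_mul_of_nonneg_left (indexWeight_le_pairWeight y 1) hQ)
    · rw [norm_zero]
      exact mul_nonneg hQ (pairWeight_pos y).le

lemma Admissible.norm_diffRem_one_le (h : Admissible s 0 β I ε) (h0 : 0 ≤ μ) (h1 : μ ≤ 1) :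
    ‖diffRem μ 1 {1, 2} β I ε‖
      ≤ termConst s * (ε * ((√I.re)⁻¹ * I.re⁻¹ + ε * (I.re ^ 2 * √I.re)) * expFactor I)
        * pairTotal := by
  have hp := h.ten_le
  have hε := h.ecc_pos
  have hK := termConst_ge h.width_nonneg
  have hE : 0 < expFactor I := Real.exp_pos _
  have hQ : 0 ≤ termConst s * (ε * ((√I.re)⁻¹ * I.re⁻¹ + ε * (I.re ^ 2 * √I.re))
    * expFactor I) := by positivity
  refine tsum_of_norm_bounded (summable_pairWeight.hasSum.mul_left _) fun y => ?_
  split_ifs with hd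
  · rw [norm_zero]
    exact mul_nonneg hQ (pairWeight_pos y).le
  · simp only [Finset.mem_insert, Finset.mem_singleton, not_or] at hd
    exact (h.norm_term_one_rem_le h0 h1 hd.1 hd.2).trans
        (mul_le_mul_of_nonneg_left (indexWeight_le_pairWeight y 1) hQ)

lemma Admissible.norm_term_two_le (h : Admissible s σ β I ε) (h0 : 0 ≤ μ) (h1 : μ ≤ 1)
    {x : (ℕ × ℕ) × ℤ} (hx : 2 ≤ x.2.natAbs) :
    ‖melnikovTerm μ x σ β I ε‖
      ≤ termConst s * (I.re * √I.re * expFactor I ^ 2) * indexWeight x := by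
  obtain ⟨⟨j, k⟩, l⟩ := x
  simp only at hx
  refine (h.norm_melnikovTerm_le h0 h1 _).trans ?_
  rcases le_total 0 l with hl | hl
  · obtain ⟨n, rfl⟩ := Int.eq_ofNat_of_zero_le hl
    exact termBound_two_le h.smallParams j k (by omega)
  · obtain ⟨n, hn⟩ := Int.eq_ofNat_of_zero_le (show 0 ≤ -l by omega)
    obtain rfl : l = -(n : ℤ) := by omega
    have := termBound_two_le h.smallParams k j (L := n) (by omega)
    rw [← termBound_swapIndex, ← indexWeight_swapIndex] at this
    exact this

lemma Admissible.norm_melnikovCoeff_mul_exp_le (h : Admissible s σ β I ε) (h0 : 0 ≤ μ)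
    (h1 : μ ≤ 1) {l : ℤ} (hl : 2 ≤ l.natAbs) :
    ‖melnikovCoeff μ l β I ε * Complex.exp (Complex.I * l * σ)‖
      ≤ termConst s * (I.re * √I.re * expFactor I ^ 2) * pairTotal * (1 / 2) ^ l.natAbs := by
  have e : melnikovCoeff μ l β I ε * Complex.exp (Complex.I * l * σ)
      = ∑' y : ℕ × ℕ, melnikovTerm μ (y, l) σ β I ε := by
    rw [melnikovCoeff, ← tsum_mul_right]
    exact tsum_congr fun y => (melnikovTerm_sigma μ (y, l) σ β I ε).symm
  rw [e]
  have hb := (summable_pairWeight.hasSum.mul_left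
    (termConst s * (I.re * √I.re * expFactor I ^ 2))).mul_right ((1 / 2) ^ l.natAbs)
  refine tsum_of_norm_bounded hb fun y => (h.norm_term_two_le h0 h1 (x := (y, l)) hl).trans ?_
  rw [indexWeight, pairWeight]
  exact le_of_eq (by ring)

lemma Admissible.norm_tail_le (h : Admissible s σ β I ε) (h0 : 0 ≤ μ) (h1 : μ ≤ 1) :
    ‖∑' l : ℕ, angleHarmonic (fun x => melnikovSeries μ (x, β, I, ε)) (l + 2) σ‖
      ≤ termConst s * (I.re * √I.re * expFactor I ^ 2) * pairTotal := by
  set Q := termConst s * (I.re * √I.re * expFactor I ^ 2) * pairTotal with hQ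
  have hgeo := (hasSum_geometric_of_lt_one (r := (1 / 2 : ℝ)) (by norm_num) (by norm_num)).mul_left
    (Q / 2)
  -- The orders l + 2 and −(l + 2) each contribute Q(1/2)^{l+2}, together (Q/2)(1/2)^l, whose sum is
  -- Q.
  rw [show Q / 2 * (1 - 1 / 2)⁻¹ = Q by norm_num] at hgeo
  refine tsum_of_norm_bounded hgeo fun l => ?_
  rw [angleHarmonic, if_neg (by omega), h.angleCoeff_melnikovSeries h0 h1,
    h.angleCoeff_melnikovSeries h0 h1]
  have a1 := h.norm_melnikovCoeff_mul_exp_le h0 h1 (l := ((l + 2 : ℕ) : ℤ)) (by omega)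
  have a2 := h.norm_melnikovCoeff_mul_exp_le h0 h1 (l := -((l + 2 : ℕ) : ℤ)) (by omega)
  rw [← hQ, Int.natAbs_neg, Int.natAbs_natCast] at a2
  rw [← hQ, Int.natAbs_natCast] at a1
  refine (norm_add_le _ _).trans ?_
  have e : Q / 2 * (1 / 2) ^ l = Q * (1 / 2) ^ (l + 2) + Q * (1 / 2) ^ (l + 2) := by
    rw [pow_add]
    ring
  rw [e]
  refine add_le_add ?_ ?_
  · rw [mul_comm]
    simpa using a1
  · rw [mul_comm]
    refine le_trans (le_of_eq ?_) a2
    congr 3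
    push_cast
    ring

end Groups

/-! ## Estimates of the coefficients -/

lemma rpow_natCast_add_half {N : ℝ} (hN : 0 < N) (n : ℕ) : N ^ ((n : ℝ) + 1 / 2) = N ^ n * √N := by
  rw [Real.rpow_add hN, Real.rpow_natCast, Real.sqrt_eq_rpow]

lemma rpow_half_integers {N : ℝ} (hN : 0 < N) :
    N ^ (1 / 2 : ℝ) = √N ∧ N ^ (3 / 2 : ℝ) = N * √N ∧ N ^ (5 / 2 : ℝ) = N ^ 2 * √N ∧
      N ^ (-(3 / 2) : ℝ) = (√N)⁻¹ * N⁻¹ ∧ N ^ (-(7 / 2) : ℝ) = (√N)⁻¹ * N⁻¹ ^ 3 := by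
  have h3 : N ^ (3 / 2 : ℝ) = N * √N := by
    have := rpow_natCast_add_half hN 1
    norm_num at this
    exact this
  have h5 : N ^ (5 / 2 : ℝ) = N ^ 2 * √N := by
    have := rpow_natCast_add_half hN 2
    norm_num at this
    exact this
  have h7 : N ^ (7 / 2 : ℝ) = N ^ 3 * √N := by
    have := rpow_natCast_add_half hN 3
    norm_num at this
    exact this
  refine ⟨(Real.sqrt_eq_rpow N).symm, h3, h5, ?_, ?_⟩
  · rw [Real.rpow_neg hN.le, h3, mul_inv, mul_comm]
  · rw [Real.rpow_neg hN.le, h7, mul_inv, mul_comm, inv_pow]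

lemma zpow_neg_ofNat_eq (N : ℝ) (n : ℕ) : N ^ (-(n : ℤ)) = N⁻¹ ^ n := by
  rw [zpow_neg, zpow_natCast, inv_pow]

lemma sqrt_norm_le_two_mul {I : ℂ} (hI : 10 ≤ I.re) (hq : |I.im| ≤ 1) :
    (√I.re)⁻¹ ≤ 2 * (√‖I‖)⁻¹ ∧ √I.re ≤ √‖I‖ := by
  have h1 := norm_action_le hI hq
  obtain ⟨h2, h3⟩ := re_le_norm_action hI
  have hp : 0 < I.re := by linarith
  refine ⟨?_, Real.sqrt_le_sqrt h2⟩
  have h4 : √‖I‖ ≤ 2 * √I.re := by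
    rw [Real.sqrt_le_left (by positivity), mul_pow, Real.sq_sqrt hp.le]
    linarith
  have h5 : 0 < √I.re := Real.sqrt_pos.2 hp
  have h6 : 0 < √‖I‖ := Real.sqrt_pos.2 h3
  rw [inv_eq_one_div, ← div_eq_mul_inv, div_le_div_iff₀ h5 h6]
  linarith

section Coefficients

variable {s μ : ℝ}

lemma mul_pow_inv_le {K p v : ℝ} (hK : 0 ≤ K) (hp : 0 ≤ p⁻¹) (h : p⁻¹ ≤ 2 * v) (n : ℕ) :
    K * p⁻¹ ^ n ≤ K * 2 ^ n * v ^ n := by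
  rw [mul_assoc, ← mul_pow]
  gcongr

/-- The term (1, 1) gives the factor 1 + (3/2)ε², and the others are O(I^{−7}), that is O(I^{−4})
relative to I^{−3}. The power 2⁷ in the constant comes from comparing Re I with |I|. -/
lemma norm_zeroth_coefficient_le (hs : 0 ≤ s) (hμ0 : 0 < μ) (hμ1 : μ < 1 / 2) :
    ∃ C : ℝ, 0 < C ∧ ∀ {I : ℂ} {ε : ℝ}, Admissible s 0 0 I ε →
      ‖((μ * (1 - μ) : ℝ) : ℂ)⁻¹ * diffSum μ 0 0 0 I ε - Real.pi / (2 * I ^ 3)‖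
        ≤ C * (‖I‖ ^ (-4 : ℤ) + ε ^ 2) * ‖Real.pi / (2 * I ^ 3)‖ := by
  have hκ : 0 < μ * (1 - μ) := mul_pos hμ0 (by linarith)
  have hK : 0 < termConst s := lt_of_lt_of_le (by norm_num) (termConst_ge hs)
  have hW := pairTotal_pos
  set κ := μ * (1 - μ) with hκd
  set B := κ⁻¹ * termConst s * pairTotal * 2 ^ 7 with hB
  have hB0 : 0 < B := by positivity
  refine ⟨B + 3 / 2, by positivity, fun {I ε} h => ?_⟩
  have hI := h.ten_le
  have hp : 0 < I.re := by linarith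
  obtain ⟨hN1, hN⟩ := re_le_norm_action hI
  have hv := inv_re_le_norm_inv hI h.action_im
  have hI0 : I ≠ 0 := norm_pos_iff.1 hN
  have hκc : (κ : ℂ) ≠ 0 := by exact_mod_cast hκ.ne'
  have hr := h.norm_diffSum_zero_zero_sub_le hμ0.le (by linarith)
  rw [melnikovTerm_one_one_zero μ hI0, show I.re * ((I.re ^ 2) ^ 4)⁻¹ = I.re⁻¹ ^ 7 by
    field_simp] at hr
  have e : (κ : ℂ)⁻¹ * diffSum μ 0 0 0 I ε - Real.pi / (2 * I ^ 3)
      = (κ : ℂ)⁻¹ * (diffSum μ 0 0 0 I ε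
        - μ * (1 - μ) * (Real.pi / (2 * I ^ 3)) * (1 + 3 / 2 * ε ^ 2))
        + ((3 / 2 * ε ^ 2 : ℝ) : ℂ) * (Real.pi / (2 * I ^ 3)) := by
    have : (μ : ℂ) * (1 - μ) = κ := by rw [hκd]; push_cast; ring
    rw [this, mul_sub]
    push_cast
    field_simp
    ring
  have hm : ‖(Real.pi / (2 * I ^ 3) : ℂ)‖ = Real.pi / 2 * ‖I‖⁻¹ ^ 3 := by
    rw [norm_div, norm_mul, norm_pow, Complex.norm_ofNat, Complex.norm_real, Real.norm_eq_abs,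
      abs_of_pos Real.pi_pos]
    field_simp
  rw [e, show (-4 : ℤ) = -((4 : ℕ) : ℤ) by norm_num, zpow_neg_ofNat_eq]
  set m : ℂ := Real.pi / (2 * I ^ 3)
  set v := ‖I‖⁻¹ with hvd
  have hv0 : 0 < v := by positivity
  have h7 : κ⁻¹ * (termConst s * I.re⁻¹ ^ 7 * pairTotal) ≤ B * v ^ 7 := by
    have := mul_pow_inv_le (K := κ⁻¹ * termConst s * pairTotal) (by positivity) (by positivity) hv 7
    rw [hB]
    linarith
  have hm1 : v ^ 3 ≤ ‖m‖ := by
    rw [hm]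
    have := Real.pi_gt_three
    have : 0 < v ^ 3 := by positivity
    nlinarith
  calc _ ≤ κ⁻¹ * (termConst s * I.re⁻¹ ^ 7 * pairTotal) + 3 / 2 * ε ^ 2 * ‖m‖ := by
        refine (norm_add_le _ _).trans ?_
        rw [norm_mul, norm_mul, norm_inv, Complex.norm_real, Complex.norm_real, Real.norm_eq_abs,
          Real.norm_eq_abs, abs_of_pos hκ, abs_of_nonneg (by positivity : 0 ≤ 3 / 2 * ε ^ 2)]
        gcongr
    _ ≤ B * v ^ 4 * ‖m‖ + 3 / 2 * ε ^ 2 * ‖m‖ := by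
        refine add_le_add_left (h7.trans ?_) _
        rw [show v ^ 7 = v ^ 4 * v ^ 3 by ring, ← mul_assoc]
        gcongr
    _ ≤ _ := by
        have a1 : 0 ≤ B * ε ^ 2 * ‖m‖ := by positivity
        have a2 : 0 ≤ v ^ 4 * ‖m‖ := by positivity
        linarith

/-- The main term carries the factor 1 − 2μ, whereas the bound of the remaining terms does not. A
relative error therefore requires dividing by 1 − 2μ, and this uses μ < 1/2. -/
lemma norm_first_coefficient_le (hs : 0 ≤ s) (hμ0 : 0 < μ) (hμ1 : μ < 1 / 2) :
    ∃ C : ℝ, 0 < C ∧ ∀ {I : ℂ} {ε : ℝ}, Admissible s 0 0 I ε →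
      ‖((μ * (1 - μ) : ℝ) : ℂ)⁻¹ * (2 * diffSum μ 0 1 0 I ε)
          - (-((1 - 2 * μ) * (15 * Real.pi * ε / (8 * I ^ 5))))‖
        ≤ C * (‖I‖ ^ (-4 : ℤ) + ε ^ 2) * ‖(1 - 2 * μ) * (15 * Real.pi * ε / (8 * I ^ 5))‖ := by
  have hκ : 0 < μ * (1 - μ) := mul_pos hμ0 (by linarith)
  have hν : 0 < 1 - 2 * μ := by linarith
  have hK : 0 < termConst s := lt_of_lt_of_le (by norm_num) (termConst_ge hs)
  have hW := pairTotal_pos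
  set κ := μ * (1 - μ) with hκd
  set ν := 1 - 2 * μ with hνd
  set B := κ⁻¹ * 2 * termConst s * pairTotal * 2 ^ 9 with hB
  have hB0 : 0 < B := by positivity
  refine ⟨B / ν + 3 / 4, by positivity, fun {I ε} h => ?_⟩
  have hI := h.ten_le
  have hε := h.ecc_pos
  have hp : 0 < I.re := by linarith
  obtain ⟨hN1, hN⟩ := re_le_norm_action hI
  have hv := inv_re_le_norm_inv hI h.action_im
  have hI0 : I ≠ 0 := norm_pos_iff.1 hN
  have hκc : (κ : ℂ) ≠ 0 := by exact_mod_cast hκ.ne'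
  have hr := h.norm_diffSum_zero_one_sub_le hμ0.le (by linarith)
  rw [melnikovTerm_two_one_zero μ hI0, show I.re * ((I.re ^ 2) ^ 5)⁻¹ = I.re⁻¹ ^ 9 by
    field_simp] at hr
  have hνc : (1 - 2 * μ : ℂ) = ν := by rw [hνd]; push_cast; ring
  set m : ℂ := ν * (15 * Real.pi * ε / (8 * I ^ 5)) with hmd
  have e : (κ : ℂ)⁻¹ * (2 * diffSum μ 0 1 0 I ε) - (-m)
      = (κ : ℂ)⁻¹ * 2 * (diffSum μ 0 1 0 I ε
        - -(μ * (1 - μ) * (1 - 2 * μ) * (15 * Real.pi / (16 * I ^ 5)) * (ε + 3 / 4 * ε ^ 3)))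
        - ((3 / 4 * ε ^ 2 : ℝ) : ℂ) * m := by
    have : (μ : ℂ) * (1 - μ) = κ := by rw [hκd]; push_cast; ring
    rw [this, hνc, mul_sub, hmd]
    push_cast
    field_simp
    ring
  have hm : ‖m‖ = ν * (15 * Real.pi / 8) * ε * ‖I‖⁻¹ ^ 5 := by
    rw [hmd, norm_mul, norm_div, norm_mul, norm_mul, norm_mul, norm_pow, Complex.norm_ofNat,
      Complex.norm_ofNat, Complex.norm_real, Complex.norm_real, Complex.norm_real, Real.norm_eq_abs,
      Real.norm_eq_abs, Real.norm_eq_abs, abs_of_pos Real.pi_pos, abs_of_pos hε, abs_of_pos hν]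
    field_simp
  rw [hνc, ← hmd, e, show (-4 : ℤ) = -((4 : ℕ) : ℤ) by norm_num, zpow_neg_ofNat_eq]
  clear_value m
  set v := ‖I‖⁻¹ with hvd
  have hv0 : 0 < v := by positivity
  have h9 : κ⁻¹ * 2 * (termConst s * (I.re⁻¹ ^ 9 * ε) * pairTotal) ≤ B * v ^ 9 * ε := by
    have := mul_pow_inv_le (K := κ⁻¹ * 2 * termConst s * pairTotal * ε) (by positivity)
      (by positivity) hv 9
    rw [hB]
    linarith
  have hm1 : v ^ 5 * ε ≤ ‖m‖ / ν := by
    rw [hm, le_div_iff₀ hν]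
    have := Real.pi_gt_three
    have : 0 < v ^ 5 * ε * ν := by positivity
    nlinarith
  calc _ ≤ κ⁻¹ * 2 * (termConst s * (I.re⁻¹ ^ 9 * ε) * pairTotal) + 3 / 4 * ε ^ 2 * ‖m‖ := by
        refine (norm_sub_le _ _).trans ?_
        rw [norm_mul, norm_mul, norm_mul, norm_inv, Complex.norm_real, Complex.norm_real,
          Real.norm_eq_abs, Complex.norm_ofNat,
          Real.norm_eq_abs, abs_of_pos hκ, abs_of_nonneg (by positivity : 0 ≤ 3 / 4 * ε ^ 2)]
        gcongr
    _ ≤ B * v ^ 4 * (‖m‖ / ν) + 3 / 4 * ε ^ 2 * ‖m‖ := by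
        refine add_le_add_left (h9.trans ?_) _
        rw [show B * v ^ 9 * ε = B * v ^ 4 * (v ^ 5 * ε) by ring]
        gcongr
    _ ≤ _ := by
        have a1 : 0 ≤ B / ν * ε ^ 2 * ‖m‖ := by positivity
        have a2 : 0 ≤ v ^ 4 * ‖m‖ := by positivity
        have a3 : B * v ^ 4 * (‖m‖ / ν) = B / ν * v ^ 4 * ‖m‖ := by ring
        linarith

lemma norm_coefficient_one_one_le (hs : 0 ≤ s) (hμ0 : 0 < μ) (hμ1 : μ < 1 / 2) :
    ∃ C : ℝ, 0 < C ∧ ∀ {I : ℂ} {ε : ℝ}, Admissible s 0 0 I ε →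
      ‖2 * (((μ * (1 - μ) : ℝ) : ℂ)⁻¹ * diffSum μ 1 1 0 I ε)
          - (1 - 2 * μ) * (Real.pi / (8 * I)) ^ (1 / 2 : ℂ) * Complex.exp (-(I ^ 3 / 3))‖
        ≤ C * (‖I‖⁻¹ + ε ^ 2) * ‖(1 - 2 * μ) * (Real.pi / (8 * I)) ^ (1 / 2 : ℂ)
            * Complex.exp (-(I ^ 3 / 3))‖ := by
  have hκ : 0 < μ * (1 - μ) := mul_pos hμ0 (by linarith)
  have hν : 0 < 1 - 2 * μ := by linarith
  have hK : 0 < termConst s := lt_of_lt_of_le (by norm_num) (termConst_ge hs)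
  have hW := pairTotal_pos
  obtain ⟨C₃, hC₃, hM⟩ := norm_melnikovTerm_two_one_one_sub_le hμ0.le hμ1.le
  set κ := μ * (1 - μ) with hκd
  set ν := 1 - 2 * μ with hνd
  set B := 2 * κ⁻¹ * (2 * termConst s * pairTotal + C₃) with hB
  have hB0 : 0 < B := by positivity
  refine ⟨4 / ν * B, by positivity, fun {I ε} h => ?_⟩
  have hI := h.ten_le
  have hp : 0 < I.re := by linarith
  obtain ⟨hN1, hN⟩ := re_le_norm_action hI
  have hv := inv_re_le_norm_inv hI h.action_im
  have hr := h.norm_diffSum_one_one_sub_le hμ0.le (by linarith)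
  have hM := hM h
  have hκc : (κ : ℂ) ≠ 0 := by exact_mod_cast hκ.ne'
  have hνc : (1 - 2 * μ : ℂ) = ν := by rw [hνd]; push_cast; ring
  rw [cpow_half_pi_div hp, hνc]
  have hE : 0 < expFactor I := Real.exp_pos _
  have e : 2 * ((κ : ℂ)⁻¹ * diffSum μ 1 1 0 I ε)
        - ν * (actionRoot I / 4) * Complex.exp (-(I ^ 3 / 3))
      = ((2 * κ⁻¹ : ℝ) : ℂ) * ((diffSum μ 1 1 0 I ε - melnikovTerm μ ((2, 1), 1) 0 0 I ε)
        + (melnikovTerm μ ((2, 1), 1) 0 0 I ε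
          - μ * (1 - μ) * ((1 - 2 * μ) * (actionRoot I / 8) * Complex.exp (-(I ^ 3 / 3))))) := by
    have : (μ : ℂ) * (1 - μ) = κ := by rw [hκd]; push_cast; ring
    rw [this, hνc]
    push_cast
    field_simp
    ring
  have hm : ‖(ν : ℂ) * (actionRoot I / 4) * Complex.exp (-(I ^ 3 / 3))‖
      = ν / 4 * (‖actionRoot I‖ * expFactor I) := by
    rw [norm_mul, norm_mul, norm_div, expFactor_eq_norm, Complex.norm_ofNat, Complex.norm_real,
      Real.norm_eq_abs, abs_of_pos hν]
    ring
  rw [e, hm, norm_mul, Complex.norm_real, Real.norm_eq_abs,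
    abs_of_pos (by positivity : 0 < 2 * κ⁻¹)]
  have hq := inv_sqrt_le_norm_actionRoot hI h.action_im
  have hr2 : termConst s * ((√I.re)⁻¹ * I.re⁻¹ * expFactor I) * pairTotal
      ≤ 2 * termConst s * pairTotal * (‖I‖⁻¹ * ‖actionRoot I‖ * expFactor I) := by
    calc _ ≤ termConst s * (‖actionRoot I‖ * (2 * ‖I‖⁻¹) * expFactor I) * pairTotal := by gcongr
      _ = _ := by ring
  calc _ ≤ 2 * κ⁻¹ * (2 * termConst s * pairTotal * (‖I‖⁻¹ * ‖actionRoot I‖ * expFactor I)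
          + C₃ * ((‖I‖⁻¹ + ε ^ 2) * ‖actionRoot I‖ * expFactor I)) := by
        gcongr
        exact (norm_add_le _ _).trans (add_le_add (hr.trans hr2) hM)
    _ ≤ B * ((‖I‖⁻¹ + ε ^ 2) * ‖actionRoot I‖ * expFactor I) := by
        have : 0 ≤ 2 * κ⁻¹ * (2 * termConst s * pairTotal)
            * (ε ^ 2 * ‖actionRoot I‖ * expFactor I) := by positivity
        rw [hB]
        linarith
    _ = _ := by
        field_simp

lemma norm_coefficient_one_two_le (hs : 0 ≤ s) (hμ0 : 0 < μ) (hμ1 : μ < 1 / 2) :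
    ∃ C : ℝ, 0 < C ∧ ∀ {I : ℂ} {ε : ℝ}, Admissible s 0 0 I ε →
      ‖2 * (((μ * (1 - μ) : ℝ) : ℂ)⁻¹ * diffSum μ 1 2 0 I ε)
          - (-(3 * ε * (2 * Real.pi * I ^ 3) ^ (1 / 2 : ℂ) * Complex.exp (-(I ^ 3 / 3))))‖
        ≤ C * (‖I‖⁻¹ + ε) * ‖3 * ε * (2 * Real.pi * I ^ 3) ^ (1 / 2 : ℂ)
            * Complex.exp (-(I ^ 3 / 3))‖ := by
  have hκ : 0 < μ * (1 - μ) := mul_pos hμ0 (by linarith)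
  have hK : 0 < termConst s := lt_of_lt_of_le (by norm_num) (termConst_ge hs)
  have hW := pairTotal_pos
  obtain ⟨C₄, hC₄, hM⟩ := norm_melnikovTerm_two_zero_one_add_le hμ0.le hμ1.le
  set κ := μ * (1 - μ) with hκd
  set B := 2 * κ⁻¹ * (termConst s * pairTotal + C₄) with hB
  have hB0 : 0 < B := by positivity
  refine ⟨B, by positivity, fun {I ε} h => ?_⟩
  have hI := h.ten_le
  have hε := h.ecc_pos
  have hp : 0 < I.re := by linarith
  obtain ⟨hN1, hN⟩ := re_le_norm_action hI
  have hr := h.norm_diffSum_one_two_sub_le hμ0.le (by linarith)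
  have hM := hM h
  have hκc : (κ : ℂ) ≠ 0 := by exact_mod_cast hκ.ne'
  rw [cpow_half_two_pi_mul hI h.action_im]
  have hE : 0 < expFactor I := Real.exp_pos _
  have e : 2 * ((κ : ℂ)⁻¹ * diffSum μ 1 2 0 I ε)
        - (-(3 * ε * (I ^ 2 * actionRoot I) * Complex.exp (-(I ^ 3 / 3))))
      = ((2 * κ⁻¹ : ℝ) : ℂ) * ((diffSum μ 1 2 0 I ε - melnikovTerm μ ((2, 0), 1) 0 0 I ε)
        + (melnikovTerm μ ((2, 0), 1) 0 0 I ε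
          + μ * (1 - μ) * (3 / 2 * ε * (I ^ 2 * actionRoot I) * Complex.exp (-(I ^ 3 / 3))))) := by
    have : (μ : ℂ) * (1 - μ) = κ := by rw [hκd]; push_cast; ring
    rw [this]
    push_cast
    field_simp
    ring
  have hm : ‖3 * (ε : ℂ) * (I ^ 2 * actionRoot I) * Complex.exp (-(I ^ 3 / 3))‖
      = 3 * (ε * (‖I‖ ^ 2 * ‖actionRoot I‖) * expFactor I) := by
    rw [norm_mul, norm_mul, norm_mul, norm_mul, norm_pow, expFactor_eq_norm, Complex.norm_ofNat,
      Complex.norm_real, Real.norm_eq_abs, abs_of_pos hε]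
    ring
  rw [e, hm, norm_mul, Complex.norm_real, Real.norm_eq_abs,
    abs_of_pos (by positivity : 0 < 2 * κ⁻¹)]
  have hq := inv_sqrt_le_norm_actionRoot hI h.action_im
  set N2 := ‖I‖ ^ 2 * ‖actionRoot I‖ with hN2
  have hN20 : 0 ≤ N2 := by positivity
  have hsq : √I.re ≤ ‖I‖⁻¹ * N2 := by
    calc √I.re = I.re * (√I.re)⁻¹ := by
          rw [← div_eq_mul_inv, Real.div_sqrt]
      _ ≤ ‖I‖ * ‖actionRoot I‖ := by gcongr
      _ = ‖I‖⁻¹ * N2 := by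
          rw [hN2]
          field_simp
  have hr2 : termConst s * (ε * √I.re * expFactor I) * pairTotal
      ≤ termConst s * pairTotal * (ε * ‖I‖⁻¹ * N2 * expFactor I) := by
    calc _ ≤ termConst s * (ε * (‖I‖⁻¹ * N2) * expFactor I) * pairTotal := by gcongr
      _ = _ := by ring
  calc _ ≤ 2 * κ⁻¹ * (termConst s * pairTotal * (ε * ‖I‖⁻¹ * N2 * expFactor I)
          + C₄ * (ε * (‖I‖⁻¹ + ε) * N2 * expFactor I)) := by
        gcongr
        exact (norm_add_le _ _).trans (add_le_add (hr.trans hr2) hM)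
    _ ≤ B * ((‖I‖⁻¹ + ε) * (ε * N2 * expFactor I)) := by
        have : 0 ≤ 2 * κ⁻¹ * (termConst s * pairTotal) * (ε * ε * N2 * expFactor I) := by positivity
        rw [hB]
        linarith
    _ ≤ _ := by
        have : 0 ≤ B * (‖I‖⁻¹ + ε) * (ε * N2 * expFactor I) := by positivity
        linarith

lemma norm_zeroth_remainder_le (hs : 0 ≤ s) (hμ0 : 0 < μ) (hμ1 : μ < 1 / 2) :
    ∃ C : ℝ, 0 < C ∧ ∀ {β I : ℂ} {ε : ℝ}, Admissible s 0 β I ε →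
      ‖((μ * (1 - μ) : ℝ) : ℂ)⁻¹ * diffRem μ 0 {0, 1, -1} β I ε‖
        ≤ C * (ε ^ 2 * ‖I‖ ^ (-7 : ℤ)) := by
  have hκ : 0 < μ * (1 - μ) := mul_pos hμ0 (by linarith)
  have hK : 0 < termConst s := lt_of_lt_of_le (by norm_num) (termConst_ge hs)
  have hW := pairTotal_pos
  set κ := μ * (1 - μ) with hκd
  refine ⟨κ⁻¹ * termConst s * pairTotal * 2 ^ 7, by positivity, fun {β I ε} h => ?_⟩
  have hI := h.ten_le
  have hp : 0 < I.re := by linarith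
  have hv := inv_re_le_norm_inv hI h.action_im
  have hr := h.norm_diffRem_zero_le hμ0.le (by linarith)
  rw [show I.re * ((I.re ^ 2) ^ 4)⁻¹ = I.re⁻¹ ^ 7 by field_simp] at hr
  rw [show (-7 : ℤ) = -((7 : ℕ) : ℤ) by norm_num, zpow_neg_ofNat_eq, norm_mul, norm_inv,
    Complex.norm_real, Real.norm_eq_abs, abs_of_pos hκ]
  have := mul_pow_inv_le (K := κ⁻¹ * termConst s * pairTotal * ε ^ 2) (by positivity)
      (by positivity) hv 7
  calc _ ≤ κ⁻¹ * (termConst s * (I.re⁻¹ ^ 7 * ε ^ 2) * pairTotal) := by gcongr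
    _ ≤ _ := by linarith

lemma norm_exp_I_mul_le {s : ℝ} {σ : ℂ} (h : |σ.im| ≤ s) :
    ‖Complex.exp (Complex.I * σ)‖ ≤ Real.exp s := by
  have := norm_exp_sigma_le h 1
  simpa using this

lemma norm_first_remainder_le (hs : 0 ≤ s) (hμ0 : 0 < μ) (hμ1 : μ < 1 / 2) :
    ∃ C : ℝ, 0 < C ∧ ∀ {σ β I : ℂ} {ε : ℝ}, Admissible s σ β I ε →
      ‖((μ * (1 - μ) : ℝ) : ℂ)⁻¹ * (Complex.exp (Complex.I * σ) * diffRem μ 1 {1, 2} β I ε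
          + Complex.exp (-(Complex.I * σ)) * diffRem μ 1 {1, 2} (-β) I ε)‖
        ≤ C * (ε * (‖I‖ ^ (-(3 / 2) : ℝ) + ε * ‖I‖ ^ (5 / 2 : ℝ))
            * ‖Complex.exp (-(I ^ 3 / 3))‖) := by
  have hκ : 0 < μ * (1 - μ) := mul_pos hμ0 (by linarith)
  have hK : 0 < termConst s := lt_of_lt_of_le (by norm_num) (termConst_ge hs)
  have hW := pairTotal_pos
  set κ := μ * (1 - μ) with hκd
  refine ⟨κ⁻¹ * (2 * Real.exp s) * (termConst s * pairTotal) * 4, by positivity,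
    fun {σ β I ε} h => ?_⟩
  have hI := h.ten_le
  have hε := h.ecc_pos
  have hp : 0 < I.re := by linarith
  obtain ⟨hN1, hN⟩ := re_le_norm_action hI
  have hv := inv_re_le_norm_inv hI h.action_im
  obtain ⟨hsq1, hsq2⟩ := sqrt_norm_le_two_mul hI h.action_im
  have hr := h.zero_sigma.norm_diffRem_one_le hμ0.le (by linarith)
  have hr' := h.neg.zero_sigma.norm_diffRem_one_le hμ0.le (by linarith)
  have hσ := norm_exp_I_mul_le h.sigma_im
  have hσ' := norm_exp_I_mul_le h.neg.sigma_im
  rw [mul_neg] at hσ'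
  have hE : 0 < expFactor I := Real.exp_pos _
  obtain ⟨-, -, h5, h3, -⟩ := rpow_half_integers hN
  rw [h5, h3, expFactor_eq_norm, norm_mul, norm_inv, Complex.norm_real, Real.norm_eq_abs,
    abs_of_pos hκ]
  set Q := termConst s * (ε * ((√I.re)⁻¹ * I.re⁻¹ + ε * (I.re ^ 2 * √I.re)) * expFactor I)
        * pairTotal with hQ
  have hQ0 : 0 ≤ Q := by positivity
  have hQ4 : Q ≤ termConst s * (ε * (4 * ((√‖I‖)⁻¹ * ‖I‖⁻¹ + ε * (‖I‖ ^ 2 * √‖I‖))) * expFactor I)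
        * pairTotal := by
    rw [hQ]
    gcongr
    calc (√I.re)⁻¹ * I.re⁻¹ + ε * (I.re ^ 2 * √I.re)
        ≤ (2 * (√‖I‖)⁻¹) * (2 * ‖I‖⁻¹) + ε * (‖I‖ ^ 2 * √‖I‖) := by gcongr
      _ ≤ _ := by
        have : 0 ≤ ε * (‖I‖ ^ 2 * √‖I‖) := by positivity
        linarith
  calc _ ≤ κ⁻¹ * (Real.exp s * Q + Real.exp s * Q) := by
        gcongr
        refine (norm_add_le _ _).trans ?_
        rw [norm_mul, norm_mul]
        gcongr
    _ = κ⁻¹ * (2 * Real.exp s) * Q := by ring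
    _ ≤ κ⁻¹ * (2 * Real.exp s) * (termConst s
        * (ε * (4 * ((√‖I‖)⁻¹ * ‖I‖⁻¹ + ε * (‖I‖ ^ 2 * √‖I‖))) * expFactor I) * pairTotal) := by
        gcongr
    _ = _ := by ring

lemma norm_higher_harmonics_le (hs : 0 ≤ s) (hμ0 : 0 < μ) (hμ1 : μ < 1 / 2) :
    ∃ C : ℝ, 0 < C ∧ ∀ {σ β I : ℂ} {ε : ℝ}, Admissible s σ β I ε →
      ‖∑' l : ℕ, angleHarmonic (fun x => melnikovSeries μ (x, β, I, ε)) (l + 2) σ‖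
        ≤ C * (‖I‖ ^ (3 / 2 : ℝ) * Real.exp (-(2 * (I ^ 3).re / 3))) := by
  have hK : 0 < termConst s := lt_of_lt_of_le (by norm_num) (termConst_ge hs)
  have hW := pairTotal_pos
  refine ⟨termConst s * pairTotal, by positivity, fun {σ β I ε} h => ?_⟩
  have hI := h.ten_le
  have hp : 0 < I.re := by linarith
  obtain ⟨hN1, hN⟩ := re_le_norm_action hI
  obtain ⟨hsq1, hsq2⟩ := sqrt_norm_le_two_mul hI h.action_im
  have hE : expFactor I ^ 2 = Real.exp (-(2 * (I ^ 3).re / 3)) := by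
    rw [expFactor, ← Real.exp_nat_mul]
    congr 1
    push_cast
    ring
  obtain ⟨-, h3, -, -, -⟩ := rpow_half_integers hN
  rw [h3, ← hE]
  calc _ ≤ termConst s * (I.re * √I.re * expFactor I ^ 2) * pairTotal :=
        h.norm_tail_le hμ0.le (by linarith)
    _ ≤ termConst s * (‖I‖ * √‖I‖ * expFactor I ^ 2) * pairTotal := by gcongr
    _ = _ := by ring

end Coefficients

/-! ## The harmonics of the Melnikov potential -/

/-- The upper bound on the action enters the estimates in this form: it makes εI, and even εI³,
bounded. -/
lemma mul_pow_three_le_one {ε p : ℝ} (hε : 0 < ε) (hp : 0 ≤ p) (h : p ≤ ε ^ (-(1 / 3) : ℝ)) :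
    ε * p ^ 3 ≤ 1 := by
  have h1 : p ^ 3 ≤ (ε ^ (-(1 / 3) : ℝ)) ^ 3 := pow_le_pow_left₀ hp h 3
  have h2 : (ε ^ (-(1 / 3) : ℝ)) ^ 3 = ε⁻¹ := by
    rw [← Real.rpow_natCast, ← Real.rpow_mul hε.le, ← Real.rpow_neg_one]
    norm_num
  calc ε * p ^ 3 ≤ ε * ε⁻¹ := by rw [← h2]; gcongr
    _ = 1 := mul_inv_cancel₀ hε.ne'

lemma lt_quarter_of_mem_eccentricities {ε K : ℝ} (hK : 100000 ≤ K) (h : ε ∈ eccentricities K) :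
    ε < 1 / 4 := by
  refine h.2.trans ?_
  rw [inv_eq_one_div]
  refine one_div_lt_one_div_of_lt (by norm_num) ?_
  calc (4 : ℝ) < 100000 ^ 3 := by norm_num
    _ ≤ K ^ 3 := by gcongr

lemma admissible_of_mem {s ρ K ε : ℝ} {σ β I : ℂ} (hs : 0 ≤ s) (hK : actionThreshold s ≤ K)
    (hρ : ρ ≤ 1) (hε : ε ∈ eccentricities K) (hI : I ∈ actionDomain ρ K ε) (hσ : |σ.im| ≤ s)
    (hβ : |β.im| ≤ 1) : Admissible s σ β I ε := by
  have h := le_actionThreshold hs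
  obtain ⟨h1, h2, h3⟩ := hI
  refine ⟨hs, hσ, hβ, h1.trans hρ, hK.trans h2, hε.1, ?_⟩
  linarith [mul_pow_three_le_one hε.1 (by linarith) h3]

lemma mem_coreDomain_of_mem {s ρ K ε : ℝ} {σ β I : ℂ} (hs : 0 ≤ s) (hK : actionThreshold s < K)
    (hρ : ρ < 1) (hε : ε ∈ eccentricities K) (hI : I ∈ actionDomain ρ K ε) (hσ : |σ.im| < s)
    (hβ : |β.im| < 1) : (σ, β, I, (ε : ℂ)) ∈ coreDomain s := by
  have h := le_actionThreshold hs
  obtain ⟨h1, h2, h3⟩ := hI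
  refine ⟨hσ, hβ, h1.trans_lt hρ, hK.trans_le h2, ?_⟩
  simp only [Complex.norm_real, Real.norm_of_nonneg hε.1.le]
  linarith [mul_pow_three_le_one hε.1 (by linarith) h3]

lemma ofReal_mem_actionDomain {ρ K ε I : ℝ} (hρ : 0 ≤ ρ) (hI : I ∈ realActions K ε) :
    (I : ℂ) ∈ actionDomain ρ K ε :=
  ⟨by simpa using hρ, by simpa using hI.1, by simpa using hI.2⟩

/-- The function is locally the real part of a complex analytic function composed with a real
analytic map. Equality is required on a full neighbourhood, which at an endpoint of the interval of
actions goes beyond that interval. -/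
lemma analyticAt_of_eventually_eq_melnikovSeries {E : Type*} [NormedAddCommGroup E]
    [NormedSpace ℝ E] {μ : ℝ} (h0 : 0 ≤ μ) (h1 : μ ≤ 1) {s : ℝ} {G : E → ℝ}
    {Φ : E → ℂ × ℂ × ℂ × ℂ} {x : E} (hΦ : AnalyticAt ℝ Φ x) (hx : Φ x ∈ coreDomain s)
    (hG : ∀ᶠ y in 𝓝 x, ((G y : ℝ) : ℂ) = melnikovSeries μ (Φ y)) : AnalyticAt ℝ G x := by
  have h2 : AnalyticAt ℝ (fun y => melnikovSeries μ (Φ y)) x :=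
    ((analyticAt_melnikovSeries h0 h1 hx).restrictScalars (𝕜 := ℝ)).comp hΦ
  have h3 : AnalyticAt ℝ (fun y => (melnikovSeries μ (Φ y)).re) x :=
    (Complex.reCLM.analyticAt _).comp h2
  refine h3.congr ?_
  filter_upwards [hG] with y hy
  rw [← hy, Complex.ofReal_re]

lemma melnikovSeries_add_two_pi (μ : ℝ) (σ β I ε : ℂ) :
    melnikovSeries μ (σ + 2 * Real.pi, β, I, ε) = melnikovSeries μ (σ, β, I, ε) ∧
      melnikovSeries μ (σ, β + 2 * Real.pi, I, ε) = melnikovSeries μ (σ, β, I, ε) := by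
  constructor <;> refine tsum_congr fun x => ?_ <;> simp only <;>
    rw [melnikovTerm_angles, melnikovTerm_angles μ x σ β] <;> congr 1 <;>
    rw [Complex.exp_eq_exp_iff_exists_int]
  · exact ⟨x.2, by ring⟩
  · exact ⟨-((x.1.1 : ℤ) - x.1.2), by push_cast; ring⟩

section Harmonics

variable {s : ℝ} {σ β I : ℂ} {ε : ℝ} {μ : ℝ}

lemma Admissible.melnikovCoeff_zero_eq (h : Admissible s 0 β I ε) (h0 : 0 ≤ μ) (h1 : μ ≤ 1) :
    melnikovCoeff μ 0 β I ε = diffSum μ 0 0 0 I ε + 2 * diffSum μ 0 1 0 I ε * Complex.cos β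
      + diffRem μ 0 {0, 1, -1} β I ε := by
  rw [h.melnikovCoeff_eq h0 h1 0 {0, 1, -1}, Finset.sum_insert (by decide),
    Finset.sum_insert (by decide), Finset.sum_singleton, diffSum_beta 0 0, diffSum_beta 0 1,
    diffSum_beta 0 (-1), diffSum_zero_neg, Complex.cos]
  simp only [Int.cast_zero, zero_mul, mul_zero, neg_zero, Complex.exp_zero, Int.cast_one, one_mul,
    Int.cast_neg, neg_mul, mul_neg, neg_neg, mul_comm β Complex.I]
  ring

/-- The coefficient of order −1 is that of order 1 with β reversed, so a group of order −d in β
pairs with its mirror image into cos(σ − dβ). -/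
lemma Admissible.first_harmonic_eq (h : Admissible s σ β I ε) (h0 : 0 ≤ μ) (h1 : μ ≤ 1) :
    angleHarmonic (fun x => melnikovSeries μ (x, β, I, ε)) 1 σ
      = 2 * diffSum μ 1 1 0 I ε * Complex.cos (σ - β)
        + 2 * diffSum μ 1 2 0 I ε * Complex.cos (σ - 2 * β)
        + (Complex.exp (Complex.I * σ) * diffRem μ 1 {1, 2} β I ε
          + Complex.exp (-(Complex.I * σ)) * diffRem μ 1 {1, 2} (-β) I ε) := by
  have hn : Admissible s 0 (-β) I ε := h.neg.zero_sigma
  rw [angleHarmonic, if_neg one_ne_zero, h.angleCoeff_melnikovSeries h0 h1,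
    h.angleCoeff_melnikovSeries h0 h1, melnikovCoeff_neg, Nat.cast_one, Nat.cast_one,
    h.zero_sigma.melnikovCoeff_eq h0 h1 1 {1, 2}, hn.melnikovCoeff_eq h0 h1 1 {1, 2},
    Finset.sum_pair (by decide), Finset.sum_pair (by decide), diffSum_beta 1 1, diffSum_beta 1 2,
    diffSum_beta 1 1 (β := -β), diffSum_beta 1 2 (β := -β), Complex.cos, Complex.cos]
  have e : ∀ d : ℂ, Complex.exp ((σ - d * β) * Complex.I)
        = Complex.exp (Complex.I * σ) * Complex.exp (-(Complex.I * (d * β))) ∧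
      Complex.exp (-(σ - d * β) * Complex.I)
        = Complex.exp (-(Complex.I * σ)) * Complex.exp (-(Complex.I * (d * -β))) := fun d => by
    constructor <;> rw [← Complex.exp_add] <;> congr 1 <;> ring
  have e1 := e 1
  rw [one_mul, one_mul] at e1
  rw [e1.1, e1.2, (e 2).1, (e 2).2]
  simp only [mul_one, Int.cast_one, Int.cast_ofNat, one_mul]
  ring

end Harmonics

theorem melnikovPotential_harmonics {μ : ℝ} (hμ0 : 0 < μ) (hμ1 : μ < 1 / 2) (σ₀ : ℝ)
    (hσ₀ : 0 < σ₀) :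
      ∃ ρ₀ Istar C : ℝ, 0 < ρ₀ ∧ 0 < Istar ∧ 0 < C ∧
      ∃ F : ℂ × ℂ × ℂ × ℂ → ℂ, ∃ L00 L01 L11 L12 : ℂ → ℝ → ℂ,
      ∃ E0 : ℂ → ℂ → ℝ → ℂ, ∃ E1 : ℂ → ℂ → ℂ → ℝ → ℂ,
        -- the integral converges and its value is real analytic in all the arguments
        (∀ u β t I ε : ℝ, ε ∈ eccentricities Istar → I ∈ realActions Istar ε →
          MeasureTheory.Integrable
            (fun s : ℝ => pertPotential μ s β (t - I ^ 3 * u + I ^ 3 * s) I ε)) ∧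
        AnalyticOnNhd ℝ
          (fun p : ℝ × ℝ × ℝ × ℝ × ℝ =>
            melnikovPotential μ p.1 p.2.1 p.2.2.1 p.2.2.2.1 p.2.2.2.2)
          {p | p.2.2.2.2 ∈ eccentricities Istar ∧ p.2.2.2.1 ∈ realActions Istar p.2.2.2.2} ∧
        -- analytic extension, as a function of `σ = t - I³ u`, `β`, `I` and `ε`
        AnalyticOnNhd ℂ F
          {p | ∃ ε ∈ eccentricities Istar, p.1 ∈ strip σ₀ ∧ p.2.1 ∈ strip ρ₀ ∧
            p.2.2.1 ∈ actionDomain ρ₀ Istar ε ∧ p.2.2.2 = (ε : ℂ)} ∧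
        (∀ u β t I ε : ℝ, ε ∈ eccentricities Istar → I ∈ realActions Istar ε →
          F (((t - I ^ 3 * u : ℝ) : ℂ), (β : ℂ), (I : ℂ), (ε : ℂ))
            = (melnikovPotential μ u β t I ε : ℂ)) ∧
        ∀ ε ∈ eccentricities Istar, ∀ I ∈ actionDomain ρ₀ Istar ε,
          -- coefficients of the zeroth and first harmonics
          ‖L00 I ε - Real.pi / (2 * I ^ 3)‖
            ≤ C * (‖I‖ ^ (-4 : ℤ) + ε ^ 2) * ‖Real.pi / (2 * I ^ 3)‖ ∧
          ‖L01 I ε - (-((1 - 2 * μ) * (15 * Real.pi * ε / (8 * I ^ 5))))‖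
            ≤ C * (‖I‖ ^ (-4 : ℤ) + ε ^ 2)
              * ‖(1 - 2 * μ) * (15 * Real.pi * ε / (8 * I ^ 5))‖ ∧
          ‖2 * L11 I ε
              - (1 - 2 * μ) * (Real.pi / (8 * I)) ^ (1 / 2 : ℂ) * Complex.exp (-(I ^ 3 / 3))‖
            ≤ C * (‖I‖⁻¹ + ε ^ 2)
              * ‖(1 - 2 * μ) * (Real.pi / (8 * I)) ^ (1 / 2 : ℂ)
                  * Complex.exp (-(I ^ 3 / 3))‖ ∧
          ‖2 * L12 I ε
              - (-(3 * ε * (2 * Real.pi * I ^ 3) ^ (1 / 2 : ℂ) * Complex.exp (-(I ^ 3 / 3))))‖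
            ≤ C * (‖I‖⁻¹ + ε)
              * ‖3 * ε * (2 * Real.pi * I ^ 3) ^ (1 / 2 : ℂ)
                  * Complex.exp (-(I ^ 3 / 3))‖ ∧
          ∀ σ ∈ strip σ₀, ∀ β ∈ strip ρ₀,
            F (σ + 2 * Real.pi, β, I, ε) = F (σ, β, I, ε) ∧
            F (σ, β + 2 * Real.pi, I, ε) = F (σ, β, I, ε) ∧
            -- the absolutely convergent Fourier series
            Summable (fun l : ℕ => ‖angleHarmonic (fun x => F (x, β, I, ε)) l σ‖) ∧
            HasSum (fun l : ℕ => angleHarmonic (fun x => F (x, β, I, ε)) l σ) (F (σ, β, I, ε)) ∧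
            -- the zeroth harmonic
            angleHarmonic (fun x => F (x, β, I, ε)) 0 σ
              = μ * (1 - μ) * (L00 I ε + L01 I ε * Complex.cos β + E0 β I ε) ∧
            ‖E0 β I ε‖ ≤ C * (ε ^ 2 * ‖I‖ ^ (-7 : ℤ)) ∧
            -- the first harmonic
            angleHarmonic (fun x => F (x, β, I, ε)) 1 σ
              = μ * (1 - μ) * (2 * L11 I ε * Complex.cos (σ - β)
                  + 2 * L12 I ε * Complex.cos (σ - 2 * β) + E1 σ β I ε) ∧
            ‖E1 σ β I ε‖
              ≤ C * (ε * (‖I‖ ^ (-(3 / 2) : ℝ) + ε * ‖I‖ ^ (5 / 2 : ℝ))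
                  * ‖Complex.exp (-(I ^ 3 / 3))‖) ∧
            -- the sum of the higher harmonics
            ‖∑' l : ℕ, angleHarmonic (fun x => F (x, β, I, ε)) (l + 2) σ‖
              ≤ C * (‖I‖ ^ (3 / 2 : ℝ) * Real.exp (-(2 * (I ^ 3).re / 3))) := by
  have h0 : 0 ≤ μ := hμ0.le
  have h1 : μ ≤ 1 := by linarith
  -- The series is considered on a wider strip, so that the closed strip of width σ₀ lies in its
  -- open domain of analyticity. The margin 1 in K below has the same purpose.
  set s := σ₀ + 1 with hs_def
  have hs : 0 ≤ s := by linarith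
  have hσs : σ₀ < s := by linarith
  have hth := le_actionThreshold hs
  set K := actionThreshold s + 1 with hK_def
  have hK : 100000 ≤ K := by linarith
  have hK1 : actionThreshold s < K := by linarith
  obtain ⟨C1, hC1, b1⟩ := norm_zeroth_coefficient_le hs hμ0 hμ1
  obtain ⟨C2, hC2, b2⟩ := norm_first_coefficient_le hs hμ0 hμ1
  obtain ⟨C3, hC3, b3⟩ := norm_coefficient_one_one_le hs hμ0 hμ1
  obtain ⟨C4, hC4, b4⟩ := norm_coefficient_one_two_le hs hμ0 hμ1
  obtain ⟨C5, hC5, b5⟩ := norm_zeroth_remainder_le hs hμ0 hμ1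
  obtain ⟨C6, hC6, b6⟩ := norm_first_remainder_le hs hμ0 hμ1
  obtain ⟨C7, hC7, b7⟩ := norm_higher_harmonics_le hs hμ0 hμ1
  have hκ : ((μ * (1 - μ) : ℝ) : ℂ) ≠ 0 := by
    exact_mod_cast (mul_pos hμ0 (by linarith : 0 < 1 - μ)).ne'
  have hκe : (μ : ℂ) * (1 - μ) = ((μ * (1 - μ) : ℝ) : ℂ) := by push_cast; ring
  have hmel : ∀ u β t I ε : ℝ, 5 ≤ I → 0 < ε → ε < 1 / 4 →
      melnikovSeries μ (((t - I ^ 3 * u : ℝ) : ℂ), (β : ℂ), (I : ℂ), (ε : ℂ))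
        = (melnikovPotential μ u β t I ε : ℂ) := fun u β t I ε hI hε0 hε1 =>
    melnikovSeries_ofReal h0 h1 _ β hI hε0 hε1
  refine ⟨1 / 2, K, C1 + C2 + C3 + C4 + C5 + C6 + C7, by norm_num, by linarith, by positivity,
    melnikovSeries μ,
    fun I ε => ((μ * (1 - μ) : ℝ) : ℂ)⁻¹ * diffSum μ 0 0 0 I ε,
    fun I ε => ((μ * (1 - μ) : ℝ) : ℂ)⁻¹ * (2 * diffSum μ 0 1 0 I ε),
    fun I ε => ((μ * (1 - μ) : ℝ) : ℂ)⁻¹ * diffSum μ 1 1 0 I ε,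
    fun I ε => ((μ * (1 - μ) : ℝ) : ℂ)⁻¹ * diffSum μ 1 2 0 I ε,
    fun β I ε => ((μ * (1 - μ) : ℝ) : ℂ)⁻¹ * diffRem μ 0 {0, 1, -1} β I ε,
    fun σ β I ε => ((μ * (1 - μ) : ℝ) : ℂ)⁻¹ * (Complex.exp (Complex.I * σ)
      * diffRem μ 1 {1, 2} β I ε + Complex.exp (-(Complex.I * σ)) * diffRem μ 1 {1, 2} (-β) I ε),
    ?_, ?_, ?_, ?_, ?_⟩
  · intro u β t I ε hε hI
    exact (integrable_hasSum_melnikovTerm h0 h1 (t - I ^ 3 * u) β (by linarith [hI.1]) hε.1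
      (lt_quarter_of_mem_eccentricities hK hε)).1
  · rintro ⟨u, β, t, I, ε⟩ ⟨hε, hI⟩
    simp only at hε hI
    refine analyticAt_of_eventually_eq_melnikovSeries h0 h1 (s := s)
      (Φ := fun p : ℝ × ℝ × ℝ × ℝ × ℝ => (((p.2.2.1 - p.2.2.2.1 ^ 3 * p.1 : ℝ) : ℂ),
        (p.2.1 : ℂ), (p.2.2.2.1 : ℂ), (p.2.2.2.2 : ℂ))) ?_ ?_ ?_
    · have hof : ∀ z : ℝ, AnalyticAt ℝ (fun y : ℝ => (y : ℂ)) z := fun z =>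
        Complex.ofRealCLM.analyticAt z
      have a1 : AnalyticAt ℝ (fun p : ℝ × ℝ × ℝ × ℝ × ℝ => p.1) (u, β, t, I, ε) := analyticAt_fst
      have c1 : AnalyticAt ℝ (fun p : ℝ × ℝ × ℝ × ℝ × ℝ => p.2) (u, β, t, I, ε) := analyticAt_snd
      have a2 : AnalyticAt ℝ (fun p : ℝ × ℝ × ℝ × ℝ × ℝ => p.2.1) (u, β, t, I, ε) :=
        analyticAt_fst.comp c1
      have c2 : AnalyticAt ℝ (fun p : ℝ × ℝ × ℝ × ℝ × ℝ => p.2.2) (u, β, t, I, ε) :=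
        analyticAt_snd.comp c1
      have a3 : AnalyticAt ℝ (fun p : ℝ × ℝ × ℝ × ℝ × ℝ => p.2.2.1) (u, β, t, I, ε) :=
        analyticAt_fst.comp c2
      have c3 : AnalyticAt ℝ (fun p : ℝ × ℝ × ℝ × ℝ × ℝ => p.2.2.2) (u, β, t, I, ε) :=
        analyticAt_snd.comp c2
      have a4 : AnalyticAt ℝ (fun p : ℝ × ℝ × ℝ × ℝ × ℝ => p.2.2.2.1) (u, β, t, I, ε) :=
        analyticAt_fst.comp c3
      have a5 : AnalyticAt ℝ (fun p : ℝ × ℝ × ℝ × ℝ × ℝ => p.2.2.2.2) (u, β, t, I, ε) :=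
        analyticAt_snd.comp c3
      exact ((hof _).comp (a3.sub ((a4.pow 3).mul a1))).prod (((hof _).comp a2).prod
        (((hof _).comp a4).prod ((hof _).comp a5)))
    · exact mem_coreDomain_of_mem hs hK1 (by norm_num : (1 / 2 : ℝ) < 1) hε
        (ofReal_mem_actionDomain (by norm_num) hI)
        (by simp only [Complex.ofReal_im, abs_zero]; linarith) (by simp)
    -- The series represents the integral as soon as I ≥ 5 and 0 < ε < 1/4. These weaker conditions
    -- hold near every point of the closed region, including its boundary.
    · have o1 : ∀ᶠ p : ℝ × ℝ × ℝ × ℝ × ℝ in 𝓝 (u, β, t, I, ε), 5 < p.2.2.2.1 :=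
        (by fun_prop : Continuous fun p : ℝ × ℝ × ℝ × ℝ × ℝ => p.2.2.2.1).continuousAt.eventually
          (lt_mem_nhds (by show 5 < I; linarith [hI.1]))
      have o2 : ∀ᶠ p : ℝ × ℝ × ℝ × ℝ × ℝ in 𝓝 (u, β, t, I, ε), 0 < p.2.2.2.2 :=
        (by fun_prop : Continuous fun p : ℝ × ℝ × ℝ × ℝ × ℝ => p.2.2.2.2).continuousAt.eventually
          (lt_mem_nhds hε.1)
      have o3 : ∀ᶠ p : ℝ × ℝ × ℝ × ℝ × ℝ in 𝓝 (u, β, t, I, ε), p.2.2.2.2 < 1 / 4 :=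
        (by fun_prop : Continuous fun p : ℝ × ℝ × ℝ × ℝ × ℝ => p.2.2.2.2).continuousAt.eventually
          (gt_mem_nhds (lt_quarter_of_mem_eccentricities hK hε))
      filter_upwards [o1, o2, o3] with p p1 p2 p3
      exact (hmel _ _ _ _ _ p1.le p2 p3).symm
  · rintro ⟨σ, β, I, z⟩ ⟨ε, hε, hσ, hβ, hI, hz⟩
    simp only at hσ hβ hI hz
    subst hz
    have hσ' : |σ.im| ≤ σ₀ := hσ
    have hβ' : |β.im| ≤ 1 / 2 := hβ
    exact analyticAt_melnikovSeries h0 h1 (mem_coreDomain_of_mem hs hK1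
      (by norm_num : (1 / 2 : ℝ) < 1) hε hI (by linarith) (by linarith))
  · intro u β t I ε hε hI
    exact hmel u β t I ε (by linarith [hI.1]) hε.1 (lt_quarter_of_mem_eccentricities hK hε)
  · intro ε hε I hI
    have hε0 : 0 < ε := hε.1
    have hA : ∀ {σ β : ℂ}, |σ.im| ≤ s → |β.im| ≤ 1 → Admissible s σ β I ε := fun hσ hβ =>
      admissible_of_mem hs hK1.le (by norm_num) hε hI hσ hβ
    have h00 : Admissible s 0 0 I ε := hA (by simpa using hs) (by simp)
    refine ⟨(b1 h00).trans (by gcongr; linarith), (b2 h00).trans (by gcongr; linarith),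
      (b3 h00).trans (by gcongr; linarith), (b4 h00).trans (by gcongr; linarith),
      fun σ hσ β hβ => ?_⟩
    have hσ' : |σ.im| ≤ σ₀ := hσ
    have hβ' : |β.im| ≤ 1 / 2 := hβ
    have h : Admissible s σ β I ε := hA (by linarith) (by linarith)
    have hh := hasSum_angleHarmonic (h.angleCoeff_melnikovSeries h0 h1)
      (h.hasSum_melnikovCoeff h0 h1).1 (h.hasSum_melnikovCoeff h0 h1).2
    refine ⟨(melnikovSeries_add_two_pi μ σ β I ε).1, (melnikovSeries_add_two_pi μ σ β I ε).2,
      hh.1, hh.2, ?_, (b5 h.zero_sigma).trans (by gcongr; linarith), ?_,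
      (b6 h).trans (by gcongr; linarith), (b7 h).trans (by gcongr; linarith)⟩
    · rw [angleHarmonic_zero, h.angleCoeff_melnikovSeries h0 h1,
        h.zero_sigma.melnikovCoeff_zero_eq h0 h1, hκe]
      field_simp
    · rw [h.first_harmonic_eq h0 h1, hκe]
      field_simp

/-! ## Bounds of the terms of the reduced potentials -/

section TermBounds

variable {s : ℝ} {σ β I : ℂ} {ε : ℝ} {μ : ℝ}

/-- With y = p³/4 one has p⁹ = 64y³, which is at most y⁴/24 ≤ e^y once y ≥ 64 · 24 = 1536.
Exponentially small terms can then be absorbed into any of the powers needed. -/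
lemma Admissible.pow_mul_expFactor_le (h : Admissible s σ β I ε) :
    I.re ^ 9 * expFactor I ≤ 1 := by
  have hp := h.smallParams.le_action
  have h1 := expFactor_le h.action_im h.ten_le le_rfl
  set y := I.re ^ 3 / 4 with hy
  have hy1 : 1536 ≤ y := by
    have : (100000 : ℝ) ^ 3 ≤ I.re ^ 3 := by gcongr
    rw [hy]
    linarith
  have h2 : y ^ 4 / 24 ≤ Real.exp y := by
    have := Real.pow_div_factorial_le_exp y (by linarith) 4
    norm_num [Nat.factorial] at this
    exact this
  have h3 : I.re ^ 9 ≤ Real.exp y := by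
    refine le_trans ?_ h2
    have e : I.re ^ 9 = 64 * y ^ 3 := by rw [hy]; ring
    rw [e]
    have : 0 ≤ y ^ 3 * (y - 1536) := mul_nonneg (by positivity) (by linarith)
    linarith
  calc I.re ^ 9 * expFactor I ≤ Real.exp y * Real.exp (-y) := by
        have : 0 < expFactor I := Real.exp_pos _
        gcongr
    _ = 1 := by rw [← Real.exp_add, add_neg_cancel, Real.exp_zero]

lemma Admissible.ecc_mul_pow_le (h : Admissible s σ β I ε) {n : ℕ} (hn : n ≤ 3) :
    ε * I.re ^ n ≤ 16 := by
  refine le_trans ?_ h.ecc_le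
  have := h.ecc_pos
  have : 1 ≤ I.re := by linarith [h.ten_le]
  gcongr

lemma Admissible.pow_mul_expFactor_le_of_le (h : Admissible s σ β I ε) {n : ℕ} (hn : n ≤ 9) :
    I.re ^ n * expFactor I ≤ 1 := by
  refine le_trans ?_ h.pow_mul_expFactor_le
  have : 1 ≤ I.re := by linarith [h.ten_le]
  have : 0 < expFactor I := Real.exp_pos _
  gcongr

lemma mul_mul_le_mul_mul {K A B w : ℝ} (hK : 0 ≤ K) (hw : 0 ≤ w) (h : A ≤ B) :
    K * A * w ≤ K * B * w :=
  mul_le_mul_of_nonneg_right (mul_le_mul_of_nonneg_left h hK) hw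

lemma le_of_eq_mul {a b c : ℝ} (e : a = b * c) (hb : 0 ≤ b) (hc : c ≤ 1) : a ≤ b := by
  rw [e]
  exact mul_le_of_le_one_right hb hc

/-- A bound of the terms of positive order in `σ` holds for the terms of negative order. -/
lemma Admissible.norm_term_le_of_pos {S : (ℕ × ℕ) × ℤ → Prop} {B : ℝ}
    (hS : ∀ x, S x → S (swapIndex x)) (h : Admissible s σ β I ε)
    (hB : ∀ {σ β : ℂ}, Admissible s σ β I ε → ∀ (j k L : ℕ), 1 ≤ L → S ((j, k), (L : ℤ)) →
      ‖melnikovTerm μ ((j, k), (L : ℤ)) σ β I ε‖ ≤ B * indexWeight ((j, k), (L : ℤ)))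
    {x : (ℕ × ℕ) × ℤ} (hx : S x) (hl : x.2 ≠ 0) :
    ‖melnikovTerm μ x σ β I ε‖ ≤ B * indexWeight x := by
  obtain ⟨⟨j, k⟩, l⟩ := x
  simp only at hl
  rcases lt_or_gt_of_ne hl with hl | hl
  · obtain ⟨n, hn⟩ := Int.eq_ofNat_of_zero_le (show 0 ≤ -l by omega)
    obtain rfl : l = -(n : ℤ) := by omega
    have := hB h.neg k j n (by omega) (by simpa [swapIndex] using hS _ hx)
    rw [← melnikovTerm_swapIndex, ← indexWeight_swapIndex] at this
    exact this
  · obtain ⟨n, rfl⟩ := Int.eq_ofNat_of_zero_le hl.le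
    exact hB h j k n (by omega) hx

lemma eccOrder_swapIndex (x : (ℕ × ℕ) × ℤ) : eccOrder (swapIndex x) = -eccOrder x := by
  simp only [eccOrder, swapIndex]
  ring

/-- At order zero in σ the next terms after (2, 1) and (1, 2) are εI^{−9} or ε²I^{−7}. At the other
orders the exponential beats the missing powers of I. -/
lemma Admissible.norm_term_le_of_ecc (h : Admissible s σ β I ε) (h0 : 0 ≤ μ) (h1 : μ ≤ 1)
    {x : (ℕ × ℕ) × ℤ} (hm : eccOrder x ≠ 0) (hx1 : x ≠ ((2, 1), 0)) (hx2 : x ≠ ((1, 2), 0)) :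
    ‖melnikovTerm μ x σ β I ε‖ ≤ termConst s * (ε * I.re⁻¹ ^ 7) * indexWeight x := by
  have hK := termConst_ge h.width_nonneg
  have hp := h.ten_le
  have hε := h.ecc_pos
  have hp0 : 0 < I.re := by linarith
  have hε1 := h.ecc_le_half
  have hpi : I.re⁻¹ ≤ 1 := inv_le_one_of_one_le₀ (by linarith)
  by_cases hl : x.2 = 0
  · obtain ⟨⟨j, k⟩, l⟩ := x
    simp only at hl
    subst hl
    have hw := indexWeight_pos ((j, k), 0)
    simp only [eccOrder, sub_zero] at hm
    rcases Nat.lt_or_ge ((j : ℤ) - k).natAbs 2 with hd | hd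
    · refine (h.norm_term_zero_one_le h0 h1 (y := (j, k)) (by simp only; omega) ?_ ?_).trans ?_
      · exact fun e => hx1 (by rw [e])
      · exact fun e => hx2 (by rw [e])
      · refine mul_mul_le_mul_mul (by linarith) hw.le ?_
        refine le_of_eq_mul (c := I.re⁻¹ ^ 2) (by field_simp) (by positivity)
          (pow_le_one₀ (by positivity) hpi)
    · refine (h.norm_term_zero_two_le h0 h1 (y := (j, k)) hd).trans ?_
      refine mul_mul_le_mul_mul (by linarith) hw.le ?_
      exact le_of_eq_mul (c := ε) (by field_simp) (by positivity) (by linarith)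
  · refine h.norm_term_le_of_pos (S := fun x => eccOrder x ≠ 0) (fun x hx => ?_) ?_ hm hl
    · rwa [eccOrder_swapIndex, neg_ne_zero]
    · intro σ' β' h' j k L hL hm
      have hw := indexWeight_pos ((j, k), (L : ℤ))
      refine (h'.norm_melnikovTerm_le h0 h1 _).trans
        ((termBound_one_le_of_ecc h'.smallParams hL hm).trans ?_)
      refine mul_mul_le_mul_mul (by linarith) hw.le ?_
      have hE : 0 < expFactor I := Real.exp_pos _
      have hsq : √I.re ≤ I.re := Real.sqrt_le_self_iff.2 (Or.inr (by linarith))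
      calc ε * I.re * √I.re * expFactor I ≤ ε * I.re * I.re * expFactor I := by gcongr
        _ ≤ _ := le_of_eq_mul (c := I.re ^ 9 * expFactor I) (by field_simp) (by positivity)
          h.pow_mul_expFactor_le

lemma Admissible.norm_term_le_of_ne (h : Admissible s σ β I ε) (h0 : 0 ≤ μ) (h1 : μ ≤ 1)
    {x : (ℕ × ℕ) × ℤ} (hx : x ≠ ((1, 1), 0)) :
    ‖melnikovTerm μ x σ β I ε‖
      ≤ termConst s * (I.re⁻¹ ^ 7 + ε * I.re⁻¹ ^ 4) * indexWeight x := by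
  have hK := termConst_ge h.width_nonneg
  have hp := h.ten_le
  have hε := h.ecc_pos
  have hp0 : 0 < I.re := by linarith
  have hpi : I.re⁻¹ ≤ 1 := inv_le_one_of_one_le₀ (by linarith)
  by_cases hl : x.2 = 0
  · obtain ⟨⟨j, k⟩, l⟩ := x
    simp only at hl
    subst hl
    have hw := indexWeight_pos ((j, k), 0)
    by_cases hd : (j : ℤ) - k = 0
    · refine (h.norm_term_zero_diag_le h0 h1 (y := (j, k)) hd fun e => hx (by rw [e])).trans ?_
      refine mul_mul_le_mul_mul (by linarith) hw.le ?_
      calc I.re * ((I.re ^ 2) ^ 4)⁻¹ = I.re⁻¹ ^ 7 := by field_simp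
        _ ≤ _ := le_add_of_nonneg_right (by positivity)
    · rcases Nat.lt_or_ge (j + k) 3 with hjk | hjk
      · have hz : melnikovTerm μ ((j, k), 0) σ β I ε = 0 := by
          rcases Nat.eq_zero_or_pos k with rfl | hk
          · exact melnikovTerm_eq_zero_of_right
          · obtain rfl : j = 0 := by omega
            exact melnikovTerm_eq_zero_of_left
        rw [hz, norm_zero]
        positivity
      · refine (h.norm_melnikovTerm_le h0 h1 _).trans ((termBound_zero_le h.smallParams hjk
          (by norm_num) (d := 1) (by norm_num) (by simp only [eccOrder]; omega)).trans ?_)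
        refine mul_mul_le_mul_mul (by linarith) hw.le ?_
        calc I.re * ((I.re ^ 2) ^ 3)⁻¹ * ε ^ 1 ≤ ε * I.re⁻¹ ^ 4 :=
              le_of_eq_mul (c := I.re⁻¹) (by field_simp) (by positivity) hpi
          _ ≤ _ := le_add_of_nonneg_left (by positivity)
  · refine h.norm_term_le_of_pos (S := fun _ => True) (fun x hx => trivial) ?_ trivial hl
    intro σ' β' h' j k L hL _
    have hw := indexWeight_pos ((j, k), (L : ℤ))
    refine (h'.norm_melnikovTerm_le h0 h1 _).trans ((termBound_one_le h'.smallParams j k hL).trans ?_)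
    refine mul_mul_le_mul_mul (by linarith) hw.le ?_
    have hE : 0 < expFactor I := Real.exp_pos _
    have hsq : √I.re ≤ I.re := Real.sqrt_le_self_iff.2 (Or.inr (by linarith))
    calc √I.re * expFactor I ≤ I.re * expFactor I := by gcongr
      _ ≤ I.re⁻¹ ^ 7 := le_of_eq_mul (c := I.re ^ 8 * expFactor I) (by field_simp) (by positivity)
          (h.pow_mul_expFactor_le_of_le (by norm_num))
      _ ≤ _ := le_add_of_nonneg_right (by positivity)

/-- Orders |l| ≥ 2 have an additional exponential. At |l| = 1, a nonzero eccentricity order costs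
εI^{3/2} = (εI³)I^{−3/2}, and εI³ ≤ 16 is the origin of the constant; at eccentricity order zero
only k ≥ 2 remains, up to the exchange of indices. -/
lemma Admissible.norm_term_le_of_sigma (h : Admissible s σ β I ε) (h0 : 0 ≤ μ) (h1 : μ ≤ 1)
    {x : (ℕ × ℕ) × ℤ} (hl : x.2 ≠ 0) (hx1 : x ≠ ((2, 1), 1)) (hx2 : x ≠ ((1, 2), -1)) :
    ‖melnikovTerm μ x σ β I ε‖
      ≤ 16 * termConst s * ((√I.re)⁻¹ * I.re⁻¹ * expFactor I) * indexWeight x := by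
  have hK := termConst_ge h.width_nonneg
  have hp := h.ten_le
  have hp0 : 0 < I.re := by linarith
  have hE : 0 < expFactor I := Real.exp_pos _
  refine h.norm_term_le_of_pos (S := fun x => x ≠ ((2, 1), 1) ∧ x ≠ ((1, 2), -1)) ?_ ?_
    ⟨hx1, hx2⟩ hl
  · rintro ⟨⟨j, k⟩, l⟩ ⟨h2, h3⟩
    simp only [swapIndex, ne_eq, Prod.mk.injEq] at h2 h3 ⊢
    omega
  · rintro σ' β' h' j k L hL ⟨h2, -⟩
    have hw := indexWeight_pos ((j, k), (L : ℤ))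
    have hb : termConst s * ((√I.re)⁻¹ * I.re⁻¹ * expFactor I) * indexWeight ((j, k), (L : ℤ))
        ≤ 16 * termConst s * ((√I.re)⁻¹ * I.re⁻¹ * expFactor I)
          * indexWeight ((j, k), (L : ℤ)) := by
      gcongr
      linarith
    rcases Nat.lt_or_ge 1 L with hL2 | hL2
    · refine (h'.norm_term_two_le h0 h1 (by simpa [Nat.succ_le_iff] using hL2)).trans (le_trans ?_ hb)
      refine mul_mul_le_mul_mul (by linarith) hw.le ?_
      refine le_of_eq_mul (c := I.re ^ 3 * expFactor I) ?_ (by positivity)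
        (h.pow_mul_expFactor_le_of_le (by norm_num))
      have := h.smallParams.eq_sqrt_mul
      have := h.smallParams.sqrt_pos
      generalize √I.re = S at *
      generalize expFactor I = E at *
      rw [‹I.re = S * S›]
      field_simp
    · obtain rfl : L = 1 := by omega
      by_cases hm : eccOrder ((j, k), ((1 : ℕ) : ℤ)) = 0
      · refine (h'.norm_term_one_diag_le h0 h1 (y := (j, k)) ?_ ?_).trans hb
        · simp only [eccOrder, Nat.cast_one] at hm
          simp only
          omega
        · exact fun e => h2 (by rw [e]; rfl)
      · refine (h'.norm_melnikovTerm_le h0 h1 _).trans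
          ((termBound_one_le_of_ecc h'.smallParams hL hm).trans ?_)
        rw [mul_comm 16 (termConst s), mul_assoc (termConst s) 16]
        refine mul_mul_le_mul_mul (by linarith) hw.le ?_
        have hε3 := h.ecc_le
        have := h.smallParams.eq_sqrt_mul
        have := h.smallParams.sqrt_pos
        generalize √I.re = S at *
        generalize I.re = P at *
        subst P
        calc ε * (S * S) * S * expFactor I
            = (ε * (S * S) ^ 3) * (S⁻¹ * (S * S)⁻¹ * expFactor I) := by field_simp
          _ ≤ _ := by gcongr

/-- At l = 1, either k ≥ 1 gives εI^{1/2} directly, or k = 0 and j ≥ 3, so that two powers of the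
eccentricity give ε²I^{5/2} = (εI²)εI^{1/2}. -/
lemma Admissible.norm_term_le_of_sigma_of_ecc (h : Admissible s σ β I ε) (h0 : 0 ≤ μ) (h1 : μ ≤ 1)
    {x : (ℕ × ℕ) × ℤ} (hl : x.2 ≠ 0) (hm : eccOrder x ≠ 0) (hx1 : x ≠ ((2, 0), 1))
    (hx2 : x ≠ ((0, 2), -1)) :
    ‖melnikovTerm μ x σ β I ε‖
      ≤ 16 * termConst s * (ε * √I.re * expFactor I) * indexWeight x := by
  have hK := termConst_ge h.width_nonneg
  have hp := h.ten_le
  have hε := h.ecc_pos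
  have hp0 : 0 < I.re := by linarith
  have hE : 0 < expFactor I := Real.exp_pos _
  refine h.norm_term_le_of_pos (S := fun x => eccOrder x ≠ 0 ∧ x ≠ ((2, 0), 1) ∧ x ≠ ((0, 2), -1))
    ?_ ?_ ⟨hm, hx1, hx2⟩ hl
  · rintro ⟨⟨j, k⟩, l⟩ ⟨h2, h3, h4⟩
    simp only [eccOrder, swapIndex, ne_eq, Prod.mk.injEq] at h2 h3 h4 ⊢
    omega
  · rintro σ' β' h' j k L hL ⟨hm, h2, -⟩
    have hw := indexWeight_pos ((j, k), (L : ℤ))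
    have hb : termConst s * (ε * √I.re * expFactor I) * indexWeight ((j, k), (L : ℤ))
        ≤ 16 * termConst s * (ε * √I.re * expFactor I) * indexWeight ((j, k), (L : ℤ)) := by
      gcongr
      linarith
    rcases Nat.lt_or_ge 1 L with hL2 | hL2
    · refine (h'.norm_melnikovTerm_le h0 h1 _).trans
        ((termBound_two_le_of_ecc h'.smallParams hL2 hm).trans (le_trans ?_ hb))
      refine mul_mul_le_mul_mul (by linarith) hw.le ?_
      exact le_of_eq_mul (c := I.re ^ 2 * expFactor I) (by ring) (by positivity)
        (h.pow_mul_expFactor_le_of_le (by norm_num))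
    · obtain rfl : L = 1 := by omega
      rcases Nat.eq_zero_or_pos k with rfl | hk
      · simp only [eccOrder, Nat.cast_one, ne_eq, Prod.mk.injEq, and_true] at hm h2
        rcases Nat.lt_or_ge j 3 with hj | hj
        · have hjk1 : j + 0 ≤ 1 := by omega
          rw [melnikovTerm_eq_zero hjk1, norm_zero]
          positivity
        · refine (h'.norm_melnikovTerm_le h0 h1 _).trans ((termBound_one_le_sq h'.smallParams hL
            (by simp only [eccOrder]; omega)).trans ?_)
          rw [mul_comm 16 (termConst s), mul_assoc (termConst s) 16]
          refine mul_mul_le_mul_mul (by linarith) hw.le ?_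
          have := h.ecc_mul_pow_le (n := 2) (by norm_num)
          calc ε ^ 2 * (I.re ^ 2 * √I.re) * expFactor I
              = (ε * I.re ^ 2) * (ε * √I.re * expFactor I) := by ring
            _ ≤ _ := by gcongr
      · exact (h'.norm_melnikovTerm_le h0 h1 _).trans
          ((termBound_one_le_of_one_le h'.smallParams hL hk hm).trans hb)

end TermBounds

/-! ## The reduced series -/

/-- The series of the reduced potential of phase `δ`. -/
noncomputable def reducedSeries (μ δ ε : ℝ) (p : ℂ × ℂ) : ℂ :=
  melnikovSeries μ (p.1 + δ, p.1, p.2, ε)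

/-- The open domain on which the reduced series converge. -/
structure ReducedDomain (ε : ℝ) (φ I : ℂ) : Prop where
  ecc_pos : 0 < ε
  angle_im : |φ.im| < 1
  action_im : |I.im| < 1
  lt_action : actionThreshold 1 < I.re
  ecc_lt : ε * I.re ^ 3 < 8

section Reduced

variable {ε : ℝ} {φ I : ℂ} {μ : ℝ}

lemma ReducedDomain.mem_coreDomain (h : ReducedDomain ε φ I) (δ : ℝ) :
    (φ + δ, φ, I, (ε : ℂ)) ∈ coreDomain 1 :=
  ⟨by simpa using h.angle_im, h.angle_im, h.action_im, h.lt_action,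
    by simpa [abs_of_pos h.ecc_pos] using h.ecc_lt⟩

lemma ReducedDomain.admissible (h : ReducedDomain ε φ I) (δ : ℝ) :
    Admissible 1 (φ + δ) φ I ε :=
  ⟨zero_le_one, by simpa using h.angle_im.le, h.angle_im.le, h.action_im.le, h.lt_action.le,
    h.ecc_pos, by linarith [h.ecc_lt]⟩

lemma ReducedDomain.analyticAt (h : ReducedDomain ε φ I) (h0 : 0 ≤ μ) (h1 : μ ≤ 1) (δ : ℝ) :
    AnalyticAt ℂ (reducedSeries μ δ ε) (φ, I) := by
  have e : AnalyticAt ℂ (fun p : ℂ × ℂ => (p.1 + (δ : ℂ), p.1, p.2, (ε : ℂ))) (φ, I) :=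
    (analyticAt_fst.add analyticAt_const).prod (analyticAt_fst.prod
      (analyticAt_snd.prod analyticAt_const))
  exact (analyticAt_melnikovSeries h0 h1 (h.mem_coreDomain δ)).comp_of_eq e rfl

lemma ReducedDomain.differentiableAt_angle (h : ReducedDomain ε φ I) (h0 : 0 ≤ μ) (h1 : μ ≤ 1)
    (δ : ℝ) : DifferentiableAt ℂ (fun x => reducedSeries μ δ ε (x, I)) φ :=
  ((h.analyticAt h0 h1 δ).comp_of_eq (analyticAt_id.prod analyticAt_const) rfl).differentiableAt

lemma ReducedDomain.differentiableAt_action (h : ReducedDomain ε φ I) (h0 : 0 ≤ μ) (h1 : μ ≤ 1)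
    (δ : ℝ) : DifferentiableAt ℂ (fun y => reducedSeries μ δ ε (φ, y)) I :=
  ((h.analyticAt h0 h1 δ).comp_of_eq (analyticAt_const.prod analyticAt_id) rfl).differentiableAt

/-- The margins are chosen for discs of radius 1/2: in the imaginary directions 1/4 + 1/2 < 1, and
the cube of the real part grows by at most (3/2)³ = 27/8 < 8. -/
lemma reducedDomain_of_dist_le {K : ℝ} {φ' I' : ℂ} (hK : actionThreshold 1 + 1 ≤ K)
    (hε : ε ∈ eccentricities K) (hφ : φ ∈ strip (1 / 4)) (hI : I ∈ actionDomain (1 / 4) K ε)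
    (hφ' : ‖φ' - φ‖ ≤ 1 / 2) (hI' : ‖I' - I‖ ≤ 1 / 2) :
    ReducedDomain ε φ' I' ∧ I.re / 2 ≤ I'.re := by
  have hth := le_actionThreshold (s := 1) (by norm_num)
  have hφ1 : |φ.im| ≤ 1 / 4 := hφ
  obtain ⟨hI1, hI2, hI3⟩ := hI
  have hre := abs_le.1 ((Complex.abs_re_le_norm (I' - I)).trans hI')
  have him := (Complex.abs_im_le_norm (I' - I)).trans hI'
  have himφ := (Complex.abs_im_le_norm (φ' - φ)).trans hφ'
  rw [Complex.sub_re] at hre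
  rw [Complex.sub_im] at him himφ
  have hε3 := mul_pow_three_le_one hε.1 (by linarith) hI3
  refine ⟨⟨hε.1, ?_, ?_, by linarith, ?_⟩, by linarith⟩
  · have := abs_sub_abs_le_abs_sub φ'.im φ.im
    linarith
  · have := abs_sub_abs_le_abs_sub I'.im I.im
    linarith
  · have h1 : I'.re ^ 3 ≤ (3 / 2 * I.re) ^ 3 := pow_le_pow_left₀ (by linarith) (by linarith) 3
    calc ε * I'.re ^ 3 ≤ ε * (3 / 2 * I.re) ^ 3 := mul_le_mul_of_nonneg_left h1 hε.1.le
      _ = 27 / 8 * (ε * I.re ^ 3) := by ring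
      _ < 8 := by linarith

/-- On σ = φ + δ, β = φ the harmonic in φ is minus the index j − k − l governing the order in the
eccentricity. Hence terms of order zero in ε do not depend on φ, and the angular derivatives are
O(ε). -/
lemma melnikovTerm_diag (x : (ℕ × ℕ) × ℤ) (δ : ℝ) :
    melnikovTerm μ x (φ + δ) φ I ε = melnikovTerm μ x 0 0 I ε
      * Complex.exp (Complex.I * (x.2 * δ)) * Complex.exp (-(Complex.I * (eccOrder x * φ))) := by
  rw [melnikovTerm_angles, mul_assoc, ← Complex.exp_add]
  congr 2
  simp only [eccOrder]
  push_cast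
  ring

lemma melnikovTerm_neg_zero_zero (μ : ℝ) (j k : ℕ) (l : ℤ) (I ε : ℂ) :
    melnikovTerm μ ((k, j), -l) 0 0 I ε = melnikovTerm μ ((j, k), l) 0 0 I ε := by
  have := melnikovTerm_swapIndex μ ((j, k), l) 0 0 I ε
  rwa [neg_zero] at this

/-- The sum of the weights of the indices. -/
noncomputable def indexTotal : ℝ := ∑' x, indexWeight x

lemma indexTotal_pos : 0 < indexTotal :=
  summable_indexWeight.tsum_pos (fun x => (indexWeight_pos x).le) ((0, 0), 0) (indexWeight_pos _)

lemma ReducedDomain.summable_norm (h : ReducedDomain ε φ I) (h0 : 0 ≤ μ) (h1 : μ ≤ 1) (δ : ℝ) :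
    Summable fun x => ‖melnikovTerm μ x (φ + δ) φ I ε‖ :=
  (h.admissible δ).summable_melnikovTerm h0 h1

/-- The part of the reduced series which does not depend on the angle. -/
noncomputable def reducedMean (μ δ ε : ℝ) (I : ℂ) : ℂ :=
  ∑' x, if eccOrder x = 0 then melnikovTerm μ x 0 0 I ε * Complex.exp (Complex.I * (x.2 * δ)) else 0

lemma reducedMean_eq (φ : ℂ) (δ : ℝ) :
    reducedMean μ δ ε I
      = ∑' x, if eccOrder x = 0 then melnikovTerm μ x (φ + δ) φ I ε else 0 := by
  refine tsum_congr fun x => ?_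
  split_ifs with hx
  · rw [melnikovTerm_diag, hx]
    simp
  · rfl

lemma ReducedDomain.hasSum_sub_reducedMean (h : ReducedDomain ε φ I) (h0 : 0 ≤ μ) (h1 : μ ≤ 1)
    (δ : ℝ) : HasSum (fun x => if eccOrder x = 0 then 0 else melnikovTerm μ x (φ + δ) φ I ε)
      (reducedSeries μ δ ε (φ, I) - reducedMean μ δ ε I) := by
  have hn := h.summable_norm h0 h1 δ
  have h2 : Summable fun x => if eccOrder x = 0 then melnikovTerm μ x (φ + δ) φ I ε else 0 := by
    refine Summable.of_norm_bounded hn fun x => ?_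
    split_ifs <;> simp
  have h3 := hn.of_norm.hasSum.sub h2.hasSum
  rw [← reducedMean_eq] at h3
  refine hasSum_of_eq h3 fun x => ?_
  split_ifs <;> simp

lemma exp_add_exp_neg_I_mul (φ : ℂ) :
    Complex.exp (-(Complex.I * φ)) + Complex.exp (Complex.I * φ) = 2 * Complex.cos φ := by
  rw [Complex.cos, show -(Complex.I * φ) = -φ * Complex.I by ring,
    show Complex.I * φ = φ * Complex.I by ring]
  ring

/-- The mean is removed because it does not contribute to the angular derivative; without it every
remaining term has a factor ε. The terms (2, 1, 0) and (1, 2, 0) combine into the cosine. -/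
lemma ReducedDomain.norm_sub_mean_le (h : ReducedDomain ε φ I) (h0 : 0 ≤ μ) (h1 : μ ≤ 1) (δ : ℝ) :
    ‖reducedSeries μ δ ε (φ, I) - reducedMean μ δ ε I
        - 2 * melnikovTerm μ ((2, 1), 0) 0 0 I ε * Complex.cos φ‖
      ≤ termConst 1 * (ε * I.re⁻¹ ^ 7) * indexTotal := by
  have hK := termConst_ge (s := 1) (by norm_num)
  have hA := h.admissible δ
  have hp : 0 < I.re := by linarith [hA.ten_le]
  have hε := h.ecc_pos
  have hQ : 0 ≤ termConst 1 * (ε * I.re⁻¹ ^ 7) := by positivity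
  have hs := h.hasSum_sub_reducedMean h0 h1 δ
  have e21 : melnikovTerm μ ((1, 2), 0) 0 0 I ε = melnikovTerm μ ((2, 1), 0) 0 0 I ε := by
    simpa using melnikovTerm_neg_zero_zero μ 2 1 0 I ε
  have key := norm_tsum_sub_sum_le {(((2, 1), 0) : (ℕ × ℕ) × ℤ), ((1, 2), 0)} hs.summable
    summable_indexWeight (fun x => (indexWeight_pos x).le) hQ fun x hx => ?_
  · rw [hs.tsum_eq, Finset.sum_pair (by decide), if_neg (by decide), if_neg (by decide),
      melnikovTerm_diag, melnikovTerm_diag, e21] at key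
    refine le_of_eq_of_le (congrArg norm ?_) key
    rw [mul_comm (2 : ℂ), mul_assoc _ (2 : ℂ), ← exp_add_exp_neg_I_mul]
    simp [eccOrder]
    ring
  · simp only [Finset.mem_insert, Finset.mem_singleton, not_or] at hx
    split_ifs with hm
    · rw [norm_zero]
      exact mul_nonneg hQ (indexWeight_pos x).le
    · exact hA.norm_term_le_of_ecc h0 h1 hm hx.1 hx.2

lemma ReducedDomain.norm_sub_term_le (h : ReducedDomain ε φ I) (h0 : 0 ≤ μ) (h1 : μ ≤ 1) (δ : ℝ) :
    ‖reducedSeries μ δ ε (φ, I) - melnikovTerm μ ((1, 1), 0) 0 0 I ε‖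
      ≤ termConst 1 * (I.re⁻¹ ^ 7 + ε * I.re⁻¹ ^ 4) * indexTotal := by
  have hK := termConst_ge (s := 1) (by norm_num)
  have hA := h.admissible δ
  have hp : 0 < I.re := by linarith [hA.ten_le]
  have hε := h.ecc_pos
  have hQ : 0 ≤ termConst 1 * (I.re⁻¹ ^ 7 + ε * I.re⁻¹ ^ 4) := by positivity
  have key := norm_tsum_sub_sum_le {(((1, 1), 0) : (ℕ × ℕ) × ℤ)} (h.summable_norm h0 h1 δ).of_norm
    summable_indexWeight (fun x => (indexWeight_pos x).le) hQ fun x hx =>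
      hA.norm_term_le_of_ne h0 h1 (by simpa using hx)
  rw [Finset.sum_singleton, melnikovTerm_diag] at key
  refine le_of_eq_of_le (congrArg norm ?_) key
  simp [eccOrder, reducedSeries, melnikovSeries]

/-- The difference of the reduced series of phases `0` and `π`. -/
noncomputable def reducedDiff (μ ε : ℝ) (p : ℂ × ℂ) : ℂ :=
  reducedSeries μ 0 ε p - reducedSeries μ Real.pi ε p

/-- The part of the difference of the reduced series which does not depend on the angle. -/
noncomputable def reducedDiffMean (μ ε : ℝ) (I : ℂ) : ℂ :=
  reducedMean μ 0 ε I - reducedMean μ Real.pi ε I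

lemma exp_I_mul_pi : Complex.exp (Complex.I * Real.pi) = -1 := by
  rw [mul_comm, Complex.exp_pi_mul_I]

lemma exp_neg_I_mul_pi : Complex.exp (-(Complex.I * Real.pi)) = -1 := by
  rw [Complex.exp_neg, exp_I_mul_pi]
  norm_num

lemma term_sub_term_eq_zero {x : (ℕ × ℕ) × ℤ} (hx : x.2 = 0) :
    melnikovTerm μ x (φ + (0 : ℝ)) φ I ε - melnikovTerm μ x (φ + Real.pi) φ I ε = 0 := by
  rw [melnikovTerm_diag, melnikovTerm_diag, hx]
  simp

/-- The phase π multiplies order l by (−1)^l, so in the difference the orders ±1 are doubled, with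
opposite harmonics in φ. -/
lemma term_sub_term_eq {j k : ℕ} :
    melnikovTerm μ ((j, k), 1) (φ + (0 : ℝ)) φ I ε - melnikovTerm μ ((j, k), 1) (φ + Real.pi) φ I ε
        = 2 * melnikovTerm μ ((j, k), 1) 0 0 I ε
          * Complex.exp (-(Complex.I * (((j : ℂ) - k - 1) * φ))) ∧
      melnikovTerm μ ((k, j), -1) (φ + (0 : ℝ)) φ I ε
          - melnikovTerm μ ((k, j), -1) (φ + Real.pi) φ I ε
        = 2 * melnikovTerm μ ((j, k), 1) 0 0 I ε
          * Complex.exp (Complex.I * (((j : ℂ) - k - 1) * φ)) := by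
  constructor
  · rw [melnikovTerm_diag, melnikovTerm_diag]
    simp only [eccOrder, Int.cast_one, one_mul, exp_I_mul_pi, Complex.ofReal_zero, mul_zero,
      Complex.exp_zero]
    push_cast
    ring
  · rw [melnikovTerm_diag, melnikovTerm_diag, melnikovTerm_neg_zero_zero]
    simp only [eccOrder, Int.cast_one, Int.cast_neg, neg_mul, one_mul, mul_neg, exp_neg_I_mul_pi,
      Complex.ofReal_zero, mul_zero, Complex.exp_zero]
    push_cast
    rw [show Complex.I * (((j : ℂ) - k - 1) * φ) = -(Complex.I * (((k : ℂ) - j - -1) * φ)) by ring]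
    ring

/-- Order zero in σ cancels. The dominant terms (2, 1, 1) and (1, 2, −1) have eccentricity order
zero, hence no dependence on φ, and contribute two equal halves. -/
lemma ReducedDomain.norm_diff_sub_le (h : ReducedDomain ε φ I) (h0 : 0 ≤ μ) (h1 : μ ≤ 1) :
    ‖reducedDiff μ ε (φ, I) - 4 * melnikovTerm μ ((2, 1), 1) 0 0 I ε‖
      ≤ 32 * termConst 1 * ((√I.re)⁻¹ * I.re⁻¹ * expFactor I) * indexTotal := by
  have hK := termConst_ge (s := 1) (by norm_num)
  have hA := h.admissible 0
  have hp : 0 < I.re := by linarith [hA.ten_le]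
  have hE : 0 < expFactor I := Real.exp_pos _
  have hQ : 0 ≤ 32 * termConst 1 * ((√I.re)⁻¹ * I.re⁻¹ * expFactor I) := by positivity
  have hs := (h.summable_norm h0 h1 0).of_norm.hasSum.sub
    (h.summable_norm h0 h1 Real.pi).of_norm.hasSum
  have key := norm_tsum_sub_sum_le {(((2, 1), 1) : (ℕ × ℕ) × ℤ), ((1, 2), -1)} hs.summable
    summable_indexWeight (fun x => (indexWeight_pos x).le) hQ fun x hx => ?_
  · rw [hs.tsum_eq, Finset.sum_pair (by decide), term_sub_term_eq.1, term_sub_term_eq.2] at key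
    refine le_of_eq_of_le (congrArg norm ?_) key
    rw [show ((2 : ℕ) : ℂ) - (1 : ℕ) - 1 = 0 by norm_num]
    simp only [zero_mul, mul_zero, neg_zero, Complex.exp_zero, mul_one, reducedDiff, reducedSeries,
      melnikovSeries]
    ring
  · simp only [Finset.mem_insert, Finset.mem_singleton, not_or] at hx
    by_cases hl : x.2 = 0
    · rw [term_sub_term_eq_zero hl, norm_zero]
      exact mul_nonneg hQ (indexWeight_pos x).le
    · have b1 := hA.norm_term_le_of_sigma h0 h1 hl hx.1 hx.2
      have b2 := (h.admissible Real.pi).norm_term_le_of_sigma h0 h1 hl hx.1 hx.2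
      refine (norm_sub_le _ _).trans ((add_le_add b1 b2).trans (le_of_eq ?_))
      ring

/-- Without its mean, the difference is dominated by (2, 0, 1) and (0, 2, −1), of eccentricity
orders 1 and −1, which form a cosine. -/
lemma ReducedDomain.norm_diff_sub_mean_le (h : ReducedDomain ε φ I) (h0 : 0 ≤ μ) (h1 : μ ≤ 1) :
    ‖reducedDiff μ ε (φ, I) - reducedDiffMean μ ε I
        - 4 * melnikovTerm μ ((2, 0), 1) 0 0 I ε * Complex.cos φ‖
      ≤ 32 * termConst 1 * (ε * √I.re * expFactor I) * indexTotal := by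
  have hK := termConst_ge (s := 1) (by norm_num)
  have hA := h.admissible 0
  have hp : 0 < I.re := by linarith [hA.ten_le]
  have hε := h.ecc_pos
  have hE : 0 < expFactor I := Real.exp_pos _
  have hQ : 0 ≤ 32 * termConst 1 * (ε * √I.re * expFactor I) := by positivity
  have hs := (h.hasSum_sub_reducedMean h0 h1 0).sub (h.hasSum_sub_reducedMean h0 h1 Real.pi)
  have key := norm_tsum_sub_sum_le {(((2, 0), 1) : (ℕ × ℕ) × ℤ), ((0, 2), -1)} hs.summable
    summable_indexWeight (fun x => (indexWeight_pos x).le) hQ fun x hx => ?_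
  · rw [hs.tsum_eq, Finset.sum_pair (by decide), if_neg (by decide), if_neg (by decide),
      if_neg (by decide), if_neg (by decide), term_sub_term_eq.1, term_sub_term_eq.2] at key
    refine le_of_eq_of_le (congrArg norm ?_) key
    rw [show ((2 : ℕ) : ℂ) - (0 : ℕ) - 1 = 1 by norm_num, one_mul, ← mul_add,
      exp_add_exp_neg_I_mul, reducedDiff, reducedDiffMean]
    ring
  · simp only [Finset.mem_insert, Finset.mem_singleton, not_or] at hx
    have hz : (0 : ℝ) ≤ 32 * termConst 1 * (ε * √I.re * expFactor I) * indexWeight x :=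
      mul_nonneg hQ (indexWeight_pos x).le
    by_cases hm : eccOrder x = 0
    · rwa [if_pos hm, if_pos hm, sub_zero, norm_zero]
    · rw [if_neg hm, if_neg hm]
      by_cases hl : x.2 = 0
      · rwa [term_sub_term_eq_zero hl, norm_zero]
      · have b1 := hA.norm_term_le_of_sigma_of_ecc h0 h1 hl hm hx.1 hx.2
        have b2 := (h.admissible Real.pi).norm_term_le_of_sigma_of_ecc h0 h1 hl hm hx.1 hx.2
        refine (norm_sub_le _ _).trans ((add_le_add b1 b2).trans (le_of_eq ?_))
        ring

end Reduced

/-! ## Derivatives of the reduced series -/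

lemma norm_hasDerivAt_le_two_mul {f : ℂ → ℂ} {f' z : ℂ} {B : ℝ} (hf : HasDerivAt f f' z)
    (hd : ∀ w, ‖w - z‖ ≤ 1 / 2 → DifferentiableAt ℂ f w)
    (hb : ∀ w, ‖w - z‖ ≤ 1 / 2 → ‖f w‖ ≤ B) : ‖f'‖ ≤ 2 * B := by
  rw [← hf.deriv]
  have hc : DifferentiableOn ℂ f (closure (Metric.ball z (1 / 2))) := fun w hw =>
    (hd w (by simpa [dist_eq_norm] using Metric.closure_ball_subset_closedBall hw)
      ).differentiableWithinAt
  have := Complex.norm_deriv_le_of_forall_mem_sphere_norm_le (R := 1 / 2) (by norm_num)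
    hc.diffContOnCl fun w hw => hb w (by simpa [dist_eq_norm] using (Metric.mem_sphere.1 hw).le)
  refine this.trans (le_of_eq ?_)
  ring

lemma norm_sin_le_three {φ : ℂ} (h : |φ.im| ≤ 1) : ‖Complex.sin φ‖ ≤ 3 := by
  have h1 := norm_exp_I_mul_le h
  have h2 := norm_exp_I_mul_le (σ := -φ) (s := 1) (by simpa using h)
  have e : Complex.sin φ
      = (Complex.exp (Complex.I * -φ) - Complex.exp (Complex.I * φ)) * Complex.I / 2 := by
    rw [Complex.sin, show Complex.I * -φ = -φ * Complex.I by ring, mul_comm Complex.I φ]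
  rw [e, norm_div, norm_mul, Complex.norm_I, mul_one, Complex.norm_ofNat]
  have h3 := norm_sub_le (Complex.exp (Complex.I * -φ)) (Complex.exp (Complex.I * φ))
  have h4 := Real.exp_one_lt_d9
  linarith

/-- A point of the domain of the angles and the actions. -/
structure InnerDomain (ε : ℝ) (φ I : ℂ) : Prop where
  reducedDomain_of_dist_le : ∀ φ' I' : ℂ, ‖φ' - φ‖ ≤ 1 / 2 → ‖I' - I‖ ≤ 1 / 2 →
    ReducedDomain ε φ' I' ∧ I.re / 2 ≤ I'.re

section Derivatives

variable {ε : ℝ} {φ I : ℂ} {μ : ℝ}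

lemma InnerDomain.reducedDomain (h : InnerDomain ε φ I) : ReducedDomain ε φ I :=
  (h.1 φ I (by norm_num) (by norm_num)).1

lemma InnerDomain.angle (h : InnerDomain ε φ I) {φ' : ℂ} (hφ' : ‖φ' - φ‖ ≤ 1 / 2) :
    ReducedDomain ε φ' I :=
  (h.1 φ' I hφ' (by norm_num)).1

lemma InnerDomain.action (h : InnerDomain ε φ I) {I' : ℂ} (hI' : ‖I' - I‖ ≤ 1 / 2) :
    ReducedDomain ε φ I' ∧ I.re / 2 ≤ I'.re :=
  h.1 φ I' (by norm_num) hI'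

lemma innerDomain_of_mem {K : ℝ} (hK : actionThreshold 1 + 1 ≤ K) (hε : ε ∈ eccentricities K)
    (hφ : φ ∈ strip (1 / 4)) (hI : I ∈ actionDomain (1 / 4) K ε) : InnerDomain ε φ I :=
  ⟨fun _ _ => RPE3BP.reducedDomain_of_dist_le hK hε hφ hI⟩

/-- Comparison of the size of an action with its real part. -/
lemma ReducedDomain.bounds (h : ReducedDomain ε φ I) :
    10 ≤ I.re ∧ I.re ≤ ‖I‖ ∧ I.re⁻¹ ≤ 2 * ‖I‖⁻¹ ∧ ε * ‖I‖ ≤ 32 ∧ ε ≤ 1 / 2 ∧ I ≠ 0 := by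
  have hA := h.admissible 0
  have hp := hA.ten_le
  obtain ⟨h1, h2⟩ := re_le_norm_action hp
  refine ⟨hp, h1, inv_re_le_norm_inv hp h.action_im.le, ?_, hA.ecc_le_half, norm_pos_iff.1 h2⟩
  have h3 := norm_action_le hp h.action_im.le
  have h4 := hA.ecc_mul_pow_le (n := 1) (by norm_num)
  have := h.ecc_pos
  calc ε * ‖I‖ ≤ ε * (2 * I.re) := by gcongr
    _ ≤ 32 := by rw [pow_one] at h4; linarith

lemma mul_one_sub_le_one (hμ0 : 0 < μ) (hμ1 : μ < 1 / 2) :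
    ‖(μ : ℂ) * (1 - μ)‖ ≤ 1 ∧ ‖(1 : ℂ) - 2 * μ‖ ≤ 1 := by
  have e1 : (μ : ℂ) * (1 - μ) = ((μ * (1 - μ) : ℝ) : ℂ) := by push_cast; ring
  have e2 : (1 : ℂ) - 2 * μ = ((1 - 2 * μ : ℝ) : ℂ) := by push_cast; ring
  rw [e1, e2, Complex.norm_real, Complex.norm_real, Real.norm_of_nonneg (by nlinarith),
    Real.norm_of_nonneg (by linarith)]
  exact ⟨by nlinarith, by linarith⟩

lemma norm_deriv_angle_sub_le (hμ0 : 0 < μ) (hμ1 : μ < 1 / 2) :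
    ∃ C : ℝ, 0 < C ∧ ∀ {ε : ℝ} {φ I : ℂ}, InnerDomain ε φ I → ∀ δ : ℝ,
      ‖deriv (fun x => reducedSeries μ δ ε (x, I)) φ
          - μ * (1 - μ) * (1 - 2 * μ) * (15 * Real.pi * ε / (8 * I ^ 5)) * Complex.sin φ‖
        ≤ C * (ε * ‖I‖ ^ (-7 : ℤ)) := by
  have hK : 0 < termConst 1 := lt_of_lt_of_le (by norm_num) (termConst_ge zero_le_one)
  have hW := indexTotal_pos
  refine ⟨2 * termConst 1 * 2 ^ 7 * indexTotal + 60 * 32 ^ 2, by positivity,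
    fun {ε φ I} hin δ => ?_⟩
  have h0 : 0 ≤ μ := hμ0.le
  have h1 : μ ≤ 1 := by linarith
  have h := hin.reducedDomain
  obtain ⟨hp, hpN, hinv, hεN, hε2, hI0⟩ := h.bounds
  have hε := h.ecc_pos
  have hp0 : 0 < I.re := by linarith
  have hN : 0 < ‖I‖ := norm_pos_iff.2 hI0
  obtain ⟨hκ, hμ2⟩ := mul_one_sub_le_one hμ0 hμ1
  rw [show (-7 : ℤ) = -((7 : ℕ) : ℤ) from rfl, zpow_neg_ofNat_eq]
  have hcos : ∀ x : ℂ, HasDerivAt (fun x => 2 * melnikovTerm μ ((2, 1), 0) 0 0 I ε * Complex.cos x)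
      (2 * melnikovTerm μ ((2, 1), 0) 0 0 I ε * -Complex.sin x) x := fun x =>
    (Complex.hasDerivAt_cos x).const_mul _
  have key := norm_hasDerivAt_le_two_mul (f := fun x => reducedSeries μ δ ε (x, I)
      - reducedMean μ δ ε I - 2 * melnikovTerm μ ((2, 1), 0) 0 0 I ε * Complex.cos x) (z := φ)
    (((h.differentiableAt_angle h0 h1 δ).hasDerivAt.sub_const _).sub (hcos φ))
    (fun w hw => (((hin.angle hw).differentiableAt_angle h0 h1 δ).sub_const _).sub
      (hcos w).differentiableAt)
    (fun w hw => (hin.angle hw).norm_sub_mean_le h0 h1 δ)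
  rw [melnikovTerm_two_one_zero μ hI0] at key
  set R' := deriv (fun x => reducedSeries μ δ ε (x, I)) φ with hR'
  have e : R' - μ * (1 - μ) * (1 - 2 * μ) * (15 * Real.pi * ε / (8 * I ^ 5)) * Complex.sin φ
      = (R' - 2 * -(μ * (1 - μ) * (1 - 2 * μ) * (15 * Real.pi / (16 * I ^ 5))
          * (ε + 3 / 4 * ε ^ 3)) * -Complex.sin φ)
        + μ * (1 - μ) * (1 - 2 * μ) * (45 / 32 * Real.pi * (ε ^ 3 * (I⁻¹) ^ 5)) * Complex.sin φ := by
    field_simp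
    ring
  rw [e]
  have hsin := norm_sin_le_three h.angle_im.le
  have b2 : ‖(μ : ℂ) * (1 - μ) * (1 - 2 * μ) * (45 / 32 * Real.pi * (ε ^ 3 * (I⁻¹) ^ 5))
      * Complex.sin φ‖ ≤ 60 * 32 ^ 2 * (ε * ‖I‖⁻¹ ^ 7) := by
    rw [norm_mul, norm_mul, norm_mul _ (1 - 2 * (μ : ℂ)), norm_mul (45 / 32 * (Real.pi : ℂ)),
      norm_mul ((ε : ℂ) ^ 3), norm_pow, norm_pow, norm_inv, Complex.norm_real,
      Real.norm_of_nonneg hε.le, norm_mul (45 / 32 : ℂ), Complex.norm_real,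
      Real.norm_of_nonneg Real.pi_pos.le]
    have hpi := Real.pi_le_four
    have hpi0 := Real.pi_pos
    have h45 : ‖(45 / 32 : ℂ)‖ = 45 / 32 := by norm_num
    rw [h45]
    -- The cubic correction in ε of the coefficient of cos φ is traded for two further powers of
    -- 1/|I|, as ε|I| ≤ 32.
    have hεe : ε ^ 3 * ‖I‖⁻¹ ^ 5 = (ε * ‖I‖) ^ 2 * (ε * ‖I‖⁻¹ ^ 7) := by field_simp
    rw [hεe]
    calc _ ≤ 1 * 1 * (45 / 32 * 4 * (32 ^ 2 * (ε * ‖I‖⁻¹ ^ 7))) * 3 := by gcongr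
      _ ≤ _ := by
        have : 0 ≤ ε * ‖I‖⁻¹ ^ 7 := by positivity
        linarith
  calc _ ≤ _ := norm_add_le _ _
    _ ≤ 2 * (termConst 1 * (ε * (2 * ‖I‖⁻¹) ^ 7) * indexTotal)
        + 60 * 32 ^ 2 * (ε * ‖I‖⁻¹ ^ 7) := by
        refine add_le_add (key.trans ?_) b2
        gcongr
    _ = _ := by ring

lemma norm_deriv_action_sub_le (hμ0 : 0 < μ) (hμ1 : μ < 1 / 2) :
    ∃ C : ℝ, 0 < C ∧ ∀ {ε : ℝ} {φ I : ℂ}, InnerDomain ε φ I → ∀ δ : ℝ,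
      ‖deriv (fun y => reducedSeries μ δ ε (φ, y)) I
          - (-(μ * (1 - μ) * (3 * Real.pi / (2 * I ^ 4))))‖
        ≤ C * (‖I‖ ^ (-7 : ℤ) + ε * ‖I‖ ^ (-4 : ℤ)) := by
  have hK : 0 < termConst 1 := lt_of_lt_of_le (by norm_num) (termConst_ge zero_le_one)
  have hW := indexTotal_pos
  refine ⟨2 * (termConst 1 * indexTotal + 96) * 4 ^ 7, by positivity, fun {ε φ I} hin δ => ?_⟩
  have h0 : 0 ≤ μ := hμ0.le
  have h1 : μ ≤ 1 := by linarith
  have h := hin.reducedDomain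
  obtain ⟨hp, hpN, hinv, hεN, hε2, hI0⟩ := h.bounds
  have hε := h.ecc_pos
  have hp0 : 0 < I.re := by linarith
  have hN : 0 < ‖I‖ := norm_pos_iff.2 hI0
  obtain ⟨hκ, hμ2⟩ := mul_one_sub_le_one hμ0 hμ1
  rw [show (-7 : ℤ) = -((7 : ℕ) : ℤ) from rfl, show (-4 : ℤ) = -((4 : ℕ) : ℤ) from rfl,
    zpow_neg_ofNat_eq, zpow_neg_ofNat_eq]
  have hder : ∀ y : ℂ, y ≠ 0 → HasDerivAt (fun y : ℂ => μ * (1 - μ) * (Real.pi / 2) * (y ^ 3)⁻¹)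
      (-(μ * (1 - μ) * (3 * Real.pi / (2 * y ^ 4)))) y := fun y hy => by
    refine (((hasDerivAt_pow 3 y).inv (pow_ne_zero 3 hy)).const_mul _).congr_deriv ?_
    norm_num
    field_simp
  have key := norm_hasDerivAt_le_two_mul (f := fun y => reducedSeries μ δ ε (φ, y)
      - μ * (1 - μ) * (Real.pi / 2) * (y ^ 3)⁻¹) (z := I)
      (B := (termConst 1 * indexTotal + 96) * (4 ^ 7 * (‖I‖⁻¹ ^ 7 + ε * ‖I‖⁻¹ ^ 4)))
    ((h.differentiableAt_action h0 h1 δ).hasDerivAt.sub (hder I hI0))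
    (fun w hw => ((hin.action hw).1.differentiableAt_action h0 h1 δ).sub
      (hder w (hin.action hw).1.bounds.2.2.2.2.2).differentiableAt)
    (fun w hw => ?_)
  · refine key.trans (le_of_eq ?_)
    ring
  · obtain ⟨hw, hre⟩ := hin.action hw
    obtain ⟨hpw, hpNw, hinvw, hεNw, -, hw0⟩ := hw.bounds
    have hNw : 0 < ‖w‖ := norm_pos_iff.2 hw0
    have hpw0 : 0 < w.re := by linarith
    have b1 := hw.norm_sub_term_le h0 h1 δ
    rw [melnikovTerm_one_one_zero μ hw0] at b1
    -- One factor 2 is the variation of the real part over the disc, the other the comparison of Re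
    -- I with |I|.
    have hwi : w.re⁻¹ ≤ 4 * ‖I‖⁻¹ := by
      have : w.re⁻¹ ≤ (I.re / 2)⁻¹ := inv_anti₀ (by linarith) hre
      rw [inv_div, div_eq_mul_inv] at this
      linarith
    have hwn : ‖w‖⁻¹ ≤ w.re⁻¹ := inv_anti₀ hpw0 hpNw
    have hZ : 0 ≤ w.re⁻¹ ^ 7 + ε * w.re⁻¹ ^ 4 := by positivity
    have b2 : ‖(μ : ℂ) * (1 - μ) * (3 / 4 * Real.pi * (ε ^ 2 * (w⁻¹) ^ 3))‖
        ≤ 96 * (w.re⁻¹ ^ 7 + ε * w.re⁻¹ ^ 4) := by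
      rw [norm_mul, norm_mul (3 / 4 * (Real.pi : ℂ)), norm_mul ((ε : ℂ) ^ 2), norm_pow, norm_pow,
        norm_inv, Complex.norm_real, Real.norm_of_nonneg hε.le, norm_mul (3 / 4 : ℂ),
        Complex.norm_real, Real.norm_of_nonneg Real.pi_pos.le]
      have hpi := Real.pi_le_four
      have hpi0 := Real.pi_pos
      have h34 : ‖(3 / 4 : ℂ)‖ = 3 / 4 := by norm_num
      have hεe : ε ^ 2 * ‖w‖⁻¹ ^ 3 = (ε * ‖w‖) * (ε * ‖w‖⁻¹ ^ 4) := by field_simp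
      rw [h34, hεe]
      calc _ ≤ 1 * (3 / 4 * 4 * (32 * (ε * w.re⁻¹ ^ 4))) := by gcongr
        _ ≤ _ := by
          have : 0 ≤ w.re⁻¹ ^ 7 := by positivity
          linarith
    have e : reducedSeries μ δ ε (φ, w) - μ * (1 - μ) * (Real.pi / 2) * (w ^ 3)⁻¹
        = (reducedSeries μ δ ε (φ, w)
            - μ * (1 - μ) * (Real.pi / (2 * w ^ 3)) * (1 + 3 / 2 * (ε : ℂ) ^ 2))
          + μ * (1 - μ) * (3 / 4 * Real.pi * (ε ^ 2 * (w⁻¹) ^ 3)) := by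
      field_simp
      ring
    rw [e]
    calc _ ≤ _ := norm_add_le _ _
      _ ≤ (termConst 1 * indexTotal + 96) * (w.re⁻¹ ^ 7 + ε * w.re⁻¹ ^ 4) := by
          refine (add_le_add b1 b2).trans (le_of_eq ?_)
          ring
      _ ≤ (termConst 1 * indexTotal + 96) * ((4 * ‖I‖⁻¹) ^ 7 + ε * (4 * ‖I‖⁻¹) ^ 4) := by gcongr
      _ ≤ _ := by
          refine mul_le_mul_of_nonneg_left ?_ (by positivity)
          have : 0 ≤ ε * ‖I‖⁻¹ ^ 4 := by positivity
          rw [mul_pow, mul_pow]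
          linarith

end Derivatives

/-! ## Derivatives of the difference of the reduced series -/

section Difference

variable {ε : ℝ} {φ I : ℂ} {μ : ℝ}

lemma ReducedDomain.differentiableAt_diff_angle (h : ReducedDomain ε φ I) (h0 : 0 ≤ μ)
    (h1 : μ ≤ 1) : DifferentiableAt ℂ (fun x => reducedDiff μ ε (x, I)) φ :=
  (h.differentiableAt_angle h0 h1 0).sub (h.differentiableAt_angle h0 h1 Real.pi)

lemma ReducedDomain.differentiableAt_diff_action (h : ReducedDomain ε φ I) (h0 : 0 ≤ μ)
    (h1 : μ ≤ 1) : DifferentiableAt ℂ (fun y => reducedDiff μ ε (φ, y)) I :=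
  (h.differentiableAt_action h0 h1 0).sub (h.differentiableAt_action h0 h1 Real.pi)

lemma norm_diff_sub_main_le (hμ0 : 0 < μ) (hμ1 : μ < 1 / 2) :
    ∃ C : ℝ, 0 < C ∧ ∀ {ε : ℝ} {φ I : ℂ}, ReducedDomain ε φ I →
      ‖reducedDiff μ ε (φ, I)
          - μ * (1 - μ) * ((1 - 2 * μ) * (actionRoot I / 2) * Complex.exp (-(I ^ 3 / 3)))‖
        ≤ C * (‖I‖⁻¹ * ‖actionRoot I‖ * expFactor I) := by
  have hK : 0 < termConst 1 := lt_of_lt_of_le (by norm_num) (termConst_ge zero_le_one)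
  have hW := indexTotal_pos
  obtain ⟨C, hC, hb⟩ := norm_melnikovTerm_two_one_one_sub_le hμ0.le hμ1.le
  refine ⟨64 * termConst 1 * indexTotal + 4 * C * 17, by positivity, fun {ε φ I} h => ?_⟩
  have h1 : μ ≤ 1 := by linarith
  obtain ⟨hp, hpN, hinv, hεN, hε2, hI0⟩ := h.bounds
  have hε := h.ecc_pos
  have hN : 0 < ‖I‖ := norm_pos_iff.2 hI0
  have hE : 0 < expFactor I := Real.exp_pos _
  have b1 := h.norm_diff_sub_le hμ0.le h1
  have b2 := hb (h.admissible 0)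
  have hroot := inv_sqrt_le_norm_actionRoot hp h.action_im.le
  have hεε : ε ^ 2 ≤ 16 * ‖I‖⁻¹ := by
    calc ε ^ 2 = ε * (ε * ‖I‖) * ‖I‖⁻¹ := by field_simp
      _ ≤ 1 / 2 * 32 * ‖I‖⁻¹ := by gcongr
      _ = _ := by ring
  set T := melnikovTerm μ ((2, 1), 1) 0 0 I ε
  set e := Complex.exp (-(I ^ 3 / 3))
  have e1 : reducedDiff μ ε (φ, I) - μ * (1 - μ) * ((1 - 2 * μ) * (actionRoot I / 2) * e)
      = (reducedDiff μ ε (φ, I) - 4 * T)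
        + 4 * (T - μ * (1 - μ) * ((1 - 2 * μ) * (actionRoot I / 8) * e)) := by ring
  rw [e1]
  refine (norm_add_le _ _).trans ?_
  rw [norm_mul, Complex.norm_ofNat]
  calc _ ≤ 32 * termConst 1 * (‖actionRoot I‖ * (2 * ‖I‖⁻¹) * expFactor I) * indexTotal
        + 4 * (C * ((‖I‖⁻¹ + 16 * ‖I‖⁻¹) * ‖actionRoot I‖ * expFactor I)) := by
        refine add_le_add (b1.trans ?_) (mul_le_mul_of_nonneg_left (b2.trans ?_) (by norm_num))
        · gcongr
        · gcongr
    _ = _ := by ring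

lemma norm_reducedDiff_le (hμ0 : 0 < μ) (hμ1 : μ < 1 / 2) :
    ∃ C : ℝ, 0 < C ∧ ∀ {ε : ℝ} {φ I : ℂ}, ReducedDomain ε φ I →
      ‖reducedDiff μ ε (φ, I)‖ ≤ C * ((√I.re)⁻¹ * expFactor I) := by
  obtain ⟨C, hC, hb⟩ := norm_diff_sub_main_le hμ0 hμ1
  refine ⟨3 * (C + 1), by positivity, fun {ε φ I} h => ?_⟩
  obtain ⟨hp, hpN, hinv, hεN, hε2, hI0⟩ := h.bounds
  have hE : 0 < expFactor I := Real.exp_pos _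
  have b := hb h
  obtain ⟨hκ, hμ2⟩ := mul_one_sub_le_one hμ0 hμ1
  have hroot := norm_actionRoot_le hp
  have hN1 : ‖I‖⁻¹ ≤ 1 := inv_le_one_of_one_le₀ (by linarith)
  have b2 : ‖(μ : ℂ) * (1 - μ) * ((1 - 2 * μ) * (actionRoot I / 2) * Complex.exp (-(I ^ 3 / 3)))‖
      ≤ ‖actionRoot I‖ * expFactor I := by
    rw [norm_mul, norm_mul _ (Complex.exp _), norm_mul (1 - 2 * (μ : ℂ)), norm_div,
      expFactor_eq_norm, Complex.norm_ofNat]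
    have := norm_nonneg (actionRoot I)
    calc _ ≤ 1 * (1 * ‖actionRoot I‖ * expFactor I) := by
          gcongr
          linarith
      _ = _ := by ring
  have b3 := norm_add_le (reducedDiff μ ε (φ, I)
    - μ * (1 - μ) * ((1 - 2 * μ) * (actionRoot I / 2) * Complex.exp (-(I ^ 3 / 3))))
    (μ * (1 - μ) * ((1 - 2 * μ) * (actionRoot I / 2) * Complex.exp (-(I ^ 3 / 3))))
  rw [sub_add_cancel] at b3
  refine (b3.trans (add_le_add b b2)).trans ?_
  calc _ ≤ C * (1 * (3 * (√I.re)⁻¹) * expFactor I) + 3 * (√I.re)⁻¹ * expFactor I := by gcongr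
    _ = _ := by ring

/-- On a disc of radius 1/2 the factor e^{−I³/3} can vary by an exponential of I², so Cauchy's
estimate is applied to D e^{I³/3}, with D the difference. The product rule then gives D' = −I²D up
to an error of the size of D, and the main term is −I² times the leading part of D. -/
lemma norm_deriv_action_diff_sub_le (hμ0 : 0 < μ) (hμ1 : μ < 1 / 2) :
    ∃ C : ℝ, 0 < C ∧ ∀ {ε : ℝ} {φ I : ℂ}, InnerDomain ε φ I →
      ‖deriv (fun y => reducedDiff μ ε (φ, y)) I
          - (-(μ * (1 - μ) * (Real.pi * I ^ 3 / 2) ^ (1 / 2 : ℂ) * (1 - 2 * μ)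
              * Complex.exp (-(I ^ 3 / 3))))‖
        ≤ C * (‖(Real.pi * I ^ 3 / 2) ^ (1 / 2 : ℂ)‖ * ‖I‖⁻¹
            * ‖Complex.exp (-(I ^ 3 / 3))‖) := by
  obtain ⟨C, hC, hb⟩ := norm_diff_sub_main_le hμ0 hμ1
  obtain ⟨B, hB, hd⟩ := norm_reducedDiff_le hμ0 hμ1
  refine ⟨2 * C + 8 * B, by positivity, fun {ε φ I} hin => ?_⟩
  have h1 : μ ≤ 1 := by linarith
  have h := hin.reducedDomain
  obtain ⟨hp, hpN, hinv, hεN, hε2, hI0⟩ := h.bounds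
  have hp0 : 0 < I.re := by linarith
  have hN : 0 < ‖I‖ := norm_pos_iff.2 hI0
  have hE : 0 < expFactor I := Real.exp_pos _
  have hroot := inv_sqrt_le_norm_actionRoot hp h.action_im.le
  have hexp : ∀ y : ℂ, HasDerivAt (fun y : ℂ => Complex.exp (y ^ 3 / 3))
      (Complex.exp (y ^ 3 / 3) * y ^ 2) y := fun y => by
    refine (((hasDerivAt_pow 3 y).div_const 3).cexp).congr_deriv ?_
    norm_num
  have hD := (h.differentiableAt_diff_action hμ0.le h1).hasDerivAt
  have key := norm_hasDerivAt_le_two_mul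
    (f := fun y => reducedDiff μ ε (φ, y) * Complex.exp (y ^ 3 / 3))
    (B := B * (2 * ‖actionRoot I‖)) (hD.mul (hexp I))
    (fun w hw => ((hin.action hw).1.differentiableAt_diff_action hμ0.le h1).mul
      (hexp w).differentiableAt) (fun w hw => ?_)
  · rw [cpow_half_pi_mul_div hp h.action_im.le, expFactor_eq_norm, norm_div, norm_mul, norm_pow,
      Complex.norm_ofNat]
    have b1 := hb h
    set D := reducedDiff μ ε (φ, I)
    set D' := deriv (fun y => reducedDiff μ ε (φ, y)) I
    have hone : Complex.exp (-(I ^ 3 / 3)) * Complex.exp (I ^ 3 / 3) = 1 := by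
      rw [← Complex.exp_add, neg_add_cancel, Complex.exp_zero]
    have hen := expFactor_eq_norm I
    set e := Complex.exp (-(I ^ 3 / 3))
    have e1 : D' - (-(μ * (1 - μ) * (I ^ 2 * actionRoot I / 2) * (1 - 2 * μ) * e))
        = e * (D' * Complex.exp (I ^ 3 / 3) + D * (Complex.exp (I ^ 3 / 3) * I ^ 2))
          - I ^ 2 * (D - μ * (1 - μ) * ((1 - 2 * μ) * (actionRoot I / 2) * e)) := by
      linear_combination (-D' - D * I ^ 2) * hone
    rw [e1]
    refine (norm_sub_le _ _).trans ?_
    rw [norm_mul, norm_mul, norm_pow, hen]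
    have hN1 : 1 ≤ ‖I‖ := by linarith
    calc _ ≤ expFactor I * (2 * (B * (2 * ‖actionRoot I‖)))
          + ‖I‖ ^ 2 * (C * (‖I‖⁻¹ * ‖actionRoot I‖ * expFactor I)) := by gcongr
      _ = (4 * B + C * ‖I‖) * (‖actionRoot I‖ * expFactor I) := by
          field_simp
          ring
      _ ≤ (4 * B * ‖I‖ + C * ‖I‖) * (‖actionRoot I‖ * expFactor I) := by
          refine mul_le_mul_of_nonneg_right ?_ (by positivity)
          have := le_mul_of_one_le_right (by positivity : 0 ≤ 4 * B) hN1
          linarith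
      _ = _ := by
          field_simp
          ring
  · obtain ⟨hw, hre⟩ := hin.action hw
    have hpw := hw.bounds.1
    have hE1 : expFactor w * ‖Complex.exp (w ^ 3 / 3)‖ = 1 := by
      rw [← expFactor_eq_norm, ← norm_mul, ← Complex.exp_add, neg_add_cancel, Complex.exp_zero,
        norm_one]
    have hsq : (√w.re)⁻¹ ≤ 2 * (√I.re)⁻¹ := by
      have h4 : √I.re ≤ 2 * √w.re := by
        rw [Real.sqrt_le_left (by positivity), mul_pow, Real.sq_sqrt (by linarith)]
        linarith
      have h5 : 0 < √I.re := Real.sqrt_pos.2 hp0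
      have h6 : 0 < √w.re := Real.sqrt_pos.2 (by linarith)
      rw [inv_eq_one_div, ← div_eq_mul_inv, div_le_div_iff₀ h6 h5]
      linarith
    rw [norm_mul]
    calc _ ≤ B * ((√w.re)⁻¹ * expFactor w) * ‖Complex.exp (w ^ 3 / 3)‖ := by
          gcongr
          exact hd hw
      _ = B * (√w.re)⁻¹ * (expFactor w * ‖Complex.exp (w ^ 3 / 3)‖) := by ring
      _ = B * (√w.re)⁻¹ := by rw [hE1, mul_one]
      _ ≤ _ := by
          gcongr
          linarith

lemma norm_deriv_angle_diff_sub_le (hμ0 : 0 < μ) (hμ1 : μ < 1 / 2) :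
    ∃ C : ℝ, 0 < C ∧ ∀ {ε : ℝ} {φ I : ℂ}, InnerDomain ε φ I →
      ‖deriv (fun x => reducedDiff μ ε (x, I)) φ
          - μ * (1 - μ) * ε * (6 * (2 * Real.pi * I ^ 3) ^ (1 / 2 : ℂ) * Complex.sin φ)
              * Complex.exp (-(I ^ 3 / 3))‖
        ≤ C * (ε * ‖I‖ ^ (1 / 2 : ℝ) * ‖Complex.exp (-(I ^ 3 / 3))‖) := by
  have hK : 0 < termConst 1 := lt_of_lt_of_le (by norm_num) (termConst_ge zero_le_one)
  have hW := indexTotal_pos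
  obtain ⟨C, hC, hb⟩ := norm_melnikovTerm_two_zero_one_add_le hμ0.le hμ1.le
  refine ⟨64 * termConst 1 * indexTotal + 72 * 33 * C, by positivity, fun {ε φ I} hin => ?_⟩
  have h1 : μ ≤ 1 := by linarith
  have h := hin.reducedDomain
  obtain ⟨hp, hpN, hinv, hεN, hε2, hI0⟩ := h.bounds
  have hε := h.ecc_pos
  have hN : 0 < ‖I‖ := norm_pos_iff.2 hI0
  have hE : 0 < expFactor I := Real.exp_pos _
  obtain ⟨hsq1, hsq2⟩ := sqrt_norm_le_two_mul hp h.action_im.le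
  have hroot := norm_actionRoot_le hp
  have hsin := norm_sin_le_three h.angle_im.le
  have hcos : ∀ x : ℂ, HasDerivAt (fun x => 4 * melnikovTerm μ ((2, 0), 1) 0 0 I ε * Complex.cos x)
      (4 * melnikovTerm μ ((2, 0), 1) 0 0 I ε * -Complex.sin x) x := fun x =>
    (Complex.hasDerivAt_cos x).const_mul _
  have key := norm_hasDerivAt_le_two_mul (f := fun x => reducedDiff μ ε (x, I)
      - reducedDiffMean μ ε I - 4 * melnikovTerm μ ((2, 0), 1) 0 0 I ε * Complex.cos x) (z := φ)
    (((h.differentiableAt_diff_angle hμ0.le h1).hasDerivAt.sub_const _).sub (hcos φ))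
    (fun w hw => (((hin.angle hw).differentiableAt_diff_angle hμ0.le h1).sub_const _).sub
      (hcos w).differentiableAt)
    (fun w hw => (hin.angle hw).norm_diff_sub_mean_le hμ0.le h1)
  have b2 := hb (h.admissible 0)
  rw [cpow_half_two_pi_mul hp h.action_im.le, expFactor_eq_norm, (rpow_half_integers hN).1]
  set T := melnikovTerm μ ((2, 0), 1) 0 0 I ε
  set D' := deriv (fun x => reducedDiff μ ε (x, I)) φ
  set e := Complex.exp (-(I ^ 3 / 3))
  have e1 : D' - μ * (1 - μ) * ε * (6 * (I ^ 2 * actionRoot I) * Complex.sin φ) * e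
      = (D' - 4 * T * -Complex.sin φ)
        - 4 * (T + μ * (1 - μ) * (3 / 2 * ε * (I ^ 2 * actionRoot I) * e)) * Complex.sin φ := by
    ring
  rw [e1]
  refine (norm_sub_le _ _).trans ?_
  rw [norm_mul, norm_mul, Complex.norm_ofNat]
  have hsN : ‖I‖ = √‖I‖ * √‖I‖ := (Real.mul_self_sqrt hN.le).symm
  have hs0 : 0 < √‖I‖ := Real.sqrt_pos.2 hN
  calc _ ≤ 2 * (32 * termConst 1 * (ε * √‖I‖ * expFactor I) * indexTotal)
        + 4 * (C * (ε * (‖I‖⁻¹ + ε) * (‖I‖ ^ 2 * (3 * (2 * (√‖I‖)⁻¹))) * expFactor I)) * 3 := by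
        refine add_le_add (key.trans ?_) ?_
        · gcongr
        · have : ‖actionRoot I‖ ≤ 3 * (2 * (√‖I‖)⁻¹) := hroot.trans (by gcongr)
          gcongr
          refine b2.trans ?_
          gcongr
    _ = 64 * termConst 1 * indexTotal * (ε * √‖I‖ * expFactor I)
        + 72 * C * (1 + ε * ‖I‖) * (ε * (‖I‖ * (√‖I‖)⁻¹) * expFactor I) := by
        field_simp
        ring
    _ ≤ 64 * termConst 1 * indexTotal * (ε * √‖I‖ * expFactor I)
        + 72 * C * (1 + 32) * (ε * √‖I‖ * expFactor I) := by
        have : ‖I‖ * (√‖I‖)⁻¹ = √‖I‖ := by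
          nth_rewrite 1 [hsN]
          field_simp
        rw [this]
        gcongr
    _ = _ := by ring

end Difference

/-! ## The reduced Melnikov potentials -/

section ReducedPotentials

variable {ε : ℝ} {φ I : ℂ} {μ : ℝ}

lemma norm_deriv_angle_le (hμ0 : 0 < μ) (hμ1 : μ < 1 / 2) :
    ∃ C : ℝ, 0 < C ∧ ∀ {ε : ℝ} {φ I : ℂ}, InnerDomain ε φ I → ∀ δ : ℝ,
      ‖deriv (fun x => reducedSeries μ δ ε (x, I)) φ‖ ≤ C * (ε * ‖I‖⁻¹ ^ 5) := by
  obtain ⟨C, hC, hb⟩ := norm_deriv_angle_sub_le hμ0 hμ1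
  refine ⟨C + 24, by positivity, fun {ε φ I} hin δ => ?_⟩
  have h := hin.reducedDomain
  obtain ⟨hp, hpN, -, -, -, hI0⟩ := h.bounds
  have hε := h.ecc_pos
  have hN : 0 < ‖I‖ := norm_pos_iff.2 hI0
  have b := hb hin δ
  obtain ⟨hκ, hμ2⟩ := mul_one_sub_le_one hμ0 hμ1
  rw [show (-7 : ℤ) = -((7 : ℕ) : ℤ) from rfl, zpow_neg_ofNat_eq] at b
  have hsin := norm_sin_le_three h.angle_im.le
  have b2 : ‖(μ : ℂ) * (1 - μ) * (1 - 2 * μ) * (15 * Real.pi * ε / (8 * I ^ 5)) * Complex.sin φ‖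
      ≤ 24 * (ε * ‖I‖⁻¹ ^ 5) := by
    have e : 15 * (Real.pi : ℂ) * ε / (8 * I ^ 5) = ((15 / 8 * Real.pi * ε : ℝ) : ℂ) * I⁻¹ ^ 5 := by
      push_cast
      field_simp
    have hpi := Real.pi_lt_four
    have hpi0 := Real.pi_pos
    rw [e, norm_mul, norm_mul, norm_mul _ (1 - 2 * (μ : ℂ)), norm_mul _ (I⁻¹ ^ 5), norm_pow,
      norm_inv, Complex.norm_real, Real.norm_of_nonneg (by positivity)]
    calc _ ≤ 1 * 1 * (15 / 8 * 4 * ε * ‖I‖⁻¹ ^ 5) * 3 := by gcongr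
      _ ≤ _ := by
        have : 0 ≤ ε * ‖I‖⁻¹ ^ 5 := by positivity
        linarith
  have b3 := norm_le_norm_sub_add (deriv (fun x => reducedSeries μ δ ε (x, I)) φ)
    ((μ : ℂ) * (1 - μ) * (1 - 2 * μ) * (15 * Real.pi * ε / (8 * I ^ 5)) * Complex.sin φ)
  have hN1 : ‖I‖⁻¹ ≤ 1 := inv_le_one_of_one_le₀ (by linarith)
  calc _ ≤ C * (ε * ‖I‖⁻¹ ^ 7) + 24 * (ε * ‖I‖⁻¹ ^ 5) := b3.trans (add_le_add b b2)
    _ ≤ C * (ε * ‖I‖⁻¹ ^ 5) + 24 * (ε * ‖I‖⁻¹ ^ 5) := by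
        have := pow_le_pow_of_le_one (by positivity) hN1 (show 5 ≤ 7 by norm_num)
        gcongr
    _ = _ := by ring

lemma norm_deriv_action_diff_le (hμ0 : 0 < μ) (hμ1 : μ < 1 / 2) :
    ∃ C : ℝ, 0 < C ∧ ∀ {ε : ℝ} {φ I : ℂ}, InnerDomain ε φ I →
      ‖deriv (fun y => reducedDiff μ ε (φ, y)) I‖
        ≤ C * (‖I‖ ^ 2 * (√I.re)⁻¹ * expFactor I) := by
  obtain ⟨C, hC, hb⟩ := norm_deriv_action_diff_sub_le hμ0 hμ1
  refine ⟨2 * (C + 1), by positivity, fun {ε φ I} hin => ?_⟩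
  have h := hin.reducedDomain
  obtain ⟨hp, hpN, -, -, -, hI0⟩ := h.bounds
  have hN : 0 < ‖I‖ := norm_pos_iff.2 hI0
  have hE : 0 < expFactor I := Real.exp_pos _
  have b := hb hin
  obtain ⟨hκ, hμ2⟩ := mul_one_sub_le_one hμ0 hμ1
  have hroot : ‖(Real.pi * I ^ 3 / 2) ^ (1 / 2 : ℂ)‖ ≤ 2 * (‖I‖ ^ 2 * (√I.re)⁻¹) := by
    rw [cpow_half_pi_mul_div hp h.action_im.le, norm_div, norm_mul, norm_pow, Complex.norm_ofNat]
    have := norm_actionRoot_le hp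
    calc _ ≤ ‖I‖ ^ 2 * (3 * (√I.re)⁻¹) / 2 := by gcongr
      _ ≤ _ := by
        have : 0 ≤ ‖I‖ ^ 2 * (√I.re)⁻¹ := by positivity
        linarith
  have hN1 : ‖I‖⁻¹ ≤ 1 := inv_le_one_of_one_le₀ (by linarith)
  rw [expFactor_eq_norm] at b
  have b2 : ‖-((μ : ℂ) * (1 - μ) * (Real.pi * I ^ 3 / 2) ^ (1 / 2 : ℂ) * (1 - 2 * μ)
      * Complex.exp (-(I ^ 3 / 3)))‖ ≤ 2 * (‖I‖ ^ 2 * (√I.re)⁻¹) * expFactor I := by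
    rw [norm_neg, norm_mul, norm_mul, norm_mul _ ((Real.pi * I ^ 3 / 2) ^ (1 / 2 : ℂ)),
      expFactor_eq_norm]
    calc _ ≤ 1 * (2 * (‖I‖ ^ 2 * (√I.re)⁻¹)) * 1 * expFactor I := by gcongr
      _ = _ := by ring
  have b3 := norm_le_norm_sub_add (deriv (fun y => reducedDiff μ ε (φ, y)) I)
    (-((μ : ℂ) * (1 - μ) * (Real.pi * I ^ 3 / 2) ^ (1 / 2 : ℂ) * (1 - 2 * μ)
      * Complex.exp (-(I ^ 3 / 3))))
  calc _ ≤ _ := b3.trans (add_le_add b b2)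
    _ ≤ C * (2 * (‖I‖ ^ 2 * (√I.re)⁻¹) * 1 * expFactor I)
        + 2 * (‖I‖ ^ 2 * (√I.re)⁻¹) * expFactor I := by gcongr
    _ = _ := by ring

/-! ### The real reduced potentials as restrictions of the series. -/

lemma reducedSeries_ofReal (h0 : 0 ≤ μ) (h1 : μ ≤ 1) (δ φ : ℝ) {I ε : ℝ} (hI : 5 ≤ I)
    (hε0 : 0 < ε) (hε1 : ε < 1 / 4) :
    reducedSeries μ δ ε (φ, I) = (reducedMelnikov δ μ ε φ I : ℂ) := by
  have := melnikovSeries_ofReal h0 h1 (φ + δ) φ hI hε0 hε1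
  rw [Complex.ofReal_add] at this
  exact this

lemma hasDerivAt_reducedMelnikov (h0 : 0 ≤ μ) (h1 : μ ≤ 1) (δ : ℝ) {φ I ε : ℝ}
    (h : ReducedDomain ε φ I) (hε1 : ε < 1 / 4) :
    HasDerivAt (fun x => reducedMelnikov δ μ ε x I)
        (deriv (fun x => reducedSeries μ δ ε (x, I)) φ).re φ ∧
      HasDerivAt (fun y => reducedMelnikov δ μ ε φ y)
        (deriv (fun y => reducedSeries μ δ ε (φ, y)) I).re I := by
  have hI : 5 < I := by
    have := h.bounds.1
    rw [Complex.ofReal_re] at this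
    linarith
  constructor
  · refine (h.differentiableAt_angle h0 h1 δ).hasDerivAt.real_of_complex.congr_of_eventuallyEq
      (Eventually.of_forall fun x => ?_)
    simp only [reducedSeries_ofReal h0 h1 δ x hI.le h.ecc_pos hε1, Complex.ofReal_re]
  · refine (h.differentiableAt_action h0 h1 δ).hasDerivAt.real_of_complex.congr_of_eventuallyEq ?_
    filter_upwards [lt_mem_nhds hI] with y hy
    simp only [reducedSeries_ofReal h0 h1 δ φ hy.le h.ecc_pos hε1, Complex.ofReal_re]

lemma analyticAt_reducedMelnikov (h0 : 0 ≤ μ) (h1 : μ ≤ 1) (δ : ℝ) {φ I ε : ℝ}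
    (h : ReducedDomain ε φ I) (hε1 : ε < 1 / 4) :
    AnalyticAt ℝ (fun p : ℝ × ℝ => reducedMelnikov δ μ ε p.1 p.2) (φ, I) := by
  have hI : 5 < I := by
    have := h.bounds.1
    rw [Complex.ofReal_re] at this
    linarith
  have hof : ∀ z : ℝ, AnalyticAt ℝ (fun y : ℝ => (y : ℂ)) z := fun z =>
    Complex.ofRealCLM.analyticAt z
  have a1 : AnalyticAt ℝ (fun p : ℝ × ℝ => (p.1 : ℂ)) (φ, I) :=
    (hof _).comp_of_eq analyticAt_fst rfl
  have a2 : AnalyticAt ℝ (fun p : ℝ × ℝ => (p.2 : ℂ)) (φ, I) :=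
    (hof _).comp_of_eq analyticAt_snd rfl
  refine analyticAt_of_eventually_eq_melnikovSeries h0 h1 (s := 1)
    (Φ := fun p : ℝ × ℝ => ((p.1 : ℂ) + δ, (p.1 : ℂ), (p.2 : ℂ), (ε : ℂ)))
    ((a1.add analyticAt_const).prod (a1.prod (a2.prod analyticAt_const))) (h.mem_coreDomain δ) ?_
  filter_upwards [continuous_snd.continuousAt.eventually (lt_mem_nhds hI)] with p hp
  exact (reducedSeries_ofReal h0 h1 δ p.1 hp.le h.ecc_pos hε1).symm

lemma reducedSeries_add_two_pi (δ : ℝ) :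
    reducedSeries μ δ ε (φ + 2 * Real.pi, I) = reducedSeries μ δ ε (φ, I) := by
  have h1 := (melnikovSeries_add_two_pi μ (φ + δ) (φ + 2 * Real.pi) I ε).1
  have h2 := (melnikovSeries_add_two_pi μ (φ + δ) φ I ε).2
  rw [reducedSeries, reducedSeries, ← h2, ← h1]
  ring_nf

lemma isAngleActionExtension_reducedSeries {K : ℝ} (hK : actionThreshold 1 + 1 ≤ K) (h0 : 0 ≤ μ)
    (h1 : μ ≤ 1) (hε : ε ∈ eccentricities K) (hε1 : ε < 1 / 4) (δ : ℝ) :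
    IsAngleActionExtension (reducedMelnikov δ μ ε) (reducedSeries μ δ ε) (1 / 4) K ε := by
  refine ⟨fun p hp => (innerDomain_of_mem hK hε hp.1 hp.2).reducedDomain.analyticAt h0 h1 δ,
    fun φ I hI => reducedSeries_ofReal h0 h1 δ φ ?_ hε.1 hε1,
    fun _ _ _ _ => reducedSeries_add_two_pi δ⟩
  linarith [hI.1, le_actionThreshold (s := 1) zero_le_one]

/-- The bracket is the product of the derivatives of the difference and of one of the functions,
up to the product of the other two derivatives. -/
lemma poissonBracket_sub (f g : ℝ → ℝ → ℝ) {φ I f₁ f₂ g₁ g₂ : ℝ}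
    (hf₁ : HasDerivAt (fun x => f x I) f₁ φ) (hf₂ : HasDerivAt (fun y => f φ y) f₂ I)
    (hg₁ : HasDerivAt (fun x => g x I) g₁ φ) (hg₂ : HasDerivAt (fun y => g φ y) g₂ I) :
    poissonBracket f g φ I - deriv (fun x => f x I - g x I) φ * deriv (fun y => f φ y) I
      = -(f₁ * (f₂ - g₂)) := by
  have e : deriv (fun x => f x I - g x I) φ = f₁ - g₁ := (hf₁.sub hg₁).deriv
  rw [poissonBracket, e, hf₁.deriv, hf₂.deriv, hg₁.deriv, hg₂.deriv]
  ring

end ReducedPotentials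

theorem reducedPotentials_derivatives {μ : ℝ} (hμ0 : 0 < μ) (hμ1 : μ < 1 / 2) :
    ∃ ρ Istar C : ℝ, 0 < ρ ∧ 0 < Istar ∧ 0 < C ∧
      ∀ ε ∈ eccentricities Istar,
        (∀ φ : ℝ, ∀ I ∈ realActions Istar ε,
          MeasureTheory.Integrable
            (fun s : ℝ => pertPotential μ s φ (φ + I ^ 3 * s) I ε) ∧
          MeasureTheory.Integrable
            (fun s : ℝ => pertPotential μ s φ (φ + Real.pi + I ^ 3 * s) I ε)) ∧
        AnalyticOnNhd ℝ (fun p : ℝ × ℝ => reducedPlus μ ε p.1 p.2)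
          (univ ×ˢ realActions Istar ε) ∧
        AnalyticOnNhd ℝ (fun p : ℝ × ℝ => reducedMinus μ ε p.1 p.2)
          (univ ×ˢ realActions Istar ε) ∧
        (∃ Fp Fm : ℂ × ℂ → ℂ,
          IsAngleActionExtension (reducedPlus μ ε) Fp ρ Istar ε ∧
          IsAngleActionExtension (reducedMinus μ ε) Fm ρ Istar ε ∧
          ∀ φ ∈ strip ρ, ∀ I ∈ actionDomain ρ Istar ε,
            -- first derivatives of both potentials
            (∀ G : ℂ × ℂ → ℂ, G = Fp ∨ G = Fm →
              ‖deriv (fun x => G (x, I)) φ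
                  - μ * (1 - μ) * (1 - 2 * μ) * (15 * Real.pi * ε / (8 * I ^ 5)) * Complex.sin φ‖
                ≤ C * (ε * ‖I‖ ^ (-7 : ℤ)) ∧
              ‖deriv (fun y => G (φ, y)) I
                  - (-(μ * (1 - μ) * (3 * Real.pi / (2 * I ^ 4))))‖
                ≤ C * (‖I‖ ^ (-7 : ℤ) + ε * ‖I‖ ^ (-4 : ℤ))) ∧
            -- first derivatives of the difference
            ‖deriv (fun y => Fp (φ, y) - Fm (φ, y)) I
                - (-(μ * (1 - μ) * (Real.pi * I ^ 3 / 2) ^ (1 / 2 : ℂ) * (1 - 2 * μ)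
                    * Complex.exp (-(I ^ 3 / 3))))‖
              ≤ C * (‖(Real.pi * I ^ 3 / 2) ^ (1 / 2 : ℂ)‖ * ‖I‖⁻¹
                  * ‖Complex.exp (-(I ^ 3 / 3))‖) ∧
            ‖deriv (fun x => Fp (x, I) - Fm (x, I)) φ
                - μ * (1 - μ) * ε * (6 * (2 * Real.pi * I ^ 3) ^ (1 / 2 : ℂ) * Complex.sin φ)
                    * Complex.exp (-(I ^ 3 / 3))‖
              ≤ C * (ε * ‖I‖ ^ (1 / 2 : ℝ) * ‖Complex.exp (-(I ^ 3 / 3))‖)) ∧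
        -- the Poisson bracket on the real annulus
        (∀ φ : ℝ, ∀ I ∈ realActions Istar ε,
          |poissonBracket (reducedPlus μ ε) (reducedMinus μ ε) φ I
              - deriv (fun x => reducedPlus μ ε x I - reducedMinus μ ε x I) φ
                  * deriv (fun y => reducedPlus μ ε φ y) I|
            ≤ C * (ε * I ^ (-(7 / 2) : ℝ) * Real.exp (-(I ^ 3 / 3)))) := by
  have h0 : 0 ≤ μ := hμ0.le
  have h1 : μ ≤ 1 := by linarith
  obtain ⟨C1, hC1, b1⟩ := norm_deriv_angle_sub_le hμ0 hμ1
  obtain ⟨C2, hC2, b2⟩ := norm_deriv_action_sub_le hμ0 hμ1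
  obtain ⟨C3, hC3, b3⟩ := norm_deriv_action_diff_sub_le hμ0 hμ1
  obtain ⟨C4, hC4, b4⟩ := norm_deriv_angle_diff_sub_le hμ0 hμ1
  obtain ⟨C5, hC5, b5⟩ := norm_deriv_angle_le hμ0 hμ1
  obtain ⟨C6, hC6, b6⟩ := norm_deriv_action_diff_le hμ0 hμ1
  have hth := le_actionThreshold (s := 1) zero_le_one
  set K := actionThreshold 1 + 1 with hK_def
  have hK : 100000 ≤ K := by linarith
  have hC56 : 0 < C5 * C6 := mul_pos hC5 hC6
  refine ⟨1 / 4, K, C1 + C2 + C3 + C4 + C5 * C6, by norm_num, by linarith, by positivity,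
    fun ε hε => ?_⟩
  have hε0 : 0 < ε := hε.1
  have hε1 := lt_quarter_of_mem_eccentricities hK hε
  have hreal : ∀ φ : ℝ, ∀ I ∈ realActions K ε, InnerDomain ε φ I := fun φ I hI =>
    innerDomain_of_mem le_rfl hε (by simp [strip]) (ofReal_mem_actionDomain (by norm_num) hI)
  have hfive : ∀ I ∈ realActions K ε, 5 ≤ I := fun I hI => by linarith [hI.1]
  refine ⟨fun φ I hI => ⟨(integrable_hasSum_melnikovTerm h0 h1 φ φ (hfive I hI) hε0 hε1).1,
      (integrable_hasSum_melnikovTerm h0 h1 (φ + Real.pi) φ (hfive I hI) hε0 hε1).1⟩,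
    fun p hp => analyticAt_reducedMelnikov h0 h1 0 (hreal p.1 p.2 hp.2).reducedDomain hε1,
    fun p hp => analyticAt_reducedMelnikov h0 h1 Real.pi (hreal p.1 p.2 hp.2).reducedDomain hε1,
    ⟨reducedSeries μ 0 ε, reducedSeries μ Real.pi ε,
      isAngleActionExtension_reducedSeries le_rfl h0 h1 hε hε1 0,
      isAngleActionExtension_reducedSeries le_rfl h0 h1 hε hε1 Real.pi, fun φ hφ I hI => ?_⟩,
    fun φ I hI => ?_⟩
  · have hin := innerDomain_of_mem le_rfl hε hφ hI
    refine ⟨?_, (b3 hin).trans (by gcongr; linarith), (b4 hin).trans (by gcongr; linarith)⟩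
    rintro G (rfl | rfl)
    · exact ⟨(b1 hin 0).trans (by gcongr; linarith), (b2 hin 0).trans (by gcongr; linarith)⟩
    · exact ⟨(b1 hin Real.pi).trans (by gcongr; linarith),
        (b2 hin Real.pi).trans (by gcongr; linarith)⟩
  · have hin := hreal φ I hI
    have h := hin.reducedDomain
    have hI0 : 0 < I := by linarith [hfive I hI]
    obtain ⟨p1, p2⟩ := hasDerivAt_reducedMelnikov h0 h1 0 h hε1
    obtain ⟨q1, q2⟩ := hasDerivAt_reducedMelnikov h0 h1 Real.pi h hε1
    have hE : expFactor (I : ℂ) = Real.exp (-(I ^ 3 / 3)) := by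
      rw [expFactor, ← Complex.ofReal_pow, Complex.ofReal_re]
    have n5 := b5 hin 0
    have n6 := b6 hin
    have e6 : deriv (fun y => reducedDiff μ ε (φ, y)) I
        = deriv (fun y => reducedSeries μ 0 ε (φ, y)) I
          - deriv (fun y => reducedSeries μ Real.pi ε (φ, y)) I :=
      ((h.differentiableAt_action h0 h1 0).hasDerivAt.sub
        (h.differentiableAt_action h0 h1 Real.pi).hasDerivAt).deriv
    rw [Complex.norm_real, Real.norm_of_nonneg hI0.le] at n5 n6
    rw [hE, Complex.ofReal_re] at n6
    rw [poissonBracket_sub (reducedPlus μ ε) (reducedMinus μ ε) p1 p2 q1 q2, abs_neg, abs_mul,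
      ← Complex.sub_re, ← e6, (rpow_half_integers hI0).2.2.2.2]
    -- The error in the bracket is the angular derivative of `reducedPlus`, of size εI^{−5}, times
    -- the action derivative of the difference, of size I^{3/2} e^{−I³/3}; this yields the power
    -- −7/2.
    calc _ ≤ (C5 * (ε * I⁻¹ ^ 5)) * (C6 * (I ^ 2 * (√I)⁻¹ * Real.exp (-(I ^ 3 / 3)))) :=
          mul_le_mul ((Complex.abs_re_le_norm _).trans n5) ((Complex.abs_re_le_norm _).trans n6)
            (abs_nonneg _) (by positivity)
      _ = C5 * C6 * (ε * ((√I)⁻¹ * I⁻¹ ^ 3) * Real.exp (-(I ^ 3 / 3))) := by field_simp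
      _ ≤ _ := by
          gcongr
          linarith

end RPE3BP

theorem mainTheorem9 (μ : ℝ) (hμ0 : 0 < μ) (hμ1 : μ < 1 / 2) :
    (∀ σ₀ : ℝ, 0 < σ₀ →
      ∃ ρ₀ Istar C : ℝ, 0 < ρ₀ ∧ 0 < Istar ∧ 0 < C ∧
      ∃ F : ℂ × ℂ × ℂ × ℂ → ℂ, ∃ L00 L01 L11 L12 : ℂ → ℝ → ℂ,
      ∃ E0 : ℂ → ℂ → ℝ → ℂ, ∃ E1 : ℂ → ℂ → ℂ → ℝ → ℂ,
        -- the integral converges and its value is real analytic in all the arguments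
        (∀ u β t I ε : ℝ, ε ∈ eccentricities Istar → I ∈ realActions Istar ε →
          MeasureTheory.Integrable
            (fun s : ℝ => pertPotential μ s β (t - I ^ 3 * u + I ^ 3 * s) I ε)) ∧
        AnalyticOnNhd ℝ
          (fun p : ℝ × ℝ × ℝ × ℝ × ℝ =>
            melnikovPotential μ p.1 p.2.1 p.2.2.1 p.2.2.2.1 p.2.2.2.2)
          {p | p.2.2.2.2 ∈ eccentricities Istar ∧ p.2.2.2.1 ∈ realActions Istar p.2.2.2.2} ∧
        -- analytic extension, as a function of `σ = t - I³ u`, `β`, `I` and `ε`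
        AnalyticOnNhd ℂ F
          {p | ∃ ε ∈ eccentricities Istar, p.1 ∈ strip σ₀ ∧ p.2.1 ∈ strip ρ₀ ∧
            p.2.2.1 ∈ actionDomain ρ₀ Istar ε ∧ p.2.2.2 = (ε : ℂ)} ∧
        (∀ u β t I ε : ℝ, ε ∈ eccentricities Istar → I ∈ realActions Istar ε →
          F (((t - I ^ 3 * u : ℝ) : ℂ), (β : ℂ), (I : ℂ), (ε : ℂ))
            = (melnikovPotential μ u β t I ε : ℂ)) ∧
        ∀ ε ∈ eccentricities Istar, ∀ I ∈ actionDomain ρ₀ Istar ε,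
          -- coefficients of the zeroth and first harmonics
          ‖L00 I ε - Real.pi / (2 * I ^ 3)‖
            ≤ C * (‖I‖ ^ (-4 : ℤ) + ε ^ 2) * ‖Real.pi / (2 * I ^ 3)‖ ∧
          ‖L01 I ε - (-((1 - 2 * μ) * (15 * Real.pi * ε / (8 * I ^ 5))))‖
            ≤ C * (‖I‖ ^ (-4 : ℤ) + ε ^ 2)
              * ‖(1 - 2 * μ) * (15 * Real.pi * ε / (8 * I ^ 5))‖ ∧
          ‖2 * L11 I ε
              - (1 - 2 * μ) * (Real.pi / (8 * I)) ^ (1 / 2 : ℂ) * Complex.exp (-(I ^ 3 / 3))‖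
            ≤ C * (‖I‖⁻¹ + ε ^ 2)
              * ‖(1 - 2 * μ) * (Real.pi / (8 * I)) ^ (1 / 2 : ℂ)
                  * Complex.exp (-(I ^ 3 / 3))‖ ∧
          ‖2 * L12 I ε
              - (-(3 * ε * (2 * Real.pi * I ^ 3) ^ (1 / 2 : ℂ) * Complex.exp (-(I ^ 3 / 3))))‖
            ≤ C * (‖I‖⁻¹ + ε)
              * ‖3 * ε * (2 * Real.pi * I ^ 3) ^ (1 / 2 : ℂ)
                  * Complex.exp (-(I ^ 3 / 3))‖ ∧
          ∀ σ ∈ strip σ₀, ∀ β ∈ strip ρ₀,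
            F (σ + 2 * Real.pi, β, I, ε) = F (σ, β, I, ε) ∧
            F (σ, β + 2 * Real.pi, I, ε) = F (σ, β, I, ε) ∧
            -- the absolutely convergent Fourier series
            Summable (fun l : ℕ => ‖angleHarmonic (fun x => F (x, β, I, ε)) l σ‖) ∧
            HasSum (fun l : ℕ => angleHarmonic (fun x => F (x, β, I, ε)) l σ) (F (σ, β, I, ε)) ∧
            -- the zeroth harmonic
            angleHarmonic (fun x => F (x, β, I, ε)) 0 σ
              = μ * (1 - μ) * (L00 I ε + L01 I ε * Complex.cos β + E0 β I ε) ∧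
            ‖E0 β I ε‖ ≤ C * (ε ^ 2 * ‖I‖ ^ (-7 : ℤ)) ∧
            -- the first harmonic
            angleHarmonic (fun x => F (x, β, I, ε)) 1 σ
              = μ * (1 - μ) * (2 * L11 I ε * Complex.cos (σ - β)
                  + 2 * L12 I ε * Complex.cos (σ - 2 * β) + E1 σ β I ε) ∧
            ‖E1 σ β I ε‖
              ≤ C * (ε * (‖I‖ ^ (-(3 / 2) : ℝ) + ε * ‖I‖ ^ (5 / 2 : ℝ))
                  * ‖Complex.exp (-(I ^ 3 / 3))‖) ∧
            -- the sum of the higher harmonics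
            ‖∑' l : ℕ, angleHarmonic (fun x => F (x, β, I, ε)) (l + 2) σ‖
              ≤ C * (‖I‖ ^ (3 / 2 : ℝ) * Real.exp (-(2 * (I ^ 3).re / 3)))) ∧
    (∃ ρ Istar C : ℝ, 0 < ρ ∧ 0 < Istar ∧ 0 < C ∧
      ∀ ε ∈ eccentricities Istar,
        (∀ φ : ℝ, ∀ I ∈ realActions Istar ε,
          MeasureTheory.Integrable
            (fun s : ℝ => pertPotential μ s φ (φ + I ^ 3 * s) I ε) ∧
          MeasureTheory.Integrable
            (fun s : ℝ => pertPotential μ s φ (φ + Real.pi + I ^ 3 * s) I ε)) ∧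
        AnalyticOnNhd ℝ (fun p : ℝ × ℝ => reducedPlus μ ε p.1 p.2)
          (univ ×ˢ realActions Istar ε) ∧
        AnalyticOnNhd ℝ (fun p : ℝ × ℝ => reducedMinus μ ε p.1 p.2)
          (univ ×ˢ realActions Istar ε) ∧
        (∃ Fp Fm : ℂ × ℂ → ℂ,
          IsAngleActionExtension (reducedPlus μ ε) Fp ρ Istar ε ∧
          IsAngleActionExtension (reducedMinus μ ε) Fm ρ Istar ε ∧
          ∀ φ ∈ strip ρ, ∀ I ∈ actionDomain ρ Istar ε,
            -- first derivatives of both potentials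
            (∀ G : ℂ × ℂ → ℂ, G = Fp ∨ G = Fm →
              ‖deriv (fun x => G (x, I)) φ
                  - μ * (1 - μ) * (1 - 2 * μ) * (15 * Real.pi * ε / (8 * I ^ 5)) * Complex.sin φ‖
                ≤ C * (ε * ‖I‖ ^ (-7 : ℤ)) ∧
              ‖deriv (fun y => G (φ, y)) I
                  - (-(μ * (1 - μ) * (3 * Real.pi / (2 * I ^ 4))))‖
                ≤ C * (‖I‖ ^ (-7 : ℤ) + ε * ‖I‖ ^ (-4 : ℤ))) ∧
            -- first derivatives of the difference
            ‖deriv (fun y => Fp (φ, y) - Fm (φ, y)) I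
                - (-(μ * (1 - μ) * (Real.pi * I ^ 3 / 2) ^ (1 / 2 : ℂ) * (1 - 2 * μ)
                    * Complex.exp (-(I ^ 3 / 3))))‖
              ≤ C * (‖(Real.pi * I ^ 3 / 2) ^ (1 / 2 : ℂ)‖ * ‖I‖⁻¹
                  * ‖Complex.exp (-(I ^ 3 / 3))‖) ∧
            ‖deriv (fun x => Fp (x, I) - Fm (x, I)) φ
                - μ * (1 - μ) * ε * (6 * (2 * Real.pi * I ^ 3) ^ (1 / 2 : ℂ) * Complex.sin φ)
                    * Complex.exp (-(I ^ 3 / 3))‖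
              ≤ C * (ε * ‖I‖ ^ (1 / 2 : ℝ) * ‖Complex.exp (-(I ^ 3 / 3))‖)) ∧
        -- the Poisson bracket on the real annulus
        (∀ φ : ℝ, ∀ I ∈ realActions Istar ε,
          |poissonBracket (reducedPlus μ ε) (reducedMinus μ ε) φ I
              - deriv (fun x => reducedPlus μ ε x I - reducedMinus μ ε x I) φ
                  * deriv (fun y => reducedPlus μ ε φ y) I|
            ≤ C * (ε * I ^ (-(7 / 2) : ℝ) * Real.exp (-(I ^ 3 / 3))))) :=
  ⟨melnikovPotential_harmonics hμ0 hμ1, reducedPotentials_derivatives hμ0 hμ1⟩
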